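/- **Setting.** Let $\mathcal D=[1,U_0]\times[1,V_0)$ with $1<U_0<\infty$, $1<V_0\le\infty$, carry the Lorentzian metric $\bar g=-\frac{\Omega^2}{2}(du\otimes dv+dv\otimes du)$, where $\Omega>0$ is $C^1$, together with a $C^2$ function $r>0$, a $C^1$ function $\phi$ and a constant $e\in\mathbb R$. Put $$\nu=\partial_u r,\quad \lambda=\partial_v r,\quad \zeta=r\,\partial_u\phi,\quad \theta=r\,\partial_v\phi,\quad m=\tfrac r2\bigl(1-\bar g(\nabla r,\nabla r)\bigr),$$ $$\mu=\tfrac{2m}{r},\quad \varpi=m+\tfrac{e^2}{2r},\quad \kappa=-\tfrac14\Omega^2\nu^{-1}.$$ Let $1<\omega\le 3$ and assume: 1. $\sup_v r(u,v)=\infty$ for every $u\in[1,U_0)$, while $r_+:=\sup_v r(U_0,v)<\infty$; 2. $\nu<0$ and $\lambda\ge0$ on $\mathcal D$, and $\lambda>0$ on $\mathcal D\cap\{u<U_0\}$; 3. on $\{u=1\}$, for some constant, $r\left|\frac\theta\lambda\right|\le \mathrm{const}$ and $r^\omega\left|\phi+\frac\theta\lambda\right|\le \mathrm{const}$; 4.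 $0<\sup_{\{u=1\}}m<\infty$; 5. throughout $\mathcal D$ (the differentiability involved being part of the assumption) $$\partial_u\varpi=\tfrac12(1-\mu)\Bigl(\frac\zeta\nu\Bigr)^2\nu,\quad \partial_v\varpi=\tfrac12\kappa^{-1}\theta^2,\quad \partial_u\kappa=\tfrac1r\Bigl(\frac\zeta\nu\Bigr)^2\nu\,\kappa,\quad \partial_u\theta=-\frac{\zeta\lambda}{r},\quad \partial_v\zeta=-\frac{\theta\nu}{r};$$ 6. $r_+\ne|e|$. **Normalized coordinates.** By a $C^1$ change of $u$ on $[1,U_0)$ and of $v$ on $[1,V_0)$, both with positive derivative, one passes to null coordinates $(u,v)$ on $\mathcal D\cap\{u<U_0\}$ with $u=v=1$ at the initial point, $\kappa=1$ along the initial outgoing curve $\{u=1\}$, and, for each $u$, $\nu=\partial_ur\to-1$ as one tends to null infinity along the outgoing curve of constant $u$. **Theorem.** Such normalized coordinates exist. In these coordinates (with $\theta$, $\zeta$ now taken with respect to them) the following holds: for every $\epsilon>0$, every $\delta>0$ and every $r_0>r_+$ there is a constant $C>0$ such that at all points of $\mathcal D\cap\{u<U_0\}$ (old $u$) where $r\ge\delta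 v$ and $r\ge r_0$, $$|\theta|\le C\,v^{-1}u^{-\omega+1+\epsilon},\qquad |\zeta|\le C\,u^{-\omega+\epsilon},\qquad |r\phi|\le C\,u^{-\omega+1}.$$ -/

import Mathlib

open Set Filter Topology

/-- Data on a two-dimensional spacetime covered by a single null chart `(u, v)` with range
`[1, U₀] × [1, V₀)`, `1 < U₀ < ∞`, `1 < V₀ ≤ ∞`: the conformal factor `Ω` of the metric
`-(Ω² / 2) (du ⊗ dv + dv ⊗ du)`, the area radius `r`, the scalar field `φ` and the charge `e`.
The values of the functions outside the chart range play no role. -/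
structure NullData where
  U₀ : ℝ
  V₀ : EReal
  one_lt_U₀ : 1 < U₀
  one_lt_V₀ : 1 < V₀
  Ω : ℝ → ℝ → ℝ
  r : ℝ → ℝ → ℝ
  φ : ℝ → ℝ → ℝ
  e : ℝ

namespace NullData

noncomputable section

variable (S : NullData)

/-- The range `[1, U₀]` of the coordinate `u`. -/
def uRange : Set ℝ := Icc 1 S.U₀

/-- The range `[1, V₀)` of the coordinate `v`. -/
def vRange : Set ℝ := {v | 1 ≤ v ∧ (v : EReal) < S.V₀}

/-- The chart range `[1, U₀] × [1, V₀)`. -/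
def dom : Set (ℝ × ℝ) := S.uRange ×ˢ S.vRange

/-- Partial derivative in `u` (one-sided at the ends of `[1, U₀]`). -/
def partialU (f : ℝ → ℝ → ℝ) (u v : ℝ) : ℝ := derivWithin (fun x => f x v) S.uRange u

/-- Partial derivative in `v` (one-sided at `v = 1`). -/
def partialV (f : ℝ → ℝ → ℝ) (u v : ℝ) : ℝ := derivWithin (fun y => f u y) S.vRange v

/-- `f` is differentiable in the direction `u` throughout the domain, with `∂_u f = g`. -/
def HasPartialU (f g : ℝ → ℝ → ℝ) : Prop :=
  ∀ u ∈ S.uRange, ∀ v ∈ S.vRange, HasDerivWithinAt (fun x => f x v) (g u v) S.uRange u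

/-- `f` is differentiable in the direction `v` throughout the domain, with `∂_v f = g`. -/
def HasPartialV (f g : ℝ → ℝ → ℝ) : Prop :=
  ∀ u ∈ S.uRange, ∀ v ∈ S.vRange, HasDerivWithinAt (fun y => f u y) (g u v) S.vRange v

/-- `ν = ∂_u r`. -/
def nu : ℝ → ℝ → ℝ := S.partialU S.r

/-- `λ = ∂_v r`. -/
def lam : ℝ → ℝ → ℝ := S.partialV S.r

/-- `ζ = r ∂_u φ`. -/
def zeta (u v : ℝ) : ℝ := S.r u v * S.partialU S.φ u v

/-- `θ = r ∂_v φ`. -/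
def theta (u v : ℝ) : ℝ := S.r u v * S.partialV S.φ u v

/-- The components of the metric `-(Ω² / 2) (du ⊗ dv + dv ⊗ du)` in the coordinates `(u, v)`. -/
def metric (u v : ℝ) : Matrix (Fin 2) (Fin 2) ℝ :=
  !![0, -(S.Ω u v ^ 2 / 2); -(S.Ω u v ^ 2 / 2), 0]

/-- `g(∇r, ∇r)`, in null coordinates. -/
def gradSq (u v : ℝ) : ℝ := -4 * S.nu u v * S.lam u v / S.Ω u v ^ 2

/-- `gradSq` is the contraction of `dr ⊗ dr` with the inverse metric. -/
theorem gradSq_eq (u v : ℝ) (h : S.Ω u v ≠ 0) :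
    S.gradSq u v =
      ![S.nu u v, S.lam u v] ⬝ᵥ ((S.metric u v)⁻¹.mulVec ![S.nu u v, S.lam u v]) := by
  have hinv : (S.metric u v)⁻¹ = !![0, -(2 / S.Ω u v ^ 2); -(2 / S.Ω u v ^ 2), 0] := by
    apply Matrix.inv_eq_right_inv
    ext i j
    fin_cases i <;> fin_cases j <;> simp [metric, Matrix.mul_apply, Fin.sum_univ_two] <;>
      field_simp
  rw [hinv]
  simp [gradSq, Matrix.mulVec, dotProduct, Fin.sum_univ_two]
  field_simp
  ring

/-- The Hawking mass `m = (r / 2) (1 - g(∇r, ∇r))`. -/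
def hawkingMass (u v : ℝ) : ℝ := S.r u v / 2 * (1 - S.gradSq u v)

/-- The mass aspect function `μ = 2 m / r`. -/
def mu (u v : ℝ) : ℝ := 2 * S.hawkingMass u v / S.r u v

/-- The renormalized Hawking mass `ϖ = m + e² / (2 r)`. -/
def varpi (u v : ℝ) : ℝ := S.hawkingMass u v + S.e ^ 2 / (2 * S.r u v)

/-- `κ = -(1/4) Ω² ν⁻¹`. -/
def kappa (u v : ℝ) : ℝ := -(1 / 4) * S.Ω u v ^ 2 * (S.nu u v)⁻¹

/-- `r₊`, the supremum of `r` on the event horizon `{U₀} × [1, V₀)`. -/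
def rPlus : ℝ := sSup ((fun v => S.r S.U₀ v) '' S.vRange)

/-- The standing assumptions, with decay exponent `ω` for the initial data. -/
structure Admissible (ω : ℝ) : Prop where
  /-- Regularity and positivity. -/
  contDiffOn_r : ContDiffOn ℝ 2 (fun p : ℝ × ℝ => S.r p.1 p.2) S.dom
  contDiffOn_Ω : ContDiffOn ℝ 1 (fun p : ℝ × ℝ => S.Ω p.1 p.2) S.dom
  contDiffOn_φ : ContDiffOn ℝ 1 (fun p : ℝ × ℝ => S.φ p.1 p.2) S.dom
  r_pos : ∀ u ∈ S.uRange, ∀ v ∈ S.vRange, 0 < S.r u v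
  Ω_pos : ∀ u ∈ S.uRange, ∀ v ∈ S.vRange, 0 < S.Ω u v
  /-- `sup_v r(u, v) = ∞` for `u < U₀`, whereas `sup_v r(U₀, v) < ∞`. -/
  r_unbounded : ∀ u ∈ Ico 1 S.U₀, ¬ BddAbove ((fun v => S.r u v) '' S.vRange)
  r_horizon_bdd : BddAbove ((fun v => S.r S.U₀ v) '' S.vRange)
  /-- Signs of `λ` and `ν`. -/
  lam_nonneg : ∀ u ∈ S.uRange, ∀ v ∈ S.vRange, 0 ≤ S.lam u v
  nu_neg : ∀ u ∈ S.uRange, ∀ v ∈ S.vRange, S.nu u v < 0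
  lam_pos : ∀ u ∈ Ico 1 S.U₀, ∀ v ∈ S.vRange, 0 < S.lam u v
  /-- Decay of the scalar field on the initial outgoing curve `{1} × [1, V₀)`. -/
  initial_decay : ∃ C : ℝ, ∀ v ∈ S.vRange,
    S.r 1 v * |S.theta 1 v / S.lam 1 v| ≤ C ∧
    S.r 1 v ^ ω * |S.φ 1 v + S.theta 1 v / S.lam 1 v| ≤ C
  /-- `0 < sup m < ∞` on the initial outgoing curve. -/
  mass_bdd : BddAbove ((fun v => S.hawkingMass 1 v) '' S.vRange)
  mass_pos : 0 < sSup ((fun v => S.hawkingMass 1 v) '' S.vRange)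
  /-- The field equations. -/
  varpi_u : S.HasPartialU S.varpi
    fun u v => 1 / 2 * (1 - S.mu u v) * (S.zeta u v / S.nu u v) ^ 2 * S.nu u v
  varpi_v : S.HasPartialV S.varpi
    fun u v => 1 / 2 * (S.kappa u v)⁻¹ * S.theta u v ^ 2
  kappa_u : S.HasPartialU S.kappa
    fun u v => 1 / S.r u v * (S.zeta u v / S.nu u v) ^ 2 * S.nu u v * S.kappa u v
  theta_u : S.HasPartialU S.theta
    fun u v => -(S.zeta u v * S.lam u v / S.r u v)
  zeta_v : S.HasPartialV S.zeta
    fun u v => -(S.theta u v * S.nu u v / S.r u v)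
  /-- The horizon is not extremal. -/
  non_extremal : S.rPlus ≠ |S.e|

/-- A pair of changes of null coordinates `u ↦ uS u` on `[1, U₀)`, `v ↦ vS v` on `[1, V₀)`
(orientation preserving and `C¹`) such that the new coordinates are normalized:
both equal `1` at the initial point `(1, 1)`; the coordinate `vS` makes `κ = 1` along the initial
outgoing curve; the coordinate `uS` makes `∂r/∂uS → -1` at null infinity.

Under such a change, `ν` becomes `ν / uS'` and `κ` becomes `κ / vS'`. -/
structure IsNormalized (uS vS : ℝ → ℝ) : Prop where
  contDiffOn_u : ContDiffOn ℝ 1 uS (Ico 1 S.U₀)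
  contDiffOn_v : ContDiffOn ℝ 1 vS S.vRange
  deriv_u_pos : ∀ u ∈ Ico 1 S.U₀, 0 < derivWithin uS (Ico 1 S.U₀) u
  deriv_v_pos : ∀ v ∈ S.vRange, 0 < derivWithin vS S.vRange v
  u_one : uS 1 = 1
  v_one : vS 1 = 1
  kappa_eq_one : ∀ v ∈ S.vRange, S.kappa 1 v / derivWithin vS S.vRange v = 1
  nu_tendsto : ∀ u ∈ Ico 1 S.U₀,
    Tendsto (fun v : S.vRange => S.nu u v / derivWithin uS (Ico 1 S.U₀) u) atTop (𝓝 (-1))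

/-- `ζ` in the new coordinates, `r ∂φ/∂uS`, at the point with old coordinates `(u, v)`. -/
def zetaIn (uS : ℝ → ℝ) (u v : ℝ) : ℝ := S.zeta u v / derivWithin uS (Ico 1 S.U₀) u

/-- `θ` in the new coordinates, `r ∂φ/∂vS`, at the point with old coordinates `(u, v)`. -/
def thetaIn (vS : ℝ → ℝ) (u v : ℝ) : ℝ := S.theta u v / derivWithin vS S.vRange v

end

end NullData

/-! The radiation field ψ = rφ solves ∂_u∂_vψ = 2κν(ϖ − e²/r)φ/r². The factor r⁻² makes ∂_vψ keep
its initial decay v^{−ω} along ingoing rays as long as φ itself decays, and φ is recovered from ∂_vψ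
by integrating outwards from a curve of constant radius. This loop closes only if φ is known to
decay on such curves, that is, if no energy lingers in the region of bounded radius down to the
event horizon.

Local energy decay comes from two currents. Inside r = R, −∂_uϖ and ∂_vϖ are weighted with r⁻⁴ and
combined as for a Morawetz multiplier, so that the bulk term is definite except where 1 − μ
degenerates; there a small multiple of ζ²/(−ν) brings in the red-shift, i.e. the positivity of ϖ −
e²/r (`NullSystem.fluxInV_le`). The boundary term of wrong sign is paid for by the mass. Outside,
the r^σ-weighted integral of (∂_vψ)² is used; its zeroth order error is removed by a Hardy
inequality (`Exterior.outer_deriv_le`). The sum is damped at rate a/L between r = L and the horizon,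
and driven only by ∂_vψ on r = L (`Exterior.exists_energy_decay`). If L² ≤ u, a time u/2 is enough
for the damping to beat every power of u, so φ on r = L is controlled by ∂_vψ on r = L at comparable
times.

The bootstrap assumes |φ| ≤ N u^{1−ω+s}/v for r ≥ L, u ≥ u₁. In the resulting bounds N always
carries a small factor, a negative power of u₁, L or u; for large L and u₁ = L² the constant
improves to B + N/2, and iteration makes it independent of the qualitative initial N
(`Exterior.exists_phiDecay`). Then rφ and θ follow by integration, while ζ on a curve r = L follows
from the damped transport equation of ζ/ν over an advanced time interval of length u^s
(`Exterior.exists_abs_zeta_curve_le`); the small powers lost are the ε of the theorem.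

The uniform constants come from the geometry up to the horizon. Non-extremality forces r₊ > |e|
(`Background.abs_e_lt_rp`); then ζ/ν is bounded, κ is bounded below, ϖ − e²/r is eventually bounded
below by a positive constant, and −ν has a limit at null infinity whose primitive is the normalized
u. At late v the condition r ≥ δv implies r ≥ L; at bounded v the condition r ≥ r₀ > r₊ leaves a
compact set, where continuity suffices. -/

/-! ### Calculus: comparison of increments, integrals with parameters, level curves -/

/-- Comparison of increments from a comparison of derivatives. -/
theorem sub_le_sub_of_hasDerivAt_le {f g f' g' : ℝ → ℝ} {a b : ℝ} (hab : a ≤ b)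
    (hf : ContinuousOn f (Icc a b)) (hg : ContinuousOn g (Icc a b))
    (hf' : ∀ x ∈ Ioo a b, HasDerivAt f (f' x) x) (hg' : ∀ x ∈ Ioo a b, HasDerivAt g (g' x) x)
    (hle : ∀ x ∈ Ioo a b, f' x ≤ g' x) : f b - f a ≤ g b - g a := by
  have key : MonotoneOn (fun x => g x - f x) (Icc a b) := by
    apply monotoneOn_of_deriv_nonneg (convex_Icc a b) (hg.sub hf)
    · intro x hx
      rw [interior_Icc] at hx
      exact ((hg' x hx).sub (hf' x hx)).differentiableAt.differentiableWithinAt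
    · intro x hx
      rw [interior_Icc] at hx
      have h := ((hg' x hx).sub (hf' x hx)).deriv
      rw [h]
      linarith [hle x hx]
  have := key (left_mem_Icc.2 hab) (right_mem_Icc.2 hab) hab
  simp only at this
  linarith

/-- Comparison of the size of an increment from a comparison of derivatives. -/
theorem abs_sub_le_sub_of_hasDerivAt {f g f' g' : ℝ → ℝ} {a b : ℝ} (hab : a ≤ b)
    (hf : ContinuousOn f (Icc a b)) (hg : ContinuousOn g (Icc a b))
    (hf' : ∀ x ∈ Ioo a b, HasDerivAt f (f' x) x) (hg' : ∀ x ∈ Ioo a b, HasDerivAt g (g' x) x)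
    (hle : ∀ x ∈ Ioo a b, |f' x| ≤ g' x) : |f b - f a| ≤ g b - g a := by
  rw [abs_le]
  constructor
  · have := sub_le_sub_of_hasDerivAt_le hab hf.neg hg (fun x hx => (hf' x hx).neg) hg'
      (fun x hx => (neg_le_abs _).trans (hle x hx))
    simp only [Pi.neg_apply] at this
    linarith
  · exact sub_le_sub_of_hasDerivAt_le hab hf hg hf' hg' (fun x hx => (le_abs_self _).trans (hle x hx))

/-- A function with nonpositive derivative does not increase. -/
theorem le_of_hasDerivAt_nonpos {f f' : ℝ → ℝ} {a b : ℝ} (hab : a ≤ b)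
    (hf : ContinuousOn f (Icc a b)) (hf' : ∀ x ∈ Ioo a b, HasDerivAt f (f' x) x)
    (hle : ∀ x ∈ Ioo a b, f' x ≤ 0) : f b ≤ f a := by
  have := sub_le_sub_of_hasDerivAt_le (g := fun _ => (0 : ℝ)) (g' := fun _ => 0) hab hf
    continuousOn_const hf' (fun x _ => hasDerivAt_const x 0) hle
  linarith

/-- A function with nonnegative derivative does not decrease. -/
theorem le_of_hasDerivAt_nonneg {f f' : ℝ → ℝ} {a b : ℝ} (hab : a ≤ b)
    (hf : ContinuousOn f (Icc a b)) (hf' : ∀ x ∈ Ioo a b, HasDerivAt f (f' x) x)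
    (hle : ∀ x ∈ Ioo a b, 0 ≤ f' x) : f a ≤ f b := by
  have := sub_le_sub_of_hasDerivAt_le (f := fun _ => (0 : ℝ)) (f' := fun _ => 0) hab
    continuousOn_const hf (fun x _ => hasDerivAt_const x 0) hf' hle
  linarith

/-- Slices of a jointly continuous function are continuous. -/
theorem Continuous.slice_left {f : ℝ → ℝ → ℝ} (hf : Continuous fun p : ℝ × ℝ => f p.1 p.2) (v : ℝ) :
    Continuous fun x => f x v := hf.comp (by fun_prop : Continuous fun x : ℝ => (x, v))

theorem Continuous.slice_right {f : ℝ → ℝ → ℝ} (hf : Continuous fun p : ℝ × ℝ => f p.1 p.2) (u : ℝ) :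
    Continuous fun y => f u y := hf.comp (by fun_prop : Continuous fun y : ℝ => (u, y))

/-- Differentiation under the integral sign, fixed limits. -/
theorem hasDerivAt_integral_of_continuous {f f' : ℝ → ℝ → ℝ} {a b t₀ : ℝ}
    (hf : Continuous fun p : ℝ × ℝ => f p.1 p.2) (hf' : Continuous fun p : ℝ × ℝ => f' p.1 p.2)
    (hd : ∀ᶠ t in 𝓝 t₀, ∀ x, HasDerivAt (fun s => f x s) (f' x t) t) :
    HasDerivAt (fun t => ∫ x in a..b, f x t) (∫ x in a..b, f' x t₀) t₀ := by
  obtain ⟨δ, hδ, hball⟩ := Metric.eventually_nhds_iff_ball.1 hd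
  obtain ⟨C, hC⟩ := ((isCompact_uIcc (a := a) (b := b)).prod
    (isCompact_closedBall t₀ (δ / 2))).exists_bound_of_continuousOn hf'.continuousOn
  refine (intervalIntegral.hasDerivAt_integral_of_dominated_loc_of_deriv_le (μ := MeasureTheory.volume)
    (F := fun t x => f x t) (F' := fun t x => f' x t) (bound := fun _ => C)
    (s := Metric.ball t₀ (δ / 2)) (Metric.ball_mem_nhds _ (by positivity)) ?_ ?_ ?_ ?_ ?_ ?_).2
  · exact Eventually.of_forall fun t => (hf.slice_left t).aestronglyMeasurable
  · exact (hf.slice_left t₀).intervalIntegrable _ _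
  · exact (hf'.slice_left t₀).aestronglyMeasurable
  · refine Eventually.of_forall fun x hx t ht => hC (x, t) ⟨uIoc_subset_uIcc hx, ?_⟩
    exact Metric.ball_subset_closedBall ht
  · exact intervalIntegrable_const
  · refine Eventually.of_forall fun x _ t ht => hball t ?_ x
    exact Metric.ball_subset_ball (by linarith) ht

/-- Derivative of an integral with a moving limit and a parameter, at the point where the
integral collapses. -/
theorem hasDerivAt_integral_collapsed {f : ℝ → ℝ → ℝ} {c : ℝ → ℝ} {c' t₀ : ℝ}
    (hf : Continuous fun p : ℝ × ℝ => f p.1 p.2) (hc : HasDerivAt c c' t₀) :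
    HasDerivAt (fun t => ∫ x in c t₀..c t, f x t) (f (c t₀) t₀ * c') t₀ := by
  -- The integrand is frozen at the collapsed point; by joint continuity the remainder is o(c t − c
  -- t₀), hence o(t − t₀).
  have h1 : HasDerivAt (fun t => f (c t₀) t₀ * (c t - c t₀)) (f (c t₀) t₀ * c') t₀ :=
    (hc.sub_const _).const_mul _
  have h2 : HasDerivAt (fun t => ∫ x in c t₀..c t, (f x t - f (c t₀) t₀)) 0 t₀ := by
    rw [hasDerivAt_iff_isLittleO]
    simp only [intervalIntegral.integral_same, sub_zero, smul_zero]
    have hO : (fun t => c t - c t₀) =O[𝓝 t₀] fun t => t - t₀ := hc.isBigO_sub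
    refine Asymptotics.IsLittleO.trans_isBigO ?_ hO
    rw [Asymptotics.isLittleO_iff]
    intro ε hε
    have hcont : ContinuousAt (fun p : ℝ × ℝ => f p.1 p.2) (c t₀, t₀) := hf.continuousAt
    obtain ⟨δ, hδ, hb⟩ := Metric.continuousAt_iff.1 hcont ε hε
    have e1 : ∀ᶠ t in 𝓝 t₀, dist (c t) (c t₀) < δ :=
      hc.continuousAt.eventually (Metric.ball_mem_nhds _ hδ)
    filter_upwards [e1, Metric.ball_mem_nhds t₀ hδ] with t ht1 ht2
    rw [Real.norm_eq_abs (c t - c t₀)]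
    apply intervalIntegral.norm_integral_le_of_norm_le_const
    intro x hx
    have hx' : dist x (c t₀) < δ := by
      refine lt_of_le_of_lt ?_ ht1
      rw [Real.dist_eq, Real.dist_eq]
      exact abs_sub_left_of_mem_uIcc (uIoc_subset_uIcc hx)
    have := hb (x := (x, t)) (by rw [Prod.dist_eq]; exact max_lt hx' ht2)
    rw [Real.dist_eq] at this
    exact this.le
  have h3 := h1.add h2
  rw [add_zero] at h3
  refine h3.congr_of_eventuallyEq (Eventually.of_forall fun t => ?_)
  have hi : IntervalIntegrable (fun x => f x t) MeasureTheory.volume (c t₀) (c t) :=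
    (hf.slice_left t).intervalIntegrable _ _
  simp only [Pi.add_apply]
  rw [intervalIntegral.integral_sub hi intervalIntegrable_const, intervalIntegral.integral_const]
  simp only [smul_eq_mul]
  ring

/-- Leibniz' rule, with moving limits. -/
theorem hasDerivAt_integral_moving {f f' : ℝ → ℝ → ℝ} {a b : ℝ → ℝ} {a' b' t₀ : ℝ}
    (hf : Continuous fun p : ℝ × ℝ => f p.1 p.2) (hf' : Continuous fun p : ℝ × ℝ => f' p.1 p.2)
    (hd : ∀ᶠ t in 𝓝 t₀, ∀ x, HasDerivAt (fun s => f x s) (f' x t) t)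
    (ha : HasDerivAt a a' t₀) (hb : HasDerivAt b b' t₀) :
    HasDerivAt (fun t => ∫ x in a t..b t, f x t)
      ((∫ x in a t₀..b t₀, f' x t₀) + f (b t₀) t₀ * b' - f (a t₀) t₀ * a') t₀ := by
  have h1 := hasDerivAt_integral_of_continuous (a := a t₀) (b := b t₀) hf hf' hd
  have h2 := hasDerivAt_integral_collapsed hf hb
  have h3 := hasDerivAt_integral_collapsed hf ha
  refine ((h1.add h2).sub h3).congr_of_eventuallyEq (Eventually.of_forall fun t => ?_)
  have hi : ∀ x y, IntervalIntegrable (fun x => f x t) MeasureTheory.volume x y := fun x y =>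
    (hf.slice_left t).intervalIntegrable _ _
  simp only [Pi.add_apply, Pi.sub_apply]
  rw [intervalIntegral.integral_add_adjacent_intervals (hi _ _) (hi _ _),
    intervalIntegral.integral_interval_sub_left (hi _ _) (hi _ _)]

theorem Continuous.along_right {f : ℝ → ℝ → ℝ} (hf : Continuous fun p : ℝ × ℝ => f p.1 p.2)
    {c : ℝ → ℝ} (hc : Continuous c) : Continuous fun p : ℝ × ℝ => f p.1 (c p.2) :=
  hf.comp (by fun_prop : Continuous fun p : ℝ × ℝ => (p.1, c p.2))

theorem Continuous.along_graph {f : ℝ → ℝ → ℝ} (hf : Continuous fun p : ℝ × ℝ => f p.1 p.2)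
    {c : ℝ → ℝ} (hc : Continuous c) : Continuous fun t : ℝ => f t (c t) :=
  hf.comp (by fun_prop : Continuous fun t : ℝ => (t, c t))

theorem Continuous.flip_args {f : ℝ → ℝ → ℝ} (hf : Continuous fun p : ℝ × ℝ => f p.1 p.2) :
    Continuous fun p : ℝ × ℝ => f p.2 p.1 :=
  hf.comp continuous_swap

/-- Increment in the first variable, along a moving second variable. -/
theorem hasDerivAt_increment_left {f fu : ℝ → ℝ → ℝ} {c : ℝ → ℝ} {t₀ : ℝ}
    (hfu : Continuous fun p : ℝ × ℝ => fu p.1 p.2)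
    (hu : ∀ᶠ t in 𝓝 t₀, ∀ v, HasDerivAt (fun x => f x v) (fu t v) t) (hc : Continuous c) :
    HasDerivAt (fun t => f t (c t) - f t₀ (c t)) (fu t₀ (c t₀)) t₀ := by
  have h1 : HasDerivAt (fun t => ∫ x in (id t₀)..(id t), (fun x t => fu x (c t)) x t)
      (fu (id t₀) (c t₀) * 1) t₀ :=
    hasDerivAt_integral_collapsed (f := fun x t => fu x (c t)) (c := id)
      (hfu.comp (by fun_prop : Continuous fun p : ℝ × ℝ => (p.1, c p.2))) (hasDerivAt_id t₀)
  rw [mul_one] at h1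
  refine h1.congr_of_eventuallyEq ?_
  obtain ⟨δ, hδ, hball⟩ := Metric.eventually_nhds_iff_ball.1 hu
  filter_upwards [Metric.ball_mem_nhds t₀ hδ] with t ht
  symm
  apply intervalIntegral.integral_eq_sub_of_hasDerivAt (f := fun x => f x (c t))
    (f' := fun x => fu x (c t))
  · intro x hx
    apply hball x _ (c t)
    rw [Metric.mem_ball, Real.dist_eq] at ht ⊢
    exact lt_of_le_of_lt (abs_sub_left_of_mem_uIcc hx) ht
  · exact (hfu.slice_left (c t)).intervalIntegrable _ _

/-- Chain rule along a curve, from partial derivatives. -/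
theorem hasDerivAt_along_curve {f fu : ℝ → ℝ → ℝ} {c : ℝ → ℝ} {c' fv t₀ : ℝ}
    (hfu : Continuous fun p : ℝ × ℝ => fu p.1 p.2)
    (hu : ∀ᶠ t in 𝓝 t₀, ∀ v, HasDerivAt (fun x => f x v) (fu t v) t)
    (hv : HasDerivAt (fun y => f t₀ y) fv (c t₀)) (hc : Continuous c) (hc' : HasDerivAt c c' t₀) :
    HasDerivAt (fun t => f t (c t)) (fu t₀ (c t₀) + fv * c') t₀ := by
  have h1 := hasDerivAt_increment_left hfu hu hc
  have h2 : HasDerivAt (fun t => f t₀ (c t)) (fv * c') t₀ := HasDerivAt.comp t₀ hv hc'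
  refine (h1.add h2).congr_of_eventuallyEq (Eventually.of_forall fun t => ?_)
  simp

/-- Derivative of a level curve. -/
theorem hasDerivAt_level_curve {f fu : ℝ → ℝ → ℝ} {c : ℝ → ℝ} {fv t₀ R : ℝ}
    (hfu : Continuous fun p : ℝ × ℝ => fu p.1 p.2)
    (hu : ∀ᶠ t in 𝓝 t₀, ∀ v, HasDerivAt (fun x => f x v) (fu t v) t)
    (hv : HasDerivAt (fun y => f t₀ y) fv (c t₀)) (hfv : fv ≠ 0) (hc : Continuous c)
    (hR : ∀ t, f t (c t) = R) : HasDerivAt c (-fu t₀ (c t₀) / fv) t₀ := by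
  have h1 := hasDerivAt_increment_left hfu hu hc
  have h2 : HasDerivAt (fun t => f t₀ (c t)) (-fu t₀ (c t₀)) t₀ := by
    refine (h1.const_sub R).congr_of_eventuallyEq (Eventually.of_forall fun t => ?_)
    simp [hR]
  -- Only continuity of `c` is known beforehand. The increment of `f t₀ (c t)` is the increment of
  -- `c` times a divided difference tending to `fv ≠ 0`; dividing by it gives the differentiability
  -- of `c`.
  have h3 : ContinuousAt (dslope (fun y => f t₀ y) (c t₀)) (c t₀) :=
    continuousAt_dslope_same.2 hv.differentiableAt
  have h4 : Tendsto (fun t => dslope (fun y => f t₀ y) (c t₀) (c t)) (𝓝 t₀) (𝓝 fv) := by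
    have := h3.tendsto.comp hc.continuousAt
    rwa [dslope_same, hv.deriv] at this
  have h5 : ∀ᶠ t in 𝓝 t₀, dslope (fun y => f t₀ y) (c t₀) (c t) ≠ 0 :=
    h4.eventually_ne hfv
  rw [hasDerivAt_iff_tendsto_slope] at h2 ⊢
  refine (h2.div (h4.mono_left nhdsWithin_le_nhds) hfv).congr' ?_
  filter_upwards [h5.filter_mono nhdsWithin_le_nhds, self_mem_nhdsWithin] with t ht htt
  have h6 : (c t - c t₀) * dslope (fun y => f t₀ y) (c t₀) (c t) = f t₀ (c t) - f t₀ (c t₀) := by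
    have := sub_smul_dslope (fun y => f t₀ y) (c t₀) (c t)
    simpa using this
  have htt' : t - t₀ ≠ 0 := sub_ne_zero.2 htt
  simp only [Pi.div_apply, slope_def_field]
  rw [← h6]
  field_simp

/-! ### The reduced field equations and the radiation field -/

/-- Functions on a characteristic chart satisfying the reduced field equations, extended
continuously to the plane; the differential equations hold for `u ∈ I`, respectively `v ∈ J`. -/
structure NullSystem (I J : Set ℝ) where
  e : ℝ
  r : ℝ → ℝ → ℝ
  phi : ℝ → ℝ → ℝ
  nu : ℝ → ℝ → ℝ
  lam : ℝ → ℝ → ℝ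
  kappa : ℝ → ℝ → ℝ
  mass : ℝ → ℝ → ℝ
  theta : ℝ → ℝ → ℝ
  zeta : ℝ → ℝ → ℝ
  r_cont : Continuous fun p : ℝ × ℝ => r p.1 p.2
  phi_cont : Continuous fun p : ℝ × ℝ => phi p.1 p.2
  nu_cont : Continuous fun p : ℝ × ℝ => nu p.1 p.2
  lam_cont : Continuous fun p : ℝ × ℝ => lam p.1 p.2
  kappa_cont : Continuous fun p : ℝ × ℝ => kappa p.1 p.2
  mass_cont : Continuous fun p : ℝ × ℝ => mass p.1 p.2
  theta_cont : Continuous fun p : ℝ × ℝ => theta p.1 p.2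
  zeta_cont : Continuous fun p : ℝ × ℝ => zeta p.1 p.2
  r_pos : ∀ u v, 0 < r u v
  kappa_pos : ∀ u v, 0 < kappa u v
  nu_neg : ∀ u v, nu u v < 0
  lam_nonneg : ∀ u v, 0 ≤ lam u v
  lam_eq : ∀ u v, lam u v = kappa u v * (1 - 2 * mass u v / r u v + e ^ 2 / r u v ^ 2)
  r_u : ∀ u ∈ I, ∀ v, HasDerivAt (fun x => r x v) (nu u v) u
  r_v : ∀ u, ∀ v ∈ J, HasDerivAt (fun y => r u y) (lam u v) v
  phi_u : ∀ u ∈ I, ∀ v, HasDerivAt (fun x => phi x v) (zeta u v / r u v) u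
  phi_v : ∀ u, ∀ v ∈ J, HasDerivAt (fun y => phi u y) (theta u v / r u v) v
  mass_u : ∀ u ∈ I, ∀ v, HasDerivAt (fun x => mass x v)
    (lam u v * zeta u v ^ 2 / (2 * kappa u v * nu u v)) u
  mass_v : ∀ u, ∀ v ∈ J, HasDerivAt (fun y => mass u y) (theta u v ^ 2 / (2 * kappa u v)) v
  kappa_u : ∀ u ∈ I, ∀ v, HasDerivAt (fun x => kappa x v)
    (kappa u v * zeta u v ^ 2 / (r u v * nu u v)) u
  theta_u : ∀ u ∈ I, ∀ v, HasDerivAt (fun x => theta x v) (-(zeta u v * lam u v / r u v)) u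
  zeta_v : ∀ u, ∀ v ∈ J, HasDerivAt (fun y => zeta u y) (-(theta u v * nu u v / r u v)) v
  nu_v : ∀ u, ∀ v ∈ J, HasDerivAt (fun y => nu u y)
    (2 * kappa u v * nu u v * (mass u v - e ^ 2 / r u v) / r u v ^ 2) v
  lam_u : ∀ u ∈ I, ∀ v, HasDerivAt (fun x => lam x v)
    (2 * kappa u v * nu u v * (mass u v - e ^ 2 / r u v) / r u v ^ 2) u

namespace NullSystem

variable {I J : Set ℝ} (S : NullSystem I J)

/-- `psi = r phi`, the radiation field. -/
noncomputable def psi (u v : ℝ) : ℝ := S.r u v * S.phi u v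

/-- `∂_v (r phi)`. -/
noncomputable def psiV (u v : ℝ) : ℝ := S.lam u v * S.phi u v + S.theta u v

/-- `∂_u (r phi)`. -/
noncomputable def psiU (u v : ℝ) : ℝ := S.nu u v * S.phi u v + S.zeta u v

/-- `∂_u ∂_v (r phi)`. -/
noncomputable def psiUV (u v : ℝ) : ℝ :=
  2 * S.kappa u v * S.nu u v * (S.mass u v - S.e ^ 2 / S.r u v) / S.r u v ^ 2 * S.phi u v

theorem r_ne (u v : ℝ) : S.r u v ≠ 0 := (S.r_pos u v).ne'
theorem kappa_ne (u v : ℝ) : S.kappa u v ≠ 0 := (S.kappa_pos u v).ne'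
theorem nu_ne (u v : ℝ) : S.nu u v ≠ 0 := (S.nu_neg u v).ne

theorem psi_cont : Continuous fun p : ℝ × ℝ => S.psi p.1 p.2 := S.r_cont.mul S.phi_cont

theorem psiV_cont : Continuous fun p : ℝ × ℝ => S.psiV p.1 p.2 :=
  (S.lam_cont.mul S.phi_cont).add S.theta_cont

theorem psiU_cont : Continuous fun p : ℝ × ℝ => S.psiU p.1 p.2 :=
  (S.nu_cont.mul S.phi_cont).add S.zeta_cont

theorem psiUV_cont : Continuous fun p : ℝ × ℝ => S.psiUV p.1 p.2 := by
  unfold psiUV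
  have h1 := S.r_cont
  have h2 := S.kappa_cont
  have h3 := S.nu_cont
  have h4 := S.mass_cont
  have h5 := S.phi_cont
  exact (((((continuous_const.mul h2).mul h3).mul
    (h4.sub (continuous_const.div h1 fun p => S.r_ne _ _))).div (h1.pow 2)
      fun p => pow_ne_zero _ (S.r_ne _ _))).mul h5

theorem psi_v (u : ℝ) {v : ℝ} (hv : v ∈ J) : HasDerivAt (fun y => S.psi u y) (S.psiV u v) v := by
  refine ((S.r_v u v hv).mul (S.phi_v u v hv)).congr_deriv ?_
  have := S.r_ne u v
  unfold psiV
  field_simp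

/-- The wave equation of the radiation field: the terms λζ/r coming from ∂_uφ and from ∂_uθ cancel,
and only (∂_uλ)φ survives, with its factor r⁻². -/
theorem psiV_u {u : ℝ} (hu : u ∈ I) (v : ℝ) :
    HasDerivAt (fun x => S.psiV x v) (S.psiUV u v) u := by
  refine (((S.lam_u u hu v).mul (S.phi_u u hu v)).add (S.theta_u u hu v)).congr_deriv ?_
  have := S.r_ne u v
  unfold psiUV
  field_simp
  ring

/-- The same right-hand side appears because ∂_vν = ∂_uλ. Along outgoing rays this carries ζ
outwards from a curve of constant radius. -/
theorem psiU_v (u : ℝ) {v : ℝ} (hv : v ∈ J) :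
    HasDerivAt (fun y => S.psiU u y) (S.psiUV u v) v := by
  refine (((S.nu_v u v hv).mul (S.phi_v u v hv)).add (S.zeta_v u v hv)).congr_deriv ?_
  have := S.r_ne u v
  unfold psiUV
  field_simp
  ring

end NullSystem

/-! ### The exterior region and the curves of constant radius -/

/-- A null system in normalized coordinates, on `u ≥ 1`, `v ≥ v₀`, with uniform bounds on the
background and decaying data on `u = 1`. -/
structure Exterior (v₀ ω : ℝ) extends NullSystem (Ioi 1) (Ioi v₀) where
  (ρ c M d q₀ Z A R₁ : ℝ)
  one_le_v₀ : 1 ≤ v₀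
  ρ_pos : 0 < ρ
  c_pos : 0 < c
  c_le_one : c ≤ 1
  one_le_M : 1 ≤ M
  d_pos : 0 < d
  q₀_pos : 0 < q₀
  R₁_ge : 4 * M ≤ R₁
  r_ge : ∀ u v, ρ ≤ r u v
  r_init : ∀ u, r u v₀ ≤ R₁
  r_tendsto : ∀ u, Tendsto (fun v => r u v) atTop atTop
  kappa_ge : ∀ u v, c ≤ kappa u v
  kappa_le : ∀ u v, kappa u v ≤ 1
  nu_ge : ∀ u v, -1 ≤ nu u v
  lam_pos : ∀ u v, 0 < lam u v
  lam_le : ∀ u v, lam u v ≤ 1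
  mass_nonneg : ∀ u v, 0 ≤ mass u v
  mass_le : ∀ u v, mass u v ≤ M
  q_ge : ∀ u v, q₀ ≤ mass u v - e ^ 2 / r u v
  d_le : ∀ u v, d ≤ 1 - e ^ 2 / r u v ^ 2
  zeta_le : ∀ u v, |zeta u v| ≤ Z * (-nu u v)
  lam_ge : ∀ u v, R₁ ≤ r u v → c ≤ lam u v
  nu_le : ∀ u v, R₁ ≤ r u v → nu u v ≤ -c
  psi_data : ∀ v, v₀ ≤ v → |r 1 v * phi 1 v| ≤ A
  psiV_data : ∀ v, v₀ ≤ v → |lam 1 v * phi 1 v + theta 1 v| ≤ A * v ^ (-ω)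

namespace Exterior

variable {v₀ ω : ℝ} (S : Exterior v₀ ω)

theorem R₁_pos : 0 < S.R₁ := by linarith [S.R₁_ge, S.one_le_M]

theorem r_strictMonoOn (u : ℝ) : StrictMonoOn (fun v => S.r u v) (Ici v₀) := by
  apply strictMonoOn_of_deriv_pos (convex_Ici v₀) (S.r_cont.slice_right u).continuousOn
  intro v hv
  rw [interior_Ici] at hv
  rw [(S.r_v u v hv).deriv]
  exact S.lam_pos u v

theorem r_antitoneOn (v : ℝ) : AntitoneOn (fun u => S.r u v) (Ici 1) := by
  apply antitoneOn_of_deriv_nonpos (convex_Ici 1) (S.r_cont.slice_left v).continuousOn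
  · intro u hu
    rw [interior_Ici] at hu
    exact (S.r_u u hu v).differentiableAt.differentiableWithinAt
  · intro u hu
    rw [interior_Ici] at hu
    rw [(S.r_u u hu v).deriv]
    exact (S.nu_neg u v).le

theorem exists_level {R : ℝ} (hR : S.R₁ < R) (u : ℝ) : ∃ v, v₀ < v ∧ S.r u v = R := by
  obtain ⟨w, hw1, hw2⟩ := ((S.r_tendsto u).eventually_ge_atTop R |>.and (eventually_ge_atTop v₀)).exists
  obtain ⟨v, hv, hvR⟩ := intermediate_value_Icc hw2 (S.r_cont.slice_right u).continuousOn
    (show R ∈ Icc (S.r u v₀) (S.r u w) from ⟨(S.r_init u).trans hR.le, hw1⟩)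
  refine ⟨v, lt_of_le_of_ne hv.1 ?_, hvR⟩
  rintro rfl
  have := S.r_init u
  simp only at hvR
  linarith

open Classical in
/-- The curve `r = R`, as a graph over `u`. -/
noncomputable def curve (R u : ℝ) : ℝ :=
  if hR : S.R₁ < R then (S.exists_level hR u).choose else 0

section curve

variable {R : ℝ} (hR : S.R₁ < R)
include hR

theorem lt_curve (u : ℝ) : v₀ < S.curve R u := by
  rw [curve, dif_pos hR]
  exact (S.exists_level hR u).choose_spec.1

theorem r_curve (u : ℝ) : S.r u (S.curve R u) = R := by
  rw [curve, dif_pos hR]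
  exact (S.exists_level hR u).choose_spec.2

/-- The radius is strictly increasing on each outgoing ray, so the position relative to the curve
can be read off from the radius. -/
theorem curve_le_iff {u v : ℝ} (hv : v₀ ≤ v) : S.curve R u ≤ v ↔ R ≤ S.r u v := by
  have h := (S.r_strictMonoOn u).le_iff_le (a := S.curve R u) (b := v) (S.lt_curve hR u).le hv
  simp only [S.r_curve hR] at h
  exact h.symm

theorem curve_lt_iff {u v : ℝ} (hv : v₀ ≤ v) : S.curve R u < v ↔ R < S.r u v := by
  have h := (S.r_strictMonoOn u).lt_iff_lt (a := S.curve R u) (b := v) (S.lt_curve hR u).le hv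
  simp only [S.r_curve hR] at h
  exact h.symm

theorem lt_curve_iff {u v : ℝ} (hv : v₀ ≤ v) : v < S.curve R u ↔ S.r u v < R := by
  rw [← not_le, S.curve_le_iff hR hv, not_le]

/-- A fixed v lies below or above the curve according to the sign of r − R at (u, v), and each
strict sign is an open condition in u. -/
theorem curve_cont : Continuous (S.curve R) := by
  rw [continuous_iff_continuousAt]
  intro u
  have h0 := S.lt_curve hR u
  rw [ContinuousAt, tendsto_order]
  constructor
  · intro a ha
    set b := max a v₀
    have hb : b < S.curve R u := max_lt ha h0
    have hb0 : v₀ ≤ b := le_max_right _ _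
    have h1 : S.r u b < R := (S.lt_curve_iff hR hb0).1 hb
    filter_upwards [(S.r_cont.slice_left b).continuousAt.eventually (gt_mem_nhds h1)] with x hx
    exact lt_of_le_of_lt (le_max_left _ _) ((S.lt_curve_iff hR hb0).2 hx)
  · intro a ha
    have hb0 : v₀ ≤ a := (h0.trans ha).le
    have h1 : R < S.r u a := (S.curve_lt_iff hR hb0).1 ha
    filter_upwards [(S.r_cont.slice_left a).continuousAt.eventually (lt_mem_nhds h1)] with x hx
    exact (S.curve_lt_iff hR hb0).2 hx

/-- The slope of the curve `r = R`. -/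
theorem curve_hasDerivAt {u : ℝ} (hu : 1 < u) :
    HasDerivAt (S.curve R) (-S.nu u (S.curve R u) / S.lam u (S.curve R u)) u :=
  hasDerivAt_level_curve S.nu_cont (by filter_upwards [lt_mem_nhds hu] with t ht using S.r_u t ht)
    (S.r_v u _ (S.lt_curve hR u)) (S.lam_pos _ _).ne' (S.curve_cont hR) (S.r_curve hR)

/-- For r ≥ R₁ both λ and −ν lie in [c, 1], so curves of constant radius are uniformly timelike and
u, v grow at comparable rates along them. -/
theorem slope_ge (u : ℝ) : S.c ≤ -S.nu u (S.curve R u) / S.lam u (S.curve R u) := by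
  have h1 : S.R₁ ≤ S.r u (S.curve R u) := by rw [S.r_curve hR]; exact hR.le
  rw [le_div_iff₀ (S.lam_pos _ _)]
  nlinarith [S.nu_le _ _ h1, S.lam_le u (S.curve R u), S.c_pos]

theorem slope_le (u : ℝ) : -S.nu u (S.curve R u) / S.lam u (S.curve R u) ≤ 1 / S.c := by
  have h1 : S.R₁ ≤ S.r u (S.curve R u) := by rw [S.r_curve hR]; exact hR.le
  exact div_le_div₀ zero_le_one (by linarith [S.nu_ge u (S.curve R u)]) S.c_pos (S.lam_ge _ _ h1)

theorem R₁_le_r {u v : ℝ} (hv : S.curve R u ≤ v) : S.R₁ < S.r u v :=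
  hR.trans_le ((S.curve_le_iff hR ((S.lt_curve hR u).le.trans hv)).1 hv)

theorem r_ge_linear {u v : ℝ} (hv : S.curve R u ≤ v) : R + S.c * (v - S.curve R u) ≤ S.r u v := by
  have := sub_le_sub_of_hasDerivAt_le (f := fun y => S.c * y) (f' := fun _ => S.c)
    (g := fun y => S.r u y) (g' := fun y => S.lam u y) hv (by fun_prop)
    (S.r_cont.slice_right u).continuousOn
    (fun x _ => by simpa using (hasDerivAt_id x).const_mul S.c)
    (fun x hx => S.r_v u x ((S.lt_curve hR u).trans hx.1))
    (fun x hx => S.lam_ge _ _ (S.R₁_le_r hR hx.1.le).le)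
  simp only [S.r_curve hR] at this
  linarith

theorem r_le_linear {u v : ℝ} (hv : S.curve R u ≤ v) : S.r u v ≤ R + (v - S.curve R u) := by
  have := sub_le_sub_of_hasDerivAt_le (g := fun y => y) (g' := fun _ => 1)
    (f := fun y => S.r u y) (f' := fun y => S.lam u y) hv
    (S.r_cont.slice_right u).continuousOn (by fun_prop)
    (fun x hx => S.r_v u x ((S.lt_curve hR u).trans hx.1)) (fun x _ => hasDerivAt_id x)
    (fun x hx => S.lam_le _ _)
  simp only [S.r_curve hR] at this
  linarith

theorem curve_ge_linear {u u' : ℝ} (hu : 1 ≤ u) (huu : u ≤ u') :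
    S.curve R u + S.c * (u' - u) ≤ S.curve R u' := by
  have := sub_le_sub_of_hasDerivAt_le (f := fun y => S.c * y) (f' := fun _ => S.c)
    (g := S.curve R) (g' := _) huu (by fun_prop)
    (S.curve_cont hR).continuousOn
    (fun x _ => by simpa using (hasDerivAt_id x).const_mul S.c)
    (fun x hx => S.curve_hasDerivAt hR (hu.trans_lt hx.1))
    (fun x hx => S.slope_ge hR x)
  linarith

theorem curve_le_linear {u u' : ℝ} (hu : 1 ≤ u) (huu : u ≤ u') :
    S.curve R u' ≤ S.curve R u + 1 / S.c * (u' - u) := by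
  have := sub_le_sub_of_hasDerivAt_le (g := fun y => 1 / S.c * y) (g' := fun _ => 1 / S.c)
    (f := S.curve R) (f' := _) huu 
    (S.curve_cont hR).continuousOn (by fun_prop)
    (fun x hx => S.curve_hasDerivAt hR (hu.trans_lt hx.1))
    (fun x _ => by simpa using (hasDerivAt_id x).const_mul (1 / S.c))
    (fun x hx => S.slope_le hR x)
  linarith

/-- Going back in u at fixed v increases r, so the segment stays where −ν ≥ c. The radius gained
this way makes early retarded times harmless for ∂_vψ. -/
theorem r_ge_backwards {u u' v : ℝ} (hu : 1 ≤ u') (huu : u' ≤ u) (hv : S.curve R u ≤ v) :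
    S.r u v + S.c * (u - u') ≤ S.r u' v := by
  have := sub_le_sub_of_hasDerivAt_le (g := fun y => (-S.c) * y) (g' := fun _ => -S.c)
    (f := fun x => S.r x v) (f' := fun x => S.nu x v) huu 
    (S.r_cont.slice_left v).continuousOn (by fun_prop)
    (fun x hx => S.r_u x (hu.trans_lt hx.1) v)
    (fun x _ => by simpa using (hasDerivAt_id x).const_mul (-S.c))
    (fun x hx => S.nu_le _ _ ?_)
  · linarith
  · exact (S.R₁_le_r hR hv).le.trans (S.r_antitoneOn v (hu.trans hx.1.le)
      (hu.trans huu) hx.2.le)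

theorem curve_mono {u u' : ℝ} (hu : 1 ≤ u) (huu : u ≤ u') : S.curve R u ≤ S.curve R u' := by
  have := S.curve_ge_linear hR hu huu
  nlinarith [S.c_pos]

/-- `u` is dominated by `v` on `r ≥ R`. -/
theorem u_le_v {u v : ℝ} (hu : 1 ≤ u) (hv : S.curve R u ≤ v) : S.c * u ≤ v := by
  have h1 := S.curve_ge_linear hR le_rfl hu
  have h2 := S.lt_curve hR 1
  nlinarith [S.one_le_v₀, S.c_le_one]

/-- `v` is dominated by `u + r` on `r ≥ R`. -/
theorem v_le_u_add_r {u v : ℝ} (hu : 1 ≤ u) (hv : S.curve R u ≤ v) :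
    v ≤ S.curve R 1 + 1 / S.c * (u + S.r u v) := by
  have h1 := S.curve_le_linear hR le_rfl hu
  have h2 := S.r_ge_linear hR hv
  have h3 : v - S.curve R u ≤ 1 / S.c * (S.r u v - R) := by
    rw [one_div, inv_mul_eq_div, le_div_iff₀ S.c_pos]
    linarith
  have h4 : 0 < 1 / S.c := by have := S.c_pos; positivity
  have h5 := S.R₁_pos
  nlinarith

end curve

end Exterior

/-! ### The energy current inside r = R -/

namespace NullSystem

variable {I J : Set ℝ} (S : NullSystem I J)

/-- `1 - μ`. -/
noncomputable def aspect (u v : ℝ) : ℝ := 1 - 2 * S.mass u v / S.r u v + S.e ^ 2 / S.r u v ^ 2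

theorem lam_eq_aspect (u v : ℝ) : S.lam u v = S.kappa u v * S.aspect u v := S.lam_eq u v

theorem aspect_nonneg (u v : ℝ) : 0 ≤ S.aspect u v := by
  have h1 := S.lam_nonneg u v
  rw [S.lam_eq_aspect] at h1
  exact nonneg_of_mul_nonneg_right h1 (S.kappa_pos u v)

theorem aspect_cont : Continuous fun p : ℝ × ℝ => S.aspect p.1 p.2 := by
  unfold aspect
  exact (continuous_const.sub ((continuous_const.mul S.mass_cont).div S.r_cont fun p => S.r_ne _ _)).add
    (continuous_const.div (S.r_cont.pow 2) fun p => pow_ne_zero _ (S.r_ne _ _))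

theorem aspect_v (u : ℝ) {v : ℝ} (hv : v ∈ J) : HasDerivAt (fun y => S.aspect u y)
    (2 * (S.mass u v - S.e ^ 2 / S.r u v) * S.lam u v / S.r u v ^ 2
      - S.theta u v ^ 2 / (S.r u v * S.kappa u v)) v := by
  have hr := S.r_ne u v
  have hk := S.kappa_ne u v
  have h1 := S.r_v u v hv
  have h2 := S.mass_v u v hv
  refine ((((h2.const_mul 2).div h1 hr).const_sub 1).add
    ((hasDerivAt_const v (S.e ^ 2)).div (h1.pow 2) (pow_ne_zero 2 hr))).congr_deriv ?_
  simp only [Pi.pow_apply]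
  field_simp
  ring

/-- The density of the modified ingoing energy flux. -/
noncomputable def fluxIn (η u v : ℝ) : ℝ :=
  (S.aspect u v / 2 + η) / S.r u v ^ 4 * S.zeta u v ^ 2 / (-S.nu u v)

/-- `∂_v` of `fluxIn`. -/
noncomputable def fluxInV (η u v : ℝ) : ℝ :=
  S.kappa u v * S.zeta u v ^ 2 / (-S.nu u v) / S.r u v ^ 5 *
      (-2 * S.aspect u v ^ 2 - 4 * η * S.aspect u v
        - 2 * η * (S.mass u v - S.e ^ 2 / S.r u v) / S.r u v)
    - S.theta u v ^ 2 * S.zeta u v ^ 2 / (2 * S.kappa u v * (-S.nu u v) * S.r u v ^ 5)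
    + 2 * S.zeta u v * S.theta u v * (S.aspect u v / 2 + η) / S.r u v ^ 5

/-- The density of the correction to the outgoing energy flux. -/
noncomputable def fluxOut (u v : ℝ) : ℝ := S.theta u v ^ 2 / (2 * S.kappa u v * S.r u v ^ 4)

/-- `∂_u` of `fluxOut`. -/
noncomputable def fluxOutU (u v : ℝ) : ℝ :=
  2 * (-S.nu u v) * S.theta u v ^ 2 / (S.kappa u v * S.r u v ^ 5)
    - S.theta u v * S.zeta u v * S.aspect u v / S.r u v ^ 5
    + S.theta u v ^ 2 * S.zeta u v ^ 2 / (2 * S.kappa u v * (-S.nu u v) * S.r u v ^ 5)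

/-- Differentiating 1/(−ν) produces the red-shift term with ϖ − e²/r. In the part with 1 − μ it
cancels against the derivative of 1 − μ; in the part with η it survives, also where 1 − μ vanishes.
-/
theorem fluxIn_v (η u : ℝ) {v : ℝ} (hv : v ∈ J) :
    HasDerivAt (fun y => S.fluxIn η u y) (S.fluxInV η u v) v := by
  have hr := S.r_ne u v
  have hk := S.kappa_ne u v
  have hn := S.nu_ne u v
  have h1 := S.r_v u v hv
  have h2 := S.aspect_v u hv
  have h3 := S.zeta_v u v hv
  have h4 := S.nu_v u v hv
  unfold fluxIn
  refine (((((h2.div_const 2).add_const η).div (h1.pow 4) (pow_ne_zero 4 hr)).mul (h3.pow 2)).div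
    h4.neg (neg_ne_zero.2 hn)).congr_deriv ?_
  unfold fluxInV
  rw [S.lam_eq_aspect]
  simp only [Pi.pow_apply, Pi.neg_apply, Pi.mul_apply, Pi.div_apply]
  generalize S.aspect u v = D
  field_simp
  ring

/-- For η = 0, `fluxIn` is −r⁻⁴∂_uϖ, and `fluxOut` is r⁻⁴∂_vϖ. Up to the weight, the sum of their
cross derivatives vanishes, but the bulk left by the weight is indefinite; the difference is the
useful combination, as for a Morawetz multiplier. -/
theorem fluxOut_u {u : ℝ} (hu : u ∈ I) (v : ℝ) :
    HasDerivAt (fun x => S.fluxOut x v) (S.fluxOutU u v) u := by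
  have hr := S.r_ne u v
  have hk := S.kappa_ne u v
  have hn := S.nu_ne u v
  have h1 := S.r_u u hu v
  have h2 := S.kappa_u u hu v
  have h3 := S.theta_u u hu v
  unfold fluxOut
  refine ((h3.pow 2).div ((h2.const_mul 2).mul (h1.pow 4)) (mul_ne_zero (mul_ne_zero two_ne_zero hk) (pow_ne_zero 4 hr))).congr_deriv ?_
  unfold fluxOutU
  rw [S.lam_eq_aspect]
  simp only [Pi.pow_apply, Pi.mul_apply]
  generalize S.aspect u v = D
  field_simp
  ring

theorem fluxIn_cont (η : ℝ) : Continuous fun p : ℝ × ℝ => S.fluxIn η p.1 p.2 := by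
  unfold fluxIn
  exact ((((S.aspect_cont.div_const 2).add continuous_const).div (S.r_cont.pow 4)
    fun p => pow_ne_zero _ (S.r_ne _ _)).mul (S.zeta_cont.pow 2)).div S.nu_cont.neg
    fun p => neg_ne_zero.2 (S.nu_ne _ _)

theorem fluxInV_cont (η : ℝ) : Continuous fun p : ℝ × ℝ => S.fluxInV η p.1 p.2 := by
  unfold fluxInV
  have hr := S.r_cont
  have hk := S.kappa_cont
  have hn := S.nu_cont
  have hz := S.zeta_cont
  have ht := S.theta_cont
  have hm := S.mass_cont
  have hD := S.aspect_cont
  have r0 : ∀ p : ℝ × ℝ, S.r p.1 p.2 ≠ 0 := fun p => S.r_ne _ _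
  have k0 : ∀ p : ℝ × ℝ, S.kappa p.1 p.2 ≠ 0 := fun p => S.kappa_ne _ _
  have n0 : ∀ p : ℝ × ℝ, S.nu p.1 p.2 ≠ 0 := fun p => S.nu_ne _ _
  fun_prop (disch := intro p; simp [r0, k0, n0])

theorem fluxOutU_cont : Continuous fun p : ℝ × ℝ => S.fluxOutU p.1 p.2 := by
  unfold fluxOutU
  have hr := S.r_cont
  have hk := S.kappa_cont
  have hn := S.nu_cont
  have hz := S.zeta_cont
  have ht := S.theta_cont
  have hD := S.aspect_cont
  have r0 : ∀ p : ℝ × ℝ, S.r p.1 p.2 ≠ 0 := fun p => S.r_ne _ _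
  have k0 : ∀ p : ℝ × ℝ, S.kappa p.1 p.2 ≠ 0 := fun p => S.kappa_ne _ _
  have n0 : ∀ p : ℝ × ℝ, S.nu p.1 p.2 ≠ 0 := fun p => S.nu_ne _ _
  fun_prop (disch := intro p; simp [r0, k0, n0])

theorem fluxIn_nonneg {η : ℝ} (hη : 0 ≤ η) (u v : ℝ) : 0 ≤ S.fluxIn η u v := by
  have h1 := S.aspect_nonneg u v
  have h2 := S.r_pos u v
  have h3 : 0 < -S.nu u v := neg_pos.2 (S.nu_neg u v)
  unfold fluxIn
  positivity

/-- Pointwise integrated-decay inequality. -/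
theorem fluxInV_le {η d u v : ℝ} (hη : 0 ≤ η) (hηd : 4 * η ≤ d)
    (hq : 0 ≤ S.mass u v - S.e ^ 2 / S.r u v) (hd : d ≤ 1 - S.e ^ 2 / S.r u v ^ 2) :
    S.fluxInV η u v ≤ S.fluxOutU u v
      - η * d / 2 * (S.kappa u v * S.zeta u v ^ 2 / (-S.nu u v) / S.r u v ^ 5) := by
  have hD := S.aspect_nonneg u v
  have hr := S.r_pos u v
  have hk := S.kappa_pos u v
  have hn : 0 < -S.nu u v := neg_pos.2 (S.nu_neg u v)
  have hDq : S.aspect u v + 2 * (S.mass u v - S.e ^ 2 / S.r u v) / S.r u v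
      = 1 - S.e ^ 2 / S.r u v ^ 2 := by
    unfold aspect
    field_simp
    ring
  unfold fluxInV fluxOutU
  set D := S.aspect u v
  set r := S.r u v
  set k := S.kappa u v
  set n := -S.nu u v with hn_def
  set t := S.theta u v
  set z := S.zeta u v
  set q := S.mass u v - S.e ^ 2 / r
  set Q := 2 * q / r with hQ
  have hQ0 : 0 ≤ Q := by positivity
  have e1 : 2 * η * q / r = η * Q := by rw [hQ]; ring
  rw [e1]
  have hnu : S.nu u v = -n := by rw [hn_def]; ring
  -- A quadratic form in (−ν)θ and κζ. Since D + Q ≥ d, the red-shift term ηQ keeps the second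
  -- square positive where D vanishes, and 4η ≤ d controls the cross term.
  have key : 0 ≤ 2 * n ^ 2 * t ^ 2 - 2 * (D + η) * (n * t) * (k * z)
      + (2 * D ^ 2 + 4 * η * D + η * Q - η * d / 2) * (k * z) ^ 2 := by
    set X := n * t
    set Y := k * z
    have hX : 2 * n ^ 2 * t ^ 2 = 2 * X ^ 2 := by simp only [X]; ring
    rw [hX]
    have h1 : η * (d - η * 2) ≥ η * d / 2 := by nlinarith
    have h2 : 3 * η * D ≥ 0 := by positivity
    have h3 : η * (D + Q) ≥ η * d := mul_le_mul_of_nonneg_left (by rw [hDq]; exact hd) hη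
    nlinarith [sq_nonneg (X - D * Y), sq_nonneg (X / 2 - η * Y), sq_nonneg Y, mul_nonneg h2 (sq_nonneg Y),
      mul_le_mul_of_nonneg_right h3 (sq_nonneg Y), mul_le_mul_of_nonneg_right h1 (sq_nonneg Y), sq_nonneg X]
  have e2 : (2 * n * t ^ 2 / (k * r ^ 5) - t * z * D / r ^ 5 + t ^ 2 * z ^ 2 / (2 * k * n * r ^ 5)
      - η * d / 2 * (k * z ^ 2 / n / r ^ 5))
      - (k * z ^ 2 / n / r ^ 5 * (-2 * D ^ 2 - 4 * η * D - η * Q)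
        - t ^ 2 * z ^ 2 / (2 * k * n * r ^ 5) + 2 * z * t * (D / 2 + η) / r ^ 5)
      = (2 * n ^ 2 * t ^ 2 - 2 * (D + η) * (n * t) * (k * z)
      + (2 * D ^ 2 + 4 * η * D + η * Q - η * d / 2) * (k * z) ^ 2) / (k * n * r ^ 5)
      + t ^ 2 * z ^ 2 / (k * n * r ^ 5) := by
    field_simp
    ring
  have h5 : 0 ≤ (2 * n ^ 2 * t ^ 2 - 2 * (D + η) * (n * t) * (k * z)
      + (2 * D ^ 2 + 4 * η * D + η * Q - η * d / 2) * (k * z) ^ 2) / (k * n * r ^ 5)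
      + t ^ 2 * z ^ 2 / (k * n * r ^ 5) := by positivity
  linarith

/-- The ratio `ζ / ν`. -/
noncomputable def ratio (u v : ℝ) : ℝ := S.zeta u v / S.nu u v

theorem ratio_cont : Continuous fun p : ℝ × ℝ => S.ratio p.1 p.2 :=
  S.zeta_cont.div S.nu_cont fun _ => S.nu_ne _ _

/-- Dividing ζ by ν makes the quantity independent of the choice of u, and ∂_vν supplies a damping
term wherever ϖ − e²/r > 0: the red-shift effect. -/
theorem ratio_v (u : ℝ) {v : ℝ} (hv : v ∈ J) : HasDerivAt (fun y => S.ratio u y)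
    (-S.theta u v / S.r u v
      - 2 * S.kappa u v * (S.mass u v - S.e ^ 2 / S.r u v) / S.r u v ^ 2 * S.ratio u v) v := by
  have hr := S.r_ne u v
  have hn := S.nu_ne u v
  refine ((S.zeta_v u v hv).div (S.nu_v u v hv) hn).congr_deriv ?_
  unfold ratio
  field_simp

end NullSystem

namespace Exterior

variable {v₀ ω : ℝ} (S : Exterior v₀ ω)

theorem nu_pos (u v : ℝ) : 0 < -S.nu u v := neg_pos.2 (S.nu_neg u v)

theorem d_le_one : S.d ≤ 1 := by
  have := S.d_le 1 1
  have h2 : 0 ≤ S.e ^ 2 / S.r 1 1 ^ 2 := by positivity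
  linarith

theorem M_pos : 0 < S.M := by linarith [S.one_le_M]

theorem aspect_le_one (u v : ℝ) : S.aspect u v ≤ 1 := by
  have h1 := S.r_pos u v
  have h2 : S.aspect u v = 1 - S.e ^ 2 / S.r u v ^ 2
      - 2 * (S.mass u v - S.e ^ 2 / S.r u v) / S.r u v := by
    unfold NullSystem.aspect
    field_simp
    ring
  have h3 : 0 ≤ 2 * (S.mass u v - S.e ^ 2 / S.r u v) / S.r u v := by
    have := S.q_ge u v
    have := S.q₀_pos
    apply div_nonneg _ h1.le
    linarith
  have h4 : 0 ≤ S.e ^ 2 / S.r u v ^ 2 := by positivity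
  linarith

theorem q_nonneg (u v : ℝ) : 0 ≤ S.mass u v - S.e ^ 2 / S.r u v :=
  S.q₀_pos.le.trans (S.q_ge u v)

theorem q_le (u v : ℝ) : S.mass u v - S.e ^ 2 / S.r u v ≤ S.M := by
  have h1 := S.mass_le u v
  have h2 : 0 ≤ S.e ^ 2 / S.r u v := div_nonneg (sq_nonneg _) (S.r_pos u v).le
  linarith

theorem abs_psiUV_le (u v : ℝ) :
    |S.psiUV u v| ≤ 2 * S.M * (-S.nu u v) / S.r u v ^ 2 * |S.phi u v| := by
  unfold NullSystem.psiUV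
  rw [abs_mul]
  apply mul_le_mul_of_nonneg_right _ (abs_nonneg _)
  have hr := S.r_pos u v
  rw [abs_div, abs_of_pos (pow_pos hr 2)]
  apply div_le_div_of_nonneg_right _ (pow_pos hr 2).le
  rw [abs_mul, abs_mul, abs_mul, abs_of_neg (S.nu_neg u v), abs_of_pos (S.kappa_pos u v),
    abs_of_nonneg (S.q_nonneg u v), abs_two]
  have h1 := S.kappa_le u v
  have h2 := S.q_le u v
  have h3 := S.q_nonneg u v
  have h4 := S.nu_pos u v
  have h5 : S.kappa u v * (S.mass u v - S.e ^ 2 / S.r u v) ≤ 1 * S.M :=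
    mul_le_mul h1 h2 h3 zero_le_one
  nlinarith

section inner

variable {R : ℝ} (hR : S.R₁ < R)

/-- The modified energy flux through the ingoing segment from the curve `r = R` to `u = U₁`. -/
noncomputable def inner (R U₁ u : ℝ) : ℝ :=
  ∫ x in u..U₁, S.fluxIn (S.d / 4) x (S.curve R u)

theorem inner_nonneg {U₁ u : ℝ} (hu : u ≤ U₁) : 0 ≤ S.inner R U₁ u :=
  intervalIntegral.integral_nonneg hu fun x _ =>
    S.fluxIn_nonneg (by have := S.d_pos; positivity) _ _

include hR

theorem slope_cont : Continuous fun t => -S.nu t (S.curve R t) / S.lam t (S.curve R t) := by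
  have hc := S.curve_cont hR
  exact ((S.nu_cont.along_graph hc).neg).div (S.lam_cont.along_graph hc) fun t => (S.lam_pos _ _).ne'

theorem inner_hasDerivAt (U₁ : ℝ) {u : ℝ} (hu : 1 < u) :
    HasDerivAt (S.inner R U₁)
      ((∫ x in u..U₁, S.fluxInV (S.d / 4) x (S.curve R u)
        * (-S.nu u (S.curve R u) / S.lam u (S.curve R u))) - S.fluxIn (S.d / 4) u (S.curve R u)) u := by
  have hc := S.curve_cont hR
  have hf : Continuous fun p : ℝ × ℝ => S.fluxIn (S.d / 4) p.1 (S.curve R p.2) :=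
    (S.fluxIn_cont (S.d / 4)).along_right hc
  have hf' : Continuous fun p : ℝ × ℝ => S.fluxInV (S.d / 4) p.1 (S.curve R p.2)
      * (-S.nu p.2 (S.curve R p.2) / S.lam p.2 (S.curve R p.2)) :=
    ((S.fluxInV_cont (S.d / 4)).along_right hc).mul ((S.slope_cont hR).comp continuous_snd)
  have hd : ∀ᶠ t in 𝓝 u, ∀ x, HasDerivAt (fun s => S.fluxIn (S.d / 4) x (S.curve R s))
      (S.fluxInV (S.d / 4) x (S.curve R t) * (-S.nu t (S.curve R t) / S.lam t (S.curve R t))) t := by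
    filter_upwards [lt_mem_nhds hu] with t ht x
    exact HasDerivAt.comp t (S.fluxIn_v (S.d / 4) x (S.lt_curve hR t)) (S.curve_hasDerivAt hR ht)
  have h := hasDerivAt_integral_moving (f := fun x t => S.fluxIn (S.d / 4) x (S.curve R t))
    (f' := fun x t => S.fluxInV (S.d / 4) x (S.curve R t)
        * (-S.nu t (S.curve R t) / S.lam t (S.curve R t))) (a := fun t => t) (b := fun _ => U₁)
    (t₀ := u) hf hf' hd (hasDerivAt_id u) (hasDerivAt_const u U₁)
  refine h.congr_deriv ?_
  simp

/-- On r ≤ R the bulk density controls the flux density itself, which turns integrated decay into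
damping; the constant uses κ ≥ c and the fact that (1 − μ)/2 + d/4 is at most 1. -/
theorem fluxIn_le_of_r_le {u v : ℝ} (hr : S.r u v ≤ R) : S.c / R * S.fluxIn (S.d / 4) u v ≤
    S.kappa u v * S.zeta u v ^ 2 / (-S.nu u v) / S.r u v ^ 5 := by
  have h1 := S.r_pos u v
  have h2 := S.nu_pos u v
  have h3 := S.kappa_ge u v
  have h4 := S.aspect_le_one u v
  have h5 := S.d_le_one
  have h6 := S.R₁_pos.trans hR
  have h7 := S.c_pos
  unfold NullSystem.fluxIn
  set n := -S.nu u v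
  set r := S.r u v
  have e1 : S.c / R * ((S.aspect u v / 2 + S.d / 4) / r ^ 4 * S.zeta u v ^ 2 / n)
      = (S.zeta u v ^ 2 / (n * r ^ 5)) * (S.c * (r / R) * (S.aspect u v / 2 + S.d / 4)) := by
    field_simp
  have e2 : S.kappa u v * S.zeta u v ^ 2 / n / r ^ 5
      = (S.zeta u v ^ 2 / (n * r ^ 5)) * S.kappa u v := by
    field_simp
  rw [e1, e2]
  apply mul_le_mul_of_nonneg_left _ (by positivity)
  have h8 : r / R ≤ 1 := (div_le_one h6).2 hr
  have h9 : 0 < r / R := by positivity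
  have h10 : 0 ≤ S.aspect u v := S.aspect_nonneg u v
  have h11 : S.aspect u v / 2 + S.d / 4 ≤ 1 := by linarith
  have h12 : 0 ≤ S.aspect u v / 2 + S.d / 4 := by linarith [S.d_pos]
  have h13 : (r / R) * (S.aspect u v / 2 + S.d / 4) ≤ 1 := mul_le_one₀ h8 h12 h11
  nlinarith

/-- Decay of the inner flux, up to boundary terms. -/
theorem inner_deriv_le {U₁ u : ℝ} (hu : 1 < u) (huU : u ≤ U₁) :
    (∫ x in u..U₁, S.fluxInV (S.d / 4) x (S.curve R u)
        * (-S.nu u (S.curve R u) / S.lam u (S.curve R u))) - S.fluxIn (S.d / 4) u (S.curve R u) ≤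
    (-S.nu u (S.curve R u) / S.lam u (S.curve R u)) *
      (S.fluxOut U₁ (S.curve R u) - S.fluxOut u (S.curve R u)
        - S.d ^ 2 * S.c / (8 * R) * S.inner R U₁ u) := by
  have hd := S.d_pos
  have hw := S.c_pos.le.trans (S.slope_ge hR u)
  set w := -S.nu u (S.curve R u) / S.lam u (S.curve R u)
  set v := S.curve R u with hv
  have h1 : 0 ≤ S.fluxIn (S.d / 4) u v := S.fluxIn_nonneg (by positivity) _ _
  rw [intervalIntegral.integral_mul_const]
  have h2 : ∫ x in u..U₁, S.fluxInV (S.d / 4) x v ≤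
      ∫ x in u..U₁, (S.fluxOutU x v - S.d ^ 2 * S.c / (8 * R) * S.fluxIn (S.d / 4) x v) := by
    apply intervalIntegral.integral_mono_on huU
      (((S.fluxInV_cont _).slice_left v).intervalIntegrable _ _)
    · exact ((S.fluxOutU_cont.slice_left v).sub
        (continuous_const.mul ((S.fluxIn_cont _).slice_left v))).intervalIntegrable _ _
    · intro x hx
      -- With η = d/4 the bulk coefficient ηd/2 equals d²/8. The term `fluxOutU` is an exact
      -- derivative in x and turns into boundary terms.
      have h3 := S.fluxInV_le (η := S.d / 4) (u := x) (v := v) (by positivity) (by linarith)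
        (S.q_nonneg _ _) (S.d_le _ _)
      have h4 : S.r x v ≤ R := by
        have := S.r_antitoneOn v hu.le (hu.le.trans hx.1) hx.1
        simp only [hv, S.r_curve hR] at this
        exact this
      have h5 := mul_le_mul_of_nonneg_left (S.fluxIn_le_of_r_le hR h4)
        (by positivity : 0 ≤ S.d / 4 * S.d / 2)
      have h6 : S.d ^ 2 * S.c / (8 * R) * S.fluxIn (S.d / 4) x v =
          S.d / 4 * S.d / 2 * (S.c / R * S.fluxIn (S.d / 4) x v) := by
        have := S.R₁_pos.trans hR
        field_simp
        ring
      linarith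
  have hI1 : IntervalIntegrable (fun x => S.fluxOutU x v) MeasureTheory.volume u U₁ :=
    (S.fluxOutU_cont.slice_left v).intervalIntegrable _ _
  have hI2 : IntervalIntegrable (fun x => S.d ^ 2 * S.c / (8 * R) * S.fluxIn (S.d / 4) x v)
      MeasureTheory.volume u U₁ :=
    (continuous_const.mul ((S.fluxIn_cont _).slice_left v)).intervalIntegrable _ _
  rw [intervalIntegral.integral_sub hI1 hI2,
    intervalIntegral.integral_const_mul,
    intervalIntegral.integral_eq_sub_of_hasDerivAt (f := fun x => S.fluxOut x v)
      (fun x hx => S.fluxOut_u (by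
        rw [uIcc_of_le huU] at hx
        exact hu.trans_le hx.1) v)
      ((S.fluxOutU_cont.slice_left v).intervalIntegrable _ _)] at h2
  have h7 := mul_le_mul_of_nonneg_right h2 hw
  have h8 : S.inner R U₁ u = ∫ x in u..U₁, S.fluxIn (S.d / 4) x v := rfl
  rw [h8]
  linarith

end inner

end Exterior

/-! ### The r^σ-weighted outgoing energy outside r = R -/

theorem rpow_eq_rpow_sub_mul_pow {x : ℝ} (hx : 0 < x) (a : ℝ) (n : ℕ) :
    x ^ a = x ^ (a - n) * x ^ n := by
  rw [← Real.rpow_natCast x n, ← Real.rpow_add hx]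
  congr 1
  ring

/-- The algebra behind the weighted estimate. -/
theorem weighted_algebra {σ c M r l n X Y W : ℝ} (hσ : 0 < σ) (hσ1 : σ ≤ 1) (hc : 0 < c)
    (hM : 0 < M) (hr0 : 0 < r) (hl : c ≤ l) (hn : n ≤ -c)
    (hr : 32 * M ^ 2 ≤ σ ^ 2 * c ^ 4 * r ^ 2) (hW : |W| ≤ 2 * M * |Y| / r ^ 3) :
    σ * n * (r ^ 4 * X ^ 2) + r ^ 5 * (2 * X * W) ≤ -(σ * c / 2) * (r ^ 4 * X ^ 2)
      - 8 * M ^ 2 / (σ * c ^ 2) * ((σ - 4) * l * Y ^ 2 + 2 * r * Y * X) := by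
  have h2 : r ^ 5 * (2 * X * W) ≤ 4 * M * r ^ 2 * (|X| * |Y|) := by
    have : X * W ≤ |X| * (2 * M * |Y| / r ^ 3) :=
      (le_abs_self _).trans (by rw [abs_mul]; exact mul_le_mul_of_nonneg_left hW (abs_nonneg _))
    have h3 := mul_le_mul_of_nonneg_left this (by positivity : 0 ≤ 2 * r ^ 5)
    have e : 2 * r ^ 5 * (|X| * (2 * M * |Y| / r ^ 3)) = 4 * M * r ^ 2 * (|X| * |Y|) := by
      field_simp
      ring
    linarith
  -- Young's inequality: the cross term costs a quarter of the good term σc·r⁴X² and leaves a zeroth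
  -- order error in Y².
  have h4 : 4 * M * r ^ 2 * (|X| * |Y|) ≤ σ * c / 4 * (r ^ 4 * X ^ 2)
      + 16 * M ^ 2 / (σ * c) * Y ^ 2 := by
    rw [← sq_abs X, ← sq_abs Y]
    have : σ * c / 4 * (r ^ 4 * |X| ^ 2) + 16 * M ^ 2 / (σ * c) * |Y| ^ 2
        - 4 * M * r ^ 2 * (|X| * |Y|)
        = (σ * c / 2 * r ^ 2 * |X| - 4 * M * |Y|) ^ 2 / (σ * c) := by
      field_simp
      ring
    have h5 : 0 ≤ (σ * c / 2 * r ^ 2 * |X| - 4 * M * |Y|) ^ 2 / (σ * c) := by positivity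
    linarith
  -- Pointwise Hardy inequality, by completing the square in cY − rX and using (4 − σ)l ≥ 3c. The
  -- first two terms on the right are −∂_v(r^{σ−4}ψ²) up to the factor r^{σ−5}.
  have h6 : 2 * c * Y ^ 2 ≤ (4 - σ) * l * Y ^ 2 - 2 * r * Y * X + 1 / c * r ^ 2 * X ^ 2 := by
    have h7 : 0 ≤ (c * Y - r * X) ^ 2 / c := by positivity
    have h8 : (c * Y - r * X) ^ 2 / c = c * Y ^ 2 - 2 * r * Y * X + 1 / c * r ^ 2 * X ^ 2 := by
      field_simp
      ring
    have h9 : 3 * c ≤ (4 - σ) * l := by nlinarith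
    have := mul_le_mul_of_nonneg_right h9 (sq_nonneg Y)
    linarith
  -- Here r is required to be large: the term returned by the Hardy inequality costs another quarter
  -- of the good term.
  have h10 : 8 * M ^ 2 / (σ * c ^ 2) * (1 / c * r ^ 2 * X ^ 2) ≤ σ * c / 4 * (r ^ 4 * X ^ 2) := by
    have e : σ * c / 4 * (r ^ 4 * X ^ 2) - 8 * M ^ 2 / (σ * c ^ 2) * (1 / c * r ^ 2 * X ^ 2)
        = (σ ^ 2 * c ^ 4 * r ^ 2 - 32 * M ^ 2) * (r ^ 2 * X ^ 2 / (4 * σ * c ^ 3)) := by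
      field_simp
      ring
    have : 0 ≤ (σ ^ 2 * c ^ 4 * r ^ 2 - 32 * M ^ 2) * (r ^ 2 * X ^ 2 / (4 * σ * c ^ 3)) :=
      mul_nonneg (by linarith) (by positivity)
    linarith
  have h12 : 8 * M ^ 2 / (σ * c ^ 2) * (2 * c * Y ^ 2) = 16 * M ^ 2 / (σ * c) * Y ^ 2 := by
    field_simp
    ring
  have hA : 0 ≤ 8 * M ^ 2 / (σ * c ^ 2) := by positivity
  generalize 8 * M ^ 2 / (σ * c ^ 2) = A at *
  generalize 16 * M ^ 2 / (σ * c) = B at *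
  have h11 := mul_le_mul_of_nonneg_left h6 hA
  have h13 : σ * n * (r ^ 4 * X ^ 2) ≤ -(σ * c) * (r ^ 4 * X ^ 2) := by
    apply mul_le_mul_of_nonneg_right _ (by positivity)
    nlinarith
  linarith

namespace Exterior

variable {v₀ ω : ℝ} (S : Exterior v₀ ω)

/-- `∂_u (r ^ σ (∂_v ψ) ^ 2)`. -/
noncomputable def weightedU (σ u v : ℝ) : ℝ :=
  σ * S.r u v ^ (σ - 1) * S.nu u v * S.psiV u v ^ 2
    + S.r u v ^ σ * (2 * S.psiV u v * S.psiUV u v)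

/-- `∂_v (r ^ (σ - 4) ψ ^ 2)`. -/
noncomputable def hardyV (σ u v : ℝ) : ℝ :=
  (σ - 4) * S.r u v ^ (σ - 5) * S.lam u v * S.psi u v ^ 2
    + S.r u v ^ (σ - 4) * (2 * S.psi u v * S.psiV u v)

theorem rpow_cont (a : ℝ) : Continuous fun p : ℝ × ℝ => S.r p.1 p.2 ^ a :=
  S.r_cont.rpow_const fun _ => Or.inl (S.r_ne _ _)

theorem weighted_u (σ : ℝ) {u : ℝ} (hu : 1 < u) (v : ℝ) :
    HasDerivAt (fun x => S.r x v ^ σ * S.psiV x v ^ 2) (S.weightedU σ u v) u := by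
  refine (((S.r_u u hu v).rpow_const (p := σ) (Or.inl (S.r_ne u v))).mul
    ((S.psiV_u hu v).pow 2)).congr_deriv ?_
  simp only [weightedU, Pi.pow_apply]
  ring

theorem hardy_v (σ u : ℝ) {v : ℝ} (hv : v₀ < v) :
    HasDerivAt (fun y => S.r u y ^ (σ - 4) * S.psi u y ^ 2) (S.hardyV σ u v) v := by
  refine (((S.r_v u v hv).rpow_const (p := σ - 4) (Or.inl (S.r_ne u v))).mul
    ((S.psi_v u hv).pow 2)).congr_deriv ?_
  simp only [hardyV, Pi.pow_apply]
  rw [show σ - 4 - 1 = σ - 5 by ring]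
  ring

theorem weightedU_cont (σ : ℝ) : Continuous fun p : ℝ × ℝ => S.weightedU σ p.1 p.2 := by
  unfold weightedU
  exact ((((continuous_const.mul (S.rpow_cont _)).mul S.nu_cont).mul (S.psiV_cont.pow 2)).add
    ((S.rpow_cont _).mul ((continuous_const.mul S.psiV_cont).mul S.psiUV_cont)))

theorem hardyV_cont (σ : ℝ) : Continuous fun p : ℝ × ℝ => S.hardyV σ p.1 p.2 := by
  unfold hardyV
  exact ((((continuous_const.mul (S.rpow_cont _)).mul S.lam_cont).mul (S.psi_cont.pow 2)).add
    ((S.rpow_cont _).mul ((continuous_const.mul S.psi_cont).mul S.psiV_cont)))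

/-- The pointwise `r`-weighted estimate, with the zeroth order error as a derivative. -/
theorem weightedU_le {σ u v : ℝ} (hσ : 0 < σ) (hσ1 : σ ≤ 1) (hr₁ : S.R₁ ≤ S.r u v)
    (hr : 32 * S.M ^ 2 ≤ σ ^ 2 * S.c ^ 4 * S.r u v ^ 2) :
    S.weightedU σ u v ≤ -(σ * S.c / 2) * (S.r u v ^ (σ - 1) * S.psiV u v ^ 2)
      - 8 * S.M ^ 2 / (σ * S.c ^ 2) * S.hardyV σ u v := by
  have hr0 := S.r_pos u v
  have hc := S.c_pos
  have hM := S.M_pos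
  have hl := S.lam_ge u v hr₁
  have hn := S.nu_le u v hr₁
  have hn1 := S.nu_ge u v
  have hUV := S.abs_psiUV_le u v
  have hpsi : S.phi u v = S.psi u v / S.r u v := by
    unfold NullSystem.psi
    field_simp
  rw [hpsi] at hUV
  unfold weightedU hardyV
  set r := S.r u v
  -- Factoring out r^{σ−5} leaves integral powers of r, as in `weighted_algebra`.
  set p := r ^ (σ - 5) with hp
  have hp0 : 0 < p := Real.rpow_pos_of_pos hr0 _
  have e1 : r ^ (σ - 1) = p * r ^ 4 := by
    rw [rpow_eq_rpow_sub_mul_pow hr0 (σ - 1) 4, hp]; norm_num; left; congr 1; ring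
  have e2 : r ^ σ = p * r ^ 5 := by
    rw [rpow_eq_rpow_sub_mul_pow hr0 σ 5, hp]; norm_num
  have e3 : r ^ (σ - 4) = p * r := by
    rw [rpow_eq_rpow_sub_mul_pow hr0 (σ - 4) 1, hp]; norm_num; left; congr 1; ring
  rw [e1, e2, e3]
  have h1 : |S.psiUV u v| ≤ 2 * S.M * |S.psi u v| / r ^ 3 := by
    refine hUV.trans ?_
    rw [abs_div, abs_of_pos hr0]
    have : 2 * S.M * -S.nu u v / r ^ 2 * (|S.psi u v| / r)
        = (2 * S.M * |S.psi u v| / r ^ 3) * (-S.nu u v) := by field_simp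
    rw [this]
    have h0 : 0 ≤ 2 * S.M * |S.psi u v| / r ^ 3 := by positivity
    nlinarith
  have h2 := mul_le_mul_of_nonneg_left
    (weighted_algebra (X := S.psiV u v) hσ hσ1 hc hM hr0 hl hn hr h1) hp0.le
  generalize 8 * S.M ^ 2 / (σ * S.c ^ 2) = A at *
  generalize S.psiV u v = X at *
  generalize S.psi u v = Y at *
  generalize S.psiUV u v = W at *
  generalize S.lam u v = l at *
  generalize S.nu u v = n at *
  linarith

section outer

variable {R L : ℝ} (hR : S.R₁ < R)

/-- The `r ^ σ`-weighted outgoing energy between the curves `r = R` and `r = L`. -/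
noncomputable def outer (σ R L u : ℝ) : ℝ :=
  ∫ y in S.curve R u..S.curve L u, S.r u y ^ σ * S.psiV u y ^ 2

theorem weighted_intervalIntegrable (σ u a b : ℝ) : IntervalIntegrable
    (fun y => S.r u y ^ σ * S.psiV u y ^ 2) MeasureTheory.volume a b :=
  (((S.rpow_cont σ).mul (S.psiV_cont.pow 2)).slice_right u
    (f := fun u y => S.r u y ^ σ * S.psiV u y ^ 2)).intervalIntegrable _ _

include hR

theorem curve_le_curve (hRL : R ≤ L) (u : ℝ) : S.curve R u ≤ S.curve L u := by
  have hL : S.R₁ < L := hR.trans_le hRL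
  rw [S.curve_le_iff hR (S.lt_curve hL u).le, S.r_curve hL]
  exact hRL

theorem outer_nonneg (σ : ℝ) (hRL : R ≤ L) (u : ℝ) : 0 ≤ S.outer σ R L u :=
  intervalIntegral.integral_nonneg (S.curve_le_curve hR hRL u) fun _ _ =>
    mul_nonneg (Real.rpow_nonneg (S.r_pos _ _).le _) (sq_nonneg _)

theorem outer_hasDerivAt (σ : ℝ) (hRL : R ≤ L) {u : ℝ} (hu : 1 < u) :
    HasDerivAt (S.outer σ R L) ((∫ y in S.curve R u..S.curve L u, S.weightedU σ u y)
      + L ^ σ * S.psiV u (S.curve L u) ^ 2 * (-S.nu u (S.curve L u) / S.lam u (S.curve L u))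
      - R ^ σ * S.psiV u (S.curve R u) ^ 2 * (-S.nu u (S.curve R u) / S.lam u (S.curve R u))) u := by
  have hL : S.R₁ < L := hR.trans_le hRL
  have hf : Continuous fun p : ℝ × ℝ => S.r p.2 p.1 ^ σ * S.psiV p.2 p.1 ^ 2 :=
    ((S.rpow_cont σ).mul (S.psiV_cont.pow 2)).flip_args
      (f := fun u y => S.r u y ^ σ * S.psiV u y ^ 2)
  have hf' : Continuous fun p : ℝ × ℝ => S.weightedU σ p.2 p.1 := (S.weightedU_cont σ).flip_args
  have hd : ∀ᶠ t in 𝓝 u, ∀ y, HasDerivAt (fun s => S.r s y ^ σ * S.psiV s y ^ 2)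
      (S.weightedU σ t y) t := by
    filter_upwards [lt_mem_nhds hu] with t ht y using S.weighted_u σ ht y
  have h := hasDerivAt_integral_moving (f := fun y t => S.r t y ^ σ * S.psiV t y ^ 2)
    (f' := fun y t => S.weightedU σ t y) hf hf' hd (S.curve_hasDerivAt hR hu)
    (S.curve_hasDerivAt hL hu)
  simp only [S.r_curve hR, S.r_curve hL] at h
  exact h

/-- Decay of the outer energy, up to boundary terms. -/
theorem outer_deriv_le {σ : ℝ} (hσ : 0 < σ) (hσ1 : σ ≤ 1)
    (hR1 : 32 * S.M ^ 2 ≤ σ ^ 2 * S.c ^ 4 * R ^ 2) (hR2 : 32 * S.M ^ 2 ≤ σ * S.c ^ 5 * R ^ 2)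
    (hRL : R ≤ L) (u : ℝ) :
    (∫ y in S.curve R u..S.curve L u, S.weightedU σ u y)
      + L ^ σ * S.psiV u (S.curve L u) ^ 2 * (-S.nu u (S.curve L u) / S.lam u (S.curve L u))
      - R ^ σ * S.psiV u (S.curve R u) ^ 2 * (-S.nu u (S.curve R u) / S.lam u (S.curve R u)) ≤
    1 / S.c * L ^ σ * S.psiV u (S.curve L u) ^ 2 - σ * S.c / 2 * S.outer (σ - 1) R L u
      - S.c ^ 3 / 4 * R ^ σ * S.phi u (S.curve R u) ^ 2
      + S.c * R ^ σ * S.theta u (S.curve R u) ^ 2 := by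
  have hL : S.R₁ < L := hR.trans_le hRL
  have hc := S.c_pos
  have hM := S.M_pos
  have hR0 := S.R₁_pos.trans hR
  have hL0 := S.R₁_pos.trans hL
  have hcc := S.curve_le_curve hR hRL u
  have hI1 := S.weighted_intervalIntegrable (σ - 1) u (S.curve R u) (S.curve L u)
  have hI2 : IntervalIntegrable (fun y => S.hardyV σ u y) MeasureTheory.volume (S.curve R u)
    (S.curve L u) := ((S.hardyV_cont σ).slice_right u).intervalIntegrable _ _
  have h1 : (∫ y in S.curve R u..S.curve L u, S.weightedU σ u y) ≤
      ∫ y in S.curve R u..S.curve L u, (-(σ * S.c / 2) * (S.r u y ^ (σ - 1) * S.psiV u y ^ 2)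
      - 8 * S.M ^ 2 / (σ * S.c ^ 2) * S.hardyV σ u y) := by
    apply intervalIntegral.integral_mono_on hcc
      (((S.weightedU_cont σ).slice_right u).intervalIntegrable _ _)
      ((hI1.const_mul _).sub (hI2.const_mul _))
    intro y hy
    have h2 : R ≤ S.r u y := (S.curve_le_iff hR ((S.lt_curve hR u).le.trans hy.1)).1 hy.1
    apply S.weightedU_le hσ hσ1 (hR.le.trans h2)
    refine hR1.trans ?_
    gcongr
  rw [intervalIntegral.integral_sub (hI1.const_mul _) (hI2.const_mul _),
    intervalIntegral.integral_const_mul, intervalIntegral.integral_const_mul,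
    intervalIntegral.integral_eq_sub_of_hasDerivAt
      (f := fun y => S.r u y ^ (σ - 4) * S.psi u y ^ 2)
      (fun y hy => S.hardy_v σ u (by
        rw [uIcc_of_le hcc] at hy
        exact (S.lt_curve hR u).trans_le hy.1)) hI2, S.r_curve hR, S.r_curve hL] at h1
  have h3 : S.outer (σ - 1) R L u
      = ∫ y in S.curve R u..S.curve L u, S.r u y ^ (σ - 1) * S.psiV u y ^ 2 := rfl
  rw [h3]
  have h4 : L ^ σ * S.psiV u (S.curve L u) ^ 2 * (-S.nu u (S.curve L u) / S.lam u (S.curve L u))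
      ≤ L ^ σ * S.psiV u (S.curve L u) ^ 2 * (1 / S.c) :=
    mul_le_mul_of_nonneg_left (S.slope_le hL u) (by positivity)
  have h5 : R ^ σ * S.psiV u (S.curve R u) ^ 2 * S.c ≤
      R ^ σ * S.psiV u (S.curve R u) ^ 2 * (-S.nu u (S.curve R u) / S.lam u (S.curve R u)) :=
    mul_le_mul_of_nonneg_left (S.slope_ge hR u) (by positivity)
  -- The boundary term on r = R has a good sign. Rewritten through φ it yields φ² at the price of
  -- θ², which the inner flux will absorb.
  have h6 : S.c ^ 2 / 2 * S.phi u (S.curve R u) ^ 2 - S.theta u (S.curve R u) ^ 2 ≤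
      S.psiV u (S.curve R u) ^ 2 := by
    have hl : S.c ≤ S.lam u (S.curve R u) := S.lam_ge _ _ (by rw [S.r_curve hR]; exact hR.le)
    unfold NullSystem.psiV
    set l := S.lam u (S.curve R u)
    set f := S.phi u (S.curve R u)
    set t := S.theta u (S.curve R u)
    have h7 : S.c ^ 2 ≤ l ^ 2 := by gcongr
    nlinarith [sq_nonneg (l * f + 2 * t), mul_le_mul_of_nonneg_right h7 (sq_nonneg f)]
  -- The Hardy boundary term on r = R consumes half of the φ² just gained; this is the purpose of
  -- the second lower bound on R. Its counterpart on r = L has a good sign and is dropped.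
  have h8 : 8 * S.M ^ 2 / (σ * S.c ^ 2) * (R ^ (σ - 4) * S.psi u (S.curve R u) ^ 2)
      ≤ S.c ^ 3 / 4 * R ^ σ * S.phi u (S.curve R u) ^ 2 := by
    unfold NullSystem.psi
    rw [S.r_curve hR]
    set f := S.phi u (S.curve R u)
    have e : R ^ σ = R ^ (σ - 4) * R ^ 4 := by
      rw [rpow_eq_rpow_sub_mul_pow hR0 σ 4]; norm_num
    rw [e]
    have hp : 0 < R ^ (σ - 4) := Real.rpow_pos_of_pos hR0 _
    have e2 : S.c ^ 3 / 4 * (R ^ (σ - 4) * R ^ 4) * f ^ 2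
        - 8 * S.M ^ 2 / (σ * S.c ^ 2) * (R ^ (σ - 4) * (R * f) ^ 2)
        = (σ * S.c ^ 5 * R ^ 2 - 32 * S.M ^ 2) * (R ^ (σ - 4) * R ^ 2 * f ^ 2 / (4 * σ * S.c ^ 2)) := by
      field_simp
      ring
    have : 0 ≤ (σ * S.c ^ 5 * R ^ 2 - 32 * S.M ^ 2) *
        (R ^ (σ - 4) * R ^ 2 * f ^ 2 / (4 * σ * S.c ^ 2)) :=
      mul_nonneg (by linarith) (by positivity)
    linarith
  have h9 : 0 ≤ 8 * S.M ^ 2 / (σ * S.c ^ 2) * (L ^ (σ - 4) * S.psi u (S.curve L u) ^ 2) := by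
    positivity
  have h10 := mul_le_mul_of_nonneg_left h6 (by positivity : 0 ≤ S.c * R ^ σ)
  rw [mul_sub] at h1
  linarith

end outer

end Exterior

/-! ### Cauchy–Schwarz, and crude bounds growing in u -/

/-- Cauchy–Schwarz for increments. -/
theorem sq_sub_le_integral_mul_integral {f f' w p : ℝ → ℝ} {a b : ℝ} (hab : a ≤ b)
    (hf : ContinuousOn f (Icc a b)) (hf' : ∀ x ∈ Ioo a b, HasDerivAt f (f' x) x)
    (hw : Continuous w) (hp : Continuous p) (hw0 : ∀ x, 0 ≤ w x) (hp0 : ∀ x, 0 ≤ p x)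
    (hle : ∀ x ∈ Ioo a b, f' x ^ 2 ≤ w x * p x) :
    (f b - f a) ^ 2 ≤ (∫ x in a..b, w x) * ∫ x in a..b, p x := by
  -- Young's inequality 2√(wp) ≤ sw + p/s, integrated with a constant s still to be chosen.
  have key : ∀ s : ℝ, 0 < s → |f b - f a| ≤ (s * (∫ x in a..b, w x) + (∫ x in a..b, p x) / s) / 2 := by
    intro s hs
    have h := abs_sub_le_sub_of_hasDerivAt (f := f) (f' := f')
      (g := fun y => (s * (∫ x in a..y, w x) + (∫ x in a..y, p x) / s) / 2)
      (g' := fun y => (s * w y + p y / s) / 2) hab hf ?_ hf' ?_ ?_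
    · simpa using h
    · have h1 : Continuous fun y => ∫ x in a..y, w x :=
        intervalIntegral.continuous_primitive (fun _ _ => hw.intervalIntegrable _ _) a
      have h2 : Continuous fun y => ∫ x in a..y, p x :=
        intervalIntegral.continuous_primitive (fun _ _ => hp.intervalIntegrable _ _) a
      exact (((continuous_const.mul h1).add (h2.div_const s)).div_const 2).continuousOn
    · intro x _
      have h1 : HasDerivAt (fun y => ∫ x in a..y, w x) (w x) x := hw.integral_hasStrictDerivAt a x |>.hasDerivAt
      have h2 : HasDerivAt (fun y => ∫ x in a..y, p x) (p x) x := hp.integral_hasStrictDerivAt a x |>.hasDerivAt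
      exact ((h1.const_mul s).add (h2.div_const s)).div_const 2
    · intro x hx
      apply abs_le_of_sq_le_sq
      · refine (hle x hx).trans ?_
        have : ((s * w x + p x / s) / 2) ^ 2 - w x * p x = ((s * w x - p x / s) / 2) ^ 2 := by
          field_simp
          ring
        nlinarith [sq_nonneg ((s * w x - p x / s) / 2)]
      · have := hw0 x
        have := hp0 x
        positivity
  set X := |f b - f a|
  have hX0 : 0 ≤ X := abs_nonneg _
  rw [← sq_abs (f b - f a)]
  change X ^ 2 ≤ _
  have hW : 0 ≤ ∫ x in a..b, w x := intervalIntegral.integral_nonneg hab fun x _ => hw0 x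
  have hP : 0 ≤ ∫ x in a..b, p x := intervalIntegral.integral_nonneg hab fun x _ => hp0 x
  set W := ∫ x in a..b, w x
  set P := ∫ x in a..b, p x
  rcases hX0.eq_or_lt with h0 | h0
  · have := mul_nonneg hW hP
    nlinarith
  -- The choice s = P/X makes P/s equal to X and leaves X ≤ (P/X)W. If P = 0, the choice s = X/(W +
  -- 1) contradicts X > 0.
  rcases hP.eq_or_lt with h1 | h1
  · exfalso
    rw [← h1] at key
    have := key (X / (W + 1)) (by positivity)
    rw [zero_div, add_zero] at this
    have h2 : X / (W + 1) * W ≤ X := by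
      rw [div_mul_eq_mul_div, div_le_iff₀ (by positivity)]
      nlinarith
    linarith
  · have := key (P / X) (by positivity)
    have h2 : P / (P / X) = X := by field_simp
    rw [h2] at this
    have h3 : X ≤ P / X * W := by linarith
    have h4 : X * X ≤ P / X * W * X := mul_le_mul_of_nonneg_right h3 h0.le
    have h5 : P / X * W * X = W * P := by field_simp
    nlinarith

namespace Exterior

variable {v₀ ω : ℝ} (S : Exterior v₀ ω)

theorem A_nonneg : 0 ≤ S.A := (abs_nonneg _).trans (S.psi_data v₀ le_rfl)

theorem Z_nonneg : 0 ≤ S.Z := by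
  have h1 := (abs_nonneg _).trans (S.zeta_le 1 1)
  exact nonneg_of_mul_nonneg_left h1 (S.nu_pos 1 1)

/-- A crude bound for `ψ`, growing in `u`. -/
theorem abs_psi_le_crude {u v : ℝ} (hu : 1 ≤ u) (hv : v₀ ≤ v) :
    |S.psi u v| ≤ (S.A + S.Z) * u := by
  have hr := S.r_pos u v
  have hA := S.A_nonneg
  have hZ := S.Z_nonneg
  -- |∂_uφ| ≤ Z(−ν)/r, where r is smallest at the end of the segment and −ν ≤ 1. The growth in u is
  -- tolerable because this bound only serves bounded ranges of u and starting values.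
  have h1 : |S.phi u v - S.phi 1 v| ≤ S.Z / S.r u v * u - S.Z / S.r u v * 1 := by
    refine abs_sub_le_sub_of_hasDerivAt (f := fun x => S.phi x v) (g := fun x => S.Z / S.r u v * x)
      (g' := fun _ => S.Z / S.r u v) hu (S.phi_cont.slice_left v).continuousOn (by fun_prop)
      (fun x hx => S.phi_u x hx.1 v)
      (fun x _ => by simpa using (hasDerivAt_id x).const_mul (S.Z / S.r u v)) ?_
    intro x hx
    rw [abs_div, abs_of_pos (S.r_pos x v)]
    apply div_le_div₀ hZ _ hr (S.r_antitoneOn v hx.1.le hu hx.2.le)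
    have := S.zeta_le x v
    nlinarith [S.nu_ge x v]
  have h2 : S.r u v * |S.phi 1 v| ≤ S.A := by
    have h3 := S.psi_data v hv
    rw [abs_mul, abs_of_pos (S.r_pos 1 v)] at h3
    have h4 : S.r u v ≤ S.r 1 v := S.r_antitoneOn v (by simp) hu hu
    exact (mul_le_mul_of_nonneg_right h4 (abs_nonneg _)).trans h3
  have h5 : |S.phi u v| ≤ |S.phi 1 v| + S.Z / S.r u v * (u - 1) := by
    have := abs_sub_abs_le_abs_sub (S.phi u v) (S.phi 1 v)
    linarith
  unfold NullSystem.psi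
  rw [abs_mul, abs_of_pos hr]
  have h6 := mul_le_mul_of_nonneg_left h5 hr.le
  have h7 : S.r u v * (|S.phi 1 v| + S.Z / S.r u v * (u - 1)) =
      S.r u v * |S.phi 1 v| + S.Z * (u - 1) := by field_simp
  nlinarith

theorem inv_r_sq_u {u : ℝ} (hu : 1 < u) (v : ℝ) :
    HasDerivAt (fun x => (S.r x v ^ 2)⁻¹) (2 * (-S.nu u v) / S.r u v ^ 3) u := by
  have hr := S.r_ne u v
  refine (((S.r_u u hu v).pow 2).inv (pow_ne_zero 2 hr)).congr_deriv ?_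
  simp only [Pi.pow_apply]
  field_simp
  norm_num
  ring

theorem inv_r_u {u : ℝ} (hu : 1 < u) (v : ℝ) :
    HasDerivAt (fun x => (S.r x v)⁻¹) (-S.nu u v / S.r u v ^ 2) u :=
  (S.r_u u hu v).inv (S.r_ne u v)

theorem abs_psiV_data {v : ℝ} (hv : v₀ ≤ v) : |S.psiV 1 v| ≤ S.A * v ^ (-ω) := S.psiV_data v hv

/-- Variation of `∂_v ψ` in `u`. -/
theorem abs_psiV_sub_le {u v : ℝ} (hu : 1 ≤ u) (hv : v₀ ≤ v) :
    |S.psiV u v - S.psiV 1 v| ≤ S.M * ((S.A + S.Z) * u) * (S.r u v ^ 2)⁻¹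
      - S.M * ((S.A + S.Z) * u) * (S.r 1 v ^ 2)⁻¹ := by
  have hA := S.A_nonneg
  have hZ := S.Z_nonneg
  have hM := S.M_pos
  refine abs_sub_le_sub_of_hasDerivAt (f := fun x => S.psiV x v)
    (g := fun x => S.M * ((S.A + S.Z) * u) * (S.r x v ^ 2)⁻¹)
    (g' := fun x => S.M * ((S.A + S.Z) * u) * (2 * (-S.nu x v) / S.r x v ^ 3)) hu
    (S.psiV_cont.slice_left v).continuousOn
    ((continuous_const.mul (((S.r_cont.slice_left v).pow 2).inv₀
      fun x => pow_ne_zero 2 (S.r_ne _ _))).continuousOn)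
    (fun x hx => S.psiV_u hx.1 v)
    (fun x hx => (S.inv_r_sq_u hx.1 v).const_mul _) ?_
  intro x hx
  refine (S.abs_psiUV_le x v).trans ?_
  have h2 := S.abs_psi_le_crude (u := x) hx.1.le hv
  have hr := S.r_pos x v
  unfold NullSystem.psi at h2
  rw [abs_mul, abs_of_pos hr] at h2
  have h3 : S.r x v * |S.phi x v| ≤ (S.A + S.Z) * u :=
    h2.trans (mul_le_mul_of_nonneg_left hx.2.le (by positivity))
  have hn := S.nu_pos x v
  have e : 2 * S.M * -S.nu x v / S.r x v ^ 2 * |S.phi x v|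
      = 2 * S.M * -S.nu x v / S.r x v ^ 3 * (S.r x v * |S.phi x v|) := by field_simp
  rw [e]
  have h4 := mul_le_mul_of_nonneg_left h3
    (by positivity : 0 ≤ 2 * S.M * -S.nu x v / S.r x v ^ 3)
  refine h4.trans (le_of_eq ?_)
  field_simp

/-- A crude bound for `∂_v ψ`, growing in `u`. -/
theorem abs_psiV_le_crude (hω : 0 ≤ ω) {u v : ℝ} (hu : 1 ≤ u) (hv : v₀ ≤ v) :
    |S.psiV u v| ≤ (S.A + S.M * (S.A + S.Z) / S.ρ ^ 2) * u := by
  have hA := S.A_nonneg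
  have hZ := S.Z_nonneg
  have hM := S.M_pos
  have hρ := S.ρ_pos
  have h1 := S.abs_psiV_sub_le hu hv
  have h5 := S.abs_psiV_data hv
  have hv1 : 1 ≤ v := S.one_le_v₀.trans hv
  have h6 : v ^ (-ω) ≤ 1 := Real.rpow_le_one_of_one_le_of_nonpos hv1 (by linarith)
  have h7 : (S.r u v ^ 2)⁻¹ ≤ (S.ρ ^ 2)⁻¹ := by
    have := S.r_ge u v
    gcongr
  have h8 : 0 ≤ (S.r 1 v ^ 2)⁻¹ := by positivity
  have h9 : |S.psiV u v| ≤ |S.psiV 1 v| + |S.psiV u v - S.psiV 1 v| := by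
    have := abs_sub_abs_le_abs_sub (S.psiV u v) (S.psiV 1 v)
    linarith
  have h10 : 0 ≤ S.M * ((S.A + S.Z) * u) := by positivity
  have h11 := mul_le_mul_of_nonneg_left h7 h10
  have h12 := mul_nonneg h10 h8
  have h13 : S.A * v ^ (-ω) ≤ S.A * 1 := mul_le_mul_of_nonneg_left h6 hA
  have e : (S.A + S.M * (S.A + S.Z) / S.ρ ^ 2) * u
      = S.A * u + S.M * ((S.A + S.Z) * u) * (S.ρ ^ 2)⁻¹ := by field_simp
  rw [e]
  nlinarith

section

variable {R L : ℝ} (hR : S.R₁ < R)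
include hR

/-- Weighted Cauchy–Schwarz from the curve r = R: the dual weight contributes ∫ r^{1−σ} ≤ r²/c, and
this r² is exactly what division by r² in passing from ψ² to φ² gives back. No factor L is lost. -/
theorem sq_phi_le {σ : ℝ} (hσ : 0 ≤ σ) (hR1 : 1 ≤ R) (hRL : R ≤ L) {u y : ℝ}
    (hy : S.curve R u ≤ y) (hyL : y ≤ S.curve L u) :
    S.phi u y ^ 2 ≤ 2 * S.phi u (S.curve R u) ^ 2 + 2 / S.c * S.outer (σ - 1) R L u := by
  have hL : S.R₁ < L := hR.trans_le hRL
  have hc := S.c_pos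
  have hy0 : v₀ ≤ y := (S.lt_curve hR u).le.trans hy
  have hr := S.r_pos u y
  have hRr : R ≤ S.r u y := (S.curve_le_iff hR hy0).1 hy
  have h1r : 1 ≤ S.r u y := hR1.trans hRr
  have hw : Continuous fun x => S.r u x ^ (σ - 1) * S.psiV u x ^ 2 :=
    ((S.rpow_cont (σ - 1)).mul (S.psiV_cont.pow 2)).slice_right u
      (f := fun u y => S.r u y ^ (σ - 1) * S.psiV u y ^ 2)
  have hp : Continuous fun x => S.r u x ^ (1 - σ) := (S.rpow_cont (1 - σ)).slice_right u
    (f := fun u y => S.r u y ^ (1 - σ))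
  have hpsi := sq_sub_le_integral_mul_integral (f := fun x => S.psi u x) (f' := fun x => S.psiV u x)
    (w := fun x => S.r u x ^ (σ - 1) * S.psiV u x ^ 2) (p := fun x => S.r u x ^ (1 - σ)) hy
    (S.psi_cont.slice_right u).continuousOn
    (fun x hx => S.psi_v u ((S.lt_curve hR u).trans hx.1)) hw hp
    (fun x => mul_nonneg (Real.rpow_nonneg (S.r_pos _ _).le _) (sq_nonneg _))
    (fun x => Real.rpow_nonneg (S.r_pos _ _).le _) (fun x _ => by
      have : S.r u x ^ (σ - 1) * S.r u x ^ (1 - σ) = 1 := by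
        rw [← Real.rpow_add (S.r_pos _ _)]; norm_num
      refine le_of_eq ?_
      rw [mul_right_comm, this, one_mul])
  have h1 : (∫ x in S.curve R u..y, S.r u x ^ (σ - 1) * S.psiV u x ^ 2) ≤
      S.outer (σ - 1) R L u := by
    apply intervalIntegral.integral_mono_interval le_rfl hy hyL
    · exact Eventually.of_forall fun x =>
        mul_nonneg (Real.rpow_nonneg (S.r_pos _ _).le _) (sq_nonneg _)
    · exact hw.intervalIntegrable _ _
  have h2 : (∫ x in S.curve R u..y, S.r u x ^ (1 - σ)) ≤ S.r u y * (S.r u y / S.c) := by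
    have h3 : (∫ x in S.curve R u..y, S.r u x ^ (1 - σ)) ≤ ∫ x in S.curve R u..y, S.r u y := by
      apply intervalIntegral.integral_mono_on hy (hp.intervalIntegrable _ _) (by simp)
      intro x hx
      have hx0 : v₀ ≤ x := (S.lt_curve hR u).le.trans hx.1
      have h4 : 1 ≤ S.r u x := hR1.trans ((S.curve_le_iff hR hx0).1 hx.1)
      calc S.r u x ^ (1 - σ) ≤ S.r u x ^ (1 : ℝ) :=
            Real.rpow_le_rpow_of_exponent_le h4 (by linarith)
        _ = S.r u x := Real.rpow_one _
        _ ≤ S.r u y := (S.r_strictMonoOn u).monotoneOn hx0 hy0 hx.2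
    rw [intervalIntegral.integral_const, smul_eq_mul] at h3
    have h5 := S.r_ge_linear hR hy
    have h6 : y - S.curve R u ≤ S.r u y / S.c := by
      rw [le_div_iff₀ hc]; linarith
    nlinarith
  have h7 : (0 : ℝ) ≤ ∫ x in S.curve R u..y, S.r u x ^ (1 - σ) :=
    intervalIntegral.integral_nonneg hy fun x _ => Real.rpow_nonneg (S.r_pos _ _).le _
  have h8 := hpsi.trans (mul_le_mul h1 h2 h7 (S.outer_nonneg hR _ hRL u))
  simp only [NullSystem.psi, S.r_curve hR] at h8
  set h := S.outer (σ - 1) R L u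
  set r := S.r u y
  set f := S.phi u y
  set g := S.phi u (S.curve R u)
  have h9 : (r * f) ^ 2 ≤ 2 * (R * g) ^ 2 + 2 * (h * (r * (r / S.c))) := by
    nlinarith [sq_nonneg (r * f - 2 * (R * g))]
  have h10 : (R * g) ^ 2 ≤ r ^ 2 * g ^ 2 := by
    rw [mul_pow]; gcongr
  have e : 2 * (h * (r * (r / S.c))) = r ^ 2 * (2 / S.c * h) := by field_simp
  rw [e] at h9
  have h11 : r ^ 2 * f ^ 2 ≤ r ^ 2 * (2 * g ^ 2 + 2 / S.c * h) := by nlinarith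
  exact le_of_mul_le_mul_left h11 (by positivity)

end

end Exterior

/-! ### The total energy and its damping -/

/-- The flux identity on a level curve of `r`: `t = w θ` with `w` the slope of the curve. -/
theorem level_flux_algebra {n l D z θ φ dd : ℝ} (hn : 0 < n) (hn1 : n ≤ 1) (hl : 0 < l)
    (hD : 1 - dd ≤ D) (hD1 : D ≤ 1) (hdd : 2 * dd ≤ 1) :
    -(D * z ^ 2 / n) + D * n * θ ^ 2 / l ^ 2 + 2 * φ * (z + n / l * θ) ≤
      (l * φ + θ) ^ 2 / l ^ 2 + 2 * dd * φ ^ 2 := by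
  set t := n * θ / l with ht
  set y := n * φ with hy
  have hd0 : 0 ≤ 1 - D := by linarith
  have h1 : D * (t ^ 2 - z ^ 2) + 2 * y * (z + t) ≤ (t + y) ^ 2 + 2 * dd * y ^ 2 := by
    -- For D = 1 the right-hand quantity is (t + y)² − (z − y)². For D < 1 the deficit is written as
    -- a sum of squares after adding 2(1 − D)y².
    have e : (t + y) ^ 2 + 2 * (1 - D) * y ^ 2 - (D * (t ^ 2 - z ^ 2) + 2 * y * (z + t))
        = (1 - 2 * (1 - D)) * (z - y) ^ 2 + (1 - D) * t ^ 2 + (1 - D) * (z - 2 * y) ^ 2 := by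
      ring
    have h2 : 0 ≤ (1 - 2 * (1 - D)) * (z - y) ^ 2 := mul_nonneg (by linarith) (sq_nonneg _)
    have h3 : 0 ≤ (1 - D) * t ^ 2 := by positivity
    have h4 : 0 ≤ (1 - D) * (z - 2 * y) ^ 2 := by positivity
    have h5 : (1 - D) * y ^ 2 ≤ dd * y ^ 2 := mul_le_mul_of_nonneg_right (by linarith) (sq_nonneg _)
    linarith
  have e1 : -(D * z ^ 2 / n) + D * n * θ ^ 2 / l ^ 2 + 2 * φ * (z + n / l * θ)
      = (D * (t ^ 2 - z ^ 2) + 2 * y * (z + t)) / n := by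
    rw [ht, hy]; field_simp; ring
  have e2 : (t + y) ^ 2 / n = n * ((l * φ + θ) ^ 2 / l ^ 2) := by
    rw [ht, hy]; field_simp; ring
  have e3 : 2 * dd * y ^ 2 / n = n * (2 * dd * φ ^ 2) := by
    rw [hy]; field_simp
  have hdd0 : 0 ≤ dd := by linarith
  rw [e1]
  calc (D * (t ^ 2 - z ^ 2) + 2 * y * (z + t)) / n
      ≤ ((t + y) ^ 2 + 2 * dd * y ^ 2) / n := div_le_div_of_nonneg_right h1 hn.le
    _ = n * ((l * φ + θ) ^ 2 / l ^ 2) + n * (2 * dd * φ ^ 2) := by rw [add_div, e2, e3]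
    _ ≤ 1 * ((l * φ + θ) ^ 2 / l ^ 2) + 1 * (2 * dd * φ ^ 2) := by gcongr
    _ = _ := by ring

namespace Exterior

variable {v₀ ω : ℝ} (S : Exterior v₀ ω)

/-- The flux part of the energy: mass difference, boundary term at `r = L`, inner flux. -/
noncomputable def flux (R L U₁ u : ℝ) : ℝ :=
  1 / S.ρ ^ 4 * (S.mass u (S.curve L u) - S.mass U₁ (S.curve R u))
    + 1 / (2 * S.ρ ^ 4) * L * S.phi u (S.curve L u) ^ 2 + S.inner R U₁ u

/-- The total energy between `r = L` and `u = U₁`. -/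
noncomputable def energy (σ R L U₁ u : ℝ) : ℝ :=
  S.outer σ R L u + 2 * R ^ σ * R ^ 4 * S.flux R L U₁ u

/-- The inner current leaves a boundary term at u = U₁ of wrong sign. As r ≥ ρ it is dominated by
the mass flux there, which explains the coefficient ρ⁻⁴ of the mass in `flux`. -/
theorem fluxOut_le_mass_v (u v : ℝ) : S.fluxOut u v ≤
    1 / S.ρ ^ 4 * (S.theta u v ^ 2 / (2 * S.kappa u v)) := by
  unfold NullSystem.fluxOut
  have h1 := S.ρ_pos
  have h2 := S.r_ge u v
  have h3 := S.kappa_pos u v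
  have e : S.theta u v ^ 2 / (2 * S.kappa u v * S.r u v ^ 4)
      = 1 / S.r u v ^ 4 * (S.theta u v ^ 2 / (2 * S.kappa u v)) := by
    have := S.r_pos u v
    field_simp
  rw [e]
  gcongr

/-- Along r = L the mass grows through its θ² term. Adding the multiple of Lφ² completes the square:
what enters is (∂_vψ)², the genuinely incoming radiation, up to an error of size M/L. -/
theorem mass_level_bound {L : ℝ} (hL : S.R₁ < L) (u : ℝ) :
    2 * (S.lam u (S.curve L u) * S.zeta u (S.curve L u) ^ 2 /
          (2 * S.kappa u (S.curve L u) * S.nu u (S.curve L u))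
        + S.theta u (S.curve L u) ^ 2 / (2 * S.kappa u (S.curve L u)) *
          (-S.nu u (S.curve L u) / S.lam u (S.curve L u)))
      + L * (2 * S.phi u (S.curve L u) * (S.zeta u (S.curve L u) / L
        + S.theta u (S.curve L u) / L * (-S.nu u (S.curve L u) / S.lam u (S.curve L u)))) ≤
    1 / S.c ^ 2 * S.psiV u (S.curve L u) ^ 2 + 4 * S.M / L * S.phi u (S.curve L u) ^ 2 := by
  set v := S.curve L u with hv
  have hrL : S.r u v = L := S.r_curve hL u
  have hL0 := S.R₁_pos.trans hL
  have hc := S.c_pos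
  have hl := S.lam_pos u v
  have hlc : S.c ≤ S.lam u v := S.lam_ge u v (by rw [hrL]; exact hL.le)
  have hn := S.nu_pos u v
  have hn1 := S.nu_ge u v
  have hk := S.kappa_pos u v
  have hlam := S.lam_eq_aspect u v
  have hD0 : 0 < S.aspect u v := by
    rw [hlam] at hl
    exact pos_of_mul_pos_right hl hk.le
  have hD : 1 - 2 * S.M / L ≤ S.aspect u v := by
    unfold NullSystem.aspect
    rw [hrL]
    have h1 : 2 * S.mass u v / L ≤ 2 * S.M / L := by
      have := S.mass_le u v
      gcongr
    have h2 : 0 ≤ S.e ^ 2 / L ^ 2 := by positivity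
    linarith
  have h4M : 2 * (2 * S.M / L) ≤ 1 := by
    rw [← mul_div_assoc, div_le_one hL0]
    linarith [S.R₁_ge]
  have key := level_flux_algebra (z := S.zeta u v) (θ := S.theta u v) (φ := S.phi u v) hn
    (by linarith) hl hD (S.aspect_le_one u v) h4M
  have hnu : S.nu u v = -(-S.nu u v) := by ring
  have e1 : S.kappa u v = S.lam u v / S.aspect u v := by rw [hlam]; field_simp
  have e2 : 2 * (S.lam u v * S.zeta u v ^ 2 / (2 * S.kappa u v * S.nu u v)
      + S.theta u v ^ 2 / (2 * S.kappa u v) * (-S.nu u v / S.lam u v))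
      + L * (2 * S.phi u v * (S.zeta u v / L + S.theta u v / L * (-S.nu u v / S.lam u v)))
      = -(S.aspect u v * S.zeta u v ^ 2 / (-S.nu u v))
        + S.aspect u v * (-S.nu u v) * S.theta u v ^ 2 / S.lam u v ^ 2
        + 2 * S.phi u v * (S.zeta u v + -S.nu u v / S.lam u v * S.theta u v) := by
    rw [e1]
    have := S.nu_ne u v
    field_simp
  rw [e2]
  refine key.trans ?_
  have h5 : (S.lam u v * S.phi u v + S.theta u v) ^ 2 / S.lam u v ^ 2 ≤
      1 / S.c ^ 2 * S.psiV u v ^ 2 := by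
    unfold NullSystem.psiV
    rw [div_eq_mul_one_div, mul_comm]
    gcongr
  have e3 : 2 * (2 * S.M / L) * S.phi u v ^ 2 = 4 * S.M / L * S.phi u v ^ 2 := by ring
  linarith

section

variable {R L : ℝ} (hR : S.R₁ < R)
include hR

/-- The inner current gains θ² on r = R, exactly the term left over by the outgoing energy. -/
theorem fluxOut_ge (u : ℝ) : S.theta u (S.curve R u) ^ 2 / (2 * R ^ 4) ≤
    S.fluxOut u (S.curve R u) := by
  unfold NullSystem.fluxOut
  rw [S.r_curve hR]
  have h3 := S.kappa_pos u (S.curve R u)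
  have h4 := S.kappa_le u (S.curve R u)
  have hR0 := S.R₁_pos.trans hR
  apply div_le_div_of_nonneg_left (sq_nonneg _) (by positivity)
  have : 2 * S.kappa u (S.curve R u) * R ^ 4 ≤ 2 * 1 * R ^ 4 := by gcongr
  linarith

theorem flux_hasDerivAt (hRL : R ≤ L) {U₁ u : ℝ} (hu : 1 < u) (huU : u ≤ U₁) :
    ∃ F' : ℝ, HasDerivAt (S.flux R L U₁) F' u ∧
      F' ≤ 1 / (2 * S.ρ ^ 4) * (1 / S.c ^ 2 * S.psiV u (S.curve L u) ^ 2
          + 4 * S.M / L * S.phi u (S.curve L u) ^ 2)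
        - S.c * (S.theta u (S.curve R u) ^ 2 / (2 * R ^ 4))
        - S.c * (S.d ^ 2 * S.c / (8 * R) * S.inner R U₁ u) := by
  have hL : S.R₁ < L := hR.trans_le hRL
  have hL0 := S.R₁_pos.trans hL
  have hR0 := S.R₁_pos.trans hR
  have hρ := S.ρ_pos
  have hev : ∀ᶠ t in 𝓝 u, 1 < t := lt_mem_nhds hu
  have hcL := S.curve_hasDerivAt hL hu
  have hcR := S.curve_hasDerivAt hR hu
  have hmu : Continuous fun p : ℝ × ℝ => S.lam p.1 p.2 * S.zeta p.1 p.2 ^ 2 /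
      (2 * S.kappa p.1 p.2 * S.nu p.1 p.2) :=
    (S.lam_cont.mul (S.zeta_cont.pow 2)).div ((continuous_const.mul S.kappa_cont).mul S.nu_cont)
      fun p => mul_ne_zero (mul_ne_zero two_ne_zero (S.kappa_ne _ _)) (S.nu_ne _ _)
  have h1 := hasDerivAt_along_curve (f := S.mass)
    (fu := fun x y => S.lam x y * S.zeta x y ^ 2 / (2 * S.kappa x y * S.nu x y)) hmu
    (by filter_upwards [hev] with t ht v using S.mass_u t ht v)
    (S.mass_v u _ (S.lt_curve hL u)) (S.curve_cont hL) hcL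
  have h2 : HasDerivAt (fun t => S.mass U₁ (S.curve R t)) _ u :=
    HasDerivAt.comp u (S.mass_v U₁ _ (S.lt_curve hR u)) hcR
  have h3 := hasDerivAt_along_curve (f := S.phi) (fu := fun x y => S.zeta x y / S.r x y)
    (S.zeta_cont.div S.r_cont fun p => S.r_ne _ _)
    (by filter_upwards [hev] with t ht v using S.phi_u t ht v)
    (S.phi_v u _ (S.lt_curve hL u)) (S.curve_cont hL) hcL
  have h4 := S.inner_hasDerivAt hR U₁ hu
  have hF := (((h1.sub h2).const_mul (1 / S.ρ ^ 4)).add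
    ((h3.pow 2).const_mul (1 / (2 * S.ρ ^ 4) * L))).add h4
  refine ⟨_, hF, ?_⟩
  have b1 := S.mass_level_bound hL u
  have b2 := S.inner_deriv_le hR hu huU
  have b3 := S.fluxOut_le_mass_v U₁ (S.curve R u)
  have b4 := S.fluxOut_ge hR u
  have b5 := S.slope_ge hR u
  have b6 := S.inner_nonneg (R := R) huU
  simp only [S.r_curve hL, Nat.cast_ofNat, Nat.add_one_sub_one, pow_one]
  generalize S.inner R U₁ u = P at *
  generalize (∫ x in u..U₁, S.fluxInV (S.d / 4) x (S.curve R u)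
        * (-S.nu u (S.curve R u) / S.lam u (S.curve R u))) - S.fluxIn (S.d / 4) u (S.curve R u) = Q at *
  generalize S.lam u (S.curve L u) * S.zeta u (S.curve L u) ^ 2 /
          (2 * S.kappa u (S.curve L u) * S.nu u (S.curve L u)) = a1 at *
  generalize S.theta u (S.curve L u) ^ 2 / (2 * S.kappa u (S.curve L u)) *
          (-S.nu u (S.curve L u) / S.lam u (S.curve L u)) = a2 at *
  generalize S.zeta u (S.curve L u) / L
        + S.theta u (S.curve L u) / L * (-S.nu u (S.curve L u) / S.lam u (S.curve L u)) = a3 at *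
  generalize -S.nu u (S.curve R u) / S.lam u (S.curve R u) = w at *
  generalize S.theta U₁ (S.curve R u) ^ 2 / (2 * S.kappa U₁ (S.curve R u)) = m at *
  generalize S.fluxOut U₁ (S.curve R u) = o1 at *
  generalize S.fluxOut u (S.curve R u) = o2 at *
  generalize S.phi u (S.curve L u) = f at *
  have hc := S.c_pos
  have hw : 0 ≤ w := hc.le.trans b5
  have c1 := mul_le_mul_of_nonneg_left b1 (by positivity : 0 ≤ 1 / (2 * S.ρ ^ 4))
  -- The flux at U₁ is replaced by the mass flux, which the derivative of −`mass U₁` cancels; the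
  -- two good terms are kept with the lower bound c for the slope.
  have c2 : w * (o1 - o2 - S.d ^ 2 * S.c / (8 * R) * P) ≤ w * (1 / S.ρ ^ 4 * m)
      - S.c * (S.theta u (S.curve R u) ^ 2 / (2 * R ^ 4)) - S.c * (S.d ^ 2 * S.c / (8 * R) * P) := by
    have e1 : 0 ≤ S.d ^ 2 * S.c / (8 * R) * P := by positivity
    have e2 : 0 ≤ S.theta u (S.curve R u) ^ 2 / (2 * R ^ 4) := by positivity
    have e3 := mul_le_mul_of_nonneg_left b3 hw
    have e4 : S.c * (S.theta u (S.curve R u) ^ 2 / (2 * R ^ 4)) ≤ w * o2 :=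
      mul_le_mul b5 b4 e2 hw
    have e5 := mul_le_mul_of_nonneg_right b5 e1
    linarith
  have e6 : 1 / S.ρ ^ 4 = 2 * (1 / (2 * S.ρ ^ 4)) := by field_simp
  rw [e6] at c2 ⊢
  linarith

end

end Exterior

namespace Exterior

variable {v₀ ω : ℝ} (S : Exterior v₀ ω)

theorem mass_mono_v (u : ℝ) : MonotoneOn (fun v => S.mass u v) (Ici v₀) := by
  intro v hv w _ hvw
  refine le_of_hasDerivAt_nonneg (f := fun v => S.mass u v) hvw
    (S.mass_cont.slice_right u).continuousOn
    (fun x hx => S.mass_v u x (lt_of_le_of_lt hv hx.1)) (fun x _ => ?_)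
  have := S.kappa_pos u x
  positivity

theorem mass_anti_u (v : ℝ) : AntitoneOn (fun u => S.mass u v) (Ici 1) := by
  intro u hu w _ huw
  refine le_of_hasDerivAt_nonpos (f := fun u => S.mass u v) huw
    (S.mass_cont.slice_left v).continuousOn
    (fun x hx => S.mass_u x (lt_of_le_of_lt hu hx.1) v) (fun x _ => ?_)
  have h1 := S.kappa_pos x v
  have h2 := S.lam_pos x v
  exact div_nonpos_of_nonneg_of_nonpos (by positivity)
    (mul_nonpos_of_nonneg_of_nonpos (by positivity) (S.nu_neg x v).le)

section

variable {R L : ℝ} (hR : S.R₁ < R)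
include hR

theorem mass_sub_nonneg (hRL : R ≤ L) {U₁ u : ℝ} (hu : 1 ≤ u) (huU : u ≤ U₁) :
    0 ≤ S.mass u (S.curve L u) - S.mass U₁ (S.curve R u) := by
  have h1 := S.mass_mono_v u (S.lt_curve hR u).le (S.lt_curve (hR.trans_le hRL) u).le
    (S.curve_le_curve hR hRL u)
  have h2 := S.mass_anti_u (S.curve R u) hu (hu.trans huU) huU
  simp only at h1 h2
  linarith

theorem curve_sub_le (hRL : R ≤ L) (u : ℝ) : S.curve L u - S.curve R u ≤ L / S.c := by
  have h1 := S.r_ge_linear hR (S.curve_le_curve hR hRL u)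
  rw [S.r_curve (hR.trans_le hRL)] at h1
  rw [le_div_iff₀ S.c_pos]
  linarith [S.R₁_pos.trans hR]

/-- ∂_vϖ = θ²/(2κ) is integrated with θ = ∂_vψ − λφ. The unweighted (∂_vψ)² is recovered through 1 ≤
L r^{σ−1} for r ≤ L, and the φ² part over a segment of length at most L/c: both lose a factor L. -/
theorem mass_sub_le_outer {σ : ℝ} (hσ : 0 ≤ σ) (hR1 : 1 ≤ R) (hRL : R ≤ L) (u : ℝ) :
    S.mass u (S.curve L u) - S.mass u (S.curve R u) ≤
      1 / S.c * (L * S.outer (σ - 1) R L u + (2 * S.phi u (S.curve R u) ^ 2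
        + 2 / S.c * S.outer (σ - 1) R L u) * (L / S.c)) := by
  have hL : S.R₁ < L := hR.trans_le hRL
  have hc := S.c_pos
  have hcc := S.curve_le_curve hR hRL u
  set B := 2 * S.phi u (S.curve R u) ^ 2 + 2 / S.c * S.outer (σ - 1) R L u with hB
  have hB0 : 0 ≤ B := by
    have := S.outer_nonneg hR (σ - 1) hRL u
    positivity
  have hw : Continuous fun x => S.r u x ^ (σ - 1) * S.psiV u x ^ 2 :=
    ((S.rpow_cont (σ - 1)).mul (S.psiV_cont.pow 2)).slice_right u
      (f := fun u y => S.r u y ^ (σ - 1) * S.psiV u y ^ 2)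
  have hW : Continuous fun y => ∫ x in S.curve R u..y, S.r u x ^ (σ - 1) * S.psiV u x ^ 2 :=
    intervalIntegral.continuous_primitive (fun _ _ => hw.intervalIntegrable _ _) _
  have h := sub_le_sub_of_hasDerivAt_le (f := fun y => S.mass u y)
    (g := fun y => 1 / S.c * (L * (∫ x in S.curve R u..y, S.r u x ^ (σ - 1) * S.psiV u x ^ 2) + B * y))
    (g' := fun y => 1 / S.c * (L * (S.r u y ^ (σ - 1) * S.psiV u y ^ 2) + B * 1))
    hcc (S.mass_cont.slice_right u).continuousOn
    ((continuous_const.mul ((continuous_const.mul hW).add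
      (continuous_const.mul continuous_id))).continuousOn)
    (fun x hx => S.mass_v u x ((S.lt_curve hR u).trans hx.1))
    (fun x _ => (((hw.integral_hasStrictDerivAt _ x).hasDerivAt.const_mul L).add
      ((hasDerivAt_id x).const_mul B)).const_mul _) ?_
  · have h2 : S.outer (σ - 1) R L u
        = ∫ x in S.curve R u..S.curve L u, S.r u x ^ (σ - 1) * S.psiV u x ^ 2 := rfl
    rw [intervalIntegral.integral_same, ← h2] at h
    have h3 := S.curve_sub_le hR hRL u
    have h4 := mul_le_mul_of_nonneg_left h3 (mul_nonneg (one_div_pos.2 hc).le hB0)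
    linarith
  · intro y hy
    have hy0 : v₀ ≤ y := (S.lt_curve hR u).le.trans hy.1.le
    have h1 := S.sq_phi_le hR hσ hR1 hRL hy.1.le hy.2.le
    have h2 : 1 ≤ S.r u y := hR1.trans ((S.curve_le_iff hR hy0).1 hy.1.le)
    have h3 : S.r u y ≤ L := by
      have := (S.lt_curve_iff hL hy0).1 hy.2
      exact this.le
    have h4 : 1 ≤ L * S.r u y ^ (σ - 1) := by
      have h5 : S.r u y ^ (-1 : ℝ) ≤ S.r u y ^ (σ - 1) :=
        Real.rpow_le_rpow_of_exponent_le h2 (by linarith)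
      rw [Real.rpow_neg_one] at h5
      have h6 : 1 ≤ L * (S.r u y)⁻¹ := by
        rw [← div_eq_mul_inv, one_le_div (S.r_pos u y)]
        exact h3
      exact h6.trans (mul_le_mul_of_nonneg_left h5 (by linarith))
    have h5 : S.theta u y ^ 2 ≤ 2 * S.psiV u y ^ 2 + 2 * S.phi u y ^ 2 := by
      unfold NullSystem.psiV
      have hl0 := S.lam_pos u y
      have hl1 := S.lam_le u y
      have : S.lam u y ^ 2 ≤ 1 := by nlinarith
      nlinarith [sq_nonneg (2 * S.lam u y * S.phi u y + S.theta u y),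
        mul_le_mul_of_nonneg_right this (sq_nonneg (S.phi u y))]
    have h6 : S.theta u y ^ 2 / (2 * S.kappa u y) ≤ S.theta u y ^ 2 / (2 * S.c) := by
      have := S.kappa_ge u y
      gcongr
    have h7 : S.psiV u y ^ 2 ≤ L * (S.r u y ^ (σ - 1) * S.psiV u y ^ 2) := by
      nlinarith [mul_le_mul_of_nonneg_right h4 (sq_nonneg (S.psiV u y))]
    refine h6.trans ?_
    rw [div_le_iff₀ (by positivity)]
    have e : 1 / S.c * (L * (S.r u y ^ (σ - 1) * S.psiV u y ^ 2) + B * 1) * (2 * S.c)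
        = 2 * (L * (S.r u y ^ (σ - 1) * S.psiV u y ^ 2) + B) := by
      field_simp
    rw [e]
    linarith

/-- −∂_uϖ is the (1 − μ)/2 part of `fluxIn` without the weight r⁻⁴, and r ≤ R on the segment. -/
theorem mass_sub_le_inner {U₁ u : ℝ} (hu : 1 ≤ u) (huU : u ≤ U₁) :
    S.mass u (S.curve R u) - S.mass U₁ (S.curve R u) ≤ R ^ 4 * S.inner R U₁ u := by
  have hf : Continuous fun x => S.fluxIn (S.d / 4) x (S.curve R u) :=
    (S.fluxIn_cont _).slice_left _
  have hF : Continuous fun y => ∫ x in u..y, S.fluxIn (S.d / 4) x (S.curve R u) :=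
    intervalIntegral.continuous_primitive (fun _ _ => hf.intervalIntegrable _ _) _
  have h := sub_le_sub_of_hasDerivAt_le (f := fun x => -S.mass x (S.curve R u))
    (g := fun y => R ^ 4 * ∫ x in u..y, S.fluxIn (S.d / 4) x (S.curve R u))
    (g' := fun y => R ^ 4 * S.fluxIn (S.d / 4) y (S.curve R u)) huU
    (S.mass_cont.slice_left _).neg.continuousOn (continuous_const.mul hF).continuousOn
    (fun x hx => (S.mass_u x (lt_of_le_of_lt hu hx.1) _).neg)
    (fun x _ => (hf.integral_hasStrictDerivAt _ x).hasDerivAt.const_mul _) ?_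
  · rw [intervalIntegral.integral_same] at h
    have h2 : S.inner R U₁ u = ∫ x in u..U₁, S.fluxIn (S.d / 4) x (S.curve R u) := rfl
    rw [h2]
    linarith
  · intro x hx
    have hr : S.r x (S.curve R u) ≤ R := by
      have := S.r_antitoneOn (S.curve R u) hu (hu.trans hx.1.le) hx.1.le
      simpa only [S.r_curve hR] using this
    have hr0 := S.r_pos x (S.curve R u)
    have hn := S.nu_pos x (S.curve R u)
    have hk := S.kappa_pos x (S.curve R u)
    have hD := S.aspect_nonneg x (S.curve R u)
    have hd := S.d_pos
    rw [S.lam_eq_aspect]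
    unfold NullSystem.fluxIn
    set v := S.curve R u
    have hnu := S.nu_ne x v
    have e1 : -(S.kappa x v * S.aspect x v * S.zeta x v ^ 2 / (2 * S.kappa x v * S.nu x v))
        = (S.aspect x v / 2) * 1 * (S.zeta x v ^ 2 / (-S.nu x v)) := by
      field_simp
    have e2 : R ^ 4 * ((S.aspect x v / 2 + S.d / 4) / S.r x v ^ 4 * S.zeta x v ^ 2 / (-S.nu x v))
        = (S.aspect x v / 2 + S.d / 4) * (R ^ 4 / S.r x v ^ 4) * (S.zeta x v ^ 2 / (-S.nu x v)) := by
      field_simp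
    rw [e1, e2]
    have h3 : 1 ≤ R ^ 4 / S.r x v ^ 4 := by
      rw [one_le_div (by positivity)]
      gcongr
    apply mul_le_mul_of_nonneg_right _ (by positivity)
    apply mul_le_mul _ h3 zero_le_one (by positivity)
    linarith

/-- ζ² ≤ Z²ν² makes the density a multiple of −∂_u r, so the integral is bounded by the drop of r
across the segment, uniformly in U₁. -/
theorem inner_le_crude {U₁ u : ℝ} (hu : 1 ≤ u) (huU : u ≤ U₁) :
    S.inner R U₁ u ≤ S.Z ^ 2 / S.ρ ^ 4 * R := by
  have hf : Continuous fun x => S.fluxIn (S.d / 4) x (S.curve R u) :=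
    (S.fluxIn_cont _).slice_left _
  have hF : Continuous fun y => ∫ x in u..y, S.fluxIn (S.d / 4) x (S.curve R u) :=
    intervalIntegral.continuous_primitive (fun _ _ => hf.intervalIntegrable _ _) _
  have hρ := S.ρ_pos
  have h := sub_le_sub_of_hasDerivAt_le
    (f := fun y => ∫ x in u..y, S.fluxIn (S.d / 4) x (S.curve R u))
    (f' := fun y => S.fluxIn (S.d / 4) y (S.curve R u))
    (g := fun x => -(S.Z ^ 2 / S.ρ ^ 4) * S.r x (S.curve R u))
    (g' := fun x => -(S.Z ^ 2 / S.ρ ^ 4) * S.nu x (S.curve R u)) huU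
    hF.continuousOn (continuous_const.mul (S.r_cont.slice_left _)).continuousOn
    (fun x _ => (hf.integral_hasStrictDerivAt _ x).hasDerivAt)
    (fun x hx => (S.r_u x (lt_of_le_of_lt hu hx.1) _).const_mul _) ?_
  · rw [intervalIntegral.integral_same, S.r_curve hR] at h
    have h2 : S.inner R U₁ u = ∫ x in u..U₁, S.fluxIn (S.d / 4) x (S.curve R u) := rfl
    rw [h2]
    have : 0 ≤ S.Z ^ 2 / S.ρ ^ 4 * S.r U₁ (S.curve R u) := by
      have := S.r_pos U₁ (S.curve R u)
      positivity
    linarith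
  · intro x hx
    set v := S.curve R u
    have hn := S.nu_pos x v
    have hz : S.zeta x v ^ 2 ≤ S.Z ^ 2 * (-S.nu x v) ^ 2 := by
      rw [← mul_pow]; exact sq_le_sq' (neg_le_of_abs_le (S.zeta_le x v)) ((le_abs_self _).trans (S.zeta_le x v))
    have hD := S.aspect_nonneg x v
    have hD1 := S.aspect_le_one x v
    have hd := S.d_le_one
    have hd0 := S.d_pos
    have hr := S.r_ge x v
    unfold NullSystem.fluxIn
    calc (S.aspect x v / 2 + S.d / 4) / S.r x v ^ 4 * S.zeta x v ^ 2 / (-S.nu x v)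
        ≤ 1 / S.ρ ^ 4 * (S.Z ^ 2 * (-S.nu x v) ^ 2) / (-S.nu x v) := by
          gcongr
          linarith
      _ = -(S.Z ^ 2 / S.ρ ^ 4) * S.nu x v := by
          have := S.nu_ne x v
          field_simp

theorem outer_le_mul (σ : ℝ) (hRL : R ≤ L) (u : ℝ) :
    S.outer σ R L u ≤ L * S.outer (σ - 1) R L u := by
  have hL : S.R₁ < L := hR.trans_le hRL
  unfold outer
  rw [← intervalIntegral.integral_const_mul]
  apply intervalIntegral.integral_mono_on (S.curve_le_curve hR hRL u)
    (S.weighted_intervalIntegrable _ _ _ _) ((S.weighted_intervalIntegrable _ _ _ _).const_mul _)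
  intro y hy
  have hr := S.r_pos u y
  have hy0 : v₀ ≤ y := (S.lt_curve hR u).le.trans hy.1
  have h3 : S.r u y ≤ L := by
    rw [← S.r_curve hL u]
    exact (S.r_strictMonoOn u).monotoneOn hy0 (S.lt_curve hL u).le hy.2
  have e : S.r u y ^ σ = S.r u y ^ (σ - 1) * S.r u y := by
    rw [rpow_eq_rpow_sub_mul_pow hr σ 1]; norm_num
  rw [e, mul_comm (S.r u y ^ (σ - 1)), mul_assoc]
  gcongr

/-- Any starting value polynomial in L and u will do, since the exponential damping beats every
power. -/
theorem outer_le_crude {σ : ℝ} (hω : 0 ≤ ω) (hσ : 0 ≤ σ) (hσ1 : σ ≤ 1) (hR1 : 1 ≤ R) (hRL : R ≤ L) {u : ℝ}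
    (hu : 1 ≤ u) : S.outer σ R L u ≤
      (S.A + S.M * (S.A + S.Z) / S.ρ ^ 2) ^ 2 / S.c * (L ^ 2 * u ^ 2) := by
  have hL : S.R₁ < L := hR.trans_le hRL
  have hL1 : 1 ≤ L := hR1.trans hRL
  have hc := S.c_pos
  set C := S.A + S.M * (S.A + S.Z) / S.ρ ^ 2 with hC
  have h : S.outer σ R L u ≤ ∫ y in S.curve R u..S.curve L u, L * (C * u) ^ 2 := by
    unfold outer
    apply intervalIntegral.integral_mono_on (S.curve_le_curve hR hRL u)
      (S.weighted_intervalIntegrable _ _ _ _) (by simp)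
    intro y hy
    have hr := S.r_pos u y
    have hy0 : v₀ ≤ y := (S.lt_curve hR u).le.trans hy.1
    have h3 : S.r u y ≤ L := by
      rw [← S.r_curve hL u]
      exact (S.r_strictMonoOn u).monotoneOn hy0 (S.lt_curve hL u).le hy.2
    have h1 : S.psiV u y ^ 2 ≤ (C * u) ^ 2 := by
      have := S.abs_psiV_le_crude hω hu hy0
      exact sq_le_sq' (neg_le_of_abs_le this) ((le_abs_self _).trans this)
    have h2 : S.r u y ^ σ ≤ L := by
      calc S.r u y ^ σ ≤ L ^ σ := by gcongr
        _ ≤ L ^ (1 : ℝ) := Real.rpow_le_rpow_of_exponent_le hL1 hσ1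
        _ = L := Real.rpow_one L
    exact mul_le_mul h2 h1 (sq_nonneg _) (by linarith)
  rw [intervalIntegral.integral_const, smul_eq_mul] at h
  have h4 := S.curve_sub_le hR hRL u
  have h5 : 0 ≤ L * (C * u) ^ 2 := by positivity
  calc S.outer σ R L u ≤ _ := h
    _ ≤ L / S.c * (L * (C * u) ^ 2) := mul_le_mul_of_nonneg_right h4 h5
    _ = _ := by field_simp

end

set_option maxHeartbeats 1000000 in
/-- The energy `E` between `r = L` and `u = U₁` is damped at rate `a / L`, and driven only by
`∂_v ψ` on `r = L`. -/
theorem exists_energy_decay (hω : 0 ≤ ω) {σ : ℝ} (hσ : 0 < σ) (hσ1 : σ ≤ 1) :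
    ∃ R a B L₁ : ℝ, S.R₁ < R ∧ 1 ≤ R ∧ 0 < a ∧ 0 < B ∧ R ≤ L₁ ∧
      ∀ L, L₁ ≤ L → ∀ U₁ u : ℝ, 1 < u → u ≤ U₁ →
        (∃ E' : ℝ, HasDerivAt (S.energy σ R L U₁) E' u ∧
          E' ≤ -(a / L) * S.energy σ R L U₁ u + B * (L ^ σ * S.psiV u (S.curve L u) ^ 2)) ∧
        S.phi u (S.curve L u) ^ 2 ≤ B / L * S.energy σ R L U₁ u ∧
        S.mass u (S.curve L u) - S.mass U₁ (S.curve R u) ≤ B * S.energy σ R L U₁ u ∧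
        S.energy σ R L U₁ u ≤ B * (L ^ 2 * u ^ 2) := by
  have hc := S.c_pos
  have hc1 := S.c_le_one
  have hM := S.M_pos
  have hρ := S.ρ_pos
  have hd := S.d_pos
  have hA := S.A_nonneg
  have hZ := S.Z_nonneg
  have hR₁ := S.R₁_pos
  -- As σ and c are at most 1, this meets both lower bounds on R in `outer_deriv_le`.
  set R := S.R₁ + 1 + 32 * S.M ^ 2 / (σ ^ 2 * S.c ^ 5) with hRdef
  have hx : 0 < 32 * S.M ^ 2 / (σ ^ 2 * S.c ^ 5) := by positivity
  have hR : S.R₁ < R := by linarith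
  have hR1 : 1 ≤ R := by linarith
  have hR0 : 0 < R := by linarith
  have hRx : 32 * S.M ^ 2 ≤ σ ^ 2 * S.c ^ 5 * R ^ 2 := by
    have h1 : 32 * S.M ^ 2 / (σ ^ 2 * S.c ^ 5) ≤ R := by linarith
    rw [div_le_iff₀ (by positivity)] at h1
    have h2 : R ≤ R ^ 2 := by nlinarith
    have h3 : R * (σ ^ 2 * S.c ^ 5) ≤ R ^ 2 * (σ ^ 2 * S.c ^ 5) := by gcongr
    linarith
  have hRa : 32 * S.M ^ 2 ≤ σ ^ 2 * S.c ^ 4 * R ^ 2 := by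
    refine hRx.trans ?_
    have : S.c ^ 5 ≤ S.c ^ 4 := pow_le_pow_of_le_one hc.le hc1 (by norm_num)
    gcongr
  have hRb : 32 * S.M ^ 2 ≤ σ * S.c ^ 5 * R ^ 2 := by
    refine hRx.trans ?_
    have : σ ^ 2 ≤ σ := by nlinarith
    gcongr
  set p := R ^ σ with hp
  have hp0 : 0 < p := Real.rpow_pos_of_pos hR0 _
  -- With this weight the θ² gained by the inner flux on r = R cancels exactly the term cR^σθ² of
  -- the outgoing energy.
  set K := 2 * p * R ^ 4 with hK
  have hK0 : 0 < K := by positivity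
  set C₀ := 1 / (2 * S.ρ ^ 4) with hC₀
  have hC₀0 : 0 < C₀ := by positivity
  -- Lower bounds on L: beyond them the error (4M/L)φ² on r = L costs at most half of the damping in
  -- φ² on r = R and in the outgoing energy of exponent σ − 1.
  set e₁ := 64 * S.M * K * C₀ / (S.c ^ 3 * p) with he₁
  set e₂ := 32 * S.M * K * C₀ / (σ * S.c ^ 2) with he₂
  have he₁0 : 0 < e₁ := by positivity
  have he₂0 : 0 < e₂ := by positivity
  -- The rates that remain for the outgoing energy of exponent σ − 1, for φ² on r = R and for the
  -- inner flux.
  set m := min (σ * S.c / 4) (min (S.c ^ 3 / 8 * p) (K * (S.c * (S.d ^ 2 * S.c / (8 * R))))) with hm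
  have hm0 : 0 < m := by positivity
  set C₂ := 1 + K * (2 * C₀ * (1 / S.c * (1 + 2 / S.c * (1 / S.c)) + R ^ 4) + C₀ * (2 / S.c) + 1) with hC₂
  have hC₂0 : 0 < C₂ := by positivity
  set D := S.A + S.M * (S.A + S.Z) / S.ρ ^ 2 with hD
  set B₁ := 1 / S.c + K * C₀ / S.c ^ 2 with hB₁
  set B₂ := 1 / (K * C₀) with hB₂
  set B₃ := D ^ 2 / S.c + K * (2 * C₀ * S.M + C₀ * (S.A + S.Z) ^ 2 + S.Z ^ 2 / S.ρ ^ 4 * R) with hB₃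
  have hB₁0 : 0 < B₁ := by positivity
  have hB₂0 : 0 < B₂ := by positivity
  have hB₃0 : 0 < B₃ := by positivity
  refine ⟨R, m / C₂, B₁ + B₂ + B₃, R + e₁ + e₂, hR, hR1, by positivity, by positivity, by linarith, ?_⟩
  intro L hL U₁ u hu huU
  have hRL : R ≤ L := by linarith
  have hL' : S.R₁ < L := hR.trans_le hRL
  have hL1 : 1 ≤ L := hR1.trans hRL
  have hL0 : 0 < L := by linarith
  obtain ⟨F', hF', hF'le⟩ := S.flux_hasDerivAt hR hRL hu huU
  have hG := S.outer_hasDerivAt hR σ hRL hu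
  have hGle := S.outer_deriv_le hR hσ hσ1 hRa hRb hRL u
  have hphi := S.sq_phi_le hR hσ.le hR1 hRL (S.curve_le_curve hR hRL u) le_rfl
  have hmo := S.mass_sub_le_outer hR hσ.le hR1 hRL u
  have hmi := S.mass_sub_le_inner hR hu.le huU
  have hi := S.inner_nonneg (R := R) huU
  have hh := S.outer_nonneg hR (σ - 1) hRL u
  have hG0 := S.outer_nonneg hR σ hRL u
  have hGL := S.outer_le_mul hR σ hRL u
  have hGc := S.outer_le_crude hR hω hσ.le hσ1 hR1 hRL hu.le
  have hic := S.inner_le_crude hR hu.le huU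
  have hms := S.mass_sub_nonneg hR hRL hu.le huU
  have hmM : S.mass u (S.curve L u) - S.mass U₁ (S.curve R u) ≤ S.M := by
    linarith [S.mass_le u (S.curve L u), S.mass_nonneg U₁ (S.curve R u)]
  have hpsi := S.abs_psi_le_crude hu.le (S.lt_curve hL' u).le
  have hEeq : S.energy σ R L U₁ u = S.outer σ R L u + K * (2 * C₀ *
      (S.mass u (S.curve L u) - S.mass U₁ (S.curve R u))
      + C₀ * L * S.phi u (S.curve L u) ^ 2 + S.inner R U₁ u) := by
    unfold energy flux
    rw [hK, hp, hC₀]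
    have : 1 / S.ρ ^ 4 = 2 * (1 / (2 * S.ρ ^ 4)) := by field_simp
    rw [this]
  have hE' : HasDerivAt (S.energy σ R L U₁) _ u := hG.add (hF'.const_mul K)
  unfold NullSystem.psi at hpsi
  rw [S.r_curve hL', abs_mul, abs_of_pos hL0] at hpsi
  set E := S.energy σ R L U₁ u with hE
  generalize S.outer σ R L u = G at *
  generalize S.outer (σ - 1) R L u = h at *
  generalize S.inner R U₁ u = P at *
  generalize S.mass u (S.curve L u) = m1 at *
  generalize S.mass u (S.curve R u) = m2 at *
  generalize S.mass U₁ (S.curve R u) = m3 at *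
  generalize S.phi u (S.curve L u) = f at *
  generalize S.phi u (S.curve R u) = g at *
  generalize S.theta u (S.curve R u) = t at *
  generalize hX : S.psiV u (S.curve L u) = X at *
  have hX2 : 0 ≤ L ^ σ * X ^ 2 := by positivity
  have hLσ : 1 ≤ L ^ σ := Real.one_le_rpow hL1 hσ.le
  have hfg : f ^ 2 ≤ 2 / S.c * (h + g ^ 2 + P) := by
    have h1 : 2 * g ^ 2 ≤ 2 / S.c * g ^ 2 := by
      apply mul_le_mul_of_nonneg_right _ (sq_nonneg g)
      rw [le_div_iff₀ hc]; linarith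
    have h2 : 0 ≤ 2 / S.c * P := by positivity
    linarith
  have hfg' : 2 * g ^ 2 + 2 / S.c * h ≤ 2 / S.c * (h + g ^ 2 + P) := by
    have h1 : 2 * g ^ 2 ≤ 2 / S.c * g ^ 2 := by
      apply mul_le_mul_of_nonneg_right _ (sq_nonneg g)
      rw [le_div_iff₀ hc]; linarith
    have h2 : 0 ≤ 2 / S.c * P := by positivity
    linarith
  have hm13 : m1 - m3 ≤ L * ((1 / S.c * (1 + 2 / S.c * (1 / S.c)) + R ^ 4) * (h + g ^ 2 + P)) := by
    set Y := h + g ^ 2 + P with hY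
    have hY0 : 0 ≤ Y := by positivity
    have h1 : 1 / S.c * (L * h + (2 * g ^ 2 + 2 / S.c * h) * (L / S.c)) ≤
        1 / S.c * (L * Y + (2 / S.c * Y) * (L / S.c)) := by
      have : h ≤ Y := by linarith only [hY, sq_nonneg g, hi]
      gcongr
    have h2 : R ^ 4 * P ≤ L * (R ^ 4 * Y) := by
      have h3 : P ≤ Y := by linarith only [hY, sq_nonneg g, hh]
      have h4 : R ^ 4 * P ≤ R ^ 4 * Y := by gcongr
      have h5 : 0 ≤ R ^ 4 * Y := by positivity
      exact h4.trans (le_mul_of_one_le_left h5 hL1)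
    have h6 : 1 / S.c * (L * Y + (2 / S.c * Y) * (L / S.c)) =
        L * (1 / S.c * (1 + 2 / S.c * (1 / S.c)) * Y) := by ring
    linarith
  -- The energy exceeds the damping terms by a factor of order L at most: this is where the rate a/L
  -- comes from.
  have hEup : E ≤ L * (C₂ * (h + g ^ 2 + P)) := by
    set Y := h + g ^ 2 + P with hY
    have hY0 : 0 ≤ Y := by positivity
    have h1 : G ≤ L * Y := hGL.trans (mul_le_mul_of_nonneg_left (by linarith only [hY, sq_nonneg g, hi]) hL0.le)
    have h2 : P ≤ L * Y := by
      have h3 : P ≤ Y := by linarith only [hY, sq_nonneg g, hh]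
      exact h3.trans (le_mul_of_one_le_left hY0 hL1)
    have h3 : C₀ * L * f ^ 2 ≤ C₀ * L * (2 / S.c * Y) := by gcongr
    have h4 := mul_le_mul_of_nonneg_left hm13 (by positivity : 0 ≤ 2 * C₀)
    have h5 := mul_le_mul_of_nonneg_left (add_le_add (add_le_add h4 h3) h2) hK0.le
    rw [hEeq]
    refine (add_le_add h1 h5).trans (le_of_eq ?_)
    rw [hC₂]
    ring
  have hE0 : 0 ≤ E := by rw [hEeq]; positivity
  refine ⟨⟨_, hE', ?_⟩, ?_, ?_, ?_⟩
  · have h1 : m / C₂ / L * E ≤ m * (h + g ^ 2 + P) := by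
      calc m / C₂ / L * E ≤ m / C₂ / L * (L * (C₂ * (h + g ^ 2 + P))) := by gcongr
        _ = _ := by field_simp
    have h2 : m * (h + g ^ 2 + P) ≤ σ * S.c / 4 * h + S.c ^ 3 / 8 * p * g ^ 2
        + K * (S.c * (S.d ^ 2 * S.c / (8 * R))) * P := by
      have a1 : m ≤ σ * S.c / 4 := min_le_left _ _
      have a2 : m ≤ S.c ^ 3 / 8 * p := (min_le_right _ _).trans (min_le_left _ _)
      have a3 : m ≤ K * (S.c * (S.d ^ 2 * S.c / (8 * R))) := (min_le_right _ _).trans (min_le_right _ _)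
      have b1 := mul_le_mul_of_nonneg_right a1 hh
      have b2 := mul_le_mul_of_nonneg_right a2 (sq_nonneg g)
      have b3 := mul_le_mul_of_nonneg_right a3 hi
      linarith
    have h3 : K * (C₀ * (4 * S.M / L * f ^ 2)) ≤ S.c ^ 3 / 8 * p * g ^ 2 + σ * S.c / 4 * h := by
      have a1 : 8 * S.M * K * C₀ / L ≤ S.c ^ 3 / 8 * p := by
        rw [div_le_iff₀ hL0]
        have : e₁ ≤ L := by linarith
        rw [he₁, div_le_iff₀ (by positivity)] at this
        linarith
      have a2 : 8 * S.M * K * C₀ / (S.c * L) ≤ σ * S.c / 4 := by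
        rw [div_le_iff₀ (by positivity)]
        have : e₂ ≤ L := by linarith
        rw [he₂, div_le_iff₀ (by positivity)] at this
        linarith
      have b1 := mul_le_mul_of_nonneg_right a1 (sq_nonneg g)
      have b2 := mul_le_mul_of_nonneg_right a2 hh
      have b3 : K * (C₀ * (4 * S.M / L * f ^ 2)) ≤
          K * (C₀ * (4 * S.M / L * (2 * g ^ 2 + 2 / S.c * h))) := by gcongr
      have e : K * (C₀ * (4 * S.M / L * (2 * g ^ 2 + 2 / S.c * h)))
          = 8 * S.M * K * C₀ / L * g ^ 2 + 8 * S.M * K * C₀ / (S.c * L) * h := by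
        field_simp
        ring
      linarith
    have h4 := mul_le_mul_of_nonneg_left hF'le hK0.le
    have h5 : K * (S.c * (t ^ 2 / (2 * R ^ 4))) = S.c * p * t ^ 2 := by
      rw [hK]; field_simp
    have h6 : K * (C₀ * (1 / S.c ^ 2 * X ^ 2)) ≤ K * C₀ / S.c ^ 2 * (L ^ σ * X ^ 2) := by
      have : X ^ 2 ≤ L ^ σ * X ^ 2 := le_mul_of_one_le_left (sq_nonneg X) hLσ
      calc K * (C₀ * (1 / S.c ^ 2 * X ^ 2)) = K * C₀ / S.c ^ 2 * X ^ 2 := by ring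
        _ ≤ _ := by gcongr
    have h7 : B₁ * (L ^ σ * X ^ 2) ≤ (B₁ + B₂ + B₃) * (L ^ σ * X ^ 2) := by
      apply mul_le_mul_of_nonneg_right _ hX2
      linarith
    have h8 : B₁ * (L ^ σ * X ^ 2) = 1 / S.c * L ^ σ * X ^ 2 + K * C₀ / S.c ^ 2 * (L ^ σ * X ^ 2) := by
      rw [hB₁]; ring
    linarith
  · have h1 : f ^ 2 ≤ B₂ / L * E := by
      have h2 : K * (C₀ * L * f ^ 2) ≤ E := by
        rw [hEeq]
        have : 0 ≤ K * (2 * C₀ * (m1 - m3)) := by positivity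
        have : 0 ≤ K * P := by positivity
        linarith
      calc f ^ 2 = B₂ / L * (K * (C₀ * L * f ^ 2)) := by rw [hB₂]; field_simp
        _ ≤ _ := by gcongr
    refine h1.trans ?_
    gcongr
    linarith
  · have h1 : m1 - m3 ≤ B₂ * E := by
      have h2 : K * (C₀ * (m1 - m3)) ≤ E := by
        rw [hEeq]
        have : 0 ≤ K * (C₀ * (m1 - m3)) := by positivity
        have : 0 ≤ K * (C₀ * L * f ^ 2) := by positivity
        have : 0 ≤ K * P := by positivity
        linarith
      calc m1 - m3 = B₂ * (K * (C₀ * (m1 - m3))) := by rw [hB₂]; field_simp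
        _ ≤ _ := by gcongr
    refine h1.trans ?_
    gcongr
    linarith
  · have hLu : 1 ≤ L ^ 2 * u ^ 2 := 
      one_le_mul_of_one_le_of_one_le (one_le_pow₀ hL1) (one_le_pow₀ hu.le)
    have h1 : L * f ^ 2 ≤ (S.A + S.Z) ^ 2 * (L ^ 2 * u ^ 2) := by
      have h2 : (L * |f|) ^ 2 ≤ ((S.A + S.Z) * u) ^ 2 := by gcongr
      rw [mul_pow, sq_abs, mul_pow] at h2
      have h3 : L * f ^ 2 ≤ L ^ 2 * f ^ 2 := by
        exact mul_le_mul_of_nonneg_right (le_self_pow₀ hL1 two_ne_zero) (sq_nonneg f)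
      have h4 : (S.A + S.Z) ^ 2 * u ^ 2 ≤ (S.A + S.Z) ^ 2 * (L ^ 2 * u ^ 2) := by
        apply mul_le_mul_of_nonneg_left _ (sq_nonneg _)
        exact le_mul_of_one_le_left (sq_nonneg u) (one_le_pow₀ hL1)
      linarith
    have h2 : E ≤ B₃ * (L ^ 2 * u ^ 2) := by
      rw [hEeq, hB₃]
      set Y := L ^ 2 * u ^ 2
      have a1 : 2 * C₀ * (m1 - m3) ≤ 2 * C₀ * S.M * Y := by
        have : m1 - m3 ≤ S.M * Y := hmM.trans (le_mul_of_one_le_right (by linarith only [S.one_le_M]) hLu)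
        calc 2 * C₀ * (m1 - m3) ≤ 2 * C₀ * (S.M * Y) := by gcongr
          _ = _ := by ring
      have a2 : C₀ * L * f ^ 2 ≤ C₀ * (S.A + S.Z) ^ 2 * Y := by
        have := mul_le_mul_of_nonneg_left h1 hC₀0.le
        linarith only [this]
      have a3 : P ≤ S.Z ^ 2 / S.ρ ^ 4 * R * Y := by
        have : 0 ≤ S.Z ^ 2 / S.ρ ^ 4 * R := by positivity
        exact hic.trans (le_mul_of_one_le_right this hLu)
      have a4 := mul_le_mul_of_nonneg_left (add_le_add (add_le_add a1 a2) a3) hK0.le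
      linarith
    refine h2.trans ?_
    gcongr
    linarith

end Exterior

/-! ### Bounds for ∂_vψ from the wave equation -/

namespace Exterior

variable {v₀ ω : ℝ} (S : Exterior v₀ ω)

/-- A constant with `v ≤ V (u + r)` away from the event horizon. -/
noncomputable def V : ℝ := S.curve (S.R₁ + 1) 1 + 1 / S.c

theorem lt_R₁_add_one : S.R₁ < S.R₁ + 1 := by linarith

theorem one_le_V : 1 ≤ S.V := by
  have h1 := S.lt_curve S.lt_R₁_add_one 1
  have h2 : 0 < 1 / S.c := one_div_pos.2 S.c_pos
  have := S.one_le_v₀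
  unfold V
  linarith

theorem v_le {L u v : ℝ} (hL : S.R₁ + 1 ≤ L) (hu : 1 ≤ u) (hv : S.curve L u ≤ v) :
    v ≤ S.V * (u + S.r u v) := by
  have h0 := S.lt_R₁_add_one
  have h1 := S.v_le_u_add_r h0 hu ((S.curve_le_curve h0 hL u).trans hv)
  have h2 := S.lt_curve h0 1
  have h3 : S.curve (S.R₁ + 1) 1 ≤ S.curve (S.R₁ + 1) 1 * (u + S.r u v) :=
    le_mul_of_one_le_right (by linarith [S.one_le_v₀]) (by linarith [S.r_pos u v])
  unfold V
  linarith

theorem curve_le_of_le {L u u' v : ℝ} (hL : S.R₁ < L) (hu' : 1 ≤ u') (huu : u' ≤ u) (hv : S.curve L u ≤ v) :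
    S.curve L u' ≤ v := (S.curve_mono hL hu' huu).trans hv

/-- Up to time u/2 the radius exceeds its value at u by at least cu/2, so it is comparable to v even
if r(u, v) is not. The factor r⁻² of the wave equation then acts as v⁻². -/
theorem mul_v_le_r {L u u' v : ℝ} (hL : S.R₁ + 1 ≤ L) (hu' : 1 ≤ u') (huu : u' ≤ u / 2)
    (hv : S.curve L u ≤ v) : S.c / (2 * S.V) * v ≤ S.r u' v := by
  have hL' : S.R₁ < L := by linarith
  have hV := S.one_le_V
  have hc := S.c_pos
  have hc1 := S.c_le_one
  have h1 := S.v_le hL (u := u) (by linarith) hv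
  have h2 := S.r_ge_backwards hL' (u := u) (u' := u') hu' (by linarith) hv
  have hr := S.r_pos u v
  calc S.c / (2 * S.V) * v ≤ S.c / (2 * S.V) * (S.V * (u + S.r u v)) := by gcongr
    _ = S.c / 2 * (u + S.r u v) := by field_simp
    _ ≤ S.r u' v := by nlinarith

theorem abs_phi_le_crude {u v : ℝ} (hu : 1 ≤ u) (hv : v₀ ≤ v) :
    |S.phi u v| ≤ (S.A + S.Z) * u / S.r u v := by
  have h := S.abs_psi_le_crude hu hv
  unfold NullSystem.psi at h
  rw [abs_mul, abs_of_pos (S.r_pos u v)] at h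
  rwa [le_div_iff₀ (S.r_pos u v), mul_comm]

/-- Early contribution to `∂_v ψ`. -/
theorem abs_psiV_sub_early {L u u₁ v : ℝ} (hL : S.R₁ + 1 ≤ L) (hu₁ : 1 ≤ u₁) (huu : 2 * u₁ ≤ u)
    (hv : S.curve L u ≤ v) :
    |S.psiV u₁ v - S.psiV 1 v| ≤
      2 * S.M * (S.A + S.Z) * (2 * S.V / S.c) ^ 3 * u₁ ^ 2 / v ^ 3 := by
  have hL' : S.R₁ < L := by linarith
  have hV := S.one_le_V
  have hc := S.c_pos
  have hM := S.M_pos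
  have hA := S.A_nonneg
  have hZ := S.Z_nonneg
  have hv0 : v₀ ≤ v := (S.lt_curve hL' u).le.trans hv
  have hvp : 0 < v := by linarith [S.one_le_v₀]
  -- Three powers of 1/v come from r⁻² and φ = ψ/r; the crude growth of ψ and the length of the
  -- range each give a factor u₁.
  set K := 2 * S.M * ((S.A + S.Z) * u₁) * ((2 * S.V / S.c) ^ 3 / v ^ 3) with hK
  have h := abs_sub_le_sub_of_hasDerivAt (f := fun x => S.psiV x v) (g := fun x => K * x)
    (g' := fun _ => K) hu₁ (S.psiV_cont.slice_left v).continuousOn (by fun_prop)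
    (fun x hx => S.psiV_u hx.1 v) (fun x _ => by simpa using (hasDerivAt_id x).const_mul K) ?_
  · refine h.trans ?_
    have hK0 : 0 ≤ K := by positivity
    have : K * u₁ = 2 * S.M * (S.A + S.Z) * (2 * S.V / S.c) ^ 3 * u₁ ^ 2 / v ^ 3 := by
      rw [hK]; ring
    linarith
  · intro x hx
    refine (S.abs_psiUV_le x v).trans ?_
    have h1 := S.abs_phi_le_crude (u := x) hx.1.le hv0
    have h2 := S.mul_v_le_r hL (u := u) (u' := x) hx.1.le (by linarith [hx.2]) hv
    have hn := S.nu_ge x v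
    have hn0 := S.nu_pos x v
    have hr := S.r_pos x v
    have h3 : 1 / S.r x v ≤ 2 * S.V / S.c / v := by
      rw [div_le_iff₀ hr]
      calc 1 = 2 * S.V / S.c / v * (S.c / (2 * S.V) * v) := by field_simp
        _ ≤ _ := by gcongr
    calc 2 * S.M * -S.nu x v / S.r x v ^ 2 * |S.phi x v|
        ≤ 2 * S.M * 1 / S.r x v ^ 2 * ((S.A + S.Z) * u₁ / S.r x v) := by
          gcongr
          · linarith
          · exact h1.trans (by gcongr; exact hx.2.le)
      _ = 2 * S.M * ((S.A + S.Z) * u₁) * (1 / S.r x v) ^ 3 := by field_simp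
      _ ≤ 2 * S.M * ((S.A + S.Z) * u₁) * (2 * S.V / S.c / v) ^ 3 := by gcongr
      _ = K := by rw [hK, div_pow (2 * S.V / S.c)]

/-- Decay of `φ` of strength `N` for `r ≥ L` on the range `[u₁, U]`. -/
def PhiDecay (s L u₁ U N : ℝ) : Prop :=
  ∀ u, u₁ ≤ u → u ≤ U → ∀ v, S.curve L u ≤ v → |S.phi u v| ≤ N * u ^ (1 - ω + s) / v

/-- Intermediate contribution to `∂_v ψ`. -/
theorem abs_psiV_sub_middle (hω : 1 < ω) (hω3 : ω ≤ 3) {s L u u₁ U v N : ℝ} (hs : 0 < s)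
    (hs2 : s ≤ 1 / 2) (hL : S.R₁ + 1 ≤ L) (hu₁ : 1 ≤ u₁) (huu : 2 * u₁ ≤ u) (huU : u ≤ U)
    (hN : 0 ≤ N) (hD : S.PhiDecay s L u₁ U N) (hv : S.curve L u ≤ v) :
    |S.psiV (u / 2) v - S.psiV u₁ v| ≤
      4 * S.M * (2 * S.V / S.c) ^ 2 / S.c ^ 2 * N * u₁ ^ (-1 + s) * v ^ (-ω) := by
  have hL' : S.R₁ < L := by linarith
  have hV := S.one_le_V
  have hc := S.c_pos
  have hc1 := S.c_le_one
  have hM := S.M_pos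
  have hv0 : v₀ ≤ v := (S.lt_curve hL' u).le.trans hv
  have hvp : 0 < v := by linarith [S.one_le_v₀]
  have hu0 : 0 < u := by linarith
  have huv := S.u_le_v hL' (u := u) (by linarith) hv
  -- x^{1−ω+s} is bounded by u^{3−ω}x^{−2+s}: the second factor integrates to the small u₁^{−1+s},
  -- while the first is absorbed by v^{3−ω} and turns v⁻³ into v^{−ω}. Both steps need ω ≤ 3.
  set K := 2 * S.M * (2 * S.V / S.c) ^ 2 / v ^ 2 * (N * u ^ (3 - ω) / v) with hK
  have hK0 : 0 ≤ K := by positivity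
  have h := abs_sub_le_sub_of_hasDerivAt (f := fun x => S.psiV x v)
    (g := fun x => (-K / (1 - s)) * x ^ (-1 + s))
    (g' := fun x => K * x ^ (-2 + s)) (a := u₁) (b := u / 2) (by linarith)
    (S.psiV_cont.slice_left v).continuousOn ?_
    (fun x hx => S.psiV_u (hu₁.trans_lt hx.1) v) ?_ ?_
  · refine h.trans ?_
    have h1 : 0 ≤ K / (1 - s) * (u / 2) ^ (-1 + s) := by
      have : 0 < 1 - s := by linarith
      positivity
    have h2 : K / (1 - s) * u₁ ^ (-1 + s) ≤ K * 2 * u₁ ^ (-1 + s) := by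
      apply mul_le_mul_of_nonneg_right _ (by positivity)
      rw [div_le_iff₀ (by linarith)]
      nlinarith
    have h3 : u ^ (3 - ω) ≤ v ^ (3 - ω) / S.c ^ 2 := by
      have h4 : u ≤ v / S.c := by rw [le_div_iff₀ hc]; linarith
      calc u ^ (3 - ω) ≤ (v / S.c) ^ (3 - ω) := Real.rpow_le_rpow hu0.le h4 (by linarith)
        _ = v ^ (3 - ω) / S.c ^ (3 - ω) := Real.div_rpow hvp.le hc.le _
        _ ≤ v ^ (3 - ω) / S.c ^ (2 : ℝ) := by
          apply div_le_div_of_nonneg_left (by positivity) (by positivity)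
          exact Real.rpow_le_rpow_of_exponent_ge hc hc1 (by linarith)
        _ = _ := by norm_num
    have h5 : v ^ (3 - ω) = v ^ (-ω) * v ^ 3 := by
      rw [rpow_eq_rpow_sub_mul_pow hvp (3 - ω) 3]
      congr 2
      push_cast
      ring
    have h6 : K ≤ 2 * S.M * (2 * S.V / S.c) ^ 2 / S.c ^ 2 * N * v ^ (-ω) := by
      calc K ≤ 2 * S.M * (2 * S.V / S.c) ^ 2 / v ^ 2 * (N * (v ^ (3 - ω) / S.c ^ 2) / v) := by
            rw [hK]; gcongr
        _ = _ := by rw [h5]; field_simp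
    have h7 : K * 2 * u₁ ^ (-1 + s) ≤
        2 * S.M * (2 * S.V / S.c) ^ 2 / S.c ^ 2 * N * v ^ (-ω) * 2 * u₁ ^ (-1 + s) := by gcongr
    have h8 : -K / (1 - s) * (u / 2) ^ (-1 + s) - -K / (1 - s) * u₁ ^ (-1 + s) =
      K / (1 - s) * u₁ ^ (-1 + s) - K / (1 - s) * (u / 2) ^ (-1 + s) := by ring
    rw [h8]
    refine ((sub_le_self _ h1).trans (h2.trans h7)).trans (le_of_eq ?_)
    ring
  · refine ContinuousOn.mul continuousOn_const (ContinuousOn.rpow_const continuousOn_id ?_)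
    intro x hx
    exact Or.inl (by linarith [hx.1])
  · intro x hx
    have hx0 : x ≠ 0 := by linarith [hx.1]
    refine ((Real.hasDerivAt_rpow_const (p := -1 + s) (Or.inl hx0)).const_mul _).congr_deriv ?_
    have : (1 - s) ≠ 0 := by linarith
    have e : -1 + s - 1 = -2 + s := by ring
    rw [e]
    field_simp
    ring
  · intro x hx
    have hx1 : 1 ≤ x := hu₁.trans hx.1.le
    have hx0 : 0 < x := by linarith
    have hxu : x ≤ u := by linarith [hx.2]
    refine (S.abs_psiUV_le x v).trans ?_
    have h1 := hD x hx.1.le (hxu.trans huU) v (S.curve_le_of_le hL' hx1 hxu hv)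
    have h2 := S.mul_v_le_r hL (u := u) (u' := x) hx1 hx.2.le hv
    have hn := S.nu_ge x v
    have hn0 := S.nu_pos x v
    have hr := S.r_pos x v
    have h3 : 1 / S.r x v ≤ 2 * S.V / S.c / v := by
      rw [div_le_iff₀ hr]
      calc 1 = 2 * S.V / S.c / v * (S.c / (2 * S.V) * v) := by field_simp
        _ ≤ _ := by gcongr
    have h4 : x ^ (1 - ω + s) ≤ u ^ (3 - ω) * x ^ (-2 + s) := by
      have e : 1 - ω + s = (3 - ω) + (-2 + s) := by ring
      rw [e, Real.rpow_add hx0]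
      gcongr
    calc 2 * S.M * -S.nu x v / S.r x v ^ 2 * |S.phi x v|
        ≤ 2 * S.M * 1 / S.r x v ^ 2 * (N * (u ^ (3 - ω) * x ^ (-2 + s)) / v) := by
          gcongr
          · linarith
          · exact h1.trans (by gcongr)
      _ = 2 * S.M * (1 / S.r x v) ^ 2 * (N * (u ^ (3 - ω) * x ^ (-2 + s)) / v) := by
          field_simp
      _ ≤ 2 * S.M * (2 * S.V / S.c / v) ^ 2 * (N * (u ^ (3 - ω) * x ^ (-2 + s)) / v) := by gcongr
      _ = K * x ^ (-2 + s) := by rw [hK, div_pow (2 * S.V / S.c)]; ring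

/-- Late contribution to `∂_v ψ`. -/
theorem abs_psiV_sub_late (hω3 : ω ≤ 3) {s L u u₁ U v N : ℝ} (hs : 0 < s)
    (hsω : s ≤ ω - 1) (hL : S.R₁ + 1 ≤ L) (hu₁ : 1 ≤ u₁) (huu : 2 * u₁ ≤ u) (huU : u ≤ U)
    (hN : 0 ≤ N) (hD : S.PhiDecay s L u₁ U N) (hv : S.curve L u ≤ v) :
    |S.psiV u v - S.psiV (u / 2) v| ≤ 8 * S.M * N * u ^ (1 - ω + s) / (v * S.r u v) := by
  have hL' : S.R₁ < L := by linarith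
  have hM := S.M_pos
  have hv0 : v₀ ≤ v := (S.lt_curve hL' u).le.trans hv
  have hvp : 0 < v := by linarith [S.one_le_v₀]
  have hu0 : 0 < u := by linarith
  -- Here r need not be comparable to v, so −ν/r² is kept and integrated exactly to 1/r; the decay
  -- of φ is uniform on [u/2, u] up to a constant.
  set K := 8 * S.M * N * u ^ (1 - ω + s) / v with hK
  have hK0 : 0 ≤ K := by positivity
  have h := abs_sub_le_sub_of_hasDerivAt (f := fun x => S.psiV x v)
    (g := fun x => K * (S.r x v)⁻¹)
    (g' := fun x => K * (-S.nu x v / S.r x v ^ 2)) (a := u / 2) (b := u) (by linarith)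
    (S.psiV_cont.slice_left v).continuousOn
    ((continuous_const.mul ((S.r_cont.slice_left v).inv₀ fun x => S.r_ne _ _)).continuousOn)
    (fun x hx => S.psiV_u (lt_of_le_of_lt (by linarith) hx.1) v)
    (fun x hx => (S.inv_r_u (lt_of_le_of_lt (by linarith) hx.1) v).const_mul K) ?_
  · refine h.trans ?_
    have h1 : 0 ≤ K * (S.r (u / 2) v)⁻¹ := by have := S.r_pos (u / 2) v; positivity
    have h2 : K * (S.r u v)⁻¹ = 8 * S.M * N * u ^ (1 - ω + s) / (v * S.r u v) := by
      have := S.r_ne u v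
      rw [hK]; field_simp
    linarith
  · intro x hx
    have hxu₁ : u₁ ≤ x := by linarith [hx.1]
    have hx0 : 0 < x := by linarith
    refine (S.abs_psiUV_le x v).trans ?_
    have h1 := hD x hxu₁ (hx.2.le.trans huU) v (S.curve_le_of_le hL' (hu₁.trans hxu₁) hx.2.le hv)
    have hn0 := S.nu_pos x v
    have hr := S.r_pos x v
    have h4 : x ^ (1 - ω + s) ≤ 4 * u ^ (1 - ω + s) := by
      calc x ^ (1 - ω + s) ≤ (u / 2) ^ (1 - ω + s) :=
            Real.rpow_le_rpow_of_nonpos (by linarith) hx.1.le (by linarith)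
        _ = u ^ (1 - ω + s) * 2 ^ (-(1 - ω + s)) := by
            rw [Real.div_rpow hu0.le (by norm_num), Real.rpow_neg (by norm_num)]; ring
        _ ≤ u ^ (1 - ω + s) * 2 ^ (2 : ℝ) := by
            gcongr
            · norm_num
            · linarith
        _ = _ := by norm_num; ring
    calc 2 * S.M * -S.nu x v / S.r x v ^ 2 * |S.phi x v|
        ≤ 2 * S.M * -S.nu x v / S.r x v ^ 2 * (N * (4 * u ^ (1 - ω + s)) / v) := by
          gcongr
          exact h1.trans (by gcongr)
      _ = K * (-S.nu x v / S.r x v ^ 2) := by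
          rw [hK]; field_simp; ring

/-- The estimate of `∂_v ψ` under a decay assumption on `φ`. -/
theorem exists_abs_psiV_le (hω : 1 < ω) (hω3 : ω ≤ 3) :
    ∃ C : ℝ, 1 ≤ C ∧ ∀ s : ℝ, 0 < s → s ≤ 1 / 2 → s ≤ ω - 1 → ∀ L u₁ U N : ℝ, S.R₁ + 1 ≤ L →
      1 ≤ u₁ → 0 ≤ N → S.PhiDecay s L u₁ U N → ∀ u v, 2 * u₁ ≤ u → u ≤ U → S.curve L u ≤ v →
        |S.psiV u v| ≤ C * (u₁ ^ 2 + N * u₁ ^ (-1 + s)) * v ^ (-ω)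
          + C * N * u ^ (1 - ω + s) / (v * S.r u v) := by
  have hV := S.one_le_V
  have hc := S.c_pos
  have hM := S.M_pos
  have hA := S.A_nonneg
  have hZ := S.Z_nonneg
  set C₁ := 2 * S.M * (S.A + S.Z) * (2 * S.V / S.c) ^ 3 with hC₁
  set C₂ := 4 * S.M * (2 * S.V / S.c) ^ 2 / S.c ^ 2 with hC₂
  have hC₁0 : 0 ≤ C₁ := by positivity
  have hC₂0 : 0 ≤ C₂ := by positivity
  refine ⟨1 + S.A + C₁ + C₂ + 8 * S.M, by linarith, ?_⟩
  intro s hs hs2 hsω L u₁ U N hL hu₁ hN hD u v huu huU hv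
  have hL' : S.R₁ < L := by linarith
  have hv0 : v₀ ≤ v := (S.lt_curve hL' u).le.trans hv
  have hv1 : 1 ≤ v := S.one_le_v₀.trans hv0
  have hvp : 0 < v := by linarith
  have hu0 : 0 < u := by linarith
  have hr := S.r_pos u v
  have h0 := S.abs_psiV_data hv0
  have h1 := S.abs_psiV_sub_early hL hu₁ huu hv
  have h2 := S.abs_psiV_sub_middle hω hω3 hs hs2 hL hu₁ huu huU hN hD hv
  have h3 := S.abs_psiV_sub_late hω3 hs hsω hL hu₁ huu huU hN hD hv
  have h4 : |S.psiV u v| ≤ |S.psiV 1 v| + |S.psiV u₁ v - S.psiV 1 v|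
      + |S.psiV (u / 2) v - S.psiV u₁ v| + |S.psiV u v - S.psiV (u / 2) v| := by
    have a1 := abs_sub_abs_le_abs_sub (S.psiV u v) (S.psiV (u / 2) v)
    have a2 := abs_sub_abs_le_abs_sub (S.psiV (u / 2) v) (S.psiV u₁ v)
    have a3 := abs_sub_abs_le_abs_sub (S.psiV u₁ v) (S.psiV 1 v)
    linarith
  -- The early part contributes v⁻³ whatever the data, which is admissible because ω ≤ 3.
  have h5 : C₁ * u₁ ^ 2 / v ^ 3 ≤ C₁ * u₁ ^ 2 * v ^ (-ω) := by
    have : (v ^ 3)⁻¹ ≤ v ^ (-ω) := by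
      rw [Real.rpow_neg hvp.le, ← Real.rpow_natCast]
      gcongr
      push_cast; linarith
    rw [div_eq_mul_inv]
    gcongr
  have hvω : 0 ≤ v ^ (-ω) := by positivity
  have hu₁2 : 1 ≤ u₁ ^ 2 := one_le_pow₀ hu₁
  have h6 : 0 ≤ N * u₁ ^ (-1 + s) * v ^ (-ω) := by positivity
  have h7 : 0 ≤ N * u ^ (1 - ω + s) / (v * S.r u v) := by positivity
  have h8 : v ^ (-ω) ≤ u₁ ^ 2 * v ^ (-ω) := le_mul_of_one_le_left hvω hu₁2
  have h9 : 0 ≤ u₁ ^ 2 * v ^ (-ω) := by positivity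
  have e : (1 + S.A + C₁ + C₂ + 8 * S.M) * (u₁ ^ 2 + N * u₁ ^ (-1 + s)) * v ^ (-ω)
      + (1 + S.A + C₁ + C₂ + 8 * S.M) * N * u ^ (1 - ω + s) / (v * S.r u v)
      = (1 + S.A + C₁ + C₂ + 8 * S.M) * (u₁ ^ 2 * v ^ (-ω))
      + (1 + S.A + C₁ + C₂ + 8 * S.M) * (N * u₁ ^ (-1 + s) * v ^ (-ω))
      + (1 + S.A + C₁ + C₂ + 8 * S.M) * (N * u ^ (1 - ω + s) / (v * S.r u v)) := by ring
  rw [e]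
  have g1 := mul_le_mul_of_nonneg_left h8 hA
  have g2 : (S.A + C₁) * (u₁ ^ 2 * v ^ (-ω)) ≤
    (1 + S.A + C₁ + C₂ + 8 * S.M) * (u₁ ^ 2 * v ^ (-ω)) :=
    mul_le_mul_of_nonneg_right (by linarith) h9
  have g3 : C₂ * (N * u₁ ^ (-1 + s) * v ^ (-ω)) ≤
    (1 + S.A + C₁ + C₂ + 8 * S.M) * (N * u₁ ^ (-1 + s) * v ^ (-ω)) :=
    mul_le_mul_of_nonneg_right (by linarith) h6
  have g4 : 8 * S.M * (N * u ^ (1 - ω + s) / (v * S.r u v)) ≤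
    (1 + S.A + C₁ + C₂ + 8 * S.M) * (N * u ^ (1 - ω + s) / (v * S.r u v)) :=
    mul_le_mul_of_nonneg_right (by linarith) h7
  have g5 : 8 * S.M * N * u ^ (1 - ω + s) / (v * S.r u v) =
    8 * S.M * (N * u ^ (1 - ω + s) / (v * S.r u v)) := by ring
  have g6 : C₂ * N * u₁ ^ (-1 + s) * v ^ (-ω) = C₂ * (N * u₁ ^ (-1 + s) * v ^ (-ω)) := by ring
  have g7 : C₁ * u₁ ^ 2 * v ^ (-ω) = C₁ * (u₁ ^ 2 * v ^ (-ω)) := by ring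
  linarith

end Exterior

/-! ### Decay of the energy, and of φ on curves of constant radius -/

/-- Grönwall's inequality with damping. -/
theorem le_exp_mul_add_of_hasDerivAt_le {f f' : ℝ → ℝ} {a b k F : ℝ} (hab : a ≤ b) (hk : 0 < k)
    (hf : ∀ x ∈ Icc a b, HasDerivAt f (f' x) x) (hle : ∀ x ∈ Icc a b, f' x ≤ -k * f x + F) :
    f b ≤ Real.exp (-(k * (b - a))) * (f a - F / k) + F / k := by
  have hd : ∀ x ∈ Icc a b, HasDerivAt (fun x => Real.exp (k * x) * (f x - F / k))
      (Real.exp (k * x) * k * (f x - F / k) + Real.exp (k * x) * f' x) x := by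
    intro x hx
    have h1 : HasDerivAt (fun x => Real.exp (k * x)) (Real.exp (k * x) * k) x := by
      have := ((hasDerivAt_id x).const_mul k).exp
      simpa using this
    exact h1.mul ((hf x hx).sub_const _)
  have h := le_of_hasDerivAt_nonpos hab (fun x hx => (hd x hx).continuousAt.continuousWithinAt)
    (fun x hx => hd x (Ioo_subset_Icc_self hx)) (fun x hx => ?_)
  · have e : Real.exp (-(k * (b - a))) = Real.exp (k * a) / Real.exp (k * b) := by
      rw [← Real.exp_sub]; congr 1; ring
    have hp := Real.exp_pos (k * b)
    rw [e]
    have : f b - F / k ≤ Real.exp (k * a) / Real.exp (k * b) * (f a - F / k) := by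
      rw [div_mul_eq_mul_div, le_div_iff₀ hp]
      linarith
    linarith
  · have h1 := hle x (Ioo_subset_Icc_self hx)
    have hp := Real.exp_pos (k * x)
    have e : Real.exp (k * x) * k * (f x - F / k) + Real.exp (k * x) * f' x =
      Real.exp (k * x) * (k * f x - F + f' x) := by field_simp
    rw [e]
    exact mul_nonpos_of_nonneg_of_nonpos hp.le (by linarith)

theorem rpow_neg_le_of_half_le {x u p : ℝ} (hu : 0 < u) (hx : u / 2 ≤ x) (hp : 0 ≤ p) (hp3 : p ≤ 3) :
    x ^ (-p) ≤ 8 * u ^ (-p) := by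
  calc x ^ (-p) ≤ (u / 2) ^ (-p) :=
        Real.rpow_le_rpow_of_nonpos (by linarith) hx (by linarith)
    _ = u ^ (-p) * 2 ^ p := by
        rw [Real.div_rpow hu.le (by norm_num), Real.rpow_neg (by norm_num : (0:ℝ) ≤ 2)]
        field_simp
    _ ≤ u ^ (-p) * 2 ^ (3 : ℝ) := by
        gcongr
        norm_num
    _ = _ := by norm_num; ring

theorem mul_rpow_neg_le {c u y p : ℝ} (hc : 0 < c) (hc1 : c ≤ 1) (hu : 0 < u) (hy : c * u ≤ y)
    (hp : 0 ≤ p) (hp3 : p ≤ 3) : y ^ (-p) ≤ u ^ (-p) / c ^ 3 := by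
  calc y ^ (-p) ≤ (c * u) ^ (-p) := Real.rpow_le_rpow_of_nonpos (by positivity) hy (by linarith)
    _ = u ^ (-p) * (c ^ p)⁻¹ := by
        rw [Real.mul_rpow hc.le hu.le, Real.rpow_neg hc.le]; ring
    _ ≤ u ^ (-p) * (c ^ (3 : ℝ))⁻¹ := by
        have : c ^ (3:ℝ) ≤ c ^ p := Real.rpow_le_rpow_of_exponent_ge hc hc1 hp3
        gcongr
    _ = _ := by norm_num; rfl

namespace Exterior

variable {v₀ ω : ℝ} (S : Exterior v₀ ω)

/-- `∂_v ψ` on `r = L` at dyadic times. -/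
theorem abs_psiV_curve_le (hω : 1 < ω) (hω3 : ω ≤ 3) {C s L₀ L u₁ U N u x : ℝ} (hC : 1 ≤ C)
    (hs : 0 < s) (hsω : s ≤ ω - 1) (hL₀ : S.R₁ + 1 ≤ L₀) (hL : L₀ ≤ L)
    (hu₁ : 1 ≤ u₁) (hN : 0 ≤ N) (hu : 4 * u₁ ≤ u) (hux : u / 2 ≤ x) (hxu : x ≤ u) (huU : u ≤ U)
    (hψ : ∀ u v, 2 * u₁ ≤ u → u ≤ U → S.curve L₀ u ≤ v →
        |S.psiV u v| ≤ C * (u₁ ^ 2 + N * u₁ ^ (-1 + s)) * v ^ (-ω)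
          + C * N * u ^ (1 - ω + s) / (v * S.r u v)) :
    |S.psiV x (S.curve L x)| ≤
      8 * C / S.c ^ 3 * ((u₁ ^ 2 + N * u₁ ^ (-1 + s)) * u ^ (-s) + N / L) * u ^ (-ω + s) := by
  have hL₀' : S.R₁ < L₀ := by linarith
  have hL' : S.R₁ < L := hL₀'.trans_le hL
  have hLp : 0 < L := S.R₁_pos.trans hL'
  have hc := S.c_pos
  have hc1 := S.c_le_one
  have hx0 : 0 < x := by linarith
  have hu0 : 0 < u := by linarith
  have h := hψ x (S.curve L x) (by linarith) (hxu.trans huU) (S.curve_le_curve hL₀' hL x)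
  have hy := S.u_le_v hL' (u := x) (by linarith) le_rfl
  rw [S.r_curve hL'] at h
  generalize S.curve L x = y at *
  have hy0 : 0 < y := lt_of_lt_of_le (by positivity) hy
  have h1 : y ^ (-ω) ≤ 8 * u ^ (-ω) / S.c ^ 3 := (mul_rpow_neg_le hc hc1 hx0 hy (by linarith) hω3).trans
    (by gcongr; exact rpow_neg_le_of_half_le hu0 hux (by linarith) hω3)
  have h2 : x ^ (1 - ω + s) / y ≤ 8 * u ^ (-ω + s) / S.c ^ 3 := by
    have e : x ^ (1 - ω + s) = x ^ (-(ω - s)) * x := by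
      rw [show 1 - ω + s = -(ω - s) + 1 by ring, Real.rpow_add_one hx0.ne']
    have h3 := rpow_neg_le_of_half_le (p := ω - s) hu0 hux (by linarith) (by linarith)
    have h4 : x / y ≤ 1 / S.c := by
      rw [div_le_div_iff₀ hy0 hc]; linarith
    have h5 : 1 / S.c ≤ 1 / S.c ^ 3 := by
      apply one_div_le_one_div_of_le (by positivity)
      exact pow_le_of_le_one hc.le hc1 (by norm_num)
    have h6 : x / y ≤ 1 / S.c ^ 3 := h4.trans h5
    have e2 : -(ω - s) = -ω + s := by ring
    rw [e2] at h3 e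
    rw [e, mul_div_assoc]
    calc x ^ (-ω + s) * (x / y) ≤ 8 * u ^ (-ω + s) * (1 / S.c ^ 3) := by gcongr
      _ = _ := by ring
  have e3 : u ^ (-ω) = u ^ (-s) * u ^ (-ω + s) := by
    rw [← Real.rpow_add hu0]; congr 1; ring
  calc |S.psiV x y| ≤ C * (u₁ ^ 2 + N * u₁ ^ (-1 + s)) * y ^ (-ω)
          + C * N / L * (x ^ (1 - ω + s) / y) := h.trans (le_of_eq (by field_simp))
    _ ≤ C * (u₁ ^ 2 + N * u₁ ^ (-1 + s)) * (8 * u ^ (-ω) / S.c ^ 3)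
          + C * N / L * (8 * u ^ (-ω + s) / S.c ^ 3) := by gcongr
    _ = _ := by rw [e3]; ring

/-- Decay of the energy over a dyadic time interval. -/
theorem exists_energy_le (hω : 0 ≤ ω) {s : ℝ} (hs : 0 < s) (hs1 : s ≤ 1) :
    ∃ R B L₁ : ℝ, S.R₁ < R ∧ 0 < B ∧ R ≤ L₁ ∧ 1 ≤ L₁ ∧
      ∀ L u U G : ℝ, L₁ ≤ L → 4 ≤ u → u ≤ U → L ^ 2 ≤ u →
        (∀ x ∈ Icc (u / 2) u, |S.psiV x (S.curve L x)| ≤ G) →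
        S.phi u (S.curve L u) ^ 2 ≤ B * ((u ^ 6)⁻¹ + L ^ s * G ^ 2) ∧
        S.mass u (S.curve L u) - S.mass U (S.curve R u) ≤
          B * (L * ((u ^ 6)⁻¹ + L ^ s * G ^ 2)) := by
  obtain ⟨R, a, B, L₁, hR, hR1, ha, hB, hRL, hE⟩ := S.exists_energy_decay hω hs hs1
  -- For z = au/(2L) and L² ≤ u one has u ≤ (4/a²)z², so u⁹ ≤ (4/a²)⁹z¹⁸ ≤ C₂eᶻ. Nine powers yield
  -- u⁻⁶ after paying for a starting energy of order L²u² ≤ Lu³.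
  set C₂ := ((18).factorial : ℝ) * (4 / a ^ 2) ^ 9 with hC₂
  have hC₂0 : 0 < C₂ := by positivity
  refine ⟨R, B * (B * (C₂ + 1 / a)), L₁, hR, by positivity, hRL, hR1.trans hRL, ?_⟩
  intro L u U G hL₁ hu4 huU hLu hG
  have hL1 : 1 ≤ L := (hR1.trans hRL).trans hL₁
  have hL0 : 0 < L := by linarith
  have hu0 : 0 < u := by linarith
  have hLu' : L ≤ u := (le_self_pow₀ hL1 two_ne_zero).trans hLu
  choose E' hE' using fun x : {x : ℝ // 1 < x ∧ x ≤ u} =>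
    (hE L hL₁ U x.1 x.2.1 (x.2.2.trans huU)).1
  have hmem : ∀ x ∈ Icc (u / 2) u, 1 < x ∧ x ≤ u := fun x hx => ⟨by linarith [hx.1], hx.2⟩
  have hgr := le_exp_mul_add_of_hasDerivAt_le (f := S.energy s R L U)
    (f' := fun x => if h : 1 < x ∧ x ≤ u then E' ⟨x, h⟩ else 0) (a := u / 2) (b := u) (k := a / L)
    (F := B * (L ^ s * G ^ 2)) (by linarith) (by positivity)
    (fun x hx => by simp only [dif_pos (hmem x hx)]; exact (hE' ⟨x, hmem x hx⟩).1)
    (fun x hx => by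
      simp only [dif_pos (hmem x hx)]
      refine (hE' ⟨x, hmem x hx⟩).2.trans ?_
      simp only
      have h2 : S.psiV x (S.curve L x) ^ 2 ≤ G ^ 2 := by
        rw [← sq_abs]
        exact pow_le_pow_left₀ (abs_nonneg _) (hG x hx) 2
      gcongr)
  have hφ := (hE L hL₁ U u (by linarith) huU).2.1
  have hm := (hE L hL₁ U u (by linarith) huU).2.2.1
  have hEh := (hE L hL₁ U (u / 2) (by linarith) (by linarith)).2.2.2
  have hexp : Real.exp (-(a / L * (u - u / 2))) * u ^ 9 ≤ C₂ := by
    set z := a / L * (u - u / 2) with hz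
    have hz0 : 0 ≤ z := by
      have : 0 ≤ u - u / 2 := by linarith
      positivity
    have h1 := Real.pow_div_factorial_le_exp z hz0 18
    rw [div_le_iff₀ (by positivity)] at h1
    have h2 : u ≤ 4 / a ^ 2 * z ^ 2 := by
      have : 4 / a ^ 2 * z ^ 2 = u ^ 2 / L ^ 2 := by rw [hz]; field_simp; ring
      rw [this, le_div_iff₀ (by positivity), sq u]
      exact mul_le_mul_of_nonneg_left hLu hu0.le
    have h3 : u ^ 9 ≤ (4 / a ^ 2) ^ 9 * z ^ 18 := by
      calc u ^ 9 ≤ (4 / a ^ 2 * z ^ 2) ^ 9 := by gcongr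
        _ = _ := by ring
    rw [Real.exp_neg, inv_mul_le_iff₀ (Real.exp_pos _)]
    calc u ^ 9 ≤ (4 / a ^ 2) ^ 9 * (Real.exp z * ((18).factorial : ℝ)) := h3.trans (by gcongr)
      _ = _ := by rw [hC₂]; ring
  have hterm1 : Real.exp (-(a / L * (u - u / 2))) * (B * (L ^ 2 * (u / 2) ^ 2)) ≤
      B * C₂ * (L * (u ^ 6)⁻¹) := by
    calc Real.exp (-(a / L * (u - u / 2))) * (B * (L ^ 2 * (u / 2) ^ 2))
        = B / 4 * (Real.exp (-(a / L * (u - u / 2))) * (L * L * u ^ 2)) := by ring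
      _ ≤ B * (Real.exp (-(a / L * (u - u / 2))) * (L * u * u ^ 2)) := by
          gcongr
          linarith
      _ = B * (L * (Real.exp (-(a / L * (u - u / 2))) * u ^ 9) * (u ^ 6)⁻¹) := by field_simp
      _ ≤ B * (L * C₂ * (u ^ 6)⁻¹) := by gcongr
      _ = _ := by ring
  have hterm2 : B * (L ^ s * G ^ 2) / (a / L) = B / a * (L * (L ^ s * G ^ 2)) := by
    field_simp
  have hEle : S.energy s R L U u ≤ B * (C₂ + 1 / a) * (L * ((u ^ 6)⁻¹ + L ^ s * G ^ 2)) := by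
    have h1 : S.energy s R L U u ≤
        Real.exp (-(a / L * (u - u / 2))) * (B * (L ^ 2 * (u / 2) ^ 2))
          + B * (L ^ s * G ^ 2) / (a / L) := by
      refine hgr.trans ?_
      gcongr
      have : 0 ≤ B * (L ^ s * G ^ 2) / (a / L) := by positivity
      linarith
    rw [hterm2] at h1
    refine (h1.trans (add_le_add_left hterm1 _)).trans ?_
    have e : B * (C₂ + 1 / a) * (L * ((u ^ 6)⁻¹ + L ^ s * G ^ 2)) =
      B * C₂ * (L * (u ^ 6)⁻¹) + B / a * (L * (L ^ s * G ^ 2)) +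
      (B * C₂ * (L * (L ^ s * G ^ 2)) + B / a * (L * (u ^ 6)⁻¹)) := by ring
    rw [e]
    have : 0 ≤ B * C₂ * (L * (L ^ s * G ^ 2)) + B / a * (L * (u ^ 6)⁻¹) := by positivity
    linarith
  constructor
  · calc S.phi u (S.curve L u) ^ 2
        ≤ B / L * (B * (C₂ + 1 / a) * (L * ((u ^ 6)⁻¹ + L ^ s * G ^ 2))) := hφ.trans (by gcongr)
      _ = _ := by field_simp
  · calc S.mass u (S.curve L u) - S.mass U (S.curve R u)
        ≤ B * (B * (C₂ + 1 / a) * (L * ((u ^ 6)⁻¹ + L ^ s * G ^ 2))) := hm.trans (by gcongr)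
      _ = _ := by ring

/-- The gain from the energy decay at `r = L`. -/
theorem exists_abs_phi_curve_le (hω : 1 < ω) (hω3 : ω ≤ 3) {s : ℝ} (hs : 0 < s) (hs2 : s ≤ 1 / 2)
    (hsω : s ≤ ω - 1) :
    ∃ C L₁ : ℝ, 1 ≤ C ∧ S.R₁ + 1 ≤ L₁ ∧ 1 ≤ L₁ ∧ ∀ L₀ u₁ U N : ℝ, L₁ ≤ L₀ → 1 ≤ u₁ → 0 ≤ N →
      S.PhiDecay s L₀ u₁ U N → ∀ u L, 4 * u₁ ≤ u → u ≤ U → L₀ ≤ L → L ^ 2 ≤ u →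
        |S.phi u (S.curve L u)| ≤
          C * (u₁ ^ 2 + N * u₁ ^ (-1 + s) + N * L₀ ^ (-(1 / 2) : ℝ)) * u ^ (-ω + s) := by
  obtain ⟨C, hC, hψ⟩ := S.exists_abs_psiV_le hω hω3
  obtain ⟨R, B, L₁, hR, hB, hRL, hL₁1, hE⟩ :=
    S.exists_energy_le (by linarith) hs (by linarith)
  have hc := S.c_pos
  set C₁ := 8 * C / S.c ^ 3 with hC₁
  have hC₁0 : 0 < C₁ := by positivity
  set Q := 1 + B * (1 + C₁ ^ 2) with hQ
  have hQ1 : 1 ≤ Q := by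
    have : 0 ≤ B * (1 + C₁ ^ 2) := by positivity
    linarith
  refine ⟨Q, max L₁ (S.R₁ + 1), hQ1, le_max_right _ _, hL₁1.trans (le_max_left _ _), ?_⟩
  intro L₀ u₁ U N hL₀ hu₁ hN hD u L hu huU hL hLu
  have hL₁ : L₁ ≤ L := (le_max_left _ _).trans (hL₀.trans hL)
  have hL1 : 1 ≤ L := hL₁1.trans hL₁
  have hL0 : 0 < L := by linarith
  have hL₀R : S.R₁ + 1 ≤ L₀ := (le_max_right _ _).trans hL₀
  have hL₀1 : 0 < L₀ := by linarith [S.R₁_pos]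
  have hu4 : 4 ≤ u := by linarith
  have hu0 : 0 < u := by linarith
  have hLu' : L ≤ u := (le_self_pow₀ hL1 two_ne_zero).trans hLu
  have hψ' := hψ s hs hs2 hsω L₀ u₁ U N hL₀R hu₁ hN hD
  -- Only φ on r = L is wanted, so the ingoing segment may end at u itself.
  have hφ := (hE L u u _ hL₁ hu4 le_rfl hLu fun x hx =>
    S.abs_psiV_curve_le hω hω3 hC hs hsω hL₀R hL hu₁ hN hu hx.1 hx.2 huU hψ').1
  set X := u₁ ^ 2 + N * u₁ ^ (-1 + s) with hX
  have hX1 : 1 ≤ X := by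
    have := one_le_pow₀ hu₁ (n := 2)
    have : 0 ≤ N * u₁ ^ (-1 + s) := by positivity
    linarith
  set Y := X + N * L₀ ^ (-(1 / 2) : ℝ) with hY
  have hY1 : 1 ≤ Y := by
    have : 0 ≤ N * L₀ ^ (-(1 / 2) : ℝ) := by positivity
    linarith
  set w := u ^ (-ω + s) with hw
  have hw0 : 0 < w := by positivity
  have hw2 : (u ^ 6)⁻¹ ≤ w ^ 2 := by
    have : w ^ 2 = u ^ (2 * (-ω + s)) := by
      rw [hw, ← Real.rpow_natCast, ← Real.rpow_mul hu0.le]; congr 1; push_cast; ring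
    rw [this, ← Real.rpow_natCast, ← Real.rpow_neg hu0.le]
    apply Real.rpow_le_rpow_of_exponent_le (by linarith)
    push_cast
    linarith
  -- The weight L^s costs L^{s/2} after taking roots. Against u^{−s} this is harmless since L ≤ u;
  -- against 1/L it leaves L₀^{−1/2}, the smallness used by the bootstrap.
  have hroot : L ^ (s / 2) * (X * u ^ (-s) + N / L) ≤ Y := by
    have h1 : L ^ (s / 2) * u ^ (-s) ≤ 1 := by
      rw [Real.rpow_neg hu0.le, ← div_eq_mul_inv, div_le_one (by positivity)]
      calc L ^ (s / 2) ≤ u ^ (s / 2) := by gcongr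
        _ ≤ u ^ s := Real.rpow_le_rpow_of_exponent_le (by linarith) (by linarith)
    have h2 : L ^ (s / 2) / L ≤ L₀ ^ (-(1 / 2) : ℝ) := by
      calc L ^ (s / 2) / L = L ^ (s / 2 - 1) := by rw [Real.rpow_sub_one hL0.ne']
        _ ≤ L ^ (-(1 / 2) : ℝ) := Real.rpow_le_rpow_of_exponent_le hL1 (by linarith)
        _ ≤ L₀ ^ (-(1 / 2) : ℝ) := Real.rpow_le_rpow_of_nonpos hL₀1 hL (by norm_num)
    calc L ^ (s / 2) * (X * u ^ (-s) + N / L)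
        = X * (L ^ (s / 2) * u ^ (-s)) + N * (L ^ (s / 2) / L) := by ring
      _ ≤ X * 1 + N * L₀ ^ (-(1 / 2) : ℝ) := by gcongr
      _ = Y := by rw [hY]; ring
  have hterm2 : L ^ s * (C₁ * (X * u ^ (-s) + N / L) * w) ^ 2 ≤ C₁ ^ 2 * Y ^ 2 * w ^ 2 := by
    have e : L ^ s = (L ^ (s / 2)) ^ 2 := by
      rw [← Real.rpow_natCast, ← Real.rpow_mul hL0.le]; congr 1; push_cast; ring
    calc L ^ s * (C₁ * (X * u ^ (-s) + N / L) * w) ^ 2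
        = C₁ ^ 2 * (L ^ (s / 2) * (X * u ^ (-s) + N / L)) ^ 2 * w ^ 2 := by rw [e]; ring
      _ ≤ _ := by gcongr
  have hsq : S.phi u (S.curve L u) ^ 2 ≤ (Q * Y * w) ^ 2 := by
    have hww : w ^ 2 ≤ Y ^ 2 * w ^ 2 := le_mul_of_one_le_left (by positivity) (one_le_pow₀ hY1)
    calc S.phi u (S.curve L u) ^ 2
        ≤ B * (Y ^ 2 * w ^ 2 + C₁ ^ 2 * Y ^ 2 * w ^ 2) :=
          hφ.trans (by gcongr; exact hw2.trans hww)
      _ = B * (1 + C₁ ^ 2) * (Y ^ 2 * w ^ 2) := by ring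
      _ ≤ Q ^ 2 * (Y ^ 2 * w ^ 2) := by
          gcongr
          exact le_trans (by linarith) (le_self_pow₀ hQ1 two_ne_zero)
      _ = _ := by ring
  exact abs_le_of_sq_le_sq hsq (by positivity)

end Exterior

/-! ### From curves of constant radius to the region r ≥ L -/

namespace Exterior

variable {v₀ ω : ℝ} (S : Exterior v₀ ω)

theorem inv_sqrt_r_v (u : ℝ) {v : ℝ} (hv : v₀ < v) :
    HasDerivAt (fun y => -2 * (√(S.r u y))⁻¹) (S.lam u v / √(S.r u v) ^ 3) v := by
  have hr := S.r_pos u v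
  have hs : √(S.r u v) ≠ 0 := (Real.sqrt_pos.2 hr).ne'
  refine ((((S.r_v u v hv).sqrt hr.ne').inv hs).const_mul (-2)).congr_deriv ?_
  field_simp

/-- v ≥ cu and 2v ≥ cr give v ≥ (c/2)√(ur). Thus 1/(vr) is at most u^{−1/2} times λr^{−3/2}, a
v-derivative up to a constant; integrating along the ray gains u^{−1/2} and no logarithm. -/
theorem one_div_mul_r_le {L u v : ℝ} (hL : S.R₁ < L) (hLu : L ≤ u) (hu : 1 ≤ u)
    (hv : S.curve L u ≤ v) :
    1 / (v * S.r u v) ≤ 2 / (S.c ^ 2 * √u) * (S.lam u v / √(S.r u v) ^ 3) := by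
  have hc := S.c_pos
  have hc1 := S.c_le_one
  have hr := S.r_pos u v
  have hu0 : 0 < u := by linarith
  have h1 := S.u_le_v hL hu hv
  have h2 := S.r_le_linear hL hv
  have h3 := S.lt_curve hL u
  have hv0 : 0 < v := lt_of_lt_of_le (by positivity) h1
  have h4 := S.lam_ge u v (S.R₁_le_r hL hv).le
  have hα : 0 < √u := Real.sqrt_pos.2 hu0
  have hβ : 0 < √(S.r u v) := Real.sqrt_pos.2 hr
  have hα2 := Real.sq_sqrt hu0.le
  have hβ2 := Real.sq_sqrt hr.le
  have h5 : S.c * S.r u v ≤ 2 * v := by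
    have h6 : S.r u v ≤ u + v := by linarith [S.one_le_v₀]
    nlinarith
  have h7 : S.c / 2 * (√u * √(S.r u v)) ≤ v := by
    apply le_of_sq_le_sq _ hv0.le
    have : (S.c / 2 * (√u * √(S.r u v))) ^ 2 = (S.c * u) * (S.c * S.r u v) / 4 := by
      rw [mul_pow, mul_pow, hα2, hβ2]; ring
    rw [this]
    have h8 : (S.c * u) * (S.c * S.r u v) ≤ v * (2 * v) := by gcongr
    nlinarith [sq_nonneg v]
  have e : √(S.r u v) ^ 3 = √(S.r u v) * S.r u v := by rw [pow_succ, hβ2]; ring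
  rw [e, div_mul_div_comm, div_le_div_iff₀ (by positivity) (by positivity)]
  generalize √(S.r u v) = β at *
  generalize √u = α at *
  have h9 : S.c ^ 2 * α * β ≤ 2 * S.lam u v * v := by
    calc S.c ^ 2 * α * β = 2 * S.c * (S.c / 2 * (α * β)) := by ring
      _ ≤ 2 * S.lam u v * v := by
        have := S.lam_pos u v
        gcongr
  calc 1 * (S.c ^ 2 * α * (β * S.r u v)) = S.c ^ 2 * α * β * S.r u v := by ring
    _ ≤ 2 * S.lam u v * v * S.r u v := by gcongr
    _ = _ := by ring

theorem curve_r {L u v : ℝ} (hL : S.R₁ < L) (hv : S.curve L u ≤ v) : S.curve (S.r u v) u = v :=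
  (S.r_strictMonoOn u).injOn (S.lt_curve (S.R₁_le_r hL hv) u).le ((S.lt_curve hL u).le.trans hv)
    (S.r_curve (S.R₁_le_r hL hv) u)

theorem abs_psi_curve {L u : ℝ} (hL : S.R₁ < L) :
    |S.psi u (S.curve L u)| = L * |S.phi u (S.curve L u)| := by
  unfold NullSystem.psi
  rw [S.r_curve hL, abs_mul, abs_of_pos (S.R₁_pos.trans hL)]

theorem abs_phi_eq (u v : ℝ) : |S.phi u v| = |S.psi u v| / S.r u v := by
  unfold NullSystem.psi
  have := S.r_pos u v
  rw [abs_mul, abs_of_pos this]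
  field_simp

section region

variable {L s u v Q P N : ℝ}

/-- Decay of `φ` outside `r = √u`, near the light cone. -/
theorem abs_phi_le_near (hω : 1 < ω) (hω3 : ω ≤ 3) (hs : 0 < s) (hL : S.R₁ + 1 ≤ √u) (hu : 1 ≤ u)
    (hQ : 0 ≤ Q) (hP : 0 ≤ P) (hN : 0 ≤ N)
    (hφ : |S.phi u (S.curve √u u)| ≤ Q * u ^ (-ω + s))
    (hψ : ∀ y, S.curve √u u ≤ y →
      |S.psiV u y| ≤ P * y ^ (-ω) + N * u ^ (1 - ω + s) / (y * S.r u y))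
    (hv : S.curve √u u ≤ v) :
    |S.phi u v| ≤ (Q + P / S.c ^ 4 + N / S.c ^ 2 / √u) * u ^ (-ω + s) := by
  have hL' : S.R₁ < √u := by linarith
  have hc := S.c_pos
  have hc1 := S.c_le_one
  have hr := S.r_pos u v
  have hu0 : 0 < u := by linarith
  have hα : 0 < √u := Real.sqrt_pos.2 hu0
  have hα2 := Real.sq_sqrt hu0.le
  have hrα : √u ≤ S.r u v := (S.curve_le_iff hL' ((S.lt_curve hL' u).le.trans hv)).1 hv
  have hlin := S.r_ge_linear hL' hv
  set w := u ^ (-ω + s) with hw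
  have hw0 : 0 < w := by positivity
  have hW : u ^ (1 - ω + s) = w * u := by
    rw [hw, ← Real.rpow_add_one hu0.ne']; congr 1; ring
  have hwω : u ^ (-ω) ≤ w := Real.rpow_le_rpow_of_exponent_le hu (by linarith)
  set K := P / S.c ^ 3 * w + N / S.c / √u * w with hK
  have hK0 : 0 ≤ K := by positivity
  have h := abs_sub_le_sub_of_hasDerivAt (f := fun y => S.psi u y) (g := fun y => K * y)
    (g' := fun _ => K) hv (S.psi_cont.slice_right u).continuousOn (by fun_prop)
    (fun y hy => S.psi_v u ((S.lt_curve hL' u).trans hy.1))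
    (fun x _ => by simpa using (hasDerivAt_id x).const_mul K) ?_
  · have h1 : |S.psi u v| ≤ √u * (Q * w) + K * (v - S.curve √u u) := by
      have a1 := abs_sub_abs_le_abs_sub (S.psi u v) (S.psi u (S.curve √u u))
      rw [S.abs_psi_curve hL'] at a1
      have a2 := mul_le_mul_of_nonneg_left hφ hα.le
      linarith
    have h2 : v - S.curve √u u ≤ S.r u v / S.c := by
      rw [le_div_iff₀ hc]; linarith
    rw [S.abs_phi_eq, div_le_iff₀ hr]
    calc |S.psi u v| ≤ S.r u v * (Q * w) + K * (S.r u v / S.c) := h1.trans (by gcongr)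
      _ = _ := by rw [hK]; field_simp; ring
  · intro y hy
    have hrα : √u ≤ S.r u y := (S.curve_le_iff hL' ((S.lt_curve hL' u).le.trans hy.1.le)).1 hy.1.le
    have hy1 := S.u_le_v hL' hu hy.1.le
    have hy0 : 0 < y := lt_of_lt_of_le (by positivity) hy1
    refine (hψ y hy.1.le).trans ?_
    have h1 := mul_rpow_neg_le (p := ω) hc hc1 hu0 hy1 (by linarith) hω3
    rw [hW]
    calc P * y ^ (-ω) + N * (w * u) / (y * S.r u y)
        ≤ P * (w / S.c ^ 3) + N * (w * u) / (S.c * u * √u) := by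
          gcongr
          exact h1.trans (by gcongr)
      _ = K := by rw [hK]; field_simp

/-- Bound for `ψ` from its value on `r = L`. -/
theorem abs_psi_le_of_curve (hω : 1 < ω) (hω3 : ω ≤ 3) (hL : S.R₁ < L) (hL1 : 1 ≤ L) (hLu : L ≤ u)
    (hP : 0 ≤ P) (hN : 0 ≤ N)
    (hψ : ∀ y, S.curve L u ≤ y → |S.psiV u y| ≤ P * y ^ (-ω) + N / (y * S.r u y))
    (hv : S.curve L u ≤ v) :
    |S.psi u v| ≤ L * |S.phi u (S.curve L u)| + P / ((ω - 1) * S.c ^ 3) * u ^ (1 - ω)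
      + 4 / S.c ^ 2 * (N / √u) := by
  have hc := S.c_pos
  have hc1 := S.c_le_one
  have hu : 1 ≤ u := hL1.trans hLu
  have hu0 : 0 < u := by linarith
  have hα : 0 < √u := Real.sqrt_pos.2 hu0
  have hω1 : 0 < ω - 1 := by linarith
  set vL := S.curve L u with hvL
  have hvL1 := S.u_le_v hL hu le_rfl
  have hvL0 : 0 < vL := lt_of_lt_of_le (by positivity) hvL1
  set K := N * (2 / (S.c ^ 2 * √u)) with hK
  have hK0 : 0 ≤ K := by positivity
  have hpos : ∀ y ∈ Icc vL v, y ≠ 0 := fun y hy => by linarith [hy.1]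
  have h := abs_sub_le_sub_of_hasDerivAt (f := fun y => S.psi u y)
    (g := fun y => -P / (ω - 1) * y ^ (1 - ω) + K * (-2 * (√(S.r u y))⁻¹))
    (g' := fun y => P * y ^ (-ω) + K * (S.lam u y / √(S.r u y) ^ 3))
    hv (S.psi_cont.slice_right u).continuousOn ?_
    (fun y hy => S.psi_v u ((S.lt_curve hL u).trans hy.1)) ?_ ?_
  · have h1 : vL ^ (1 - ω) ≤ u ^ (1 - ω) / S.c ^ 3 := by
      have := mul_rpow_neg_le (p := ω - 1) hc hc1 hu0 hvL1 (by linarith) (by linarith)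
      rwa [neg_sub] at this
    have h2 : (√(S.r u vL))⁻¹ ≤ 1 := by
      rw [hvL, S.r_curve hL]
      exact inv_le_one_of_one_le₀ (Real.one_le_sqrt.2 hL1)
    have h4 : 0 ≤ P / (ω - 1) * v ^ (1 - ω) := by
      have := hvL0.trans_le hv
      positivity
    have h5 : 0 ≤ K * (2 * (√(S.r u v))⁻¹) := by positivity
    have h6 : P / (ω - 1) * vL ^ (1 - ω) ≤ P / (ω - 1) * (u ^ (1 - ω) / S.c ^ 3) := by gcongr
    have h7 : K * (2 * (√(S.r u vL))⁻¹) ≤ K * (2 * 1) := by gcongr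
    have a1 := abs_sub_abs_le_abs_sub (S.psi u v) (S.psi u vL)
    have e1 : -P / (ω - 1) * v ^ (1 - ω) = -(P / (ω - 1) * v ^ (1 - ω)) := by ring
    have e2 : -P / (ω - 1) * vL ^ (1 - ω) = -(P / (ω - 1) * vL ^ (1 - ω)) := by ring
    have e3 : P / ((ω - 1) * S.c ^ 3) * u ^ (1 - ω) = P / (ω - 1) * (u ^ (1 - ω) / S.c ^ 3) := by
      field_simp
    have e4 : 4 / S.c ^ 2 * (N / √u) = K * (2 * 1) := by rw [hK]; field_simp; ring
    rw [e1, e2] at h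
    rw [e3, e4, ← S.abs_psi_curve hL]
    linarith
  · apply ContinuousOn.add
    · exact continuousOn_const.mul (continuousOn_id.rpow_const fun y hy => Or.inl (hpos y hy))
    · refine (continuous_const.mul (continuous_const.mul
        (((S.r_cont.slice_right u).sqrt).inv₀ fun y => ?_))).continuousOn
      exact (Real.sqrt_pos.2 (S.r_pos u y)).ne'
  · intro y hy
    refine HasDerivAt.add ?_ ((S.inv_sqrt_r_v u ((S.lt_curve hL u).trans hy.1)).const_mul K)
    refine ((Real.hasDerivAt_rpow_const (p := 1 - ω)
      (Or.inl (hpos y (Ioo_subset_Icc_self hy)))).const_mul _).congr_deriv ?_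
    have e : 1 - ω - 1 = -ω := by ring
    rw [e]
    field_simp
    ring
  · intro y hy
    refine (hψ y hy.1.le).trans ?_
    have h1 := S.one_div_mul_r_le hL hLu hu hy.1.le
    have h2 : N / (y * S.r u y) = N * (1 / (y * S.r u y)) := by ring
    have h3 : N * (1 / (y * S.r u y)) ≤ N * (2 / (S.c ^ 2 * √u) *
      (S.lam u y / √(S.r u y) ^ 3)) := by gcongr
    rw [h2, hK]
    linarith

end region

/-- From the level sets `r ≤ √u` to the whole region. -/
theorem exists_abs_phi_le_of_level (hω : 1 < ω) (hω3 : ω ≤ 3) :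
    ∃ C : ℝ, 1 ≤ C ∧ ∀ s L u Q P N : ℝ, 0 < s → S.R₁ + 1 ≤ L → 1 ≤ L → L ^ 2 ≤ u → 0 ≤ Q → 0 ≤ P →
      0 ≤ N → (∀ L', L ≤ L' → L' ^ 2 ≤ u → |S.phi u (S.curve L' u)| ≤ Q * u ^ (-ω + s)) →
      (∀ y, S.curve L u ≤ y →
        |S.psiV u y| ≤ P * y ^ (-ω) + N * u ^ (1 - ω + s) / (y * S.r u y)) →
      ∀ v, S.curve L u ≤ v → |S.phi u v| ≤ C * (Q + P + N / √u) * u ^ (1 - ω + s) / v := by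
  have hc := S.c_pos
  have hc1 := S.c_le_one
  have hV := S.one_le_V
  have hω1 : 0 < ω - 1 := by linarith
  set D := 1 + 1 / S.c ^ 4 + 4 / S.c ^ 2 + 1 / ((ω - 1) * S.c ^ 3) with hD
  have p1 : 0 < 1 / S.c ^ 4 := by positivity
  have p2 : 0 < 4 / S.c ^ 2 := by positivity
  have p3 : 0 < 1 / ((ω - 1) * S.c ^ 3) := by positivity
  have p4 : 1 / S.c ^ 2 ≤ 4 / S.c ^ 2 := by gcongr; norm_num
  have hD1 : 1 ≤ D := by linarith
  have hVc : 3 * S.V ≤ 3 * S.V / S.c := by rw [le_div_iff₀ hc]; nlinarith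
  refine ⟨3 * S.V / S.c * D, ?_, ?_⟩
  · have : 1 ≤ 3 * S.V / S.c := by linarith
    exact one_le_mul_of_one_le_of_one_le this hD1
  intro s L u Q P N hs hL hL1 hLu hQ hP hN hφ hψ v hv
  have hL' : S.R₁ < L := by linarith
  have hL0 : 0 < L := by linarith
  have hu : 1 ≤ u := (one_le_pow₀ hL1).trans hLu
  have hu0 : 0 < u := by linarith
  have hLα : L ≤ √u := Real.le_sqrt_of_sq_le hLu
  have hα2 := Real.sq_sqrt hu0.le
  have hα : 0 < √u := Real.sqrt_pos.2 hu0
  have hαu : √u ≤ u := by nlinarith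
  have hVu : u ≤ S.V * u := le_mul_of_one_le_left hu0.le hV
  have hr := S.r_pos u v
  have hvL := S.v_le hL hu hv
  have hv0 : 0 < v := lt_of_lt_of_le (by linarith [S.one_le_v₀]) ((S.lt_curve hL' u).le.trans hv)
  set w := u ^ (-ω + s) with hw
  have hw0 : 0 < w := by positivity
  have hW : u ^ (1 - ω + s) = w * u := by
    rw [hw, ← Real.rpow_add_one hu0.ne']; congr 1; ring
  set T := Q + P + N / √u with hT
  have hN' : 0 ≤ N / √u := by positivity
  have hT0 : 0 ≤ T := by positivity
  have close : ∀ b, b ≤ D * T → |S.phi u v| ≤ b * w → v ≤ 3 * S.V * u →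
      |S.phi u v| ≤ 3 * S.V / S.c * D * T * u ^ (1 - ω + s) / v := by
    intro b hb h1 h2
    rw [le_div_iff₀ hv0, hW]
    calc |S.phi u v| * v ≤ (D * T * w) * (3 * S.V / S.c * u) := by
          gcongr
          · exact h1.trans (by gcongr)
          · exact h2.trans (by gcongr)
      _ = _ := by ring
  have hαc : S.curve L u ≤ S.curve √u u := S.curve_le_curve hL' hLα u
  have hRα : S.R₁ + 1 ≤ √u := hL.trans hLα
  have hRα' : S.R₁ < √u := by linarith
  -- Three regimes. For r < √u the hypothesis on level curves applies directly. Up to distance u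
  -- beyond r = √u, v is still of order u and ∂_vψ is integrated with a constant bound. Further out
  -- r is comparable to v, and a bound for ψ is enough.
  rcases le_or_gt (S.curve √u u) v with h | h
  · have hvα := S.v_le hRα hu (v := S.curve √u u) le_rfl
    rw [S.r_curve hRα'] at hvα
    have hvα2 : S.curve √u u ≤ 2 * S.V * u := hvα.trans (by
      have : S.V * (u + √u) ≤ S.V * (u + u) := by gcongr
      linarith)
    have hφα := hφ √u hLα hα2.le
    rcases le_or_gt (v - S.curve √u u) u with h1 | h1
    · refine close _ ?_ (S.abs_phi_le_near hω hω3 hs hRα hu hQ hP hN hφα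
        (fun y hy => hψ y (hαc.trans hy)) h) (by linarith)
      have e : Q + P / S.c ^ 4 + N / S.c ^ 2 / √u =
        1 * Q + 1 / S.c ^ 4 * P + 1 / S.c ^ 2 * (N / √u) := by ring
      have e2 : D * T = D * Q + D * P + D * (N / √u) := by rw [hT]; ring
      rw [e, e2]
      gcongr
      · linarith
      · linarith
    · have h2 := S.abs_psi_le_of_curve hω hω3 hRα' (hL1.trans hLα) hαu hP
        (N := N * u ^ (1 - ω + s)) (by positivity) (fun y hy => hψ y (hαc.trans hy)) h
      have h3 := S.r_ge_linear hRα' h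
      have h4 : √u * |S.phi u (S.curve √u u)| + P / ((ω - 1) * S.c ^ 3) * u ^ (1 - ω)
          + 4 / S.c ^ 2 * (N * u ^ (1 - ω + s) / √u) ≤ D * T * u ^ (1 - ω + s) := by
        have a1 : √u * |S.phi u (S.curve √u u)| ≤ Q * u ^ (1 - ω + s) := by
          calc √u * |S.phi u (S.curve √u u)| ≤ u * (Q * w) := by gcongr
            _ = _ := by rw [hW]; ring
        have a2 : u ^ (1 - ω) ≤ u ^ (1 - ω + s) :=
          Real.rpow_le_rpow_of_exponent_le hu (by linarith)
        calc √u * |S.phi u (S.curve √u u)| + P / ((ω - 1) * S.c ^ 3) * u ^ (1 - ω)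
              + 4 / S.c ^ 2 * (N * u ^ (1 - ω + s) / √u)
            ≤ Q * u ^ (1 - ω + s) + P / ((ω - 1) * S.c ^ 3) * u ^ (1 - ω + s)
              + 4 / S.c ^ 2 * (N * u ^ (1 - ω + s) / √u) := by gcongr
          _ = (1 * Q + 1 / ((ω - 1) * S.c ^ 3) * P + 4 / S.c ^ 2 * (N / √u)) * u ^ (1 - ω + s) := by
            ring
          _ ≤ (D * Q + D * P + D * (N / √u)) * u ^ (1 - ω + s) := by
            gcongr
            · linarith
            · linarith
          _ = _ := by rw [hT]; ring
      have h5 : v ≤ 3 * S.V / S.c * S.r u v := by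
        have h6 : v ≤ 3 * S.V * (v - S.curve √u u) := by
          have a1 : S.V * u ≤ S.V * (v - S.curve √u u) := by gcongr
          have a2 : v - S.curve √u u ≤ S.V * (v - S.curve √u u) :=
            le_mul_of_one_le_left (by linarith) hV
          linarith
        have h7 : v - S.curve √u u ≤ S.r u v / S.c := by
          rw [le_div_iff₀ hc]; linarith
        calc v ≤ 3 * S.V * (S.r u v / S.c) := h6.trans (by gcongr)
          _ = _ := by ring
      rw [S.abs_phi_eq, div_le_div_iff₀ hr hv0]
      calc |S.psi u v| * v ≤ (D * T * u ^ (1 - ω + s)) * (3 * S.V / S.c * S.r u v) := by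
            gcongr
            exact h2.trans h4
        _ = _ := by ring
  · have hrα : S.r u v < √u := (S.lt_curve_iff hRα' ((S.lt_curve hL' u).le.trans hv)).1 h
    have hLr : L ≤ S.r u v := (S.curve_le_iff hL' ((S.lt_curve hL' u).le.trans hv)).1 hv
    have h1 := hφ (S.r u v) hLr ((pow_le_pow_left₀ hr.le hrα.le 2).trans_eq hα2)
    rw [S.curve_r hL' hv] at h1
    refine close _ ?_ h1 (by
      have : S.V * (u + S.r u v) ≤ S.V * (u + u) := by gcongr; linarith
      linarith)
    calc Q ≤ T := by rw [hT]; linarith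
      _ ≤ D * T := le_mul_of_one_le_left hT0 hD1

end Exterior

/-! ### The bootstrap -/

namespace Exterior

variable {v₀ ω : ℝ} (S : Exterior v₀ ω)

theorem PhiDecay.mono {s L u₁ U N N' : ℝ} (hL : S.R₁ < L) (hu₁ : 1 ≤ u₁) (hNN : N ≤ N')
    (h : S.PhiDecay s L u₁ U N) : S.PhiDecay s L u₁ U N' := by
  intro u hu huU v hv
  refine (h u hu huU v hv).trans ?_
  have hv0 : 0 < v := lt_of_lt_of_le (by linarith [S.one_le_v₀]) ((S.lt_curve hL u).le.trans hv)
  have hu0 : 0 < u := by linarith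
  gcongr

/-- The qualitative starting point: on a finite range u ≤ U the crude bound is some multiple of the
desired decay. The dependence on U disappears in the iteration. -/
theorem phiDecay_crude (hω3 : ω ≤ 3) {s L u₁ : ℝ} (hs : 0 < s) (hL : S.R₁ + 1 ≤ L) (hL1 : 1 ≤ L)
    (hu₁ : 1 ≤ u₁) (U : ℝ) : S.PhiDecay s L u₁ U (2 * (S.A + S.Z) * S.V * U ^ 4) := by
  intro u hu huU v hv
  have hL' : S.R₁ < L := by linarith
  have hA := S.A_nonneg
  have hZ := S.Z_nonneg
  have hV := S.one_le_V
  have hv0' := (S.lt_curve hL' u).le.trans hv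
  have hv0 : 0 < v := lt_of_lt_of_le (by linarith [S.one_le_v₀]) hv0'
  have hu1 : 1 ≤ u := hu₁.trans hu
  have hu0 : 0 < u := by linarith
  have hr := S.r_pos u v
  have hr1 : 1 ≤ S.r u v := hL1.trans ((S.curve_le_iff hL' hv0').1 hv)
  have h1 := S.abs_phi_le_crude hu1 hv0'
  have h2 := S.v_le hL hu1 hv
  have h3 : (u ^ 2)⁻¹ ≤ u ^ (1 - ω + s) := by
    rw [← Real.rpow_natCast, ← Real.rpow_neg hu0.le]
    exact Real.rpow_le_rpow_of_exponent_le hu1 (by push_cast; linarith)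
  have h4 : 1 ≤ U ^ 2 * u ^ (1 - ω + s) := by
    calc (1 : ℝ) = u ^ 2 * (u ^ 2)⁻¹ := by field_simp
      _ ≤ _ := by gcongr
  rw [le_div_iff₀ hv0]
  have h5 : v ≤ 2 * S.V * u * S.r u v := by
    have : S.V * (u + S.r u v) ≤ S.V * (2 * (u * S.r u v)) := by
      gcongr
      nlinarith
    linarith
  calc |S.phi u v| * v ≤ ((S.A + S.Z) * u / S.r u v) * (2 * S.V * u * S.r u v) := by gcongr
    _ = 2 * (S.A + S.Z) * S.V * u ^ 2 * 1 := by field_simp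
    _ ≤ 2 * (S.A + S.Z) * S.V * U ^ 2 * (U ^ 2 * u ^ (1 - ω + s)) := by gcongr
    _ = _ := by ring

/-- Weak decay of the scalar field. -/
theorem exists_phiDecay (hω : 1 < ω) (hω3 : ω ≤ 3) {s : ℝ} (hs : 0 < s) (hs2 : s ≤ 1 / 2)
    (hsω : s ≤ ω - 1) :
    ∃ L u₁ N : ℝ, S.R₁ + 1 ≤ L ∧ 1 ≤ L ∧ 1 ≤ u₁ ∧ 0 ≤ N ∧ ∀ U, S.PhiDecay s L u₁ U N := by
  obtain ⟨Cψ, hCψ, hψ⟩ := S.exists_abs_psiV_le hω hω3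
  obtain ⟨Cφ, L₁, hCφ, hL₁, hL₁1, hφ⟩ := S.exists_abs_phi_curve_le hω hω3 hs hs2 hsω
  obtain ⟨C, hC, hlev⟩ := S.exists_abs_phi_le_of_level hω hω3
  set D := 2 * C * (Cφ + Cψ) with hD
  have hD1 : 1 ≤ D := by
    rw [hD]
    nlinarith
  -- This makes D·L^{−1/2} ≤ 1/4. With u₁ = L² the factors u₁^{−1+s} and u^{−1/2} are also at most
  -- L^{−1/2}, so each occurrence of N on the right carries this small factor.
  set L := max L₁ ((4 * D) ^ 2) with hL
  have hLL₁ : L₁ ≤ L := le_max_left _ _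
  have hLR : S.R₁ + 1 ≤ L := hL₁.trans hLL₁
  have hL1 : 1 ≤ L := hL₁1.trans hLL₁
  have hL0 : 0 < L := by linarith
  have hLR' : S.R₁ < L := by linarith
  set u₁ := L ^ 2 with hu₁
  have hu₁1 : 1 ≤ u₁ := one_le_pow₀ hL1
  have hA := S.A_nonneg
  have hZ := S.Z_nonneg
  have hV := S.one_le_V
  have hsmall : D * L ^ (-(1 / 2) : ℝ) ≤ 1 / 4 := by
    have h1 : ((4 * D) ^ 2 : ℝ) ^ (-(1 / 2) : ℝ) = (4 * D)⁻¹ := by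
      rw [← Real.rpow_natCast, ← Real.rpow_mul (by linarith), ← Real.rpow_neg_one]
      congr 1; norm_num
    have h2 : L ^ (-(1 / 2) : ℝ) ≤ (4 * D)⁻¹ := by
      rw [← h1]
      exact Real.rpow_le_rpow_of_nonpos (by positivity) (le_max_right _ _) (by norm_num)
    calc D * L ^ (-(1 / 2) : ℝ) ≤ D * (4 * D)⁻¹ := by gcongr
      _ = 1 / 4 := by field_simp
  set B := D * u₁ ^ 2 + 2 * (S.A + S.Z) * S.V * (4 * u₁) ^ 4 with hB
  have hB0 : 0 ≤ B := by positivity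
  -- For u ≤ 4u₁ the crude bound is a fixed constant. Later, the passage from φ to ∂_vψ, to φ on
  -- curves of constant radius and back to φ returns at most a constant plus N/4.
  have improve : ∀ U N : ℝ, 0 ≤ N → S.PhiDecay s L u₁ U N → S.PhiDecay s L u₁ U (B + N / 2) := by
    intro U N hN hdec u hu huU v hv
    have hv0 : 0 < v := lt_of_lt_of_le (by linarith [S.one_le_v₀]) ((S.lt_curve hLR' u).le.trans hv)
    have hu0 : 0 < u := by linarith
    have hW : 0 < u ^ (1 - ω + s) := by positivity
    rcases le_or_gt u (4 * u₁) with h4 | h4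
    · refine (S.phiDecay_crude hω3 hs hLR hL1 hu₁1 (4 * u₁) u hu h4 v hv).trans ?_
      have : 2 * (S.A + S.Z) * S.V * (4 * u₁) ^ 4 ≤ B + N / 2 := by
        have : 0 ≤ D * u₁ ^ 2 := by positivity
        linarith
      gcongr
    · have hq : L ^ 2 ≤ u := by rw [← hu₁]; linarith
      set X := u₁ ^ 2 + N * u₁ ^ (-1 + s) with hX
      have hX0 : 0 ≤ X := by positivity
      have hfin := hlev s L u (Cφ * (X + N * L ^ (-(1 / 2) : ℝ))) (Cψ * X) (Cψ * N) hs hLR hL1 hq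
        (by positivity) (by positivity) (by positivity)
        (fun L' h1 h2 => hφ L u₁ U N hLL₁ hu₁1 hN hdec u L' h4.le huU h1 h2)
        (fun y hy => hψ s hs hs2 hsω L u₁ U N hLR hu₁1 hN hdec u y (by linarith) huU hy) v hv
      refine hfin.trans ?_
      have hp : L ^ (-1 : ℝ) ≤ L ^ (-(1 / 2) : ℝ) :=
        Real.rpow_le_rpow_of_exponent_le hL1 (by norm_num)
      have hp1 : u₁ ^ (-1 + s) ≤ L ^ (-(1 / 2) : ℝ) := by
        rw [hu₁, ← Real.rpow_natCast, ← Real.rpow_mul hL0.le]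
        exact Real.rpow_le_rpow_of_exponent_le hL1 (by push_cast; linarith)
      have hp2 : 1 / √u ≤ L ^ (-(1 / 2) : ℝ) := by
        refine le_trans ?_ hp
        rw [Real.rpow_neg_one, ← one_div]
        exact one_div_le_one_div_of_le hL0 (Real.le_sqrt_of_sq_le hq)
      generalize L ^ (-(1 / 2) : ℝ) = p at *
      have hXle : X ≤ u₁ ^ 2 + N * p := by rw [hX]; gcongr
      have hT : Cφ * (X + N * p) + Cψ * X + Cψ * N / √u ≤ 2 * (Cφ + Cψ) * (u₁ ^ 2 + N * p) := by
        have a1 : Cφ * (X + N * p) ≤ Cφ * ((u₁ ^ 2 + N * p) + N * p) := by gcongr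
        have a2 : Cψ * X ≤ Cψ * (u₁ ^ 2 + N * p) := by gcongr
        have a3 : Cψ * N / √u ≤ Cψ * N * p := by
          rw [div_eq_mul_one_div]; gcongr
        have a4 : 0 ≤ Cφ * u₁ ^ 2 := by positivity
        have a5 : 0 ≤ Cψ * u₁ ^ 2 := by positivity
        linarith
      have hT2 : C * (Cφ * (X + N * p) + Cψ * X + Cψ * N / √u) ≤ B + N / 2 := by
        have b1 : C * (Cφ * (X + N * p) + Cψ * X + Cψ * N / √u) ≤
          C * (2 * (Cφ + Cψ) * (u₁ ^ 2 + N * p)) := by gcongr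
        have b2 : C * (2 * (Cφ + Cψ) * (u₁ ^ 2 + N * p)) = D * u₁ ^ 2 + N * (D * p) := by
          rw [hD]; ring
        have b3 : N * (D * p) ≤ N * (1 / 4) := by gcongr
        have b4 : 0 ≤ 2 * (S.A + S.Z) * S.V * (4 * u₁) ^ 4 := by positivity
        linarith
      gcongr
  refine ⟨L, u₁, 2 * B + 1, hLR, hL1, hu₁1, by linarith, fun U => ?_⟩
  set N₀ := 2 * (S.A + S.Z) * S.V * U ^ 4 with hN₀
  have hN₀0 : 0 ≤ N₀ := by positivity
  -- 2B is the fixed point of N ↦ B + N/2 and the excess is halved each time, so `N₀`, the only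
  -- quantity depending on U, is eventually at most 1.
  have iter : ∀ k : ℕ, S.PhiDecay s L u₁ U (2 * B + N₀ / 2 ^ k) := by
    intro k
    induction k with
    | zero =>
      refine PhiDecay.mono S hLR' hu₁1 ?_ (S.phiDecay_crude hω3 hs hLR hL1 hu₁1 U)
      simp only [pow_zero, div_one]
      linarith
    | succ k ih =>
      have := improve U _ (by positivity) ih
      refine PhiDecay.mono S hLR' hu₁1 (le_of_eq ?_) this
      rw [pow_succ]
      field_simp
      ring
  obtain ⟨k, hk⟩ := pow_unbounded_of_one_lt N₀ (one_lt_two : (1 : ℝ) < 2)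
  refine PhiDecay.mono S hLR' hu₁1 ?_ (iter k)
  have : N₀ / 2 ^ k ≤ 1 := by
    rw [div_le_one (by positivity)]
    exact hk.le
  linarith

end Exterior

/-! ### The red-shift, and decay of rφ, θ and ζ -/

namespace Exterior

variable {v₀ ω : ℝ} (S : Exterior v₀ ω)

theorem abs_ratio_le (u v : ℝ) : |S.ratio u v| ≤ S.Z := by
  unfold NullSystem.ratio
  rw [abs_div, abs_of_neg (S.nu_neg u v), div_le_iff₀ (S.nu_pos u v)]
  exact S.zeta_le u v

theorem abs_zeta_le_ratio (u v : ℝ) : |S.zeta u v| ≤ |S.ratio u v| := by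
  have h1 := S.nu_pos u v
  have h2 := S.nu_ge u v
  have h3 : S.zeta u v = S.ratio u v * S.nu u v := by
    unfold NullSystem.ratio
    rw [div_mul_cancel₀ _ (S.nu_ne u v)]
  rw [h3, abs_mul, abs_of_neg (S.nu_neg u v)]
  exact mul_le_of_le_one_right (abs_nonneg _) (by linarith)

/-- The red-shift estimate. -/
theorem sq_ratio_le {L u a b : ℝ} (hab : a ≤ b) (ha : v₀ ≤ a)
    (hr : ∀ v ∈ Icc a b, S.r u v ≤ L) :
    S.ratio u b ^ 2 ≤ Real.exp (-(2 * S.c * S.q₀ / L ^ 2 * (b - a))) * S.Z ^ 2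
      + L ^ 2 / (S.c * S.q₀ * S.ρ ^ 2) * (S.mass u b - S.mass u a) := by
  have hc := S.c_pos
  have hq := S.q₀_pos
  have hρ := S.ρ_pos
  have hL : 0 < L := (S.r_pos u a).trans_le (hr a ⟨le_rfl, hab⟩)
  -- A lower bound for the damping coefficient of ζ/ν where r ≤ L. Half of the damping of its square
  -- pays for the weight e^{kv}, the other half completes the square against θ; the resulting θ² is
  -- a multiple of ∂_vϖ.
  set k := 2 * S.c * S.q₀ / L ^ 2 with hk
  have hk0 : 0 < k := by positivity
  have hratio : Continuous fun y => S.ratio u y :=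
    (S.zeta_cont.slice_right u).div (S.nu_cont.slice_right u) fun y => S.nu_ne u y
  set D := Real.exp (k * b) * (2 / (k * S.ρ ^ 2)) with hD
  have h := sub_le_sub_of_hasDerivAt_le (f := fun y => Real.exp (k * y) * S.ratio u y ^ 2)
    (g := fun y => D * S.mass u y) (g' := fun y => D * (S.theta u y ^ 2 / (2 * S.kappa u y)))
    (f' := fun y => Real.exp (k * y) * k * S.ratio u y ^ 2 + Real.exp (k * y) *
      (2 * S.ratio u y * (-S.theta u y / S.r u y
      - 2 * S.kappa u y * (S.mass u y - S.e ^ 2 / S.r u y) / S.r u y ^ 2 * S.ratio u y)))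
    hab (by fun_prop) (continuous_const.mul (S.mass_cont.slice_right u)).continuousOn ?_
    (fun y hy => (S.mass_v u y (lt_of_le_of_lt ha hy.1)).const_mul D) ?_
  · have hb := Real.exp_pos (k * b)
    have h1 : S.ratio u a ^ 2 ≤ S.Z ^ 2 := by
      rw [← sq_abs]
      exact pow_le_pow_left₀ (abs_nonneg _) (S.abs_ratio_le u a) 2
    have h2 : Real.exp (k * b) * S.ratio u b ^ 2 ≤ Real.exp (k * a) * S.Z ^ 2
        + D * (S.mass u b - S.mass u a) := by
      have := mul_le_mul_of_nonneg_left h1 (Real.exp_pos (k * a)).le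
      linarith
    have h3 : Real.exp (k * a) = Real.exp (k * b) * Real.exp (-(k * (b - a))) := by
      rw [← Real.exp_add]; congr 1; ring
    have h4 : 2 / (k * S.ρ ^ 2) = L ^ 2 / (S.c * S.q₀ * S.ρ ^ 2) := by
      rw [hk]; field_simp
    rw [h3, hD, h4] at h2
    refine le_of_mul_le_mul_left (h2.trans (le_of_eq ?_)) hb
    ring
  · intro y hy
    refine HasDerivAt.mul ?_ ?_
    · simpa using ((hasDerivAt_id y).const_mul k).exp
    · refine ((S.ratio_v u (lt_of_le_of_lt ha hy.1)).pow 2).congr_deriv ?_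
      norm_num
  · intro y hy
    have hry := hr y (Ioo_subset_Icc_self hy)
    have hr0 := S.r_pos u y
    have hκ := S.kappa_pos u y
    have hκ1 := S.kappa_le u y
    have hκc := S.kappa_ge u y
    have hqy := S.q_ge u y
    have hρr := S.r_ge u y
    have h1 : k ≤ 2 * S.kappa u y * (S.mass u y - S.e ^ 2 / S.r u y) / S.r u y ^ 2 := by
      rw [hk]
      gcongr
      have := hq.le.trans hqy
      positivity
    set K := 2 * S.kappa u y * (S.mass u y - S.e ^ 2 / S.r u y) / S.r u y ^ 2
    set z := S.ratio u y
    set t := S.theta u y / S.r u y with ht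
    have h2 : k * z ^ 2 + 2 * z * (-S.theta u y / S.r u y - K * z) ≤ t ^ 2 / k := by
      have e : -S.theta u y / S.r u y = -t := by rw [ht]; ring
      rw [e, le_div_iff₀ hk0]
      have h5 : k * z ^ 2 ≤ K * z ^ 2 := by gcongr
      nlinarith [sq_nonneg (k * z + t)]
    have h3 : t ^ 2 / k ≤ 2 / (k * S.ρ ^ 2) * (S.theta u y ^ 2 / (2 * S.kappa u y)) := by
      have e1 : t ^ 2 / k = S.theta u y ^ 2 / (k * S.r u y ^ 2) := by rw [ht]; field_simp
      have e2 : 2 / (k * S.ρ ^ 2) * (S.theta u y ^ 2 / (2 * S.kappa u y))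
        = S.theta u y ^ 2 / (k * S.ρ ^ 2 * S.kappa u y) := by field_simp
      rw [e1, e2]
      apply div_le_div_of_nonneg_left (sq_nonneg _) (by positivity)
      calc k * S.ρ ^ 2 * S.kappa u y ≤ k * S.r u y ^ 2 * 1 := by gcongr
        _ = _ := by ring
    have h4 : Real.exp (k * y) ≤ Real.exp (k * b) := by
      apply Real.exp_le_exp.2
      have := hy.2.le
      gcongr
    calc Real.exp (k * y) * k * z ^ 2 + Real.exp (k * y) *
          (2 * z * (-S.theta u y / S.r u y - K * z))
        = Real.exp (k * y) * (k * z ^ 2 + 2 * z * (-S.theta u y / S.r u y - K * z)) := by ring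
      _ ≤ Real.exp (k * y) * (2 / (k * S.ρ ^ 2) * (S.theta u y ^ 2 / (2 * S.kappa u y))) := by
          gcongr
          exact h2.trans h3
      _ ≤ Real.exp (k * b) * (2 / (k * S.ρ ^ 2) * (S.theta u y ^ 2 / (2 * S.kappa u y))) := by
          gcongr
      _ = _ := by rw [hD]; ring

/-- Weak decay of `φ` and `∂_v ψ`. -/
theorem exists_weak_decay (hω : 1 < ω) (hω3 : ω ≤ 3) {s : ℝ} (hs : 0 < s) (hs2 : s ≤ 1 / 2)
    (hsω : s ≤ ω - 1) :
    ∃ L₀ u₁ K : ℝ, S.R₁ + 1 ≤ L₀ ∧ 1 ≤ L₀ ∧ 1 ≤ u₁ ∧ 0 < K ∧ ∀ L u v, L₀ ≤ L → u₁ ≤ u →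
      S.curve L u ≤ v → |S.phi u v| ≤ K * u ^ (1 - ω + s) / v ∧
        |S.psiV u v| ≤ K * v ^ (-ω) + K * u ^ (1 - ω + s) / (v * S.r u v) := by
  obtain ⟨C, hC, hψ⟩ := S.exists_abs_psiV_le hω hω3
  obtain ⟨L₀, u₁, N, hL₀, hL₀1, hu₁, hN, hD⟩ := S.exists_phiDecay hω hω3 hs hs2 hsω
  have hL' : S.R₁ < L₀ := by linarith
  set K := N + C * (u₁ ^ 2 + N * u₁ ^ (-1 + s)) + C * N with hK
  have p1 : 0 < C * (u₁ ^ 2 + N * u₁ ^ (-1 + s)) := by positivity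
  have p2 : 0 ≤ C * N := by positivity
  refine ⟨L₀, 2 * u₁, K, hL₀, hL₀1, by linarith, by linarith, ?_⟩
  intro L u v hL hu hv
  have hv' : S.curve L₀ u ≤ v := (S.curve_le_curve hL' hL u).trans hv
  have hv0 : 0 < v := lt_of_lt_of_le (by linarith [S.one_le_v₀]) ((S.lt_curve hL' u).le.trans hv')
  have hu0 : 0 < u := by linarith
  have hr := S.r_pos u v
  constructor
  · refine (hD u u (by linarith) le_rfl v hv').trans ?_
    gcongr
    linarith
  · refine (hψ s hs hs2 hsω L₀ u₁ u N hL₀ hu₁ hN (hD u) u v hu le_rfl hv').trans ?_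
    gcongr
    · linarith
    · linarith

/-- Decay of the radiation field. -/
theorem abs_psi_le_of_weak (hω : 1 < ω) (hω3 : ω ≤ 3) {s K L u v : ℝ} (hs2 : s ≤ 1 / 2)
    (hL : S.R₁ < L) (hL1 : 1 ≤ L) (hLu : L ≤ u) (hK : 0 < K)
    (hφ : ∀ y, S.curve L u ≤ y → |S.phi u y| ≤ K * u ^ (1 - ω + s) / y)
    (hψ : ∀ y, S.curve L u ≤ y →
      |S.psiV u y| ≤ K * y ^ (-ω) + K * u ^ (1 - ω + s) / (y * S.r u y))
    (hv : S.curve L u ≤ v) :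
    |S.psi u v| ≤ (L * K / S.c + K / ((ω - 1) * S.c ^ 3) + 4 * K / S.c ^ 2) * u ^ (1 - ω) := by
  have hc := S.c_pos
  have hu : 1 ≤ u := hL1.trans hLu
  have hu0 : 0 < u := by linarith
  have h1 := S.abs_psi_le_of_curve hω hω3 hL hL1 hLu hK.le (N := K * u ^ (1 - ω + s))
    (by positivity) hψ hv
  have hvL := S.u_le_v hL hu le_rfl
  have hα : 0 < √u := Real.sqrt_pos.2 hu0
  -- No ε is lost for rφ: on r = L one has v ≥ cu, so φ is already of order u^{−ω+s} there, and s ≤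
  -- 1/2 leaves room. In the remaining integral the factor u^{−1/2} absorbs u^s.
  have h2 : L * |S.phi u (S.curve L u)| ≤ L * K / S.c * u ^ (1 - ω) := by
    have e : u ^ (1 - ω + s) / u ≤ u ^ (1 - ω) := by
      rw [← Real.rpow_sub_one hu0.ne']
      exact Real.rpow_le_rpow_of_exponent_le hu (by linarith)
    calc L * |S.phi u (S.curve L u)| ≤ L * (K * u ^ (1 - ω + s) / (S.c * u)) := by
          gcongr
          exact (hφ _ le_rfl).trans (by gcongr)
      _ = L * K / S.c * (u ^ (1 - ω + s) / u) := by field_simp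
      _ ≤ _ := by gcongr
  have h3 : K * u ^ (1 - ω + s) / √u ≤ K * u ^ (1 - ω) := by
    rw [mul_div_assoc]
    gcongr
    rw [Real.sqrt_eq_rpow, ← Real.rpow_sub hu0]
    exact Real.rpow_le_rpow_of_exponent_le hu (by linarith)
  have h4 : 4 / S.c ^ 2 * (K * u ^ (1 - ω + s) / √u) ≤ 4 / S.c ^ 2 * (K * u ^ (1 - ω)) := by gcongr
  refine h1.trans ?_
  have e : (L * K / S.c + K / ((ω - 1) * S.c ^ 3) + 4 * K / S.c ^ 2) * u ^ (1 - ω) =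
    L * K / S.c * u ^ (1 - ω) + K / ((ω - 1) * S.c ^ 3) * u ^ (1 - ω)
      + 4 / S.c ^ 2 * (K * u ^ (1 - ω)) := by ring
  rw [e]
  linarith

/-- Decay of `θ`. -/
theorem abs_theta_le_of_weak (hω : 1 < ω) (hω3 : ω ≤ 3) {s K L u v : ℝ} (hs : 0 < s)
    (hL : S.R₁ < L) (hL1 : 1 ≤ L) (hu : 1 ≤ u) (hK : 0 < K) (hv : S.curve L u ≤ v)
    (hφ : |S.phi u v| ≤ K * u ^ (1 - ω + s) / v)
    (hψ : |S.psiV u v| ≤ K * v ^ (-ω) + K * u ^ (1 - ω + s) / (v * S.r u v)) :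
    |S.theta u v| ≤ (K / S.c ^ 3 + 2 * K) * v⁻¹ * u ^ (1 - ω + s) := by
  have hc := S.c_pos
  have hu0 : 0 < u := by linarith
  have hvL := S.u_le_v hL hu hv
  have hv0' := (S.lt_curve hL u).le.trans hv
  have hv0 : 0 < v := lt_of_lt_of_le (by positivity) hvL
  have hr1 : 1 ≤ S.r u v := hL1.trans ((S.curve_le_iff hL hv0').1 hv)
  have h1 : |S.theta u v| ≤ |S.psiV u v| + |S.phi u v| := by
    have e : S.theta u v = S.psiV u v - S.lam u v * S.phi u v := by
      unfold NullSystem.psiV; ring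
    rw [e]
    refine (abs_sub _ _).trans ?_
    rw [abs_mul, abs_of_pos (S.lam_pos u v)]
    have := mul_le_of_le_one_left (abs_nonneg (S.phi u v)) (S.lam_le u v)
    linarith
  have h2 : v ^ (-ω) ≤ u ^ (1 - ω + s) / S.c ^ 3 / v := by
    have h3 := mul_rpow_neg_le (p := ω - 1) hc S.c_le_one hu0 hvL (by linarith) (by linarith)
    rw [neg_sub] at h3
    have e : v ^ (-ω) = v ^ (1 - ω) / v := by
      rw [← Real.rpow_sub_one hv0.ne']; congr 1; ring
    rw [e]
    gcongr
    exact h3.trans (div_le_div_of_nonneg_right (Real.rpow_le_rpow_of_exponent_le hu (by linarith))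
      (by positivity))
  have h4 : K * u ^ (1 - ω + s) / (v * S.r u v) ≤ K * u ^ (1 - ω + s) / v := by
    apply div_le_div_of_nonneg_left (by positivity) hv0
    exact le_mul_of_one_le_right hv0.le hr1
  have h5 : K * v ^ (-ω) ≤ K * (u ^ (1 - ω + s) / S.c ^ 3 / v) := by gcongr
  calc |S.theta u v| ≤ K * (u ^ (1 - ω + s) / S.c ^ 3 / v) + K * u ^ (1 - ω + s) / v
        + K * u ^ (1 - ω + s) / v := by linarith
    _ = _ := by ring

/-- From `ζ` on `r = L` to `ζ` on `r ≥ L`. -/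
theorem abs_zeta_le_of_curve {s K L u v : ℝ} 
    (hL : S.R₁ < L) (hL1 : 1 ≤ L) (hu : 1 ≤ u) (hK : 0 < K)
    (hφ : ∀ y, S.curve L u ≤ y → |S.phi u y| ≤ K * u ^ (1 - ω + s) / y)
    (hv : S.curve L u ≤ v) :
    |S.zeta u v| ≤ |S.zeta u (S.curve L u)|
      + (2 * S.M * K / S.c ^ 2 + 2 * K / S.c) * u ^ (-ω + s) := by
  have hc := S.c_pos
  have hM := S.M_pos
  have hu0 : 0 < u := by linarith
  have hφ' : ∀ y, S.curve L u ≤ y → |S.phi u y| ≤ K / S.c * u ^ (-ω + s) := by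
    intro y hy
    have h1 := S.u_le_v hL hu hy
    refine (hφ y hy).trans ?_
    have e : u ^ (1 - ω + s) = u ^ (-ω + s) * u := by
      rw [← Real.rpow_add_one hu0.ne']; congr 1; ring
    rw [e]
    calc K * (u ^ (-ω + s) * u) / y ≤ K * (u ^ (-ω + s) * u) / (S.c * u) := by gcongr
      _ = _ := by field_simp
  set w := u ^ (-ω + s) with hw
  have hw0 : 0 < w := by positivity
  -- As λ ≥ c, ∂_v∂_uψ is at most D·λ/r², an exact derivative, so ∂_uψ changes by at most D beyond r
  -- = L.
  set D := 2 * S.M * (K / S.c * w) / S.c with hD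
  have hD0 : 0 < D := by positivity
  have h := abs_sub_le_sub_of_hasDerivAt (f := fun y => S.psiU u y)
    (g := fun y => -D * (S.r u y)⁻¹) (g' := fun y => D * (S.lam u y / S.r u y ^ 2)) hv
    (S.psiU_cont.slice_right u).continuousOn
    (continuous_const.mul ((S.r_cont.slice_right u).inv₀ fun y => S.r_ne u y)).continuousOn
    (fun y hy => S.psiU_v u ((S.lt_curve hL u).trans hy.1)) (fun y hy => ?_) (fun y hy => ?_)
  · have hr0 := S.r_pos u v
    have h1 : 0 ≤ D * (S.r u v)⁻¹ := by positivity
    have h2 : D * (S.r u (S.curve L u))⁻¹ ≤ D * 1 := by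
      rw [S.r_curve hL]
      gcongr
      exact inv_le_one_of_one_le₀ hL1
    have hnu : ∀ y, |S.nu u y| ≤ 1 := fun y => by
      rw [abs_of_neg (S.nu_neg u y)]; linarith [S.nu_ge u y]
    have h3 : |S.zeta u v| ≤ |S.psiU u v| + |S.phi u v| := by
      have e : S.zeta u v = S.psiU u v - S.nu u v * S.phi u v := by
        unfold NullSystem.psiU; ring
      rw [e]
      refine (abs_sub _ _).trans ?_
      rw [abs_mul]
      have := mul_le_of_le_one_left (abs_nonneg (S.phi u v)) (hnu v)
      linarith
    have h4 : |S.psiU u (S.curve L u)| ≤ |S.zeta u (S.curve L u)| + |S.phi u (S.curve L u)| := by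
      unfold NullSystem.psiU
      refine (abs_add_le _ _).trans ?_
      rw [abs_mul]
      have := mul_le_of_le_one_left (abs_nonneg (S.phi u (S.curve L u))) (hnu (S.curve L u))
      linarith
    have h5 := hφ' v hv
    have h6 := hφ' _ le_rfl
    have h7 := abs_sub_abs_le_abs_sub (S.psiU u v) (S.psiU u (S.curve L u))
    have e : (2 * S.M * K / S.c ^ 2 + 2 * K / S.c) * w = D * 1 + 2 * (K / S.c * w) := by
      rw [hD]; field_simp
    rw [e]
    linarith
  · refine (((S.r_v u y ((S.lt_curve hL u).trans hy.1)).inv (S.r_ne u y)).const_mul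
      (-D)).congr_deriv ?_
    ring
  · refine (S.abs_psiUV_le u y).trans ?_
    have h1 := hφ' y hy.1.le
    have h2 := S.nu_ge u y
    have h3 := S.nu_pos u y
    have h4 := S.lam_ge u y (S.R₁_le_r hL hy.1.le).le
    have hr := S.r_pos u y
    calc 2 * S.M * -S.nu u y / S.r u y ^ 2 * |S.phi u y|
        ≤ 2 * S.M * 1 / S.r u y ^ 2 * (K / S.c * w) := by gcongr; linarith
      _ = D * (S.c / S.r u y ^ 2) := by rw [hD]; field_simp
      _ ≤ _ := by gcongr

end Exterior

/-- Exponentials of powers decay faster than any power. -/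
theorem exists_exp_neg_mul_rpow_le {a s : ℝ} (ha : 0 < a) (hs : 0 < s) :
    ∃ D : ℝ, 0 < D ∧ ∀ u : ℝ, 1 ≤ u → Real.exp (-(a * u ^ s)) ≤ D * (u ^ 6)⁻¹ := by
  obtain ⟨n, hn⟩ := exists_nat_ge (6 / s)
  refine ⟨(n.factorial : ℝ) / a ^ n, by positivity, fun u hu => ?_⟩
  have hu0 : 0 < u := by linarith
  have h1 := Real.pow_div_factorial_le_exp (a * u ^ s) (by positivity) n
  have h2 : u ^ 6 ≤ (u ^ s) ^ n := by
    rw [← Real.rpow_natCast, ← Real.rpow_natCast, ← Real.rpow_mul hu0.le]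
    apply Real.rpow_le_rpow_of_exponent_le hu
    rw [div_le_iff₀ hs] at hn
    push_cast
    linarith
  rw [div_le_iff₀ (by positivity), mul_pow] at h1
  rw [Real.exp_neg, inv_le_comm₀ (Real.exp_pos _) (by positivity), mul_inv, inv_inv, inv_div,
    div_mul_eq_mul_div, div_le_iff₀ (by positivity)]
  calc a ^ n * u ^ 6 ≤ a ^ n * (u ^ s) ^ n := by gcongr
    _ ≤ _ := h1

namespace Exterior

variable {v₀ ω : ℝ} (S : Exterior v₀ ω)

/-- Decay of `ζ` on a curve of constant radius. -/
theorem exists_abs_zeta_curve_le (hω : 1 < ω) (hω3 : ω ≤ 3) {s : ℝ} (hs : 0 < s) (hs4 : s ≤ 1 / 4)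
    {L₀ u₁ K : ℝ} (hL₀ : S.R₁ + 1 ≤ L₀) (hK : 0 < K)
    (hψ : ∀ L u v, L₀ ≤ L → u₁ ≤ u → S.curve L u ≤ v →
        |S.psiV u v| ≤ K * v ^ (-ω) + K * u ^ (1 - ω + s) / (v * S.r u v)) :
    ∃ L u₂ C : ℝ, L₀ ≤ L ∧ L ≤ u₂ ∧ 1 ≤ u₂ ∧ u₁ ≤ u₂ ∧ 0 < C ∧ ∀ u, u₂ ≤ u →
      |S.zeta u (S.curve L u)| ≤ C * u ^ (-ω + 2 * s) := by
  obtain ⟨R, B, L₁, hR, hB, hRL₁, hL₁1, hE⟩ := S.exists_energy_le (by linarith) hs (by linarith)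
  have hc := S.c_pos
  have hc1 := S.c_le_one
  have hq := S.q₀_pos
  have hρ := S.ρ_pos
  have hZ := S.Z_nonneg
  set L := max L₀ L₁ with hLdef
  have hLL₀ : L₀ ≤ L := le_max_left _ _
  have hLL₁ : L₁ ≤ L := le_max_right _ _
  have hL1 : 1 ≤ L := hL₁1.trans hLL₁
  have hL0 : 0 < L := by linarith
  have hLR : S.R₁ < L := by linarith
  have hRL : R ≤ L := hRL₁.trans hLL₁
  set k := 2 * S.c * S.q₀ / L ^ 2 with hk
  have hk0 : 0 < k := by positivity
  obtain ⟨D, hD, hexp⟩ := exists_exp_neg_mul_rpow_le (a := k * S.c) (by positivity) hs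
  set C₁ := 128 * K / S.c ^ 3 with hC₁
  have hC₁0 : 0 < C₁ := by positivity
  set C₂ := D * S.Z ^ 2 + L ^ 2 / (S.c * S.q₀ * S.ρ ^ 2) * (B * ((L + 1) ^ 2 * (64 + C₁ ^ 2)))
    with hC₂
  have hC₂0 : 0 ≤ C₂ := by positivity
  -- u ≥ 64 gives √u ≤ u/8, u ≥ 16L² makes room for L² in the radius used below, and u ≥ 4|u₁| keeps
  -- all times above u/4 in the range of the hypothesis.
  refine ⟨L, 64 + 16 * L ^ 2 + 4 * |u₁|, C₂ + 1, hLL₀, ?_, ?_, ?_, by linarith, ?_⟩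
  · have := le_self_pow₀ hL1 two_ne_zero
    linarith [abs_nonneg u₁, sq_nonneg L]
  · linarith [abs_nonneg u₁, sq_nonneg L]
  · linarith [abs_nonneg u₁, sq_nonneg L, le_abs_self u₁]
  intro u hu
  have hu64 : 64 ≤ u := by linarith [abs_nonneg u₁, sq_nonneg L]
  have huL : 16 * L ^ 2 ≤ u := by linarith [abs_nonneg u₁, sq_nonneg L]
  have huu₁ : 4 * u₁ ≤ u := by linarith [le_abs_self u₁, sq_nonneg L]
  have hu1 : 1 ≤ u := by linarith
  have hu0 : 0 < u := by linarith
  -- The red-shift acts between `curve R (u − Δ)` and `curve L u`, an interval of length at least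
  -- cΔ: long enough for its exponential to beat all powers, short enough to lose only small powers
  -- of u elsewhere.
  set Δ := u ^ s with hΔ
  have hΔ1 : 1 ≤ Δ := Real.one_le_rpow hu1 hs.le
  have hΔ0 : 0 < Δ := by linarith
  have hα : √u ≤ u / 8 := by
    rw [Real.sqrt_le_left (by linarith)]
    nlinarith
  -- s ≤ 1/4 gives Δ² ≤ √u, which keeps (L + Δ)² below u − Δ as the energy estimate requires.
  have hΔ2 : Δ ^ 2 ≤ u / 8 := by
    refine le_trans ?_ hα
    rw [hΔ, ← Real.rpow_natCast, ← Real.rpow_mul hu0.le, Real.sqrt_eq_rpow]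
    exact Real.rpow_le_rpow_of_exponent_le hu1 (by push_cast; linarith)
  have hΔu : Δ ≤ u / 8 := (le_self_pow₀ hΔ1 two_ne_zero).trans hΔ2
  set x := u - Δ with hx
  have hxu : u / 2 ≤ x := by linarith
  have hx1 : 1 ≤ x := by linarith
  have hx0 : 0 < x := by linarith
  have hxle : x ≤ u := by linarith
  -- Since −ν ≤ 1, going back by Δ in u raises r by at most Δ. Hence the point of r = L at time u
  -- lies in r ≤ L' at time x, and monotonicity of ϖ compares the masses.
  set L' := L + Δ with hL'
  have hLL' : L ≤ L' := by linarith
  have hL'1 : 1 ≤ L' := by linarith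
  have hL'R : S.R₁ < L' := by linarith
  have hL'2 : L' ^ 2 ≤ x := by
    have : L' ^ 2 ≤ 2 * L ^ 2 + 2 * Δ ^ 2 := by
      rw [hL']; nlinarith only [sq_nonneg (L - Δ)]
    linarith
  have hL'le : L' ≤ (L + 1) * Δ := by
    have : L ≤ L * Δ := le_mul_of_one_le_right hL0.le hΔ1
    linarith
  set w := u ^ (-ω + s) with hw
  have hw0 : 0 < w := by positivity
  have hw2 : (u ^ 6)⁻¹ ≤ w ^ 2 := by
    have : w ^ 2 = u ^ (2 * (-ω + s)) := by
      rw [hw, ← Real.rpow_natCast, ← Real.rpow_mul hu0.le]; congr 1; push_cast; ring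
    rw [this, ← Real.rpow_natCast, ← Real.rpow_neg hu0.le]
    apply Real.rpow_le_rpow_of_exponent_le hu1
    push_cast
    linarith
  have hx6 : (x ^ 6)⁻¹ ≤ 64 * w ^ 2 := by
    calc (x ^ 6)⁻¹ ≤ ((u / 2) ^ 6)⁻¹ := by gcongr
      _ = 64 * (u ^ 6)⁻¹ := by rw [div_pow, inv_div]; ring
      _ ≤ _ := by gcongr
  have hG : ∀ y ∈ Icc (x / 2) x, |S.psiV y (S.curve L' y)| ≤ C₁ * w := by
    intro y hy
    have hyu : u / 2 / 2 ≤ y := by linarith [hy.1]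
    have hy1 : 1 ≤ y := by linarith
    have hy0 : 0 < y := by linarith
    have h1 := hψ L' y (S.curve L' y) (by linarith) (by linarith) le_rfl
    have h2 := S.u_le_v hL'R hy1 (v := S.curve L' y) le_rfl
    rw [S.r_curve hL'R] at h1
    refine h1.trans ?_
    generalize S.curve L' y = t at *
    have ht0 : 0 < t := lt_of_lt_of_le (by positivity) h2
    have h3 := mul_rpow_neg_le (p := ω) hc hc1 hy0 h2 (by linarith) hω3
    have h4 : y ^ (-ω) ≤ y ^ (-ω + s) := Real.rpow_le_rpow_of_exponent_le hy1 (by linarith)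
    have e : y ^ (1 - ω + s) = y ^ (-ω + s) * y := by
      rw [← Real.rpow_add_one hy0.ne']; congr 1; ring
    have h5 : y ^ (-ω + s) ≤ 64 * w := by
      have a1 := rpow_neg_le_of_half_le (p := ω - s) (by linarith) hyu (by linarith) (by linarith)
      have a2 := rpow_neg_le_of_half_le (p := ω - s) hu0 (le_refl (u / 2)) (by linarith)
        (by linarith)
      rw [neg_sub, show s - ω = -ω + s by ring] at a1 a2
      linarith
    have h6 : 1 / S.c ≤ 1 / S.c ^ 3 := by
      apply one_div_le_one_div_of_le (by positivity)
      exact pow_le_of_le_one hc.le hc1 (by norm_num)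
    calc K * t ^ (-ω) + K * y ^ (1 - ω + s) / (t * L')
        ≤ K * (y ^ (-ω + s) / S.c ^ 3) + K * (y ^ (-ω + s) * y) / (S.c * y * 1) := by
          rw [e]
          gcongr
          exact h3.trans (by gcongr)
      _ = K * y ^ (-ω + s) * (1 / S.c ^ 3) + K * y ^ (-ω + s) * (1 / S.c) := by field_simp
      _ ≤ K * y ^ (-ω + s) * (1 / S.c ^ 3) + K * y ^ (-ω + s) * (1 / S.c ^ 3) := by gcongr
      _ = 2 * K / S.c ^ 3 * y ^ (-ω + s) := by ring
      _ ≤ 2 * K / S.c ^ 3 * (64 * w) := by gcongr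
      _ = C₁ * w := by rw [hC₁]; ring
  have hm := (hE L' x u (C₁ * w) (by linarith) (by linarith) hxle hL'2 hG).2
  set a := S.curve R x with ha
  set b := S.curve L u with hb
  have hav₀ : v₀ ≤ a := (S.lt_curve hR x).le
  have hbv₀ : v₀ ≤ b := (S.lt_curve hLR u).le
  have hba : S.c * Δ ≤ b - a := by
    have h1 := S.curve_ge_linear hR hx1 hxle
    have h2 := S.curve_le_curve hR hRL u
    have h3 : u - x = Δ := by rw [hx]; ring
    rw [h3] at h1
    linarith
  have hab : a ≤ b := by
    have : 0 ≤ S.c * Δ := by positivity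
    linarith
  have hsq := S.sq_ratio_le (u := u) hab hav₀ (L := L) (fun v hv => by
    rw [← S.r_curve hLR u]
    exact (S.r_strictMonoOn u).monotoneOn (hav₀.trans hv.1) hbv₀ hv.2)
  have hmb : S.mass u b ≤ S.mass x (S.curve L' x) := by
    refine (S.mass_anti_u b hx1 hu1 hxle).trans ?_
    refine S.mass_mono_v x hbv₀ (S.lt_curve hL'R x).le ?_
    by_contra hcon
    push Not at hcon
    rw [S.curve_lt_iff hL'R hbv₀] at hcon
    have h1 := sub_le_sub_of_hasDerivAt_le (f := fun y => -S.r y b) (f' := fun y => -S.nu y b)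
      (g := fun y => y) (g' := fun _ => 1) hxle (S.r_cont.slice_left b).neg.continuousOn
      (by fun_prop) (fun y hy => (S.r_u y (hx1.trans_lt hy.1) b).neg) (fun y _ => hasDerivAt_id y)
      (fun y _ => by linarith [S.nu_ge y b])
    simp only [hb, S.r_curve hLR] at h1
    rw [← hb] at h1
    linarith
  have hmdiff : S.mass u b - S.mass u a ≤ B * (((L + 1) * Δ) ^ 2 * ((64 + C₁ ^ 2) * w ^ 2)) := by
    have h1 : S.mass u b - S.mass u a ≤ B * (L' * ((x ^ 6)⁻¹ + L' ^ s * (C₁ * w) ^ 2)) := by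
      linarith
    refine h1.trans ?_
    have h2 : L' ^ s ≤ L' := by
      calc L' ^ s ≤ L' ^ (1 : ℝ) := Real.rpow_le_rpow_of_exponent_le hL'1 (by linarith)
        _ = L' := Real.rpow_one _
    calc B * (L' * ((x ^ 6)⁻¹ + L' ^ s * (C₁ * w) ^ 2))
        ≤ B * (L' * (L' * (64 * w ^ 2) + L' * (C₁ * w) ^ 2)) := by
          gcongr
          exact hx6.trans (le_mul_of_one_le_left (by positivity) hL'1)
      _ = B * (L' ^ 2 * ((64 + C₁ ^ 2) * w ^ 2)) := by ring
      _ ≤ _ := by gcongr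
  have hexp' : Real.exp (-(k * (b - a))) ≤ D * (Δ ^ 2 * w ^ 2) := by
    have h1 : Real.exp (-(k * (b - a))) ≤ Real.exp (-(k * S.c * Δ)) := by
      apply Real.exp_le_exp.2
      have : k * (S.c * Δ) ≤ k * (b - a) := by gcongr
      linarith
    refine (h1.trans (hexp u hu1)).trans ?_
    gcongr
    exact hw2.trans (le_mul_of_one_le_left (by positivity) (one_le_pow₀ hΔ1))
  have hfin : S.ratio u b ^ 2 ≤ ((C₂ + 1) * (Δ * w)) ^ 2 := by
    calc S.ratio u b ^ 2 ≤ D * (Δ ^ 2 * w ^ 2) * S.Z ^ 2 + L ^ 2 / (S.c * S.q₀ * S.ρ ^ 2) *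
          (B * (((L + 1) * Δ) ^ 2 * ((64 + C₁ ^ 2) * w ^ 2))) := hsq.trans (by gcongr)
      _ = C₂ * (Δ * w) ^ 2 := by rw [hC₂]; ring
      _ ≤ (C₂ + 1) ^ 2 * (Δ * w) ^ 2 := by
          gcongr
          exact le_trans (by linarith) (le_self_pow₀ (by linarith) two_ne_zero)
      _ = _ := by ring
  have e : Δ * w = u ^ (-ω + 2 * s) := by
    rw [hΔ, hw, ← Real.rpow_add hu0]; congr 1; ring
  rw [← e]
  exact (S.abs_zeta_le_ratio u b).trans (abs_le_of_sq_le_sq hfin (by positivity))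

/-- Decay on `u ≥ u₂`, `r ≥ L`. -/
theorem exists_late_decay (hω : 1 < ω) (hω3 : ω ≤ 3) {s : ℝ} (hs : 0 < s) (hs4 : s ≤ 1 / 4)
    (hsω : s ≤ ω - 1) :
    ∃ L u₂ C : ℝ, S.R₁ + 1 ≤ L ∧ 1 ≤ L ∧ 1 ≤ u₂ ∧ 0 < C ∧ ∀ u v, u₂ ≤ u → S.curve L u ≤ v →
      |S.theta u v| ≤ C * v⁻¹ * u ^ (1 - ω + s) ∧ |S.zeta u v| ≤ C * u ^ (-ω + 2 * s) ∧
        |S.psi u v| ≤ C * u ^ (1 - ω) := by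
  obtain ⟨L₀, u₁, K, hL₀, hL₀1, hu₁, hK, hweak⟩ := S.exists_weak_decay hω hω3 hs (by linarith) hsω
  obtain ⟨L, u₂, C, hL, hLu₂, hu₂1, hu₁₂, hC, hζ⟩ := S.exists_abs_zeta_curve_le hω hω3 hs hs4 hL₀ hK
    fun L u v h1 h2 h3 => (hweak L u v h1 h2 h3).2
  have hc := S.c_pos
  have hM := S.M_pos
  have hLR : S.R₁ < L := by linarith
  have hL1 : 1 ≤ L := by linarith
  have hω1 : 0 < ω - 1 := by linarith
  set C₁ := K / S.c ^ 3 + 2 * K with hC₁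
  set C₂ := C + (2 * S.M * K / S.c ^ 2 + 2 * K / S.c) with hC₂
  set C₃ := L * K / S.c + K / ((ω - 1) * S.c ^ 3) + 4 * K / S.c ^ 2 with hC₃
  have p1 : 0 < C₁ := by positivity
  have p2 : 0 < C₂ := by positivity
  have p3 : 0 < C₃ := by positivity
  refine ⟨L, u₂, C₁ + C₂ + C₃, by linarith, hL1, hu₂1, by positivity, ?_⟩
  intro u v hu hv
  have hu1 : 1 ≤ u := by linarith
  have hu0 : 0 < u := by linarith
  have hv0 : 0 < v := lt_of_lt_of_le (by linarith [S.one_le_v₀]) ((S.lt_curve hLR u).le.trans hv)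
  have hw := fun y hy => hweak L u y hL (hu₁₂.trans hu) hy
  refine ⟨?_, ?_, ?_⟩
  · refine (S.abs_theta_le_of_weak hω hω3 hs hLR hL1 hu1 hK hv (hw v hv).1 (hw v hv).2).trans ?_
    rw [← hC₁]
    gcongr
    linarith
  · refine (S.abs_zeta_le_of_curve hLR hL1 hu1 hK (fun y hy => (hw y hy).1) hv).trans ?_
    have h1 : u ^ (-ω + s) ≤ u ^ (-ω + 2 * s) :=
      Real.rpow_le_rpow_of_exponent_le hu1 (by linarith)
    have h2 : (2 * S.M * K / S.c ^ 2 + 2 * K / S.c) * u ^ (-ω + s) ≤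
      (2 * S.M * K / S.c ^ 2 + 2 * K / S.c) * u ^ (-ω + 2 * s) := by gcongr
    have h3 : 0 ≤ (C₁ + C₃) * u ^ (-ω + 2 * s) := by positivity
    have h4 := hζ u hu
    have e : (C₁ + C₂ + C₃) * u ^ (-ω + 2 * s) = C * u ^ (-ω + 2 * s) +
      (2 * S.M * K / S.c ^ 2 + 2 * K / S.c) * u ^ (-ω + 2 * s) + (C₁ + C₃) * u ^ (-ω + 2 * s) := by
      rw [hC₂]; ring
    rw [e]
    linarith
  · refine (S.abs_psi_le_of_weak hω hω3 (by linarith) hLR hL1 (hLu₂.trans hu) hK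
      (fun y hy => (hw y hy).1) (fun y hy => (hw y hy).2) hv).trans ?_
    rw [← hC₃]
    gcongr
    linarith

/-- Bounds on bounded ranges of `u`, for `r ≥ L`. -/
theorem exists_early_bound (hω : 1 < ω) {L : ℝ} (hL : S.R₁ + 1 ≤ L) (hL1 : 1 ≤ L) (U : ℝ)
    (hU : 1 ≤ U) : ∃ C : ℝ, 0 < C ∧ ∀ u v, 1 ≤ u → u ≤ U → S.curve L u ≤ v →
      |S.theta u v| ≤ C * v⁻¹ ∧ |S.zeta u v| ≤ C ∧ |S.psi u v| ≤ C := by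
  have hLR : S.R₁ < L := by linarith
  have hA := S.A_nonneg
  have hZ := S.Z_nonneg
  have hM := S.M_pos
  have hV := S.one_le_V
  set E := (S.A + S.Z) * U with hE
  have hE0 : 0 ≤ E := by positivity
  set C := 1 + S.Z + E + (S.A + (S.M * E + E) * (S.V * (U + 1))) with hC
  have p1 : 0 ≤ (S.M * E + E) * (S.V * (U + 1)) := by positivity
  refine ⟨C, by linarith, ?_⟩
  intro u v hu huU hv
  have hv0' := (S.lt_curve hLR u).le.trans hv
  have hv1 : 1 ≤ v := S.one_le_v₀.trans hv0'
  have hv0 : 0 < v := by linarith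
  have hr0 := S.r_pos u v
  have hr1 : 1 ≤ S.r u v := hL1.trans ((S.curve_le_iff hLR hv0').1 hv)
  have hψ : |S.psi u v| ≤ E := (S.abs_psi_le_crude hu hv0').trans (by rw [hE]; gcongr)
  refine ⟨?_, ?_, by linarith⟩
  · have h1 := S.abs_psiV_sub_le hu hv0'
    have h2 := S.abs_psiV_data hv0'
    have h3 : v ^ (-ω) ≤ v⁻¹ := by
      rw [← Real.rpow_neg_one]
      exact Real.rpow_le_rpow_of_exponent_le hv1 (by linarith)
    have h4 : (S.r u v)⁻¹ ≤ S.V * (U + 1) * v⁻¹ := by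
      rw [inv_eq_one_div, div_le_iff₀ hr0, mul_right_comm, ← div_eq_mul_inv, le_div_iff₀ hv0, one_mul]
      calc v ≤ S.V * (u + S.r u v) := S.v_le hL hu hv
        _ ≤ S.V * (U * S.r u v + S.r u v) := by
            gcongr
            exact huU.trans (le_mul_of_one_le_right (by linarith) hr1)
        _ = _ := by ring
    have h5 : (S.r u v ^ 2)⁻¹ ≤ (S.r u v)⁻¹ :=
      inv_anti₀ hr0 (le_self_pow₀ hr1 two_ne_zero)
    have h6 : S.M * ((S.A + S.Z) * u) * (S.r u v ^ 2)⁻¹ ≤ S.M * E * (S.V * (U + 1) * v⁻¹) := by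
      rw [hE]
      gcongr
      exact h5.trans h4
    have h7 : 0 ≤ S.M * ((S.A + S.Z) * u) * (S.r 1 v ^ 2)⁻¹ := by positivity
    have h8 : |S.phi u v| ≤ E * (S.V * (U + 1) * v⁻¹) := by
      rw [S.abs_phi_eq, div_eq_mul_inv]
      gcongr
    have h9 : |S.theta u v| ≤ |S.psiV u v| + |S.phi u v| := by
      have e : S.theta u v = S.psiV u v - S.lam u v * S.phi u v := by
        unfold NullSystem.psiV; ring
      rw [e]
      refine (abs_sub _ _).trans ?_
      rw [abs_mul, abs_of_pos (S.lam_pos u v)]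
      have := mul_le_of_le_one_left (abs_nonneg (S.phi u v)) (S.lam_le u v)
      linarith
    have h10 : S.A * v ^ (-ω) ≤ S.A * v⁻¹ := by gcongr
    have h11 := abs_sub_abs_le_abs_sub (S.psiV u v) (S.psiV 1 v)
    have h12 : 0 ≤ (1 + S.Z + E) * v⁻¹ := by positivity
    have e : C * v⁻¹ = (1 + S.Z + E) * v⁻¹ + S.A * v⁻¹ + S.M * E * (S.V * (U + 1) * v⁻¹)
      + E * (S.V * (U + 1) * v⁻¹) := by rw [hC]; ring
    rw [e]
    linarith
  · have h1 := S.zeta_le u v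
    have h2 : S.Z * -S.nu u v ≤ S.Z * 1 := by
      gcongr
      linarith [S.nu_ge u v]
    linarith

/-- Decay for `r ≥ L`. -/
theorem exists_decay (hω : 1 < ω) (hω3 : ω ≤ 3) {ε : ℝ} (hε : 0 < ε) :
    ∃ L C : ℝ, S.R₁ < L ∧ 0 < C ∧ ∀ u v, 1 ≤ u → S.curve L u ≤ v →
      |S.theta u v| ≤ C * v⁻¹ * u ^ (-ω + 1 + ε) ∧ |S.zeta u v| ≤ C * u ^ (-ω + ε) ∧
        |S.psi u v| ≤ C * u ^ (-ω + 1) := by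
  -- ζ loses u^{2s}, so 2s ≤ ε is needed; the other bounds are the range of s in which decay was
  -- derived.
  set s := min (ε / 2) (min (1 / 4) (ω - 1)) with hs
  have hs0 : 0 < s := by
    have : 0 < ω - 1 := by linarith
    positivity
  have hs1 : s ≤ ε / 2 := min_le_left _ _
  have hs2 : s ≤ 1 / 4 := (min_le_right _ _).trans (min_le_left _ _)
  have hs3 : s ≤ ω - 1 := (min_le_right _ _).trans (min_le_right _ _)
  obtain ⟨L, u₂, C, hL, hL1, hu₂, hC, hlate⟩ := S.exists_late_decay hω hω3 hs0 hs2 hs3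
  obtain ⟨C', hC', hearly⟩ := S.exists_early_bound hω hL hL1 u₂ hu₂
  have hu₂0 : 0 < u₂ := by linarith
  refine ⟨L, C + C' * u₂ ^ 3, by linarith, by positivity, ?_⟩
  intro u v hu hv
  have hu0 : 0 < u := by linarith
  have hv0 : 0 < v := lt_of_lt_of_le (by linarith [S.one_le_v₀])
    ((S.lt_curve (by linarith : S.R₁ < L) u).le.trans hv)
  rcases le_or_gt u₂ u with h | h
  · obtain ⟨h1, h2, h3⟩ := hlate u v h hv
    have p : 0 ≤ C' * u₂ ^ 3 := by positivity
    refine ⟨h1.trans ?_, h2.trans ?_, h3.trans ?_⟩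
    · have : u ^ (1 - ω + s) ≤ u ^ (-ω + 1 + ε) :=
        Real.rpow_le_rpow_of_exponent_le hu (by linarith)
      gcongr
      linarith
    · have : u ^ (-ω + 2 * s) ≤ u ^ (-ω + ε) :=
        Real.rpow_le_rpow_of_exponent_le hu (by linarith)
      gcongr
      linarith
    · rw [show 1 - ω = -ω + 1 by ring]
      gcongr
      linarith
  · obtain ⟨h1, h2, h3⟩ := hearly u v hu h.le hv
    -- All exponents of u in the claim are at least −ω ≥ −3, so for u ≤ u₂ a factor u₂³ turns
    -- boundedness into the required form.
    have key : ∀ p : ℝ, -3 ≤ p → C' ≤ (C + C' * u₂ ^ 3) * u ^ p := by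
      intro p hp
      have a1 : (u₂ ^ 3)⁻¹ ≤ u ^ p := by
        calc (u₂ ^ 3)⁻¹ ≤ (u ^ 3)⁻¹ := by gcongr
          _ = u ^ (-3 : ℝ) := by rw [Real.rpow_neg hu0.le]; norm_num
          _ ≤ _ := Real.rpow_le_rpow_of_exponent_le hu hp
      calc C' = C' * u₂ ^ 3 * (u₂ ^ 3)⁻¹ := by field_simp
        _ ≤ (C + C' * u₂ ^ 3) * u ^ p := by gcongr; linarith
    refine ⟨h1.trans ?_, h2.trans (key _ (by linarith)), h3.trans (key _ (by linarith))⟩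
    rw [mul_right_comm]
    gcongr
    exact key _ (by linarith)

end Exterior

/-! ### From the spacetime data to the reduced system -/

namespace NullData

variable (S : NullData)

theorem one_mem_uRange : (1 : ℝ) ∈ S.uRange := ⟨le_rfl, S.one_lt_U₀.le⟩

theorem one_mem_vRange : (1 : ℝ) ∈ S.vRange := ⟨le_rfl, by exact_mod_cast S.one_lt_V₀⟩

theorem uRange_uniqueDiffOn : UniqueDiffOn ℝ S.uRange := uniqueDiffOn_Icc S.one_lt_U₀

theorem vRange_ordConnected : S.vRange.OrdConnected := by
  refine ⟨fun x hx y hy z hz => ⟨hx.1.trans hz.1, lt_of_le_of_lt ?_ hy.2⟩⟩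
  exact_mod_cast hz.2

theorem exists_gt_of_mem_vRange {v : ℝ} (hv : v ∈ S.vRange) : ∃ w ∈ S.vRange, v < w := by
  obtain ⟨w, hw1, hw2⟩ := EReal.lt_iff_exists_real_btwn.1 hv.2
  have hw : v < w := by exact_mod_cast hw1
  exact ⟨w, ⟨hv.1.trans hw.le, hw2⟩, hw⟩

theorem vRange_mem_nhds {v : ℝ} (hv : v ∈ S.vRange) (h1 : 1 < v) : S.vRange ∈ 𝓝 v := by
  obtain ⟨w, hw, hvw⟩ := S.exists_gt_of_mem_vRange hv
  exact mem_of_superset (Icc_mem_nhds h1 hvw) (S.vRange_ordConnected.out S.one_mem_vRange hw)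

theorem vRange_convex : Convex ℝ S.vRange := S.vRange_ordConnected.convex

theorem vRange_uniqueDiffOn : UniqueDiffOn ℝ S.vRange := by
  apply uniqueDiffOn_convex S.vRange_convex
  obtain ⟨w, hw, hvw⟩ := S.exists_gt_of_mem_vRange S.one_mem_vRange
  refine ⟨(1 + w) / 2, mem_interior_iff_mem_nhds.2 (S.vRange_mem_nhds ?_ (by linarith))⟩
  exact S.vRange_ordConnected.out S.one_mem_vRange hw ⟨by linarith, by linarith⟩

theorem dom_uniqueDiffOn : UniqueDiffOn ℝ S.dom := S.uRange_uniqueDiffOn.prod S.vRange_uniqueDiffOn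

variable {S}

theorem hasPartialU_of_contDiffOn {f : ℝ → ℝ → ℝ}
    (hf : ContDiffOn ℝ 1 (fun p : ℝ × ℝ => f p.1 p.2) S.dom) :
    S.HasPartialU f (S.partialU f) ∧ ContinuousOn (fun p : ℝ × ℝ => S.partialU f p.1 p.2) S.dom := by
  have key : ∀ u ∈ S.uRange, ∀ v ∈ S.vRange, HasDerivWithinAt (fun x => f x v)
      (fderivWithin ℝ (fun p : ℝ × ℝ => f p.1 p.2) S.dom (u, v) (1, 0)) S.uRange u := by
    intro u hu v hv
    have h1 := ((hf.differentiableOn one_ne_zero) (u, v) ⟨hu, hv⟩).hasFDerivWithinAt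
    have h2 : HasDerivWithinAt (fun x : ℝ => (x, v)) ((1 : ℝ), (0 : ℝ)) S.uRange u :=
      (hasDerivWithinAt_id u S.uRange).prodMk (hasDerivWithinAt_const u S.uRange v)
    exact h1.comp_hasDerivWithinAt u h2 fun x hx => (⟨hx, hv⟩ : (x, v) ∈ S.dom)
  have key2 : ∀ u ∈ S.uRange, ∀ v ∈ S.vRange, S.partialU f u v =
      fderivWithin ℝ (fun p : ℝ × ℝ => f p.1 p.2) S.dom (u, v) (1, 0) := fun u hu v hv =>
    (key u hu v hv).derivWithin (S.uRange_uniqueDiffOn u hu)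
  refine ⟨fun u hu v hv => by rw [key2 u hu v hv]; exact key u hu v hv, ?_⟩
  have h3 := (hf.continuousOn_fderivWithin S.dom_uniqueDiffOn le_rfl).clm_apply
    (continuousOn_const (c := ((1 : ℝ), (0 : ℝ))))
  exact h3.congr fun p hp => key2 p.1 hp.1 p.2 hp.2

theorem hasPartialV_of_contDiffOn {f : ℝ → ℝ → ℝ}
    (hf : ContDiffOn ℝ 1 (fun p : ℝ × ℝ => f p.1 p.2) S.dom) :
    S.HasPartialV f (S.partialV f) ∧ ContinuousOn (fun p : ℝ × ℝ => S.partialV f p.1 p.2) S.dom := by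
  have key : ∀ u ∈ S.uRange, ∀ v ∈ S.vRange, HasDerivWithinAt (fun y => f u y)
      (fderivWithin ℝ (fun p : ℝ × ℝ => f p.1 p.2) S.dom (u, v) (0, 1)) S.vRange v := by
    intro u hu v hv
    have h1 := ((hf.differentiableOn one_ne_zero) (u, v) ⟨hu, hv⟩).hasFDerivWithinAt
    have h2 : HasDerivWithinAt (fun y : ℝ => (u, y)) ((0 : ℝ), (1 : ℝ)) S.vRange v :=
      (hasDerivWithinAt_const v S.vRange u).prodMk (hasDerivWithinAt_id v S.vRange)
    exact h1.comp_hasDerivWithinAt v h2 fun x hx => (⟨hu, hx⟩ : (u, x) ∈ S.dom)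
  have key2 : ∀ u ∈ S.uRange, ∀ v ∈ S.vRange, S.partialV f u v =
      fderivWithin ℝ (fun p : ℝ × ℝ => f p.1 p.2) S.dom (u, v) (0, 1) := fun u hu v hv =>
    (key u hu v hv).derivWithin (S.vRange_uniqueDiffOn v hv)
  refine ⟨fun u hu v hv => by rw [key2 u hu v hv]; exact key u hu v hv, ?_⟩
  have h3 := (hf.continuousOn_fderivWithin S.dom_uniqueDiffOn le_rfl).clm_apply
    (continuousOn_const (c := ((0 : ℝ), (1 : ℝ))))
  exact h3.congr fun p hp => key2 p.1 hp.1 p.2 hp.2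

/-- The right-hand side of the equation for `∂_u λ = ∂_v ν`. -/
noncomputable def rUV (S : NullData) (u v : ℝ) : ℝ :=
  2 * S.kappa u v * S.nu u v * (S.varpi u v - S.e ^ 2 / S.r u v) / S.r u v ^ 2

namespace Admissible

variable {ω : ℝ} (hS : S.Admissible ω)
include hS

theorem hasPartialU_r : S.HasPartialU S.r S.nu :=
  (hasPartialU_of_contDiffOn (hS.contDiffOn_r.of_le (by norm_num))).1

theorem hasPartialV_r : S.HasPartialV S.r S.lam :=
  (hasPartialV_of_contDiffOn (hS.contDiffOn_r.of_le (by norm_num))).1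

theorem continuousOn_r : ContinuousOn (fun p : ℝ × ℝ => S.r p.1 p.2) S.dom :=
  hS.contDiffOn_r.continuousOn

theorem continuousOn_φ : ContinuousOn (fun p : ℝ × ℝ => S.φ p.1 p.2) S.dom :=
  hS.contDiffOn_φ.continuousOn

theorem continuousOn_nu : ContinuousOn (fun p : ℝ × ℝ => S.nu p.1 p.2) S.dom :=
  (hasPartialU_of_contDiffOn (hS.contDiffOn_r.of_le (by norm_num))).2

theorem continuousOn_lam : ContinuousOn (fun p : ℝ × ℝ => S.lam p.1 p.2) S.dom :=
  (hasPartialV_of_contDiffOn (hS.contDiffOn_r.of_le (by norm_num))).2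

theorem continuousOn_zeta : ContinuousOn (fun p : ℝ × ℝ => S.zeta p.1 p.2) S.dom :=
  hS.continuousOn_r.mul (hasPartialU_of_contDiffOn hS.contDiffOn_φ).2

theorem continuousOn_theta : ContinuousOn (fun p : ℝ × ℝ => S.theta p.1 p.2) S.dom :=
  hS.continuousOn_r.mul (hasPartialV_of_contDiffOn hS.contDiffOn_φ).2

theorem r_ne {u v : ℝ} (hu : u ∈ S.uRange) (hv : v ∈ S.vRange) : S.r u v ≠ 0 :=
  (hS.r_pos u hu v hv).ne'

theorem nu_ne {u v : ℝ} (hu : u ∈ S.uRange) (hv : v ∈ S.vRange) : S.nu u v ≠ 0 :=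
  (hS.nu_neg u hu v hv).ne

theorem hasPartialU_φ : S.HasPartialU S.φ fun u v => S.zeta u v / S.r u v := by
  intro u hu v hv
  have h := (hasPartialU_of_contDiffOn hS.contDiffOn_φ).1 u hu v hv
  rwa [show S.partialU S.φ u v = S.zeta u v / S.r u v from
    (mul_div_cancel_left₀ _ (hS.r_ne hu hv)).symm] at h

theorem hasPartialV_φ : S.HasPartialV S.φ fun u v => S.theta u v / S.r u v := by
  intro u hu v hv
  have h := (hasPartialV_of_contDiffOn hS.contDiffOn_φ).1 u hu v hv
  rwa [show S.partialV S.φ u v = S.theta u v / S.r u v from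
    (mul_div_cancel_left₀ _ (hS.r_ne hu hv)).symm] at h

theorem kappa_pos {u v : ℝ} (hu : u ∈ S.uRange) (hv : v ∈ S.vRange) : 0 < S.kappa u v := by
  have h1 := hS.Ω_pos u hu v hv
  have h2 := inv_lt_zero.2 (hS.nu_neg u hu v hv)
  unfold kappa
  have : 0 < S.Ω u v ^ 2 := by positivity
  nlinarith [mul_pos this (neg_pos.2 h2)]

theorem continuousOn_kappa : ContinuousOn (fun p : ℝ × ℝ => S.kappa p.1 p.2) S.dom :=
  (continuousOn_const.mul (hS.contDiffOn_Ω.continuousOn.pow 2)).mul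
    (hS.continuousOn_nu.inv₀ fun _ hp => hS.nu_ne hp.1 hp.2)

theorem continuousOn_varpi : ContinuousOn (fun p : ℝ × ℝ => S.varpi p.1 p.2) S.dom := by
  have hr := hS.continuousOn_r
  have hg : ContinuousOn (fun p : ℝ × ℝ => S.gradSq p.1 p.2) S.dom :=
    ((continuousOn_const.mul hS.continuousOn_nu).mul hS.continuousOn_lam).div
      (hS.contDiffOn_Ω.continuousOn.pow 2) fun p hp => (pow_pos (hS.Ω_pos _ hp.1 _ hp.2) 2).ne'
  refine ((hr.div_const 2).mul (continuousOn_const.sub hg)).add (continuousOn_const.div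
    (continuousOn_const.mul hr) fun p hp => mul_ne_zero two_ne_zero (hS.r_ne hp.1 hp.2))

theorem one_sub_mu {u v : ℝ} (hu : u ∈ S.uRange) (hv : v ∈ S.vRange) :
    1 - S.mu u v = 1 - 2 * S.varpi u v / S.r u v + S.e ^ 2 / S.r u v ^ 2 := by
  have := hS.r_ne hu hv
  unfold mu varpi
  field_simp
  ring

theorem lam_eq {u v : ℝ} (hu : u ∈ S.uRange) (hv : v ∈ S.vRange) :
    S.lam u v = S.kappa u v * (1 - 2 * S.varpi u v / S.r u v + S.e ^ 2 / S.r u v ^ 2) := by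
  rw [← hS.one_sub_mu hu hv]
  have h1 := hS.r_ne hu hv
  have h2 := hS.nu_ne hu hv
  have h3 := (hS.Ω_pos u hu v hv).ne'
  unfold mu hawkingMass gradSq kappa
  field_simp
  ring

/-- In the derivative of λ = κ(1 − 2ϖ/r + e²/r²) the ζ² terms from ∂_uκ and ∂_uϖ cancel. This
supplies the equation for ∂_u∂_v r, which is not among the assumptions. -/
theorem hasPartialU_lam : S.HasPartialU S.lam S.rUV := by
  intro u hu v hv
  have h1 := hS.r_ne hu hv
  have h2 := hS.nu_ne hu hv
  have hr := hS.hasPartialU_r u hu v hv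
  have h := (hS.kappa_u u hu v hv).mul ((((hS.varpi_u u hu v hv).const_mul 2).div hr h1).const_sub 1
    |>.add (((hasDerivWithinAt_const u S.uRange (S.e ^ 2)).div (hr.pow 2) (pow_ne_zero 2 h1))))
  refine (h.congr (fun x hx => hS.lam_eq hx hv) (hS.lam_eq hu hv)).congr_deriv ?_
  unfold rUV
  simp only [hS.one_sub_mu hu hv, Pi.add_apply, Pi.div_apply, Pi.pow_apply]
  field_simp
  ring

theorem continuousOn_rUV : ContinuousOn (fun p : ℝ × ℝ => S.rUV p.1 p.2) S.dom := by
  have hr := hS.continuousOn_r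
  exact (((continuousOn_const.mul hS.continuousOn_kappa).mul hS.continuousOn_nu).mul
    (hS.continuousOn_varpi.sub (continuousOn_const.div hr fun p hp => hS.r_ne hp.1 hp.2))).div
      (hr.pow 2) fun p hp => pow_ne_zero 2 (hS.r_ne hp.1 hp.2)

end Admissible

end NullData

/-- Projection of the line onto a compact interval. -/
noncomputable def clamp (a b x : ℝ) : ℝ := max a (min x b)

theorem clamp_cont (a b : ℝ) : Continuous (clamp a b) :=
  continuous_const.max (continuous_id.min continuous_const)

theorem clamp_mem {a b : ℝ} (hab : a ≤ b) (x : ℝ) : clamp a b x ∈ Icc a b :=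
  ⟨le_max_left _ _, max_le hab (min_le_right _ _)⟩

theorem clamp_of_mem {a b x : ℝ} (hx : x ∈ Icc a b) : clamp a b x = x := by
  rw [clamp, min_eq_left hx.2, max_eq_right hx.1]

theorem clamp_hasDerivAt {a b x : ℝ} (hx : x ∈ Ioo a b) : HasDerivAt (clamp a b) 1 x :=
  (hasDerivAt_id x).congr_of_eventuallyEq (by
    filter_upwards [Ioo_mem_nhds hx.1 hx.2] with y hy using clamp_of_mem (Ioo_subset_Icc_self hy))

/-- Mixed partial derivatives, in integrated form, up to the boundary. -/
theorem sub_eq_integral_of_mixed {r nu lam G : ℝ → ℝ → ℝ} {a b c d : ℝ} (hab : a < b) (hcd : c ≤ d)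
    (hnu : ContinuousOn (fun p : ℝ × ℝ => nu p.1 p.2) (Icc a b ×ˢ Icc c d))
    (hlam : ContinuousOn (fun p : ℝ × ℝ => lam p.1 p.2) (Icc a b ×ˢ Icc c d))
    (hG : ContinuousOn (fun p : ℝ × ℝ => G p.1 p.2) (Icc a b ×ˢ Icc c d))
    (hru : ∀ u ∈ Icc a b, ∀ v ∈ Icc c d, HasDerivWithinAt (fun x => r x v) (nu u v) (Icc a b) u)
    (hrv : ∀ u ∈ Icc a b, ∀ v ∈ Icc c d, HasDerivWithinAt (fun y => r u y) (lam u v) (Icc c d) v)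
    (hlu : ∀ u ∈ Icc a b, ∀ v ∈ Icc c d, HasDerivWithinAt (fun x => lam x v) (G u v) (Icc a b) u)
    {u : ℝ} (hu : u ∈ Icc a b) : nu u d - nu u c = ∫ y in c..d, G u y := by
  -- Clamping both arguments produces functions continuous on the whole plane, as needed to
  -- differentiate under the integral, and changes nothing on the rectangle.
  set P := clamp a b with hP
  set Q := clamp c d with hQ
  have hPm := clamp_mem (a := a) (b := b) hab.le
  have hQm := clamp_mem (a := c) (b := d) hcd
  have hPQ : Continuous fun p : ℝ × ℝ => (P p.2, Q p.1) :=
    ((clamp_cont a b).comp continuous_snd).prodMk ((clamp_cont c d).comp continuous_fst)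
  have cl : Continuous fun p : ℝ × ℝ => lam (P p.2) (Q p.1) :=
    hlam.comp_continuous hPQ fun p => ⟨hPm _, hQm _⟩
  have cG : Continuous fun p : ℝ × ℝ => G (P p.2) (Q p.1) :=
    hG.comp_continuous hPQ fun p => ⟨hPm _, hQm _⟩
  have hint : ∀ t ∈ Icc a b, r t d - r t c = ∫ y in c..d, lam (P t) (Q y) := by
    intro t ht
    symm
    apply intervalIntegral.integral_eq_sub_of_hasDeriv_right_of_le hcd
      (fun v hv => (hrv t ht v hv).continuousWithinAt)
    · intro v hv
      have hv' := Ioo_subset_Icc_self hv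
      rw [hP, hQ, clamp_of_mem ht, clamp_of_mem hv']
      exact ((hrv t ht v hv').hasDerivAt (Icc_mem_nhds hv.1 hv.2)).hasDerivWithinAt
    · exact (cl.slice_left (f := fun y t => lam (P t) (Q y)) t).intervalIntegrable _ _
  have hintr : ∀ t ∈ Ioo a b, nu t d - nu t c = ∫ y in c..d, G (P t) (Q y) := by
    intro t ht
    have h1 := hasDerivAt_integral_of_continuous (f := fun y t => lam (P t) (Q y))
      (f' := fun y t => G (P t) (Q y)) (a := c) (b := d) (t₀ := t) cl cG (by
        filter_upwards [Ioo_mem_nhds ht.1 ht.2] with x hx y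
        have h2 := ((hlu x (Ioo_subset_Icc_self hx) (Q y) (hQm y)).hasDerivAt
          (Icc_mem_nhds hx.1 hx.2))
        have h3 : P x = x := clamp_of_mem (Ioo_subset_Icc_self hx)
        rw [h3]
        refine h2.congr_of_eventuallyEq ?_
        filter_upwards [Ioo_mem_nhds hx.1 hx.2] with z hz
        rw [hP, clamp_of_mem (Ioo_subset_Icc_self hz)])
    have h4 : HasDerivAt (fun t => r t d - r t c) (nu t d - nu t c) t :=
      ((hru t (Ioo_subset_Icc_self ht) d (right_mem_Icc.2 hcd)).hasDerivAt
        (Icc_mem_nhds ht.1 ht.2)).sub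
      ((hru t (Ioo_subset_Icc_self ht) c (left_mem_Icc.2 hcd)).hasDerivAt (Icc_mem_nhds ht.1 ht.2))
    refine h4.unique (h1.congr_of_eventuallyEq ?_)
    filter_upwards [Ioo_mem_nhds ht.1 ht.2] with x hx using hint x (Ioo_subset_Icc_self hx)
  have hc1 : Continuous fun t => nu (P t) d - nu (P t) c :=
    (hnu.comp_continuous ((clamp_cont a b).prodMk continuous_const)
      fun t => ⟨hPm t, right_mem_Icc.2 hcd⟩).sub
    (hnu.comp_continuous ((clamp_cont a b).prodMk continuous_const)
      fun t => ⟨hPm t, left_mem_Icc.2 hcd⟩)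
  have hc2 : Continuous fun t => ∫ y in c..d, G (P t) (Q y) :=
    intervalIntegral.continuous_parametric_intervalIntegral_of_continuous' 
      (f := fun t y => G (P t) (Q y)) (cG.comp continuous_swap) c d
  -- The identity, proved for interior t, extends to the end points by continuity.
  have heq : EqOn (fun t => nu (P t) d - nu (P t) c) (fun t => ∫ y in c..d, G (P t) (Q y))
      (closure (Ioo a b)) := by
    refine Set.EqOn.closure (fun t ht => ?_) hc1 hc2
    have h3 : P t = t := clamp_of_mem (Ioo_subset_Icc_self ht)
    simp only [h3]
    have := hintr t ht
    rwa [h3] at this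
  rw [closure_Ioo hab.ne] at heq
  have h := heq hu
  have h3 : P u = u := clamp_of_mem hu
  simp only [h3] at h
  rw [h]
  apply intervalIntegral.integral_congr
  intro y hy
  rw [uIcc_of_le hcd] at hy
  have : Q y = y := clamp_of_mem hy
  simp only [this]

namespace NullData.Admissible

variable {S : NullData} {ω : ℝ} (hS : S.Admissible ω)
include hS

theorem nu_sub_nu {u c d : ℝ} (hu : u ∈ S.uRange) (hc : c ∈ S.vRange) (hd : d ∈ S.vRange)
    (hcd : c ≤ d) : S.nu u d - S.nu u c = ∫ y in c..d, S.rUV u y := by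
  have hsub : Icc c d ⊆ S.vRange := S.vRange_ordConnected.out hc hd
  have hsub2 : Icc 1 S.U₀ ×ˢ Icc c d ⊆ S.dom := prod_mono subset_rfl hsub
  exact sub_eq_integral_of_mixed (r := S.r) (lam := S.lam) S.one_lt_U₀ hcd
    (G := S.rUV) (nu := S.nu)
    (hS.continuousOn_nu.mono hsub2) (hS.continuousOn_lam.mono hsub2)
    (hS.continuousOn_rUV.mono hsub2) (fun u hu v hv => hS.hasPartialU_r u hu v (hsub hv))
    (fun u hu v hv => (hS.hasPartialV_r u hu v (hsub hv)).mono hsub)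
    (fun u hu v hv => hS.hasPartialU_lam u hu v (hsub hv)) hu

/-- The detour through the integrated identity gives ∂_vν = ∂_uλ also on the edges u = 1 and u = U₀,
in particular along the event horizon. -/
theorem nu_hasDerivAt_v {u v : ℝ} (hu : u ∈ S.uRange) (hv : v ∈ S.vRange) (hv1 : 1 < v) :
    HasDerivAt (fun y => S.nu u y) (S.rUV u v) v := by
  obtain ⟨w, hw, hvw⟩ := S.exists_gt_of_mem_vRange hv
  have hsub : Icc 1 w ⊆ S.vRange := S.vRange_ordConnected.out S.one_mem_vRange hw
  have h1w : (1 : ℝ) ≤ w := hw.1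
  have hcont : ContinuousOn (fun y => S.rUV u y) (Icc 1 w) := by
    refine hS.continuousOn_rUV.comp (f := fun y : ℝ => (u, y)) ?_ ?_
    · fun_prop
    · exact fun y hy => (⟨hu, hsub hy⟩ : (u, y) ∈ S.dom)
  have hG : Continuous fun y => S.rUV u (clamp 1 w y) :=
    hcont.comp_continuous (clamp_cont 1 w) fun y => clamp_mem h1w y
  have h1 : HasDerivAt (fun y => (∫ z in (1 : ℝ)..y, S.rUV u (clamp 1 w z)) + S.nu u 1)
      (S.rUV u v) v := by
    have h0 := (hG.integral_hasStrictDerivAt 1 v).hasDerivAt.add_const (S.nu u 1)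
    simp only [clamp_of_mem (⟨hv1.le, hvw.le⟩ : v ∈ Icc 1 w)] at h0
    exact h0
  refine h1.congr_of_eventuallyEq ?_
  filter_upwards [Ioo_mem_nhds hv1 hvw] with y hy
  have h2 := hS.nu_sub_nu hu S.one_mem_vRange (hsub (Ioo_subset_Icc_self hy)) hy.1.le
  have h3 : ∫ z in (1 : ℝ)..y, S.rUV u (clamp 1 w z) = ∫ z in (1 : ℝ)..y, S.rUV u z := by
    apply intervalIntegral.integral_congr
    intro z hz
    rw [uIcc_of_le hy.1.le] at hz
    simp only [clamp_of_mem (⟨hz.1, hz.2.trans hy.2.le⟩ : z ∈ Icc 1 w)]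
  rw [h3, ← h2]
  ring

end NullData.Admissible

/-! ### Changes of null coordinates -/

/-- A solution of `f (h x) = g x` with `f` strictly monotone and `g` continuous is continuous. -/
theorem continuous_of_strictMonoOn_comp {s : Set ℝ} {f g h : ℝ → ℝ} (hs : s.OrdConnected)
    (hf : StrictMonoOn f s) (hg : Continuous g) (hm : ∀ x, h x ∈ s) (hfh : ∀ x, f (h x) = g x) :
    Continuous h := by
  rw [continuous_iff_continuousAt]
  intro x
  rw [ContinuousAt, tendsto_order]
  constructor
  · intro a ha
    by_cases hex : a ∈ s
    · have h1 : f a < g x := by rw [← hfh]; exact hf hex (hm x) ha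
      filter_upwards [hg.continuousAt.eventually (lt_mem_nhds h1)] with y hy
      rw [← hfh] at hy
      exact (hf.lt_iff_lt hex (hm y)).1 hy
    · refine Eventually.of_forall fun y => ?_
      by_contra hcon
      push Not at hcon
      exact hex (hs.out (hm y) (hm x) ⟨hcon, ha.le⟩)
  · intro a ha
    by_cases hex : a ∈ s
    · have h1 : g x < f a := by rw [← hfh]; exact hf (hm x) hex ha
      filter_upwards [hg.continuousAt.eventually (gt_mem_nhds h1)] with y hy
      rw [← hfh] at hy
      exact (hf.lt_iff_lt (hm y) hex).1 hy
    · refine Eventually.of_forall fun y => ?_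
      by_contra hcon
      push Not at hcon
      exact hex (hs.out (hm x) (hm y) ⟨ha.le, hcon⟩)

theorem strictMonoOn_of_forall_hasDerivWithinAt {s : Set ℝ} {f f' : ℝ → ℝ} (hs : s.OrdConnected)
    (hf : ∀ x ∈ s, HasDerivWithinAt f (f' x) s x) (hf' : ∀ x ∈ s, 0 < f' x) : StrictMonoOn f s := by
  apply strictMonoOn_of_deriv_pos hs.convex fun x hx => (hf x hx).continuousWithinAt
  intro x hx
  have hx' := mem_interior_iff_mem_nhds.1 hx
  rw [((hf x (interior_subset hx)).hasDerivAt hx').deriv]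
  exact hf' x (interior_subset hx)

/-- Inverse of a change of coordinate onto `[1, ∞)`, frozen below `a`. -/
theorem exists_inverse_coordinate {s : Set ℝ} {f f' : ℝ → ℝ} {a : ℝ} (hs : s.OrdConnected)
    (h1 : (1 : ℝ) ∈ s) (hmin : ∀ x ∈ s, 1 ≤ x) (hnhds : ∀ x ∈ s, 1 < x → s ∈ 𝓝 x)
    (hf : ∀ x ∈ s, HasDerivWithinAt f (f' x) s x) (hf' : ∀ x ∈ s, 0 < f' x) (f1 : f 1 = 1)
    (hunb : ¬ BddAbove (f '' s)) (ha : 1 ≤ a) :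
    ∃ g : ℝ → ℝ, Continuous g ∧ (∀ x, g x ∈ s) ∧ (∀ x, f (g x) = max a x) ∧
      (∀ x, a < x → 1 < g x ∧ HasDerivAt g (f' (g x))⁻¹ x) ∧ ∀ x ∈ s, a ≤ f x → g (f x) = x := by
  have hmono := strictMonoOn_of_forall_hasDerivWithinAt hs hf hf'
  have hcont : ContinuousOn f s := fun x hx => (hf x hx).continuousWithinAt
  have hsurj : ∀ x, ∃ y ∈ s, f y = max a x := by
    intro x
    obtain ⟨_, ⟨y, hy, rfl⟩, hxy⟩ := not_bddAbove_iff.1 hunb (max a x)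
    obtain ⟨z, hz, hzx⟩ := intermediate_value_Icc (hmin y hy) (hcont.mono (hs.out h1 hy))
      (show max a x ∈ Icc (f 1) (f y) from ⟨by rw [f1]; exact ha.trans (le_max_left _ _), hxy.le⟩)
    exact ⟨z, hs.out h1 hy hz, hzx⟩
  choose g hgs hfg using hsurj
  have hgc : Continuous g := continuous_of_strictMonoOn_comp hs hmono
    (continuous_const.max continuous_id) hgs hfg
  refine ⟨g, hgc, hgs, hfg, ?_, ?_⟩
  · intro x hx
    have hgx : 1 < g x := by
      rw [← hmono.lt_iff_lt h1 (hgs x), f1, hfg]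
      exact lt_of_le_of_lt ha (hx.trans_le (le_max_right _ _))
    refine ⟨hgx, HasDerivAt.of_local_left_inverse hgc.continuousAt
      ((hf _ (hgs x)).hasDerivAt (hnhds _ (hgs x) hgx)) (hf' _ (hgs x)).ne' ?_⟩
    filter_upwards [lt_mem_nhds hx] with y hy
    rw [hfg, max_eq_right hy.le]
  · intro x hx hax
    apply hmono.injOn (hgs _) hx
    rw [hfg, max_eq_right hax]

namespace NullData

variable {S : NullData}

theorem HasPartialU.comp {f f' : ℝ → ℝ → ℝ} (hf : S.HasPartialU f f') {g : ℝ → ℝ} {a u v : ℝ}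
    (hg : ∀ x, g x ∈ S.uRange) (hg' : HasDerivAt g a u) (hv : v ∈ S.vRange) :
    HasDerivAt (fun x => f (g x) v) (f' (g u) v * a) u := by
  have h := (hf (g u) (hg u) v hv).comp u (hg'.hasDerivWithinAt (s := univ)) fun x _ => hg x
  exact h.hasDerivAt univ_mem

theorem HasPartialV.comp {f f' : ℝ → ℝ → ℝ} (hf : S.HasPartialV f f') {h : ℝ → ℝ} {b u v : ℝ}
    (hh : ∀ x, h x ∈ S.vRange) (hh' : HasDerivAt h b v) (hu : u ∈ S.uRange) :
    HasDerivAt (fun y => f u (h y)) (f' u (h v) * b) v := by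
  have h := (hf u hu (h v) (hh v)).comp v (hh'.hasDerivWithinAt (s := univ)) fun x _ => hh x
  exact h.hasDerivAt univ_mem

/-- The data read in new null coordinates. -/
noncomputable def Admissible.pullback {ω : ℝ} (hS : S.Admissible ω) {I J : Set ℝ} {g a h b : ℝ → ℝ}
    (hg : Continuous g) (ha : Continuous a) (hh : Continuous h) (hb : Continuous b)
    (hgm : ∀ x, g x ∈ S.uRange) (hhm : ∀ x, h x ∈ S.vRange) (ha0 : ∀ x, 0 < a x)
    (hb0 : ∀ x, 0 < b x) (hg' : ∀ x ∈ I, HasDerivAt g (a x) x)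
    (hh' : ∀ x ∈ J, 1 < h x ∧ HasDerivAt h (b x) x) : NullSystem I J where
  e := S.e
  r u v := S.r (g u) (h v)
  phi u v := S.φ (g u) (h v)
  nu u v := S.nu (g u) (h v) * a u
  lam u v := S.lam (g u) (h v) * b v
  kappa u v := S.kappa (g u) (h v) * b v
  mass u v := S.varpi (g u) (h v)
  theta u v := S.theta (g u) (h v) * b v
  zeta u v := S.zeta (g u) (h v) * a u
  r_cont := hS.continuousOn_r.comp_continuous (hg.prodMap hh) fun p => ⟨hgm p.1, hhm p.2⟩
  phi_cont := hS.continuousOn_φ.comp_continuous (hg.prodMap hh) fun p => ⟨hgm p.1, hhm p.2⟩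
  nu_cont := (hS.continuousOn_nu.comp_continuous (hg.prodMap hh) fun p => ⟨hgm p.1, hhm p.2⟩).mul
    (ha.comp continuous_fst)
  lam_cont := (hS.continuousOn_lam.comp_continuous (hg.prodMap hh) fun p => ⟨hgm p.1, hhm p.2⟩).mul
    (hb.comp continuous_snd)
  kappa_cont := (hS.continuousOn_kappa.comp_continuous (hg.prodMap hh)
    fun p => ⟨hgm p.1, hhm p.2⟩).mul (hb.comp continuous_snd)
  mass_cont := hS.continuousOn_varpi.comp_continuous (hg.prodMap hh) fun p => ⟨hgm p.1, hhm p.2⟩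
  theta_cont := (hS.continuousOn_theta.comp_continuous (hg.prodMap hh)
    fun p => ⟨hgm p.1, hhm p.2⟩).mul (hb.comp continuous_snd)
  zeta_cont := (hS.continuousOn_zeta.comp_continuous (hg.prodMap hh)
    fun p => ⟨hgm p.1, hhm p.2⟩).mul (ha.comp continuous_fst)
  r_pos u v := hS.r_pos _ (hgm u) _ (hhm v)
  kappa_pos u v := mul_pos (hS.kappa_pos (hgm u) (hhm v)) (hb0 v)
  nu_neg u v := mul_neg_of_neg_of_pos (hS.nu_neg _ (hgm u) _ (hhm v)) (ha0 u)
  lam_nonneg u v := mul_nonneg (hS.lam_nonneg _ (hgm u) _ (hhm v)) (hb0 v).le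
  lam_eq u v := by rw [hS.lam_eq (hgm u) (hhm v)]; ring
  r_u u hu v := hS.hasPartialU_r.comp hgm (hg' u hu) (hhm v)
  r_v u v hv := hS.hasPartialV_r.comp hhm (hh' v hv).2 (hgm u)
  phi_u u hu v := by
    refine (hS.hasPartialU_φ.comp hgm (hg' u hu) (hhm v)).congr_deriv ?_
    ring
  phi_v u v hv := by
    refine (hS.hasPartialV_φ.comp hhm (hh' v hv).2 (hgm u)).congr_deriv ?_
    ring
  mass_u u hu v := by
    refine (HasPartialU.comp hS.varpi_u hgm (hg' u hu) (hhm v)).congr_deriv ?_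
    have h1 := (hS.kappa_pos (hgm u) (hhm v)).ne'
    have h2 := hS.nu_ne (hgm u) (hhm v)
    have h3 := (ha0 u).ne'
    have h4 := (hb0 v).ne'
    rw [hS.one_sub_mu (hgm u) (hhm v), hS.lam_eq (hgm u) (hhm v)]
    generalize (1 - 2 * S.varpi (g u) (h v) / S.r (g u) (h v)
      + S.e ^ 2 / S.r (g u) (h v) ^ 2) = D
    field_simp
  mass_v u v hv := by
    refine (HasPartialV.comp hS.varpi_v hhm (hh' v hv).2 (hgm u)).congr_deriv ?_
    have h1 := (hS.kappa_pos (hgm u) (hhm v)).ne'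
    have h4 := (hb0 v).ne'
    field_simp
  kappa_u u hu v := by
    refine ((HasPartialU.comp hS.kappa_u hgm (hg' u hu) (hhm v)).mul_const (b v)).congr_deriv ?_
    have h1 := hS.r_ne (hgm u) (hhm v)
    have h2 := hS.nu_ne (hgm u) (hhm v)
    have h3 := (ha0 u).ne'
    field_simp
  theta_u u hu v := by
    refine ((HasPartialU.comp hS.theta_u hgm (hg' u hu) (hhm v)).mul_const (b v)).congr_deriv ?_
    ring
  zeta_v u v hv := by
    refine ((HasPartialV.comp hS.zeta_v hhm (hh' v hv).2 (hgm u)).mul_const (a u)).congr_deriv ?_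
    ring
  nu_v u v hv := by
    have h0 := ((hS.nu_hasDerivAt_v (hgm u) (hhm v) (hh' v hv).1).comp v (hh' v hv).2).mul_const (a u)
    refine h0.congr_deriv ?_
    unfold rUV
    ring
  lam_u u hu v := by
    refine ((hS.hasPartialU_lam.comp hgm (hg' u hu) (hhm v)).mul_const (b v)).congr_deriv ?_
    unfold rUV
    ring

end NullData

/-! ### Geometry up to the event horizon -/

/-- A null system on `1 ≤ u ≤ U`, `v ≥ 1`, normalized on `u = 1`, with event horizon `u = U`. -/
structure Background (U : ℝ) extends NullSystem (Ioo 1 U) (Ioi 1) where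
  one_lt : 1 < U
  kappa_one : ∀ v, kappa 1 v = 1
  r_unbdd : ∀ u ∈ Ico 1 U, ∀ C, ∃ v, 1 ≤ v ∧ C ≤ r u v
  rp : ℝ
  rp_isLUB : IsLUB ((fun v => r U v) '' Ici 1) rp
  rp_ne : rp ≠ |e|
  M : ℝ
  one_le_M : 1 ≤ M
  mass_one_le : ∀ v, 1 ≤ v → mass 1 v ≤ M

namespace Background

variable {U : ℝ} (S : Background U)

include S in
theorem one_mem : (1 : ℝ) ∈ Icc 1 U := ⟨le_rfl, S.one_lt.le⟩

include S in
theorem end_mem : U ∈ Icc 1 U := ⟨S.one_lt.le, le_rfl⟩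

theorem r_anti_u (v : ℝ) : AntitoneOn (fun u => S.r u v) (Icc 1 U) := by
  intro u hu w hw huw
  exact le_of_hasDerivAt_nonpos huw (S.r_cont.slice_left v).continuousOn
    (fun x hx => S.r_u x ⟨hu.1.trans_lt hx.1, hx.2.trans_le hw.2⟩ v) (fun x _ => (S.nu_neg x v).le)

theorem r_mono_v (u : ℝ) : MonotoneOn (fun v => S.r u v) (Ici 1) := by
  intro v hv w _ hvw
  exact le_of_hasDerivAt_nonneg hvw (S.r_cont.slice_right u).continuousOn
    (fun x hx => S.r_v u x (lt_of_le_of_lt hv hx.1)) (fun x _ => S.lam_nonneg u x)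

theorem mass_anti_u (v : ℝ) : AntitoneOn (fun u => S.mass u v) (Icc 1 U) := by
  intro u hu w hw huw
  refine le_of_hasDerivAt_nonpos huw (S.mass_cont.slice_left v).continuousOn
    (fun x hx => S.mass_u x ⟨hu.1.trans_lt hx.1, hx.2.trans_le hw.2⟩ v) (fun x _ => ?_)
  have h1 := S.kappa_pos x v
  exact div_nonpos_of_nonneg_of_nonpos (mul_nonneg (S.lam_nonneg x v) (sq_nonneg _))
    (mul_nonpos_of_nonneg_of_nonpos (by positivity) (S.nu_neg x v).le)

theorem mass_mono_v (u : ℝ) : MonotoneOn (fun v => S.mass u v) (Ici 1) := by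
  intro v hv w _ hvw
  refine le_of_hasDerivAt_nonneg hvw (S.mass_cont.slice_right u).continuousOn
    (fun x hx => S.mass_v u x (lt_of_le_of_lt hv hx.1)) (fun x _ => ?_)
  have := S.kappa_pos u x
  positivity

theorem mass_le {u v : ℝ} (hu : u ∈ Icc 1 U) (hv : 1 ≤ v) : S.mass u v ≤ S.M :=
  (S.mass_anti_u v S.one_mem hu hu.1).trans (S.mass_one_le v hv)

theorem kappa_le_one {u : ℝ} (hu : u ∈ Icc 1 U) (v : ℝ) : S.kappa u v ≤ 1 := by
  refine (le_of_hasDerivAt_nonpos (f := fun u => S.kappa u v) hu.1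
    (S.kappa_cont.slice_left v).continuousOn
    (fun x hx => S.kappa_u x ⟨hx.1, hx.2.trans_le hu.2⟩ v) (fun x _ => ?_)).trans_eq (S.kappa_one v)
  exact div_nonpos_of_nonneg_of_nonpos (mul_nonneg (S.kappa_pos x v).le (sq_nonneg _))
    (mul_nonpos_of_nonneg_of_nonpos (S.r_pos x v).le (S.nu_neg x v).le)

/-- The quantity `ϖ - e² / r`, whose sign governs the red-shift. -/
noncomputable def charge (u v : ℝ) : ℝ := S.mass u v - S.e ^ 2 / S.r u v

/-- ϖ and r both decrease in u. Together with the monotonicity in v, a lower bound at one point of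
the horizon spreads to all u ≤ U and all later v. -/
theorem charge_anti_u (v : ℝ) : AntitoneOn (fun u => S.charge u v) (Icc 1 U) := by
  intro u hu w hw huw
  have h1 := S.mass_anti_u v hu hw huw
  have h2 : S.e ^ 2 / S.r u v ≤ S.e ^ 2 / S.r w v :=
    div_le_div_of_nonneg_left (sq_nonneg _) (S.r_pos w v) (S.r_anti_u v hu hw huw)
  simp only [charge] at *
  linarith

theorem charge_mono_v (u : ℝ) : MonotoneOn (fun v => S.charge u v) (Ici 1) := by
  intro v hv w hw hvw
  have h1 := S.mass_mono_v u hv hw hvw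
  have h2 : S.e ^ 2 / S.r u w ≤ S.e ^ 2 / S.r u v :=
    div_le_div_of_nonneg_left (sq_nonneg _) (S.r_pos u v) (S.r_mono_v u hv hw hvw)
  simp only [charge] at *
  linarith

theorem charge_le_mass (u v : ℝ) : S.charge u v ≤ S.mass u v := by
  have : 0 ≤ S.e ^ 2 / S.r u v := div_nonneg (sq_nonneg _) (S.r_pos u v).le
  unfold charge
  linarith

theorem aspect_nonneg (u v : ℝ) : 0 ≤ 1 - 2 * S.mass u v / S.r u v + S.e ^ 2 / S.r u v ^ 2 := by
  have h1 := S.lam_nonneg u v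
  rw [S.lam_eq] at h1
  exact nonneg_of_mul_nonneg_right h1 (S.kappa_pos u v)

theorem aspect_eq (u v : ℝ) : 1 - 2 * S.mass u v / S.r u v + S.e ^ 2 / S.r u v ^ 2 =
    (1 - S.e ^ 2 / S.r u v ^ 2) - 2 * S.charge u v / S.r u v := by
  have := S.r_ne u v
  unfold charge
  field_simp
  ring

/-- 1 − μ = (1 − e²/r²) − 2(ϖ − e²/r)/r is nonnegative because λ is, while the first bracket is
nonpositive for r ≤ |e|. -/
theorem charge_nonpos {u v : ℝ} (h : S.r u v ≤ |S.e|) : S.charge u v ≤ 0 := by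
  have h1 := S.aspect_nonneg u v
  have hr := S.r_pos u v
  rw [S.aspect_eq] at h1
  have h2 : 1 ≤ S.e ^ 2 / S.r u v ^ 2 := by
    rw [le_div_iff₀ (by positivity), one_mul, ← sq_abs S.e]
    exact pow_le_pow_left₀ hr.le h 2
  have h3 : 2 * S.charge u v / S.r u v ≤ 0 := by linarith
  have h4 := mul_nonpos_of_nonpos_of_nonneg h3 hr.le
  rw [div_mul_cancel₀ _ hr.ne'] at h4
  linarith

theorem r_le_rp {v : ℝ} (hv : 1 ≤ v) : S.r U v ≤ S.rp := S.rp_isLUB.1 ⟨v, hv, rfl⟩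

/-- The horizon radius exceeds the absolute value of the charge. -/
theorem abs_e_lt_rp : |S.e| < S.rp := by
  -- Suppose r₊ < |e|. Where r ≤ |e| the charge function is nonpositive, so −ν does not increase in
  -- v and is bounded by its values on v = 1. On a thin rectangle ending at the horizon, with r =
  -- |e| at its upper corner on the side u < U, the radius then stays above r₊ up to the horizon, a
  -- contradiction.
  by_contra hcon
  have hlt : S.rp < |S.e| := lt_of_le_of_ne (not_lt.1 hcon) S.rp_ne
  obtain ⟨B, hB⟩ := (isCompact_Icc (a := (1 : ℝ)) (b := U)).exists_bound_of_continuousOn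
    (S.nu_cont.slice_left 1).continuousOn
  have h1 : ∀ᶠ u in 𝓝[<] U, S.r u 1 < |S.e| :=
    ((S.r_cont.slice_left 1).continuousAt.eventually
      (gt_mem_nhds ((S.r_le_rp le_rfl).trans_lt hlt))).filter_mono nhdsWithin_le_nhds
  have h2 : ∀ᶠ u in 𝓝[<] U, B * (U - u) < |S.e| - S.rp := by
    have : ContinuousAt (fun u => B * (U - u)) U := by fun_prop
    refine (this.eventually (gt_mem_nhds ?_)).filter_mono nhdsWithin_le_nhds
    show B * (U - U) < _
    rw [sub_self, mul_zero]
    linarith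
  have h3 : ∀ᶠ u in 𝓝[<] U, u ∈ Ioo 1 U := Ioo_mem_nhdsLT S.one_lt
  obtain ⟨u, hu1, hu2, hu3⟩ := (h1.and (h2.and h3)).exists
  obtain ⟨w, hw1, hw2⟩ := S.r_unbdd u (Ioo_subset_Ico_self hu3) |S.e|
  obtain ⟨v, hv, hve⟩ := intermediate_value_Icc hw1 (S.r_cont.slice_right u).continuousOn
    (show |S.e| ∈ Icc (S.r u 1) (S.r u w) from ⟨hu1.le, hw2⟩)
  simp only at hve
  have huI : u ∈ Icc 1 U := Ioo_subset_Icc_self hu3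
  have hle : ∀ x ∈ Icc u U, ∀ y ∈ Icc 1 v, S.r x y ≤ |S.e| := by
    intro x hx y hy
    rw [← hve]
    exact (S.r_anti_u y huI ⟨huI.1.trans hx.1, hx.2⟩ hx.1).trans
      (S.r_mono_v u hy.1 (hy.1.trans hy.2) hy.2)
  have hnu : ∀ x ∈ Icc u U, -S.nu x v ≤ B := by
    intro x hx
    have h4 : S.nu x 1 ≤ S.nu x v := by
      refine le_of_hasDerivAt_nonneg (f := fun y => S.nu x y) hv.1
        (S.nu_cont.slice_right x).continuousOn (fun y hy => S.nu_v x y hy.1) (fun y hy => ?_)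
      have h5 := S.charge_nonpos (hle x hx y (Ioo_subset_Icc_self hy))
      have h6 := S.kappa_pos x y
      have h7 := S.nu_neg x y
      unfold charge at h5
      apply div_nonneg _ (sq_nonneg _)
      exact mul_nonneg_of_nonpos_of_nonpos
        (mul_nonpos_of_nonneg_of_nonpos (by positivity) h7.le) h5
    have h8 := hB x ⟨huI.1.trans hx.1, hx.2⟩
    rw [Real.norm_eq_abs] at h8
    have := neg_le_abs (S.nu x 1)
    linarith
  have h9 := sub_le_sub_of_hasDerivAt_le (f := fun x => -S.r x v) (f' := fun x => -S.nu x v)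
    (g := fun x => B * x) (g' := fun _ => B) hu3.2.le (S.r_cont.slice_left v).neg.continuousOn
    (by fun_prop) (fun x hx => (S.r_u x ⟨hu3.1.trans hx.1, hx.2⟩ v).neg)
    (fun x _ => by simpa using (hasDerivAt_id x).const_mul B)
    (fun x hx => hnu x (Ioo_subset_Icc_self hx))
  have h10 := S.r_le_rp hv.1
  linarith

/-- The radius stays above the absolute value of the charge at late advanced times. -/
theorem exists_radius : ∃ ρ v₁ : ℝ, |S.e| < ρ ∧ 1 ≤ v₁ ∧
    ∀ u ∈ Icc 1 U, ∀ v, v₁ ≤ v → ρ ≤ S.r u v := by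
  have h := S.abs_e_lt_rp
  obtain ⟨_, ⟨v₁, hv₁, rfl⟩, h1, _⟩ :=
    S.rp_isLUB.exists_between (show (|S.e| + S.rp) / 2 < S.rp by linarith)
  refine ⟨(|S.e| + S.rp) / 2, v₁, by linarith, hv₁, fun u hu v hv => ?_⟩
  exact h1.le.trans ((S.r_mono_v U hv₁ (le_trans hv₁ hv) hv).trans (S.r_anti_u v hu S.end_mem hu.2))

section estimates

variable {ρ v₁ : ℝ} (hρ : |S.e| < ρ) (hv₁ : 1 ≤ v₁)
  (hr : ∀ u ∈ Icc 1 U, ∀ v, v₁ ≤ v → ρ ≤ S.r u v)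
include hρ hv₁ hr

omit hv₁ in
-- Since r ≥ ρ > |e|, a small charge function forces 1 − μ away from zero: wherever the red-shift is
-- weak, λ controls κ.
theorem lam_ge_of_charge_le {u v : ℝ} (hu : u ∈ Icc 1 U) (hv : v₁ ≤ v)
    (hq : S.charge u v ≤ (1 - S.e ^ 2 / ρ ^ 2) * ρ / 4) :
    S.kappa u v * ((1 - S.e ^ 2 / ρ ^ 2) / 2) ≤ S.lam u v := by
  have hρ0 : 0 < ρ := (abs_nonneg _).trans_lt hρ
  have hκ := S.kappa_pos u v
  have hr0 := S.r_pos u v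
  have hrv := hr u hu v hv
  rw [S.lam_eq, S.aspect_eq]
  apply mul_le_mul_of_nonneg_left _ hκ.le
  have h1 : S.e ^ 2 / S.r u v ^ 2 ≤ S.e ^ 2 / ρ ^ 2 := by gcongr
  have hd : 0 < 1 - S.e ^ 2 / ρ ^ 2 := by
    rw [sub_pos, div_lt_one (by positivity), ← sq_abs]
    exact pow_lt_pow_left₀ hρ (abs_nonneg _) two_ne_zero
  have h2 : 2 * S.charge u v / S.r u v ≤ (1 - S.e ^ 2 / ρ ^ 2) / 2 := by
    rw [div_le_iff₀ hr0]
    have : (1 - S.e ^ 2 / ρ ^ 2) / 2 * ρ ≤ (1 - S.e ^ 2 / ρ ^ 2) / 2 * S.r u v := by gcongr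
    linarith
  linarith

omit hv₁ in
/-- The pointwise estimate behind the bound of `ζ / ν`. -/
theorem ratio_sq_deriv_le {Q u v : ℝ} (hu : u ∈ Icc 1 U) (hv : v₁ ≤ v) (hQ : 0 ≤ Q)
    (hQc : -Q ≤ S.charge u v) :
    2 * S.ratio u v * (-S.theta u v / S.r u v
      - 2 * S.kappa u v * S.charge u v / S.r u v ^ 2 * S.ratio u v) ≤
    (1 + 4 * Q) * (2 / (1 - S.e ^ 2 / ρ ^ 2)) * (S.lam u v / S.r u v ^ 2) * S.ratio u v ^ 2
      + (2 + 1 / (2 * ((1 - S.e ^ 2 / ρ ^ 2) * ρ / 4))) * (S.theta u v ^ 2 / (2 * S.kappa u v)) := by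
  have hρ0 : 0 < ρ := (abs_nonneg _).trans_lt hρ
  have hκ := S.kappa_pos u v
  have hr0 := S.r_pos u v
  have hd : 0 < 1 - S.e ^ 2 / ρ ^ 2 := by
    rw [sub_pos, div_lt_one (by positivity), ← sq_abs]
    exact pow_lt_pow_left₀ hρ (abs_nonneg _) two_ne_zero
  have hlam := S.lam_ge_of_charge_le hρ hr hu hv
  have hlam0 := S.lam_nonneg u v
  generalize S.charge u v = q at *
  generalize S.lam u v = l at *
  generalize S.theta u v = t at *
  generalize 1 - S.e ^ 2 / ρ ^ 2 = d at *
  generalize S.kappa u v = κ at *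
  set q₁ := d * ρ / 4 with hq₁
  have hq₁0 : 0 < q₁ := by positivity
  have e1 : 2 * S.ratio u v * (-t / S.r u v - 2 * κ * q / S.r u v ^ 2 * S.ratio u v) =
      -2 * (S.ratio u v / S.r u v) * t - 4 * κ * q * (S.ratio u v / S.r u v) ^ 2 := by
    field_simp
    ring
  have e2 : (1 + 4 * Q) * (2 / d) * (l / S.r u v ^ 2) * S.ratio u v ^ 2 =
      (1 + 4 * Q) * (2 / d) * l * (S.ratio u v / S.r u v) ^ 2 := by
    field_simp
  rw [e1, e2]
  generalize S.ratio u v / S.r u v = x at *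
  have hP : 0 ≤ t ^ 2 / (2 * κ) := by positivity
  have hX : 0 ≤ (1 + 4 * Q) * (2 / d) * l * x ^ 2 := by positivity
  -- Small charge: λ dominates κ, and the term λ/r² pays for everything. Large charge: the damping
  -- completes the square against θ.
  rcases le_or_gt q q₁ with h | h
  · have h1 : κ * (1 + 4 * Q) * x ^ 2 ≤ (1 + 4 * Q) * (2 / d) * l * x ^ 2 := by
      apply mul_le_mul_of_nonneg_right _ (sq_nonneg x)
      calc κ * (1 + 4 * Q) = (1 + 4 * Q) * (2 / d) * (κ * (d / 2)) := by field_simp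
        _ ≤ _ := by
          apply mul_le_mul_of_nonneg_left (hlam h)
          positivity
    have h2 : -2 * x * t ≤ κ * x ^ 2 + 2 * (t ^ 2 / (2 * κ)) := by
      have e3 : κ * x ^ 2 + 2 * (t ^ 2 / (2 * κ)) + 2 * x * t = (κ * x + t) ^ 2 / κ := by
        field_simp
        ring
      have : 0 ≤ (κ * x + t) ^ 2 / κ := by positivity
      linarith
    have h3 : -(4 * κ * q * x ^ 2) ≤ 4 * κ * Q * x ^ 2 := by
      have : 0 ≤ 4 * κ * x ^ 2 := by positivity
      nlinarith
    have h4 : 0 ≤ 1 / (2 * q₁) * (t ^ 2 / (2 * κ)) := by positivity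
    linarith
  · have h1 : 4 * κ * q₁ * x ^ 2 ≤ 4 * κ * q * x ^ 2 := by gcongr
    have h2 : -2 * x * t - 4 * κ * q₁ * x ^ 2 ≤ 1 / (2 * q₁) * (t ^ 2 / (2 * κ)) := by
      have e3 : 1 / (2 * q₁) * (t ^ 2 / (2 * κ)) + 2 * x * t + 4 * κ * q₁ * x ^ 2 =
          (t + 4 * κ * q₁ * x) ^ 2 / (4 * κ * q₁) := by
        field_simp
        ring
      have : 0 ≤ (t + 4 * κ * q₁ * x) ^ 2 / (4 * κ * q₁) := by positivity
      linarith
    linarith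

/-- Boundedness of `ζ / ν`. -/
theorem exists_ratio_bound : ∃ Z : ℝ, 0 ≤ Z ∧ ∀ u ∈ Icc 1 U, ∀ v, v₁ ≤ v → |S.ratio u v| ≤ Z := by
  have hρ0 : 0 < ρ := (abs_nonneg _).trans_lt hρ
  have hd : 0 < 1 - S.e ^ 2 / ρ ^ 2 := by
    rw [sub_pos, div_lt_one (by positivity), ← sq_abs]
    exact pow_lt_pow_left₀ hρ (abs_nonneg _) two_ne_zero
  obtain ⟨Z₁, hZ₁⟩ := (isCompact_Icc (a := (1 : ℝ)) (b := U)).exists_bound_of_continuousOn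
    (S.ratio_cont.slice_left v₁).continuousOn
  set Q := |S.charge U v₁| with hQ
  have hQ0 : 0 ≤ Q := abs_nonneg _
  -- The weight exp(C₁/r) has logarithmic v-derivative −C₁λ/r², which absorbs the first term of
  -- `ratio_sq_deriv_le`. The second is C₂∂_vϖ, whose integral is bounded by the total mass.
  set C₁ := (1 + 4 * Q) * (2 / (1 - S.e ^ 2 / ρ ^ 2)) with hC₁
  set C₂ := 2 + 1 / (2 * ((1 - S.e ^ 2 / ρ ^ 2) * ρ / 4)) with hC₂
  have hC₁0 : 0 ≤ C₁ := by positivity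
  have hC₂0 : 0 ≤ C₂ := by positivity
  set E := Real.exp (C₁ / ρ) with hE
  have hE0 : 0 < E := Real.exp_pos _
  set W := Z₁ ^ 2 * E + E * C₂ * (S.M - S.mass U v₁) with hW
  have hMm : 0 ≤ S.M - S.mass U v₁ := sub_nonneg.2 (S.mass_le S.end_mem hv₁)
  have hW0 : 0 ≤ W := by positivity
  refine ⟨W + 1, by linarith, fun u hu v hv => ?_⟩
  have hexp : ∀ y, v₁ ≤ y → Real.exp (C₁ / S.r u y) ≤ E := by
    intro y hy
    have := hr u hu y hy
    exact Real.exp_le_exp.2 (by gcongr)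
  have h := sub_le_sub_of_hasDerivAt_le
    (f := fun y => S.ratio u y ^ 2 * Real.exp (C₁ * (S.r u y)⁻¹))
    (f' := fun y => 2 * S.ratio u y * (-S.theta u y / S.r u y
      - 2 * S.kappa u y * S.charge u y / S.r u y ^ 2 * S.ratio u y) * Real.exp (C₁ * (S.r u y)⁻¹)
      + S.ratio u y ^ 2 * (Real.exp (C₁ * (S.r u y)⁻¹) * (C₁ * (-S.lam u y / S.r u y ^ 2))))
    (g := fun y => E * C₂ * S.mass u y) (g' := fun y => E * C₂ * (S.theta u y ^ 2 / (2 * S.kappa u y)))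
    hv ?_ (continuous_const.mul (S.mass_cont.slice_right u)).continuousOn ?_
    (fun y hy => (S.mass_v u y (lt_of_le_of_lt hv₁ hy.1)).const_mul _) ?_
  · have h1 : S.ratio u v ^ 2 ≤ S.ratio u v ^ 2 * Real.exp (C₁ * (S.r u v)⁻¹) := by
      apply le_mul_of_one_le_right (sq_nonneg _)
      have := S.r_pos u v
      exact Real.one_le_exp (by positivity)
    have h2 : S.ratio u v₁ ^ 2 * Real.exp (C₁ * (S.r u v₁)⁻¹) ≤ Z₁ ^ 2 * E := by
      rw [← div_eq_mul_inv]
      have h3 := hZ₁ u hu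
      rw [Real.norm_eq_abs] at h3
      have h4 := hexp v₁ le_rfl
      have h5 : S.ratio u v₁ ^ 2 ≤ Z₁ ^ 2 := by
        rw [← sq_abs]; exact pow_le_pow_left₀ (abs_nonneg _) h3 2
      gcongr
    have h6 : E * C₂ * (S.mass u v - S.mass u v₁) ≤ E * C₂ * (S.M - S.mass U v₁) := by
      have h7 := S.mass_le hu (hv₁.trans hv)
      have h8 := S.mass_anti_u v₁ hu S.end_mem hu.2
      simp only at h8
      gcongr
    have h9 : S.ratio u v ^ 2 ≤ W := by linarith
    apply abs_le_of_sq_le_sq _ (by linarith)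
    nlinarith
  · exact (((S.ratio_cont.slice_right u).pow 2).mul (Real.continuous_exp.comp
      (continuous_const.mul ((S.r_cont.slice_right u).inv₀ fun y => S.r_ne u y)))).continuousOn
  · intro y hy
    have hy1 : 1 < y := lt_of_le_of_lt hv₁ hy.1
    have h1 := (S.ratio_v u (J := Ioi 1) hy1).pow 2
    have h2 := (((S.r_v u y hy1).inv (S.r_ne u y)).const_mul C₁).exp
    refine (h1.mul h2).congr_deriv ?_
    unfold charge
    norm_num
  · intro y hy
    have h1 := S.ratio_sq_deriv_le hρ hr hu hy.1.le hQ0 (by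
      have h2 := S.charge_mono_v U hv₁ (hv₁.trans hy.1.le) hy.1.le
      have h3 := S.charge_anti_u y hu S.end_mem hu.2
      have h4 := neg_abs_le (S.charge U v₁)
      simp only at h2 h3
      linarith)
    rw [← hC₁, ← hC₂] at h1
    have hx := Real.exp_pos (C₁ * (S.r u y)⁻¹)
    have h5 := hexp y hy.1.le
    rw [div_eq_mul_inv] at h5
    have hκ := S.kappa_pos u y
    have hP : 0 ≤ C₂ * (S.theta u y ^ 2 / (2 * S.kappa u y)) := by positivity
    have h6 : E * C₂ * (S.theta u y ^ 2 / (2 * S.kappa u y)) =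
      E * (C₂ * (S.theta u y ^ 2 / (2 * S.kappa u y))) := by ring
    have h7 := mul_le_mul_of_nonneg_right h5 hP
    have h8 := mul_le_mul_of_nonneg_left h1 hx.le
    rw [h6]
    refine le_trans (le_of_eq ?_) ((sub_le_sub_right h8
      (Real.exp (C₁ * (S.r u y)⁻¹) * (C₁ * (S.lam u y / S.r u y ^ 2) * S.ratio u y ^ 2))).trans (le_trans (le_of_eq ?_) h7))
    · ring
    · ring

/-- Lower bound for `κ`. -/
theorem exists_kappa_ge : ∃ k : ℝ, 0 < k ∧ ∀ u ∈ Icc 1 U, ∀ v, v₁ ≤ v → k ≤ S.kappa u v := by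
  have hρ0 : 0 < ρ := (abs_nonneg _).trans_lt hρ
  obtain ⟨Z, hZ0, hZ⟩ := S.exists_ratio_bound hρ hv₁ hr
  have hM := S.one_le_M
  -- Beyond r = 4M one has 1 − μ ≥ 1/2, and −∂_u log κ is controlled by −∂_uϖ; inside, ζ/ν is
  -- bounded and ∂_u(1/r) is a majorant. Both integrate, and K collects the two contributions.
  set R := 4 * S.M with hR
  have hR0 : 0 < R := by positivity
  set K := 4 / R * (S.M - S.mass U v₁) + Z ^ 2 * R / ρ with hK
  refine ⟨Real.exp (-K), Real.exp_pos _, fun u hu v hv => ?_⟩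
  have hv1 : 1 ≤ v := hv₁.trans hv
  have hsub : ∀ x ∈ Ioo 1 u, x ∈ Ioo 1 U := fun x hx => ⟨hx.1, hx.2.trans_le hu.2⟩
  have h := sub_le_sub_of_hasDerivAt_le
    (f := fun x => -Real.log (S.kappa x v))
    (f' := fun x => -(S.kappa x v * S.zeta x v ^ 2 / (S.r x v * S.nu x v) / S.kappa x v))
    (g := fun x => -(4 / R) * S.mass x v + Z ^ 2 * R * (S.r x v)⁻¹)
    (g' := fun x => -(4 / R) * (S.lam x v * S.zeta x v ^ 2 / (2 * S.kappa x v * S.nu x v))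
      + Z ^ 2 * R * (-S.nu x v / S.r x v ^ 2)) hu.1
    ((S.kappa_cont.slice_left v).log fun x => S.kappa_ne x v).neg.continuousOn
    ((continuous_const.mul (S.mass_cont.slice_left v)).add (continuous_const.mul
      ((S.r_cont.slice_left v).inv₀ fun x => S.r_ne x v))).continuousOn
    (fun x hx => ((S.kappa_u x (hsub x hx) v).log (S.kappa_ne x v)).neg)
    (fun x hx => ((S.mass_u x (hsub x hx) v).const_mul _).add
      (((S.r_u x (hsub x hx) v).inv (S.r_ne x v)).const_mul _)) ?_
  · have h1 : Real.log (S.kappa 1 v) = 0 := by rw [S.kappa_one, Real.log_one]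
    have h2 : 0 ≤ Z ^ 2 * R * (S.r 1 v)⁻¹ := by have := S.r_pos 1 v; positivity
    have h3 : Z ^ 2 * R * (S.r u v)⁻¹ ≤ Z ^ 2 * R / ρ := by
      have := hr u hu v hv
      rw [div_eq_mul_inv]
      gcongr
    have h4 : 4 / R * (S.mass 1 v - S.mass u v) ≤ 4 / R * (S.M - S.mass U v₁) := by
      have h5 := S.mass_one_le v hv1
      have h6 := S.mass_anti_u v hu S.end_mem hu.2
      have h7 := S.mass_mono_v U hv₁ hv1 hv
      simp only at h6 h7
      gcongr
      exact h7.trans h6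
    have h8 : -K ≤ Real.log (S.kappa u v) := by
      simp only [h1] at h
      linarith
    calc Real.exp (-K) ≤ Real.exp (Real.log (S.kappa u v)) := Real.exp_le_exp.2 h8
      _ = S.kappa u v := Real.exp_log (S.kappa_pos u v)
  · intro x hx
    have hxI : x ∈ Icc 1 U := Ioo_subset_Icc_self (hsub x hx)
    have hκ := S.kappa_pos x v
    have hr0 := S.r_pos x v
    have hn := S.nu_neg x v
    have hasp := S.aspect_nonneg x v
    have hz : |S.ratio x v| ≤ Z := hZ x hxI v hv
    have hζ : S.zeta x v = S.ratio x v * S.nu x v := by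
      unfold NullSystem.ratio
      rw [div_mul_cancel₀ _ hn.ne]
    have hm := S.mass_le hxI hv1
    rw [S.lam_eq, hζ]
    have hhalf : R ≤ S.r x v →
        1 / 2 ≤ 1 - 2 * S.mass x v / S.r x v + S.e ^ 2 / S.r x v ^ 2 := by
      intro hRr
      have a1 : 0 ≤ S.e ^ 2 / S.r x v ^ 2 := by positivity
      have a2 : 2 * S.mass x v / S.r x v ≤ 1 / 2 := by
        rw [div_le_iff₀ hr0]; linarith
      linarith
    generalize 1 - 2 * S.mass x v / S.r x v + S.e ^ 2 / S.r x v ^ 2 = D at *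
    generalize S.ratio x v = y at *
    obtain ⟨n, hn'⟩ : ∃ n, n = -S.nu x v := ⟨_, rfl⟩
    have hnu : S.nu x v = -n := by linarith
    rw [hnu] at hn ⊢
    have hn0 : 0 < n := by linarith
    have e1 : -(S.kappa x v * (y * -n) ^ 2 / (S.r x v * -n) / S.kappa x v) = y ^ 2 * n / S.r x v := by
      field_simp
    have e2 : -(4 / R) * (S.kappa x v * D * (y * -n) ^ 2 / (2 * S.kappa x v * -n)) =
        2 * D / R * (y ^ 2 * n) := by
      field_simp
      ring
    rw [e1, e2, neg_neg]
    have hy2 : y ^ 2 ≤ Z ^ 2 := by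
      rw [← sq_abs]; exact pow_le_pow_left₀ (abs_nonneg _) hz 2
    rcases le_or_gt R (S.r x v) with h1 | h1
    · have h2 := hhalf h1
      have h3 : y ^ 2 * n / S.r x v ≤ 2 * D / R * (y ^ 2 * n) := by
        calc y ^ 2 * n / S.r x v ≤ y ^ 2 * n / R := by gcongr
          _ = 1 / R * (y ^ 2 * n) := by ring
          _ ≤ _ := by
            gcongr
            linarith
      have h4 : 0 ≤ Z ^ 2 * R * (n / S.r x v ^ 2) := by positivity
      linarith
    · have h3 : y ^ 2 * n / S.r x v ≤ Z ^ 2 * R * (n / S.r x v ^ 2) := by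
        calc y ^ 2 * n / S.r x v = y ^ 2 * S.r x v * (n / S.r x v ^ 2) := by field_simp
          _ ≤ _ := by gcongr
      have h4 : 0 ≤ 2 * D / R * (y ^ 2 * n) := by positivity
      linarith

/-- The charge function is bounded below by a positive constant at late advanced times. -/
theorem exists_charge_ge : ∃ v₀ q : ℝ, v₁ ≤ v₀ ∧ 0 < q ∧
    ∀ u ∈ Icc 1 U, ∀ v, v₀ ≤ v → q ≤ S.charge u v := by
  have hρ0 : 0 < ρ := (abs_nonneg _).trans_lt hρ
  have hd : 0 < 1 - S.e ^ 2 / ρ ^ 2 := by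
    rw [sub_pos, div_lt_one (by positivity), ← sq_abs]
    exact pow_lt_pow_left₀ hρ (abs_nonneg _) two_ne_zero
  obtain ⟨k, hk, hκ⟩ := S.exists_kappa_ge hρ hv₁ hr
  set q := (1 - S.e ^ 2 / ρ ^ 2) * ρ / 4 with hq
  have hq0 : 0 < q := by positivity
  -- Otherwise λ would stay above a positive constant along the horizon, and r would exceed r₊ after
  -- a finite advanced time.
  obtain ⟨v₀, hv₀, hqv⟩ : ∃ v₀, v₁ ≤ v₀ ∧ q ≤ S.charge U v₀ := by
    by_contra hcon
    push Not at hcon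
    set l := k * ((1 - S.e ^ 2 / ρ ^ 2) / 2) with hl
    have hl0 : 0 < l := by positivity
    set w := v₁ + (S.rp + 1) / l with hw
    have hrp : 0 < S.rp := (S.r_pos U 1).trans_le (S.r_le_rp le_rfl)
    have hvw : v₁ ≤ w := by
      have : 0 ≤ (S.rp + 1) / l := by positivity
      linarith
    have h := sub_le_sub_of_hasDerivAt_le (f := fun y => l * y) (f' := fun _ => l)
      (g := fun y => S.r U y) (g' := fun y => S.lam U y) hvw (by fun_prop)
      (S.r_cont.slice_right U).continuousOn
      (fun x _ => by simpa using (hasDerivAt_id x).const_mul l)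
      (fun x hx => S.r_v U x (lt_of_le_of_lt hv₁ hx.1)) (fun x hx => by
        refine le_trans ?_ (S.lam_ge_of_charge_le hρ hr S.end_mem hx.1.le (hcon x hx.1.le).le)
        have := hκ U S.end_mem x hx.1.le
        rw [hl]
        gcongr)
    have h1 := S.r_le_rp (hv₁.trans hvw)
    have h2 := S.r_pos U v₁
    have h3 : l * w - l * v₁ = S.rp + 1 := by rw [hw]; field_simp; ring
    linarith
  refine ⟨v₀, q, hv₀, hq0, fun u hu v hv => ?_⟩
  have h1 : 1 ≤ v₀ := hv₁.trans hv₀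
  exact hqv.trans ((S.charge_mono_v U h1 (h1.trans hv) hv).trans
    (S.charge_anti_u v hu S.end_mem hu.2))

end estimates

end Background

/-! ### The limit of −ν at null infinity -/

namespace Background

variable {U : ℝ} (S : Background U)

theorem r_tendsto {u : ℝ} (hu : u ∈ Ico 1 U) : Tendsto (fun v => S.r u v) atTop atTop := by
  refine tendsto_atTop.2 fun C => ?_
  obtain ⟨v, hv, hC⟩ := S.r_unbdd u hu C
  filter_upwards [eventually_ge_atTop v] with w hw
  exact hC.trans (S.r_mono_v u hv (hv.trans hw) hw)

theorem lam_ge_half {u v : ℝ} (hu : u ∈ Icc 1 U) (hv : 1 ≤ v) (hr : 4 * S.M ≤ S.r u v) :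
    S.kappa u v * (1 / 2) ≤ S.lam u v := by
  have hr0 := S.r_pos u v
  have hm := S.mass_le hu hv
  have hD : 1 / 2 ≤ 1 - 2 * S.mass u v / S.r u v + S.e ^ 2 / S.r u v ^ 2 := by
    have a1 : 0 ≤ S.e ^ 2 / S.r u v ^ 2 := by positivity
    have a2 : 2 * S.mass u v / S.r u v ≤ 1 / 2 := by
      rw [div_le_iff₀ hr0]; linarith
    linarith
  rw [S.lam_eq]
  exact mul_le_mul_of_nonneg_left hD (S.kappa_pos u v).le

/-- The radius grows at least linearly on `u = 1`. -/
theorem exists_r_one_ge_linear {ρ v₀ : ℝ} (hρ : 0 < ρ) (hv₀ : 1 ≤ v₀)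
    (hr : ∀ v, v₀ ≤ v → ρ ≤ S.r 1 v) : ∃ c : ℝ, 0 < c ∧ ∀ v, v₀ ≤ v → c * v ≤ S.r 1 v := by
  obtain ⟨w, hrw, hw⟩ := (((S.r_tendsto ⟨le_rfl, S.one_lt⟩).eventually_ge_atTop
    (4 * S.M)).and (eventually_ge_atTop v₀)).exists
  have hw1 : 1 ≤ w := hv₀.trans hw
  have hw0 : 0 < w := by linarith
  -- 1/2 is a lower bound for λ on u = 1 once r ≥ 4M; ρ/w takes care of v₀ ≤ v ≤ w.
  set c := min (1 / 2) (ρ / w) with hc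
  have hc0 : 0 < c := lt_min (by norm_num) (by positivity)
  have hcw : c * w ≤ ρ := (le_div_iff₀ hw0).1 (min_le_right _ _)
  refine ⟨c, hc0, fun v hv => ?_⟩
  rcases le_total v w with h | h
  · exact (mul_le_mul_of_nonneg_left h hc0.le).trans (hcw.trans (hr v hv))
  · have h1 := sub_le_sub_of_hasDerivAt_le (f := fun y => c * y) (f' := fun _ => c)
      (g := fun y => S.r 1 y) (g' := fun y => S.lam 1 y) h (by fun_prop)
      (S.r_cont.slice_right 1).continuousOn
      (fun x _ => by simpa using (hasDerivAt_id x).const_mul c)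
      (fun x hx => S.r_v 1 x (lt_of_le_of_lt hw1 hx.1)) (fun x hx => by
        have hx1 : 1 ≤ x := hw1.trans hx.1.le
        have h2 := S.lam_ge_half S.one_mem hx1 (hrw.trans (S.r_mono_v 1 hw1 hx1 hx.1.le))
        rw [S.kappa_one, one_mul] at h2
        exact (min_le_left _ _).trans h2)
    have h3 := hr w hw
    linarith

section speed

variable {v₀ : ℝ} (hv₀ : 1 ≤ v₀) (hq : ∀ u ∈ Icc 1 U, ∀ v, v₀ ≤ v → 0 ≤ S.charge u v)
include hv₀ hq

theorem neg_nu_mono {u v w : ℝ} (hu : u ∈ Icc 1 U) (hv : v₀ ≤ v) (hvw : v ≤ w) :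
    -S.nu u v ≤ -S.nu u w := by
  refine le_of_hasDerivAt_nonneg (f := fun y => -S.nu u y) hvw
    (S.nu_cont.slice_right u).neg.continuousOn
    (fun y hy => (S.nu_v u y (lt_of_le_of_lt (hv₀.trans hv) hy.1)).neg) (fun y hy => ?_)
  have h1 := hq u hu y (hv.trans hy.1.le)
  have h2 := S.kappa_pos u y
  rw [charge] at h1
  rw [neg_nonneg]
  apply div_nonpos_of_nonpos_of_nonneg _ (sq_nonneg _)
  exact mul_nonpos_of_nonpos_of_nonneg
    (mul_nonpos_of_nonneg_of_nonpos (by positivity) (S.nu_neg u y).le) h1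

omit hq in
-- ∂_v log(−ν) = 2κ(ϖ − e²/r)/r² is at most 4Mλ/r², because κ ≤ 2λ for r ≥ 4M, and this majorant is
-- the derivative of −4M/r.
theorem neg_nu_le {u v w : ℝ} (hu : u ∈ Icc 1 U) (hv : v₀ ≤ v) (hvw : v ≤ w)
    (hr : 4 * S.M ≤ S.r u v) : -S.nu u w ≤ -S.nu u v * Real.exp (4 * S.M / S.r u v) := by
  have hM := S.one_le_M
  have hn : ∀ y, 0 < -S.nu u y := fun y => neg_pos.2 (S.nu_neg u y)
  have hv1 : 1 ≤ v := hv₀.trans hv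
  have h := sub_le_sub_of_hasDerivAt_le
    (f := fun y => Real.log (-S.nu u y))
    (g := fun y => 4 * S.M * -(S.r u y)⁻¹)
    (g' := fun y => 4 * S.M * -(-S.lam u y / S.r u y ^ 2)) hvw
    ((S.nu_cont.slice_right u).neg.log fun y => (hn y).ne').continuousOn
    (continuous_const.mul ((S.r_cont.slice_right u).inv₀ fun y => S.r_ne u y).neg).continuousOn
    (fun y hy => (S.nu_v u y (lt_of_le_of_lt hv1 hy.1)).neg.log (hn y).ne')
    (fun y hy => ((S.r_v u y (lt_of_le_of_lt hv1 hy.1)).inv (S.r_ne u y)).neg.const_mul _) ?_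
  · have h1 : 0 < (S.r u w)⁻¹ := inv_pos.2 (S.r_pos u w)
    have h2 : 0 < S.M * (S.r u w)⁻¹ := by positivity
    have h3 : Real.log (-S.nu u w) ≤ Real.log (-S.nu u v) + 4 * S.M / S.r u v := by
      rw [div_eq_mul_inv]
      linarith
    calc -S.nu u w = Real.exp (Real.log (-S.nu u w)) := (Real.exp_log (hn w)).symm
      _ ≤ Real.exp (Real.log (-S.nu u v) + 4 * S.M / S.r u v) := Real.exp_le_exp.2 h3
      _ = _ := by rw [Real.exp_add, Real.exp_log (hn v)]
  · intro y hy
    have hy1 : 1 ≤ y := hv1.trans hy.1.le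
    have hr0 := S.r_pos u y
    have hκ := S.kappa_pos u y
    have hry : 4 * S.M ≤ S.r u y := hr.trans (S.r_mono_v u hv1 hy1 hy.1.le)
    have hm := S.mass_le hu hy1
    have hcm := S.charge_le_mass u y
    have hlam := S.lam_ge_half hu hy1 hry
    have e1 : -(2 * S.kappa u y * S.nu u y * (S.mass u y - S.e ^ 2 / S.r u y) / S.r u y ^ 2) /
        -S.nu u y = 2 * S.kappa u y * S.charge u y / S.r u y ^ 2 := by
      have := (S.nu_neg u y).ne
      have := hr0.ne'
      unfold charge
      field_simp
    refine le_trans (le_of_eq e1) ?_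
    calc 2 * S.kappa u y * S.charge u y / S.r u y ^ 2
        ≤ 2 * S.kappa u y * S.M / S.r u y ^ 2 := by gcongr; linarith
      _ = 4 * S.M * (S.kappa u y * (1 / 2) / S.r u y ^ 2) := by ring
      _ ≤ 4 * S.M * (S.lam u y / S.r u y ^ 2) := by gcongr
      _ = _ := by ring

theorem exists_speed_limit {u : ℝ} (hu : u ∈ Ico 1 U) : ∃ n : ℝ,
    Tendsto (fun v => -S.nu u v) atTop (𝓝 n) ∧ ∀ v, v₀ ≤ v → -S.nu u v ≤ n ∧
      (4 * S.M ≤ S.r u v → n ≤ -S.nu u v * Real.exp (4 * S.M / S.r u v)) := by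
  have huI : u ∈ Icc 1 U := Ico_subset_Icc_self hu
  obtain ⟨v₂, hv₂, hr₂⟩ := (((S.r_tendsto hu).eventually_ge_atTop (4 * S.M)).and
    (eventually_ge_atTop v₀)).exists
  have hmono : Monotone fun v => -S.nu u (max v₀ v) := fun v w hvw =>
    S.neg_nu_mono hv₀ hq huI (le_max_left _ _) (max_le_max le_rfl hvw)
  have hbdd : BddAbove (range fun v => -S.nu u (max v₀ v)) := by
    refine ⟨-S.nu u v₂ * Real.exp (4 * S.M / S.r u v₂), ?_⟩
    rintro _ ⟨v, rfl⟩
    exact (S.neg_nu_mono hv₀ hq huI (le_max_left _ _)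
      ((le_max_left _ v₂))).trans (S.neg_nu_le hv₀ huI hr₂ (le_max_right _ _) hv₂)
  have ht := tendsto_atTop_ciSup hmono hbdd
  have ht' : Tendsto (fun v => -S.nu u v) atTop (𝓝 (⨆ v, -S.nu u (max v₀ v))) := by
    refine ht.congr' ?_
    filter_upwards [eventually_ge_atTop v₀] with v hv
    rw [max_eq_right hv]
  refine ⟨_, ht', fun v hv => ⟨?_, fun hr => ?_⟩⟩
  · refine ge_of_tendsto ht' ?_
    filter_upwards [eventually_ge_atTop v] with w hw using S.neg_nu_mono hv₀ hq huI hv hw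
  · refine le_of_tendsto ht' ?_
    filter_upwards [eventually_ge_atTop v] with w hw using S.neg_nu_le hv₀ huI hv hw hr

/-- The limit of `-ν` at null infinity. -/
theorem exists_speed : ∃ N : ℝ → ℝ, ContinuousOn N (Ico 1 U) ∧ ∀ u ∈ Ico 1 U,
    Tendsto (fun v => -S.nu u v) atTop (𝓝 (N u)) ∧ ∀ v, v₀ ≤ v → -S.nu u v ≤ N u ∧
      (4 * S.M ≤ S.r u v → N u ≤ -S.nu u v * Real.exp (4 * S.M / S.r u v)) := by
  choose! N hN using fun u (hu : u ∈ Ico 1 U) => S.exists_speed_limit hv₀ hq hu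
  refine ⟨N, fun u₁ hu₁ => ?_, hN⟩
  have hM := S.one_le_M
  obtain ⟨U', hU'1, hU'2⟩ := exists_between hu₁.2
  have hU' : U' ∈ Ico 1 U := ⟨hu₁.1.trans hU'1.le, hU'2⟩
  have hsub : Icc 1 U' ⊆ Ico 1 U := fun u hu => ⟨hu.1, hu.2.trans_lt hU'2⟩
  obtain ⟨v₂, hr₂, hv₂⟩ := (((S.r_tendsto hU').eventually_ge_atTop (4 * S.M)).and
    (eventually_ge_atTop v₀)).exists
  have hrU : ∀ u ∈ Icc 1 U', ∀ v, S.r U' v ≤ S.r u v := fun u hu v =>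
    S.r_anti_u v (Ico_subset_Icc_self (hsub hu)) (Ico_subset_Icc_self hU') hu.2
  obtain ⟨B, hB⟩ := (isCompact_Icc (a := (1 : ℝ)) (b := U')).exists_bound_of_continuousOn
    (S.nu_cont.slice_left v₂).continuousOn
  have hB0 : 0 ≤ B := (norm_nonneg _).trans (hB 1 ⟨le_rfl, hU'.1⟩)
  have hle : ∀ u ∈ Icc 1 U', N u ≤ B * Real.exp 1 := by
    intro u hu
    have h1 := ((hN u (hsub hu)).2 v₂ hv₂).2 (hr₂.trans (hrU u hu v₂))
    have h2 := hB u hu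
    rw [Real.norm_eq_abs] at h2
    have h3 : 4 * S.M / S.r u v₂ ≤ 1 :=
      (div_le_one (S.r_pos u v₂)).2 (hr₂.trans (hrU u hu v₂))
    refine h1.trans (mul_le_mul ((neg_le_abs _).trans h2) (Real.exp_le_exp.2 h3)
      (Real.exp_pos _).le hB0)
  -- N is pinched between −ν and −ν·exp(4M/r), and r is at least its value at U'. The convergence is
  -- therefore uniform on [1, U'], and N inherits continuity.
  have hunif : TendstoUniformlyOn (fun v u => -S.nu u v) N atTop (Icc 1 U') := by
    rw [Metric.tendstoUniformlyOn_iff]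
    intro ε hε
    have hlim : Tendsto (fun v => B * Real.exp 1 * (Real.exp (4 * S.M / S.r U' v) - 1)) atTop
        (𝓝 (B * Real.exp 1 * (Real.exp 0 - 1))) := by
      refine (((Real.continuous_exp.tendsto 0).comp ?_).sub_const 1).const_mul _
      exact (S.r_tendsto hU').const_div_atTop (4 * S.M)
    rw [Real.exp_zero, sub_self, mul_zero] at hlim
    filter_upwards [hlim.eventually (gt_mem_nhds hε), eventually_ge_atTop v₂] with v hv hv2 u hu
    have hv0 := hv₂.trans hv2
    have hr4 : 4 * S.M ≤ S.r U' v :=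
      hr₂.trans (S.r_mono_v U' (hv₀.trans hv₂) (hv₀.trans hv0) hv2)
    obtain ⟨h1, h2⟩ := (hN u (hsub hu)).2 v hv0
    have h3 := h2 (hr4.trans (hrU u hu v))
    have hr0 := S.r_pos U' v
    have h4 : Real.exp (4 * S.M / S.r u v) ≤ Real.exp (4 * S.M / S.r U' v) := by
      apply Real.exp_le_exp.2
      have := hrU u hu v
      gcongr
    have h5 : 1 ≤ Real.exp (4 * S.M / S.r U' v) := Real.one_le_exp (by positivity)
    have hn : 0 ≤ -S.nu u v := (neg_pos.2 (S.nu_neg u v)).le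
    have h6 : -S.nu u v * (Real.exp (4 * S.M / S.r U' v) - 1) ≤
        B * Real.exp 1 * (Real.exp (4 * S.M / S.r U' v) - 1) :=
      mul_le_mul_of_nonneg_right (h1.trans (hle u hu)) (by linarith)
    have h7 : -S.nu u v * Real.exp (4 * S.M / S.r u v) ≤
        -S.nu u v * Real.exp (4 * S.M / S.r U' v) := mul_le_mul_of_nonneg_left h4 hn
    rw [Real.dist_eq, abs_of_nonneg (by linarith)]
    linarith
  have hcont : ContinuousOn N (Icc 1 U') := hunif.continuousOn
    (Eventually.of_forall fun v => (S.nu_cont.slice_left v).neg.continuousOn).frequently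
  refine (hcont u₁ ⟨hu₁.1, hU'1.le⟩).mono_of_mem_nhdsWithin ?_
  filter_upwards [self_mem_nhdsWithin, mem_nhdsWithin_of_mem_nhds (gt_mem_nhds hU'1)] with x hx hx2
  exact ⟨hx.1, hx2.le⟩

omit hq in
/-- The normalized coordinate `u` exhausts `[1, ∞)`. -/
theorem unbounded_of_speed {N F : ℝ → ℝ} (hN : ∀ u ∈ Ico 1 U, ∀ v, v₀ ≤ v → -S.nu u v ≤ N u)
    (hF : ∀ u ∈ Ico 1 U, HasDerivWithinAt F (N u) (Ico 1 U) u) : ¬ BddAbove (F '' Ico 1 U) := by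
  rintro ⟨C, hC⟩
  -- As −ν ≤ F', a bounded F would bound the drop of r from u = 1 to the horizon uniformly in v,
  -- although r is unbounded on u = 1 and bounded on the horizon.
  have h1 : ∀ v, v₀ ≤ v → S.r 1 v ≤ S.rp + C - F 1 := by
    intro v hv
    have h2 : ∀ u ∈ Ico 1 U, S.r 1 v - (C - F 1) ≤ S.r u v := by
      intro u hu
      have h3 := sub_le_sub_of_hasDerivAt_le (f := fun x => -S.r x v) (f' := fun x => -S.nu x v)
        (g := F) (g' := N) hu.1 (S.r_cont.slice_left v).neg.continuousOn
        (fun x hx => ((hF x ⟨hx.1, hx.2.trans_lt hu.2⟩).continuousWithinAt).mono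
          fun y hy => ⟨hy.1, hy.2.trans_lt hu.2⟩)
        (fun x hx => (S.r_u x ⟨hx.1, hx.2.trans hu.2⟩ v).neg)
        (fun x hx => (hF x ⟨hx.1.le, hx.2.trans hu.2⟩).hasDerivAt
          (Ico_mem_nhds hx.1 (hx.2.trans hu.2)))
        (fun x hx => hN x ⟨hx.1.le, hx.2.trans hu.2⟩ v hv)
      have h4 := hC ⟨u, hu, rfl⟩
      linarith
    have h5 : S.r 1 v - (C - F 1) ≤ S.r U v := by
      have hc : Tendsto (fun u => S.r u v) (𝓝[<] U) (𝓝 (S.r U v)) :=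
        ((S.r_cont.slice_left v).tendsto U).mono_left nhdsWithin_le_nhds
      refine ge_of_tendsto hc ?_
      filter_upwards [Ioo_mem_nhdsLT S.one_lt] with u hu using h2 u (Ioo_subset_Ico_self hu)
    have := S.r_le_rp (hv₀.trans hv)
    linarith
  obtain ⟨v, hv1, hv2⟩ := (((S.r_tendsto ⟨le_rfl, S.one_lt⟩).eventually_gt_atTop
    (S.rp + C - F 1)).and (eventually_ge_atTop v₀)).exists
  exact (h1 v hv2).not_gt hv1

end speed

/-- The uniform estimates available at late advanced times. -/
theorem exists_constants : ∃ ρ v₀ Z k q : ℝ, |S.e| < ρ ∧ 1 ≤ v₀ ∧ 0 ≤ Z ∧ 0 < k ∧ 0 < q ∧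
    ∀ u ∈ Icc 1 U, ∀ v, v₀ ≤ v → ρ ≤ S.r u v ∧ |S.ratio u v| ≤ Z ∧ k ≤ S.kappa u v ∧
      q ≤ S.charge u v := by
  obtain ⟨ρ, v₁, hρ, hv₁, hr⟩ := S.exists_radius
  obtain ⟨Z, hZ0, hZ⟩ := S.exists_ratio_bound hρ hv₁ hr
  obtain ⟨k, hk0, hk⟩ := S.exists_kappa_ge hρ hv₁ hr
  obtain ⟨v₀, q, hv₀, hq0, hq⟩ := S.exists_charge_ge hρ hv₁ hr
  exact ⟨ρ, v₀, Z, k, q, hρ, hv₁.trans hv₀, hZ0, hk0, hq0, fun u hu v hv =>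
    ⟨hr u hu v (hv₀.trans hv), hZ u hu v (hv₀.trans hv), hk u hu v (hv₀.trans hv), hq u hu v hv⟩⟩

end Background

/-! ### Normalized coordinates and passage to the exterior problem -/

/-- The fundamental theorem of calculus on an interval containing its left end point. -/
theorem hasDerivWithinAt_primitive {s : Set ℝ} {f : ℝ → ℝ} (hs : s.OrdConnected) {a : ℝ}
    (ha : a ∈ s) (hmin : ∀ x ∈ s, a ≤ x) (hgt : ∀ x ∈ s, ∃ y ∈ s, x < y) (hf : ContinuousOn f s)
    (c : ℝ) {x : ℝ} (hx : x ∈ s) :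
    HasDerivWithinAt (fun y => c + ∫ t in a..y, f t) (f x) s x := by
  obtain ⟨w, hw, hxw⟩ := hgt x hx
  have haw : a ≤ w := hmin w hw
  have hsub : Icc a w ⊆ s := hs.out ha hw
  have hcont : Continuous fun t => f (clamp a w t) :=
    (hf.mono hsub).comp_continuous (clamp_cont a w) (clamp_mem haw)
  have h1 : HasDerivAt (fun y => c + ∫ t in a..y, f (clamp a w t)) (f (clamp a w x)) x :=
    ((hcont.integral_hasStrictDerivAt a x).hasDerivAt).const_add c
  rw [clamp_of_mem ⟨hmin x hx, hxw.le⟩] at h1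
  have heq : ∀ y ∈ s, y < w → c + ∫ t in a..y, f t = c + ∫ t in a..y, f (clamp a w t) := by
    intro y hy hyw
    congr 1
    apply intervalIntegral.integral_congr
    intro t ht
    rw [uIcc_of_le (hmin y hy)] at ht
    simp only
    rw [clamp_of_mem ⟨ht.1, ht.2.trans hyw.le⟩]
  refine h1.hasDerivWithinAt.congr_of_eventuallyEq ?_ (heq x hx hxw)
  filter_upwards [self_mem_nhdsWithin, mem_nhdsWithin_of_mem_nhds (gt_mem_nhds hxw)] with y hy hyw
  exact heq y hy hyw

/-- `C¹` regularity from a continuous derivative. -/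
theorem contDiffOn_one_of_hasDerivWithinAt {s : Set ℝ} {f f' : ℝ → ℝ} (hs : UniqueDiffOn ℝ s)
    (hf : ∀ x ∈ s, HasDerivWithinAt f (f' x) s x) (hf' : ContinuousOn f' s) :
    ContDiffOn ℝ 1 f s :=
  (contDiffOn_one_iff_derivWithin hs).2 ⟨fun x hx => (hf x hx).differentiableWithinAt,
    hf'.congr fun x hx => (hf x hx).derivWithin (hs x hx)⟩

namespace NullData

variable {S : NullData} {ω : ℝ}

namespace Admissible

variable (hS : S.Admissible ω)
include hS

theorem continuousOn_kappa_one : ContinuousOn (fun v => S.kappa 1 v) S.vRange :=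
  hS.continuousOn_kappa.comp (f := fun v : ℝ => ((1 : ℝ), v)) (by fun_prop)
    fun _ hv => ⟨S.one_mem_uRange, hv⟩

/-- The advanced time normalized on the initial curve exists. -/
theorem exists_advanced_time : ∃ vS : ℝ → ℝ, vS 1 = 1 ∧
    ∀ v ∈ S.vRange, HasDerivWithinAt vS (S.kappa 1 v) S.vRange v := by
  refine ⟨fun v => 1 + ∫ t in (1 : ℝ)..v, S.kappa 1 t, by simp, fun v hv => ?_⟩
  exact hasDerivWithinAt_primitive S.vRange_ordConnected S.one_mem_vRange (fun x hx => hx.1)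
    (fun x hx => S.exists_gt_of_mem_vRange hx) hS.continuousOn_kappa_one 1 hv

theorem r_one_le {v : ℝ} (hv : v ∈ S.vRange) : S.r 1 1 ≤ S.r 1 v := by
  have hsub : Icc 1 v ⊆ S.vRange := S.vRange_ordConnected.out S.one_mem_vRange hv
  refine le_of_hasDerivAt_nonneg (f := fun y => S.r 1 y) (f' := fun y => S.lam 1 y) hv.1
    (fun x hx => ((hS.hasPartialV_r 1 S.one_mem_uRange x (hsub hx)).continuousWithinAt).mono hsub)
    (fun x hx => (hS.hasPartialV_r 1 S.one_mem_uRange x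
      (hsub (Ioo_subset_Icc_self hx))).hasDerivAt
      (S.vRange_mem_nhds (hsub (Ioo_subset_Icc_self hx)) hx.1))
    (fun x hx => hS.lam_nonneg 1 S.one_mem_uRange x (hsub (Ioo_subset_Icc_self hx)))

theorem varpi_one_le {v : ℝ} (hv : v ∈ S.vRange) : S.varpi 1 1 ≤ S.varpi 1 v := by
  have hsub : Icc 1 v ⊆ S.vRange := S.vRange_ordConnected.out S.one_mem_vRange hv
  refine le_of_hasDerivAt_nonneg (f := fun y => S.varpi 1 y)
    (f' := fun y => 1 / 2 * (S.kappa 1 y)⁻¹ * S.theta 1 y ^ 2) hv.1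
    (fun x hx => ((hS.varpi_v 1 S.one_mem_uRange x (hsub hx)).continuousWithinAt).mono hsub)
    (fun x hx => (hS.varpi_v 1 S.one_mem_uRange x
      (hsub (Ioo_subset_Icc_self hx))).hasDerivAt
      (S.vRange_mem_nhds (hsub (Ioo_subset_Icc_self hx)) hx.1))
    (fun x hx => ?_)
  have := hS.kappa_pos S.one_mem_uRange (hsub (Ioo_subset_Icc_self hx))
  positivity

/-- On the initial curve λ = κ(1 − μ) ≤ Cκ, since r and ϖ are bounded below there by their values at
v = 1. A bounded primitive of κ would thus bound r. -/
theorem not_bddAbove_advanced_time {vS : ℝ → ℝ}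
    (hv : ∀ v ∈ S.vRange, HasDerivWithinAt vS (S.kappa 1 v) S.vRange v) :
    ¬ BddAbove (vS '' S.vRange) := by
  rintro ⟨B, hB⟩
  refine hS.r_unbounded 1 ⟨le_rfl, S.one_lt_U₀⟩ ?_
  have hr1 : 0 < S.r 1 1 := hS.r_pos 1 S.one_mem_uRange 1 S.one_mem_vRange
  set C := 1 + 2 * |S.varpi 1 1| / S.r 1 1 + S.e ^ 2 / S.r 1 1 ^ 2 with hC
  have hC0 : 0 ≤ C := by positivity
  refine ⟨S.r 1 1 + C * (B - vS 1), ?_⟩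
  rintro _ ⟨v, hvm, rfl⟩
  have hsub : Icc 1 v ⊆ S.vRange := S.vRange_ordConnected.out S.one_mem_vRange hvm
  have h := sub_le_sub_of_hasDerivAt_le (f := fun y => S.r 1 y) (f' := fun y => S.lam 1 y)
    (g := fun y => C * vS y) (g' := fun y => C * S.kappa 1 y) hvm.1
    (fun x hx => ((hS.hasPartialV_r 1 S.one_mem_uRange x (hsub hx)).continuousWithinAt).mono hsub)
    (fun x hx => (((hv x (hsub hx)).const_mul C).continuousWithinAt).mono hsub)
    (fun x hx => (hS.hasPartialV_r 1 S.one_mem_uRange x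
      (hsub (Ioo_subset_Icc_self hx))).hasDerivAt
      (S.vRange_mem_nhds (hsub (Ioo_subset_Icc_self hx)) hx.1))
    (fun x hx => ((hv x (hsub (Ioo_subset_Icc_self hx))).const_mul C).hasDerivAt
      (S.vRange_mem_nhds (hsub (Ioo_subset_Icc_self hx)) hx.1)) (fun x hx => ?_)
  · have h1 : C * vS v ≤ C * B := mul_le_mul_of_nonneg_left (hB ⟨v, hvm, rfl⟩) hC0
    simp only at h ⊢
    linarith
  · have hx' := hsub (Ioo_subset_Icc_self hx)
    have hκ := hS.kappa_pos S.one_mem_uRange hx'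
    have h1 := hS.r_one_le hx'
    have h2 := hS.varpi_one_le hx'
    have hrx : 0 < S.r 1 x := hr1.trans_le h1
    rw [hS.lam_eq S.one_mem_uRange hx', mul_comm C]
    apply mul_le_mul_of_nonneg_left _ hκ.le
    have h3 : S.e ^ 2 / S.r 1 x ^ 2 ≤ S.e ^ 2 / S.r 1 1 ^ 2 := by gcongr
    have h4 : -(2 * S.varpi 1 x / S.r 1 x) ≤ 2 * |S.varpi 1 1| / S.r 1 1 := by
      calc -(2 * S.varpi 1 x / S.r 1 x) = 2 * (-S.varpi 1 x) / S.r 1 x := by ring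
        _ ≤ 2 * |S.varpi 1 1| / S.r 1 x := by
          gcongr
          linarith [neg_le_abs (S.varpi 1 1)]
        _ ≤ _ := by gcongr
    linarith

end Admissible

/-- The background `B` is the chart of `S` with advanced time replaced by `vS`. -/
structure IsBackground (S : NullData) (vS : ℝ → ℝ) (B : Background S.U₀) : Prop where
  e_eq : B.e = S.e
  rp_eq : B.rp = S.rPlus
  r_eq : ∀ u ∈ S.uRange, ∀ v ∈ S.vRange, B.r u (vS v) = S.r u v
  nu_eq : ∀ u ∈ S.uRange, ∀ v ∈ S.vRange, B.nu u (vS v) = S.nu u v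
  zeta_eq : ∀ u ∈ S.uRange, ∀ v ∈ S.vRange, B.zeta u (vS v) = S.zeta u v
  mass_eq : ∀ u ∈ S.uRange, ∀ v ∈ S.vRange, B.mass u (vS v) = S.varpi u v
  lam_eq : ∀ u ∈ S.uRange, ∀ v ∈ S.vRange, B.lam u (vS v) = S.lam u v * (S.kappa 1 v)⁻¹
  kappa_eq : ∀ u ∈ S.uRange, ∀ v ∈ S.vRange, B.kappa u (vS v) = S.kappa u v * (S.kappa 1 v)⁻¹

namespace Admissible

variable (hS : S.Admissible ω)
include hS

/-- Inverse of the normalized advanced time, frozen below `a`. -/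
theorem exists_inverse_advanced_time {vS : ℝ → ℝ} (h1 : vS 1 = 1)
    (hv : ∀ v ∈ S.vRange, HasDerivWithinAt vS (S.kappa 1 v) S.vRange v) {a : ℝ} (ha : 1 ≤ a) :
    ∃ h : ℝ → ℝ, Continuous h ∧ (∀ x, h x ∈ S.vRange) ∧ (∀ x, vS (h x) = max a x) ∧
      (∀ x, a < x → 1 < h x ∧ HasDerivAt h (S.kappa 1 (h x))⁻¹ x) ∧
      ∀ x ∈ S.vRange, a ≤ vS x → h (vS x) = x :=
  exists_inverse_coordinate S.vRange_ordConnected S.one_mem_vRange (fun _ hx => hx.1)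
    (fun _ hx hx1 => S.vRange_mem_nhds hx hx1) hv
    (fun _ hx => hS.kappa_pos S.one_mem_uRange hx) h1 (hS.not_bddAbove_advanced_time hv) ha

theorem one_le_advanced_time {vS : ℝ → ℝ} (h1 : vS 1 = 1)
    (hv : ∀ v ∈ S.vRange, HasDerivWithinAt vS (S.kappa 1 v) S.vRange v) {v : ℝ}
    (hvm : v ∈ S.vRange) : 1 ≤ vS v := by
  rw [← h1]
  exact (strictMonoOn_of_forall_hasDerivWithinAt S.vRange_ordConnected hv
    fun _ hx => hS.kappa_pos S.one_mem_uRange hx).monotoneOn S.one_mem_vRange hvm hvm.1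

/-- Only the advanced time is changed at this stage: normalizing u requires the limit of ν at null
infinity, which the estimates on this background provide. -/
theorem exists_isBackground {vS : ℝ → ℝ} (h1 : vS 1 = 1)
    (hv : ∀ v ∈ S.vRange, HasDerivWithinAt vS (S.kappa 1 v) S.vRange v) :
    ∃ B : Background S.U₀, S.IsBackground vS B := by
  obtain ⟨h, hc, hm, -, hd, hinv⟩ := hS.exists_inverse_advanced_time h1 hv le_rfl
  have hle : ∀ v ∈ S.vRange, 1 ≤ vS v := fun v hvm => hS.one_le_advanced_time h1 hv hvm
  have hinv' : ∀ v ∈ S.vRange, h (vS v) = v := fun v hvm => hinv v hvm (hle v hvm)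
  have hκ0 : ∀ v ∈ S.vRange, 0 < S.kappa 1 v := fun v hvm => hS.kappa_pos S.one_mem_uRange hvm
  have hb : Continuous fun x => (S.kappa 1 (h x))⁻¹ :=
    (hS.continuousOn_kappa_one.comp_continuous hc hm).inv₀ fun x => (hκ0 _ (hm x)).ne'
  have hcl : ∀ u ∈ S.uRange, clamp 1 S.U₀ u = u := fun u hu => clamp_of_mem hu
  let N : NullSystem (Ioo 1 S.U₀) (Ioi 1) :=
    hS.pullback (I := Ioo 1 S.U₀) (J := Ioi 1) (g := clamp 1 S.U₀) (a := fun _ => 1) (h := h)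
      (b := fun x => (S.kappa 1 (h x))⁻¹) (clamp_cont 1 S.U₀) continuous_const hc hb
      (clamp_mem S.one_lt_U₀.le) hm (fun _ => one_pos) (fun x => inv_pos.2 (hκ0 _ (hm x)))
      (fun x hx => clamp_hasDerivAt hx) hd
  have hr11 := hS.r_pos 1 S.one_mem_uRange 1 S.one_mem_vRange
  refine ⟨{ N with
    one_lt := S.one_lt_U₀
    kappa_one := ?_
    r_unbdd := ?_
    rp := S.rPlus
    rp_isLUB := ?_
    rp_ne := hS.non_extremal
    -- The bound on m passes to ϖ because e²/(2r) is largest at v = 1 on the initial curve.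
    M := max 1 (sSup ((fun v => S.hawkingMass 1 v) '' S.vRange) + S.e ^ 2 / (2 * S.r 1 1))
    one_le_M := le_max_left _ _
    mass_one_le := ?_ }, rfl, rfl, ?_, ?_, ?_, ?_, ?_, ?_⟩
  · intro v
    show S.kappa (clamp 1 S.U₀ 1) (h v) * (S.kappa 1 (h v))⁻¹ = 1
    rw [hcl 1 S.one_mem_uRange]
    exact mul_inv_cancel₀ (hκ0 _ (hm v)).ne'
  · intro u hu C
    have h2 := hS.r_unbounded u hu
    rw [not_bddAbove_iff] at h2
    obtain ⟨_, ⟨w, hw, rfl⟩, hC⟩ := h2 C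
    refine ⟨vS w, hle w hw, ?_⟩
    show C ≤ S.r (clamp 1 S.U₀ u) (h (vS w))
    rw [hcl u (Ico_subset_Icc_self hu), hinv' w hw]
    exact hC.le
  · have himg : (fun v => S.r (clamp 1 S.U₀ S.U₀) (h v)) '' Ici 1 =
        (fun v => S.r S.U₀ v) '' S.vRange := by
      rw [hcl S.U₀ ⟨S.one_lt_U₀.le, le_rfl⟩]
      ext y
      constructor
      · rintro ⟨x, -, rfl⟩
        exact ⟨h x, hm x, rfl⟩
      · rintro ⟨x, hx, rfl⟩
        exact ⟨vS x, hle x hx, by simp only [hinv' x hx]⟩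
    show IsLUB ((fun v => S.r (clamp 1 S.U₀ S.U₀) (h v)) '' Ici 1) S.rPlus
    rw [himg]
    exact isLUB_csSup ⟨_, 1, S.one_mem_vRange, rfl⟩ hS.r_horizon_bdd
  · intro v _
    show S.varpi (clamp 1 S.U₀ 1) (h v) ≤ _
    rw [hcl 1 S.one_mem_uRange]
    refine le_trans ?_ (le_max_right _ _)
    have h2 := le_csSup hS.mass_bdd ⟨h v, hm v, rfl⟩
    have h3 := hS.r_one_le (hm v)
    have h4 : S.e ^ 2 / (2 * S.r 1 (h v)) ≤ S.e ^ 2 / (2 * S.r 1 1) := by gcongr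
    exact add_le_add h2 h4
  · intro u hu v hvm
    show S.r (clamp 1 S.U₀ u) (h (vS v)) = _
    rw [hcl u hu, hinv' v hvm]
  · intro u hu v hvm
    show S.nu (clamp 1 S.U₀ u) (h (vS v)) * 1 = _
    rw [hcl u hu, hinv' v hvm, mul_one]
  · intro u hu v hvm
    show S.zeta (clamp 1 S.U₀ u) (h (vS v)) * 1 = _
    rw [hcl u hu, hinv' v hvm, mul_one]
  · intro u hu v hvm
    show S.varpi (clamp 1 S.U₀ u) (h (vS v)) = _
    rw [hcl u hu, hinv' v hvm]
  · intro u hu v hvm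
    show S.lam (clamp 1 S.U₀ u) (h (vS v)) * (S.kappa 1 (h (vS v)))⁻¹ = _
    rw [hcl u hu, hinv' v hvm]
  · intro u hu v hvm
    show S.kappa (clamp 1 S.U₀ u) (h (vS v)) * (S.kappa 1 (h (vS v)))⁻¹ = _
    rw [hcl u hu, hinv' v hvm]

/-- The advanced time tends to infinity towards null infinity. -/
theorem tendsto_advanced_time {vS : ℝ → ℝ}
    (hv : ∀ v ∈ S.vRange, HasDerivWithinAt vS (S.kappa 1 v) S.vRange v) :
    Tendsto (fun v : S.vRange => vS v) atTop atTop := by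
  have hmono := (strictMonoOn_of_forall_hasDerivWithinAt S.vRange_ordConnected hv
    fun _ hx => hS.kappa_pos S.one_mem_uRange hx).monotoneOn
  refine tendsto_atTop_atTop_of_monotone (fun x y hxy => hmono x.2 y.2 hxy) fun C => ?_
  have h2 := hS.not_bddAbove_advanced_time hv
  rw [not_bddAbove_iff] at h2
  obtain ⟨_, ⟨w, hw, rfl⟩, hC⟩ := h2 C
  exact ⟨⟨w, hw⟩, hC.le⟩

theorem tendsto_nu {vS : ℝ → ℝ}
    (hv : ∀ v ∈ S.vRange, HasDerivWithinAt vS (S.kappa 1 v) S.vRange v) {B : Background S.U₀}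
    (hB : S.IsBackground vS B) {u n : ℝ} (hu : u ∈ S.uRange)
    (hn : Tendsto (fun v => -B.nu u v) atTop (𝓝 n)) :
    Tendsto (fun v : S.vRange => S.nu u v) atTop (𝓝 (-n)) := by
  refine (hn.comp (hS.tendsto_advanced_time hv)).neg.congr fun v => ?_
  simp only [Function.comp_apply, neg_neg]
  exact hB.nu_eq u hu v v.2

end Admissible

theorem IsNormalized.advanced_time {uS vS : ℝ → ℝ} (hn : S.IsNormalized uS vS) {v : ℝ}
    (hv : v ∈ S.vRange) : derivWithin vS S.vRange v = S.kappa 1 v ∧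
      HasDerivWithinAt vS (S.kappa 1 v) S.vRange v := by
  have h1 : derivWithin vS S.vRange v = S.kappa 1 v :=
    ((div_eq_one_iff_eq (hn.deriv_v_pos v hv).ne').1 (hn.kappa_eq_one v hv)).symm
  refine ⟨h1, ?_⟩
  rw [← h1]
  exact (hn.contDiffOn_v.differentiableOn one_ne_zero v hv).hasDerivWithinAt

/-- The normalization determines the derivative of `uS` as the limit of −ν, so the estimates apply
to every normalized pair and not only to the one constructed. -/
theorem IsNormalized.retarded_time {uS vS : ℝ → ℝ} (hn : S.IsNormalized uS vS) {u n : ℝ}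
    (hu : u ∈ Ico 1 S.U₀) (hlim : Tendsto (fun v : S.vRange => S.nu u v) atTop (𝓝 (-n))) :
    derivWithin uS (Ico 1 S.U₀) u = n ∧ HasDerivWithinAt uS n (Ico 1 S.U₀) u := by
  have : Nonempty S.vRange := ⟨⟨1, S.one_mem_vRange⟩⟩
  have h0 := hn.deriv_u_pos u hu
  have h1 : derivWithin uS (Ico 1 S.U₀) u = n := by
    have h2 := tendsto_nhds_unique (hn.nu_tendsto u hu) (hlim.div_const _)
    rw [eq_div_iff h0.ne'] at h2
    linarith
  refine ⟨h1, ?_⟩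
  rw [← h1]
  exact (hn.contDiffOn_u.differentiableOn one_ne_zero u hu).hasDerivWithinAt

end NullData

namespace NullData

variable {S : NullData} {ω : ℝ}

namespace Admissible

variable (hS : S.Admissible ω)
include hS

theorem exists_isNormalized : ∃ uS vS : ℝ → ℝ, S.IsNormalized uS vS := by
  obtain ⟨vS, hv1, hv⟩ := hS.exists_advanced_time
  obtain ⟨B, hB⟩ := hS.exists_isBackground hv1 hv
  obtain ⟨ρ, v₀, Z, k, q, -, hv₀, -, -, hq0, hK⟩ := B.exists_constants
  obtain ⟨N, hNc, hN⟩ := B.exists_speed hv₀ fun u hu v hv => hq0.le.trans (hK u hu v hv).2.2.2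
  have hN0 : ∀ u ∈ Ico 1 S.U₀, 0 < N u := fun u hu =>
    (neg_pos.2 (B.nu_neg u v₀)).trans_le ((hN u hu).2 v₀ le_rfl).1
  have hu : ∀ u ∈ Ico 1 S.U₀,
      HasDerivWithinAt (fun u => 1 + ∫ t in (1 : ℝ)..u, N t) (N u) (Ico 1 S.U₀) u := fun u hu =>
    hasDerivWithinAt_primitive ordConnected_Ico ⟨le_rfl, S.one_lt_U₀⟩ (fun x hx => hx.1)
      (fun x hx => by
        obtain ⟨y, h1, h2⟩ := exists_between hx.2
        exact ⟨y, ⟨hx.1.trans h1.le, h2⟩, h1⟩) hNc 1 hu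
  have hdu : ∀ u ∈ Ico 1 S.U₀,
      derivWithin (fun u => 1 + ∫ t in (1 : ℝ)..u, N t) (Ico 1 S.U₀) u = N u := fun u h =>
    (hu u h).derivWithin (uniqueDiffOn_Ico 1 S.U₀ u h)
  have hdv : ∀ v ∈ S.vRange, derivWithin vS S.vRange v = S.kappa 1 v := fun v h =>
    (hv v h).derivWithin (S.vRange_uniqueDiffOn v h)
  refine ⟨_, vS,
    { contDiffOn_u := contDiffOn_one_of_hasDerivWithinAt (uniqueDiffOn_Ico 1 S.U₀) hu hNc
      contDiffOn_v := contDiffOn_one_of_hasDerivWithinAt S.vRange_uniqueDiffOn hv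
        hS.continuousOn_kappa_one
      deriv_u_pos := fun u h => by rw [hdu u h]; exact hN0 u h
      deriv_v_pos := fun v h => by rw [hdv v h]; exact hS.kappa_pos S.one_mem_uRange h
      u_one := by simp
      v_one := hv1
      kappa_eq_one := fun v h => by
        rw [hdv v h]
        exact div_self (hS.kappa_pos S.one_mem_uRange h).ne'
      nu_tendsto := fun u h => ?_ }⟩
  rw [hdu u h, show (-1 : ℝ) = -N u / N u by rw [neg_div, div_self (hN0 u h).ne']]
  exact (hS.tendsto_nu hv hB (Ico_subset_Icc_self h) (hN u h).1).div_const _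

/-- The region of late advanced time, in normalized coordinates. -/
theorem exists_exterior (hω : 1 < ω) {uS vS : ℝ → ℝ} (hn : S.IsNormalized uS vS) :
    ∃ (v₀ : ℝ) (E : Exterior v₀ ω), ∀ u ∈ Ico 1 S.U₀, ∀ v ∈ S.vRange, v₀ ≤ vS v →
      E.r (uS u) (vS v) = S.r u v ∧ E.phi (uS u) (vS v) = S.φ u v ∧
      E.theta (uS u) (vS v) = S.thetaIn vS u v ∧ E.zeta (uS u) (vS v) = S.zetaIn uS u v := by
  have hv : ∀ v ∈ S.vRange, HasDerivWithinAt vS (S.kappa 1 v) S.vRange v := fun v h =>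
    (hn.advanced_time h).2
  obtain ⟨B, hB⟩ := hS.exists_isBackground hn.v_one hv
  obtain ⟨ρ, v₀, Z, k, q, hρ, hv₀, hZ0, hk0, hq0, hK⟩ := B.exists_constants
  obtain ⟨N, hNc, hN⟩ := B.exists_speed hv₀ fun u hu v hv => hq0.le.trans (hK u hu v hv).2.2.2
  have hρ0 : 0 < ρ := (abs_nonneg _).trans_lt hρ
  obtain ⟨c', hc'0, hc'⟩ := B.exists_r_one_ge_linear hρ0 hv₀ fun v hv =>
    (hK 1 B.one_mem v hv).1
  have hN0 : ∀ u ∈ Ico 1 S.U₀, 0 < N u := fun u hu =>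
    (neg_pos.2 (B.nu_neg u v₀)).trans_le ((hN u hu).2 v₀ le_rfl).1
  have hut := fun u (hu : u ∈ Ico 1 S.U₀) =>
    hn.retarded_time hu (hS.tendsto_nu hv hB (Ico_subset_Icc_self hu) (hN u hu).1)
  obtain ⟨h, hhc, hhm, hhv, hhd, hhinv⟩ := hS.exists_inverse_advanced_time hn.v_one hv hv₀
  obtain ⟨g, hgc, hgm, hgu, hgd, hginv⟩ := exists_inverse_coordinate (f := uS) (f' := N) (a := 1)
    (ordConnected_Ico (a := (1 : ℝ)) (b := S.U₀)) ⟨le_rfl, S.one_lt_U₀⟩ (fun x hx => hx.1)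
    (fun x hx hx1 => Ico_mem_nhds hx1 hx.2) (fun u hu => (hut u hu).2) hN0 hn.u_one
    (B.unbounded_of_speed hv₀ (fun u hu v hv => ((hN u hu).2 v hv).1) fun u hu => (hut u hu).2)
    le_rfl
  have hgI : ∀ x, g x ∈ S.uRange := fun x => Ico_subset_Icc_self (hgm x)
  have hg1 : g 1 = 1 := by
    have := hginv 1 ⟨le_rfl, S.one_lt_U₀⟩ hn.u_one.ge
    rwa [hn.u_one] at this
  have hκ0 : ∀ v ∈ S.vRange, 0 < S.kappa 1 v := fun v hvm => hS.kappa_pos S.one_mem_uRange hvm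
  have hb : Continuous fun x => (S.kappa 1 (h x))⁻¹ :=
    (hS.continuousOn_kappa_one.comp_continuous hhc hhm).inv₀ fun x => (hκ0 _ (hhm x)).ne'
  have ha : Continuous fun x => (N (g x))⁻¹ :=
    (hNc.comp_continuous hgc hgm).inv₀ fun x => (hN0 _ (hgm x)).ne'
  have hle : ∀ y, v₀ ≤ vS (h y) := fun y => by rw [hhv]; exact le_max_left _ _
  have hle1 : ∀ y, 1 ≤ vS (h y) := fun y => hv₀.trans (hle y)
  have er : ∀ x y, S.r (g x) (h y) = B.r (g x) (vS (h y)) := fun x y =>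
    (hB.r_eq _ (hgI x) _ (hhm y)).symm
  have en : ∀ x y, S.nu (g x) (h y) = B.nu (g x) (vS (h y)) := fun x y =>
    (hB.nu_eq _ (hgI x) _ (hhm y)).symm
  have ez : ∀ x y, S.zeta (g x) (h y) = B.zeta (g x) (vS (h y)) := fun x y =>
    (hB.zeta_eq _ (hgI x) _ (hhm y)).symm
  have em : ∀ x y, S.varpi (g x) (h y) = B.mass (g x) (vS (h y)) := fun x y =>
    (hB.mass_eq _ (hgI x) _ (hhm y)).symm
  have el : ∀ x y, S.lam (g x) (h y) * (S.kappa 1 (h y))⁻¹ = B.lam (g x) (vS (h y)) := fun x y =>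
    (hB.lam_eq _ (hgI x) _ (hhm y)).symm
  have ek : ∀ x y, S.kappa (g x) (h y) * (S.kappa 1 (h y))⁻¹ = B.kappa (g x) (vS (h y)) :=
    fun x y => (hB.kappa_eq _ (hgI x) _ (hhm y)).symm
  have hd : 0 < 1 - B.e ^ 2 / ρ ^ 2 := by
    rw [sub_pos, div_lt_one (by positivity), ← sq_abs]
    exact pow_lt_pow_left₀ hρ (abs_nonneg _) two_ne_zero
  have hmass : ∀ x y, q + B.e ^ 2 / B.r (g x) (vS (h y)) ≤ B.mass (g x) (vS (h y)) := by
    intro x y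
    have h1 := (hK (g x) (hgI x) _ (hle y)).2.2.2
    unfold Background.charge at h1
    linarith
  have hlam1 : ∀ x y, B.lam (g x) (vS (h y)) ≤ 1 := by
    intro x y
    have h1 := (hK (g x) (hgI x) _ (hle y)).2.2.2
    have h2 := B.kappa_le_one (hgI x) (vS (h y))
    have h3 := B.r_pos (g x) (vS (h y))
    have h4 : 0 ≤ 2 * B.charge (g x) (vS (h y)) / B.r (g x) (vS (h y)) := by
      have := hq0.trans_le h1
      positivity
    have h5 : 0 ≤ B.e ^ 2 / B.r (g x) (vS (h y)) ^ 2 := by positivity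
    have h6 := B.aspect_nonneg (g x) (vS (h y))
    rw [B.lam_eq]
    refine mul_le_one₀ h2 h6 ?_
    rw [B.aspect_eq]
    linarith
  obtain ⟨C, hC⟩ := hS.initial_decay
  have hC0 : 0 ≤ C := by
    refine le_trans ?_ (hC 1 S.one_mem_vRange).1
    exact mul_nonneg (hS.r_pos 1 S.one_mem_uRange 1 S.one_mem_vRange).le (abs_nonneg _)
  have hpsiV : ∀ y, |S.φ 1 (h y) + S.theta 1 (h y) / S.lam 1 (h y)| ≤ C * S.r 1 (h y) ^ (-ω) := by
    intro y
    have h1 := (hC (h y) (hhm y)).2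
    have h2 := hS.r_pos 1 S.one_mem_uRange _ (hhm y)
    rw [Real.rpow_neg h2.le, ← div_eq_mul_inv, le_div_iff₀ (Real.rpow_pos_of_pos h2 _), mul_comm]
    exact h1
  have hrlin : ∀ y, v₀ ≤ y → c' * y ≤ S.r 1 (h y) ∧ ρ ≤ S.r 1 (h y) := by
    intro y hy
    have h1 := er 1 y
    rw [hg1] at h1
    rw [h1]
    have h2 := hc' _ (hle y)
    refine ⟨?_, (hK 1 B.one_mem _ (hle y)).1⟩
    rwa [hhv, max_eq_right hy] at h2 ⊢
  let NS : NullSystem (Ioi 1) (Ioi v₀) :=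
    hS.pullback (I := Ioi 1) (J := Ioi v₀) (g := g) (a := fun x => (N (g x))⁻¹) (h := h)
      (b := fun x => (S.kappa 1 (h x))⁻¹) hgc ha hhc hb hgI hhm
      (fun x => inv_pos.2 (hN0 _ (hgm x))) (fun x => inv_pos.2 (hκ0 _ (hhm x)))
      (fun x hx => (hgd x hx).2) hhd
  have hM := B.one_le_M
  -- For r ≥ 4M, k/2 bounds λ ≥ κ/2 from below, and 1/e bounds −ν/N ≥ exp(−4M/r).
  set c := min (min (k / 2) (Real.exp 1)⁻¹) 1 with hc
  have hck : c ≤ k / 2 := (min_le_left _ _).trans (min_le_left _ _)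
  have hce : c ≤ (Real.exp 1)⁻¹ := (min_le_left _ _).trans (min_le_right _ _)
  have hc0 : 0 < c := lt_min (lt_min (by positivity) (by positivity)) one_pos
  refine ⟨v₀, { NS with
    ρ := ρ
    c := c
    M := B.M
    d := 1 - B.e ^ 2 / ρ ^ 2
    q₀ := q
    Z := Z
    -- The first entry bounds r|φ| by r·Cr^{−ω} + r|θ/λ| with r ≥ ρ; the second turns decay in r
    -- into decay in v through r ≥ c'v on u = 1.
    A := max (C * ρ ^ (-ω + 1) + C) (C * c' ^ (-ω))
    -- The second entry bounds r along v = v₀, where r is largest at u = 1; it ensures that level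
    -- curves beyond R₁ stay in v > v₀.
    R₁ := max (4 * B.M) (S.r 1 (h v₀))
    one_le_v₀ := hv₀
    ρ_pos := hρ0
    c_pos := hc0
    c_le_one := min_le_right _ _
    one_le_M := hM
    d_pos := hd
    q₀_pos := hq0
    R₁_ge := le_max_left _ _
    r_ge := fun x y => ?_
    r_init := fun x => ?_
    r_tendsto := fun x => ?_
    kappa_ge := fun x y => ?_
    kappa_le := fun x y => ?_
    nu_ge := fun x y => ?_
    lam_pos := fun x y => mul_pos (hS.lam_pos _ (hgm x) _ (hhm y)) (inv_pos.2 (hκ0 _ (hhm y)))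
    lam_le := fun x y => (el x y).trans_le (hlam1 x y)
    mass_nonneg := fun x y => ?_
    mass_le := fun x y => (em x y).trans_le (B.mass_le (hgI x) (hle1 y))
    q_ge := fun x y => ?_
    d_le := fun x y => ?_
    zeta_le := fun x y => ?_
    lam_ge := fun x y hxy => ?_
    nu_le := fun x y hxy => ?_
    psi_data := fun y hy => ?_
    psiV_data := fun y hy => ?_ }, ?_⟩
  · exact ((hK _ (hgI x) _ (hle y)).1).trans_eq (er x y).symm
  · refine le_trans ?_ (le_max_right _ _)
    have h1 := er 1 v₀
    rw [hg1] at h1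
    show S.r (g x) (h v₀) ≤ S.r 1 (h v₀)
    rw [er, h1]
    exact B.r_anti_u _ B.one_mem (hgI x) (hgI x).1
  · refine (B.r_tendsto (hgm x)).congr' ?_
    filter_upwards [eventually_ge_atTop v₀] with y hy
    show _ = S.r (g x) (h y)
    rw [er, hhv, max_eq_right hy]
  · refine le_trans ?_ ((hK _ (hgI x) _ (hle y)).2.2.1.trans_eq (ek x y).symm)
    linarith
  · exact (ek x y).trans_le (B.kappa_le_one (hgI x) _)
  · show -1 ≤ S.nu (g x) (h y) * (N (g x))⁻¹
    have h1 := ((hN _ (hgm x)).2 _ (hle y)).1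
    rw [en, ← div_eq_mul_inv, le_div_iff₀ (hN0 _ (hgm x))]
    linarith
  · show 0 ≤ S.varpi (g x) (h y)
    rw [em]
    have h1 := B.r_pos (g x) (vS (h y))
    exact le_trans (by positivity) (hmass x y)
  · show q ≤ S.varpi (g x) (h y) - S.e ^ 2 / S.r (g x) (h y)
    rw [em, er, ← hB.e_eq]
    linarith [hmass x y]
  · show _ ≤ 1 - S.e ^ 2 / S.r (g x) (h y) ^ 2
    rw [er, ← hB.e_eq]
    have h1 := (hK _ (hgI x) _ (hle y)).1
    gcongr
  · show |S.zeta (g x) (h y) * (N (g x))⁻¹| ≤ Z * -(S.nu (g x) (h y) * (N (g x))⁻¹)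
    have h1 := (hK _ (hgI x) _ (hle y)).2.1
    have h2 := B.nu_neg (g x) (vS (h y))
    have h3 := inv_pos.2 (hN0 _ (hgm x))
    rw [ez, en, abs_mul, abs_of_pos h3, ← neg_mul, ← mul_assoc]
    apply mul_le_mul_of_nonneg_right _ h3.le
    rw [NullSystem.ratio, abs_div, abs_of_neg h2, div_le_iff₀ (neg_pos.2 h2)] at h1
    exact h1
  · show c ≤ S.lam (g x) (h y) * (S.kappa 1 (h y))⁻¹
    rw [el]
    have h1 : 4 * B.M ≤ S.r (g x) (h y) := (le_max_left _ _).trans hxy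
    rw [er] at h1
    have h2 := B.lam_ge_half (hgI x) (hle1 y) h1
    have h3 := (hK _ (hgI x) _ (hle y)).2.2.1
    linarith
  · show S.nu (g x) (h y) * (N (g x))⁻¹ ≤ -c
    have h1 : 4 * B.M ≤ S.r (g x) (h y) := (le_max_left _ _).trans hxy
    rw [er] at h1
    have h2 := ((hN _ (hgm x)).2 _ (hle y)).2 h1
    have h3 : 4 * B.M / B.r (g x) (vS (h y)) ≤ 1 := (div_le_one (B.r_pos _ _)).2 h1
    have h4 := Real.exp_le_exp.2 h3
    have h5 := neg_pos.2 (B.nu_neg (g x) (vS (h y)))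
    have h6 := hN0 _ (hgm x)
    have h7 : (Real.exp 1)⁻¹ * N (g x) ≤ -B.nu (g x) (vS (h y)) := by
      rw [inv_mul_le_iff₀ (Real.exp_pos 1), mul_comm]
      exact h2.trans (mul_le_mul_of_nonneg_left h4 h5.le)
    rw [en, ← div_eq_mul_inv, div_le_iff₀ h6]
    have h8 := mul_le_mul_of_nonneg_right hce h6.le
    linarith
  · show |S.r (g 1) (h y) * S.φ (g 1) (h y)| ≤ _
    refine le_trans ?_ (le_max_left _ _)
    rw [hg1]
    have h1 := hpsiV y
    have h2 := (hC (h y) (hhm y)).1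
    have hr0 := hS.r_pos 1 S.one_mem_uRange _ (hhm y)
    have h3 : |S.φ 1 (h y)| ≤ C * S.r 1 (h y) ^ (-ω) + |S.theta 1 (h y) / S.lam 1 (h y)| := by
      have h4 := abs_sub (S.φ 1 (h y) + S.theta 1 (h y) / S.lam 1 (h y))
        (S.theta 1 (h y) / S.lam 1 (h y))
      rw [add_sub_cancel_right] at h4
      linarith
    rw [abs_mul, abs_of_pos hr0]
    have h5 : S.r 1 (h y) ^ (-ω + 1) ≤ ρ ^ (-ω + 1) :=
      Real.rpow_le_rpow_of_nonpos hρ0 (hrlin y hy).2 (by linarith)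
    calc S.r 1 (h y) * |S.φ 1 (h y)|
        ≤ S.r 1 (h y) * (C * S.r 1 (h y) ^ (-ω) + |S.theta 1 (h y) / S.lam 1 (h y)|) := by gcongr
      _ = C * S.r 1 (h y) ^ (-ω + 1) + S.r 1 (h y) * |S.theta 1 (h y) / S.lam 1 (h y)| := by
        rw [Real.rpow_add_one hr0.ne']
        ring
      _ ≤ _ := by gcongr
  · show |S.lam (g 1) (h y) * (S.kappa 1 (h y))⁻¹ * S.φ (g 1) (h y)
      + S.theta (g 1) (h y) * (S.kappa 1 (h y))⁻¹| ≤ _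
    have hy0 : 0 < y := by linarith
    have hl := hS.lam_pos 1 ⟨le_rfl, S.one_lt_U₀⟩ _ (hhm y)
    have e1 : S.lam (g 1) (h y) * (S.kappa 1 (h y))⁻¹ * S.φ (g 1) (h y)
        + S.theta (g 1) (h y) * (S.kappa 1 (h y))⁻¹ = B.lam (g 1) (vS (h y)) *
          (S.φ 1 (h y) + S.theta 1 (h y) / S.lam 1 (h y)) := by
      rw [← el, hg1]
      have := hl.ne'
      field_simp
    rw [e1, abs_mul, abs_of_nonneg (B.lam_nonneg _ _)]
    have hcy : 0 < c' * y := mul_pos hc'0 hy0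
    calc B.lam (g 1) (vS (h y)) * |S.φ 1 (h y) + S.theta 1 (h y) / S.lam 1 (h y)|
        ≤ 1 * (C * S.r 1 (h y) ^ (-ω)) :=
          mul_le_mul (hlam1 1 y) (hpsiV y) (abs_nonneg _) zero_le_one
      _ ≤ 1 * (C * (c' * y) ^ (-ω)) := by
        have := Real.rpow_le_rpow_of_nonpos hcy (hrlin y hy).1 (by linarith : -ω ≤ 0)
        gcongr
      _ = C * c' ^ (-ω) * y ^ (-ω) := by
        rw [Real.mul_rpow hc'0.le hy0.le]
        ring
      _ ≤ _ := mul_le_mul_of_nonneg_right (le_max_right _ _) (Real.rpow_nonneg hy0.le _)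
  · intro u hu v hvm hvv
    have h1 : h (vS v) = v := hhinv v hvm hvv
    have hu1 : 1 ≤ uS u := by
      rw [← hn.u_one]
      exact (strictMonoOn_of_forall_hasDerivWithinAt ordConnected_Ico (fun u hu => (hut u hu).2)
        hN0).monotoneOn ⟨le_rfl, S.one_lt_U₀⟩ hu hu.1
    have h2 : g (uS u) = u := hginv u hu hu1
    refine ⟨?_, ?_, ?_, ?_⟩
    · show S.r (g (uS u)) (h (vS v)) = _
      rw [h1, h2]
    · show S.φ (g (uS u)) (h (vS v)) = _
      rw [h1, h2]
    · show S.theta (g (uS u)) (h (vS v)) * (S.kappa 1 (h (vS v)))⁻¹ = _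
      rw [h1, h2, thetaIn, (hn.advanced_time hvm).1, div_eq_mul_inv]
    · show S.zeta (g (uS u)) (h (vS v)) * (N (g (uS u)))⁻¹ = _
      rw [h1, h2, zetaIn, (hut u hu).1, div_eq_mul_inv]

end Admissible

end NullData

/-! ### Bounded advanced time by compactness, and the conclusion -/

/-- On a compact set, a continuous function is dominated by a multiple of any positive one. -/
theorem IsCompact.exists_abs_le_const_mul {X : Type*} [TopologicalSpace X] {K : Set X}
    (hK : IsCompact K) {f g : X → ℝ} (hf : ContinuousOn f K) (hg : ContinuousOn g K)
    (hg0 : ∀ x ∈ K, 0 < g x) : ∃ C : ℝ, ∀ x ∈ K, |f x| ≤ C * g x := by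
  obtain ⟨C, hC⟩ := hK.exists_bound_of_continuousOn (hf.div hg fun x hx => (hg0 x hx).ne')
  refine ⟨C, fun x hx => ?_⟩
  have h1 := hC x hx
  rwa [Pi.div_apply, Real.norm_eq_abs, abs_div, abs_of_pos (hg0 x hx), div_le_iff₀ (hg0 x hx)] at h1

namespace NullData

variable {S : NullData} {ω : ℝ}

namespace IsNormalized

variable {uS vS : ℝ → ℝ} (hn : S.IsNormalized uS vS)
include hn

theorem one_le_uS {u : ℝ} (hu : u ∈ Ico 1 S.U₀) : 1 ≤ uS u := by
  rw [← hn.u_one]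
  exact (strictMonoOn_of_forall_hasDerivWithinAt ordConnected_Ico
    (fun x hx => (hn.contDiffOn_u.differentiableOn one_ne_zero x hx).hasDerivWithinAt)
    hn.deriv_u_pos).monotoneOn ⟨le_rfl, S.one_lt_U₀⟩ hu hu.1

theorem strictMonoOn_vS : StrictMonoOn vS S.vRange :=
  strictMonoOn_of_forall_hasDerivWithinAt S.vRange_ordConnected
    (fun x hx => (hn.contDiffOn_v.differentiableOn one_ne_zero x hx).hasDerivWithinAt) hn.deriv_v_pos

theorem one_le_vS {v : ℝ} (hv : v ∈ S.vRange) : 1 ≤ vS v := by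
  rw [← hn.v_one]
  exact hn.strictMonoOn_vS.monotoneOn S.one_mem_vRange hv hv.1

end IsNormalized

namespace Admissible

variable (hS : S.Admissible ω)
include hS

/-- The estimates for bounded advanced time, away from the event horizon. -/
theorem exists_bound_of_advanced_time_le {uS vS : ℝ → ℝ} (hn : S.IsNormalized uS vS) (V p₁ p₂ p₃ : ℝ)
    {r₀ : ℝ} (hr₀ : S.rPlus < r₀) : ∃ C : ℝ, ∀ u ∈ Ico 1 S.U₀, ∀ v ∈ S.vRange, vS v ≤ V →
      r₀ ≤ S.r u v → |S.thetaIn vS u v| ≤ C * ((vS v)⁻¹ * uS u ^ p₁) ∧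
        |S.zetaIn uS u v| ≤ C * uS u ^ p₂ ∧ |S.r u v * S.φ u v| ≤ C * uS u ^ p₃ := by
  have hv : ∀ v ∈ S.vRange, HasDerivWithinAt vS (S.kappa 1 v) S.vRange v := fun v h =>
    (hn.advanced_time h).2
  obtain ⟨B, hB⟩ := hS.exists_isBackground hn.v_one hv
  obtain ⟨h, -, hhm, hhv, -, -⟩ := hS.exists_inverse_advanced_time hn.v_one hv le_rfl
  set w := h V with hw
  have hwm : w ∈ S.vRange := hhm V
  have hwV : vS w = max 1 V := hhv V
  -- For u near U₀ even the largest radius in the range, attained at advanced time `max 1 V`, is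
  -- below r₀, because r₊ < r₀. The condition r ≥ r₀ therefore confines u to a compact part of [1,
  -- U₀).
  have hev : ∀ᶠ u in 𝓝[<] S.U₀, B.r u (max 1 V) < r₀ := by
    have h1 : B.r S.U₀ (max 1 V) < r₀ := by
      refine (B.r_le_rp (le_max_left _ _)).trans_lt ?_
      rwa [hB.rp_eq]
    exact (((B.r_cont.slice_left (max 1 V)).tendsto S.U₀).mono_left nhdsWithin_le_nhds).eventually
      (gt_mem_nhds h1)
  obtain ⟨U', hU', hsubU⟩ := (mem_nhdsLT_iff_exists_mem_Ico_Ioo_subset S.one_lt_U₀).1 hev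
  have hK1 : Icc 1 U' ⊆ Ico 1 S.U₀ := fun u hu => ⟨hu.1, hu.2.trans_lt hU'.2⟩
  have hK2 : Icc 1 w ⊆ S.vRange := S.vRange_ordConnected.out S.one_mem_vRange hwm
  set K := Icc 1 U' ×ˢ Icc 1 w with hKdef
  have hK : IsCompact K := isCompact_Icc.prod isCompact_Icc
  have hKd : K ⊆ S.dom := prod_mono (hK1.trans Ico_subset_Icc_self) hK2
  have hfst : MapsTo Prod.fst K (Ico 1 S.U₀) := fun p hp => hK1 hp.1
  have hsnd : MapsTo Prod.snd K S.vRange := fun p hp => hK2 hp.2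
  have huc : ContinuousOn (fun p : ℝ × ℝ => uS p.1) K :=
    hn.contDiffOn_u.continuousOn.comp continuousOn_fst hfst
  have hvc : ContinuousOn (fun p : ℝ × ℝ => vS p.2) K :=
    hn.contDiffOn_v.continuousOn.comp continuousOn_snd hsnd
  have hu0 : ∀ p ∈ K, 0 < uS p.1 := fun p hp => one_pos.trans_le (hn.one_le_uS (hfst hp))
  have hv0 : ∀ p ∈ K, 0 < vS p.2 := fun p hp => one_pos.trans_le (hn.one_le_vS (hsnd hp))
  have hpc : ∀ q : ℝ, ContinuousOn (fun p : ℝ × ℝ => uS p.1 ^ q) K := fun q =>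
    huc.rpow_const fun p hp => Or.inl (hu0 p hp).ne'
  have hp0 : ∀ q : ℝ, ∀ p ∈ K, 0 < uS p.1 ^ q := fun q p hp => Real.rpow_pos_of_pos (hu0 p hp) q
  have hθ : ContinuousOn (fun p : ℝ × ℝ => S.thetaIn vS p.1 p.2) K :=
    (hS.continuousOn_theta.mono hKd).div
      ((hn.contDiffOn_v.continuousOn_derivWithin S.vRange_uniqueDiffOn le_rfl).comp
        continuousOn_snd hsnd) fun p hp => (hn.deriv_v_pos _ (hsnd hp)).ne'
  have hζ : ContinuousOn (fun p : ℝ × ℝ => S.zetaIn uS p.1 p.2) K :=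
    (hS.continuousOn_zeta.mono hKd).div
      ((hn.contDiffOn_u.continuousOn_derivWithin (uniqueDiffOn_Ico 1 S.U₀) le_rfl).comp
        continuousOn_fst hfst) fun p hp => (hn.deriv_u_pos _ (hfst hp)).ne'
  have hψ : ContinuousOn (fun p : ℝ × ℝ => S.r p.1 p.2 * S.φ p.1 p.2) K :=
    (hS.continuousOn_r.mul hS.continuousOn_φ).mono hKd
  obtain ⟨C₁, hC₁⟩ := hK.exists_abs_le_const_mul hθ
    ((hvc.inv₀ fun p hp => (hv0 p hp).ne').mul (hpc p₁))
    fun p hp => mul_pos (inv_pos.2 (hv0 p hp)) (hp0 p₁ p hp)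
  obtain ⟨C₂, hC₂⟩ := hK.exists_abs_le_const_mul hζ (hpc p₂) (hp0 p₂)
  obtain ⟨C₃, hC₃⟩ := hK.exists_abs_le_const_mul hψ (hpc p₃) (hp0 p₃)
  refine ⟨max C₁ (max C₂ C₃), fun u hu v hvm hvV hr => ?_⟩
  have hvw : v ≤ w := by
    rw [← hn.strictMonoOn_vS.le_iff_le hvm hwm, hwV]
    exact hvV.trans (le_max_right _ _)
  have huU : u ≤ U' := by
    by_contra hcon
    have h1 : B.r u (max 1 V) < r₀ := hsubU ⟨not_le.1 hcon, hu.2⟩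
    have h2 := B.r_mono_v u (hn.one_le_vS hvm) (le_max_left 1 V) (hvV.trans (le_max_right _ _))
    simp only at h2
    rw [hB.r_eq u (Ico_subset_Icc_self hu) v hvm] at h2
    linarith
  have hp : (u, v) ∈ K := ⟨⟨hu.1, huU⟩, hvm.1, hvw⟩
  have hle2 : C₂ ≤ max C₁ (max C₂ C₃) := (le_max_left _ _).trans (le_max_right _ _)
  have hle3 : C₃ ≤ max C₁ (max C₂ C₃) := (le_max_right _ _).trans (le_max_right _ _)
  exact ⟨(hC₁ _ hp).trans (mul_le_mul_of_nonneg_right (le_max_left _ _)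
      (mul_pos (inv_pos.2 (hv0 _ hp)) (hp0 p₁ _ hp)).le),
    (hC₂ _ hp).trans (mul_le_mul_of_nonneg_right hle2 (hp0 p₂ _ hp).le),
    (hC₃ _ hp).trans (mul_le_mul_of_nonneg_right hle3 (hp0 p₃ _ hp).le)⟩

/-- The estimates for late advanced time. -/
theorem exists_bound_of_le_advanced_time (hω : 1 < ω) (hω3 : ω ≤ 3) {uS vS : ℝ → ℝ}
    (hn : S.IsNormalized uS vS) {ε δ : ℝ} (hε : 0 < ε) (hδ : 0 < δ) : ∃ V C : ℝ, 0 < C ∧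
      ∀ u ∈ Ico 1 S.U₀, ∀ v ∈ S.vRange, V ≤ vS v → δ * vS v ≤ S.r u v →
        |S.thetaIn vS u v| ≤ C * (vS v)⁻¹ * uS u ^ (-ω + 1 + ε) ∧
        |S.zetaIn uS u v| ≤ C * uS u ^ (-ω + ε) ∧ |S.r u v * S.φ u v| ≤ C * uS u ^ (-ω + 1) := by
  obtain ⟨v₀, E, hE⟩ := hS.exists_exterior hω hn
  obtain ⟨L, C, hL, hC0, hC⟩ := E.exists_decay hω hω3 hε
  -- Once v ≥ L/δ, the condition r ≥ δv implies r ≥ L, where decay is known.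
  refine ⟨max v₀ (L / δ), C, hC0, fun u hu v hv hV hr => ?_⟩
  have hv₀ : v₀ ≤ vS v := (le_max_left _ _).trans hV
  obtain ⟨er, ep, et, ez⟩ := hE u hu v hv hv₀
  have hLr : L ≤ S.r u v := by
    have h1 := (div_le_iff₀ hδ).1 ((le_max_right _ _).trans hV)
    linarith
  have hcurve : E.curve L (uS u) ≤ vS v := (E.curve_le_iff hL hv₀).2 (er ▸ hLr)
  have h2 := hC (uS u) (vS v) (hn.one_le_uS hu) hcurve
  rw [et, ez, NullSystem.psi, er, ep] at h2
  exact h2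

end Admissible

end NullData

theorem theorem9p4 (S : NullData) (ω : ℝ) (hω : 1 < ω) (hω' : ω ≤ 3) (hS : S.Admissible ω) :
    (∃ uS vS : ℝ → ℝ, S.IsNormalized uS vS) ∧
    ∀ uS vS : ℝ → ℝ, S.IsNormalized uS vS →
      ∀ ε : ℝ, 0 < ε → ∀ δ : ℝ, 0 < δ → ∀ r₀ : ℝ, S.rPlus < r₀ →
        ∃ C : ℝ, 0 < C ∧ ∀ u ∈ Set.Ico 1 S.U₀, ∀ v ∈ S.vRange,
          δ * vS v ≤ S.r u v → r₀ ≤ S.r u v →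
            |S.thetaIn vS u v| ≤ C * (vS v)⁻¹ * (uS u) ^ (-ω + 1 + ε) ∧
            |S.zetaIn uS u v| ≤ C * (uS u) ^ (-ω + ε) ∧
            |S.r u v * S.φ u v| ≤ C * (uS u) ^ (-ω + 1) := by
  refine ⟨hS.exists_isNormalized, fun uS vS hn ε hε δ hδ r₀ hr₀ => ?_⟩
  obtain ⟨V, C₁, hC₁, hfar⟩ := hS.exists_bound_of_le_advanced_time hω hω' hn hε hδ
  obtain ⟨C₂, hnear⟩ := hS.exists_bound_of_advanced_time_le hn V (-ω + 1 + ε) (-ω + ε) (-ω + 1) hr₀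
  refine ⟨max C₁ C₂, lt_max_of_lt_left hC₁, fun u hu v hv hδv hrv => ?_⟩
  have hv0 : 0 ≤ (vS v)⁻¹ := inv_nonneg.2 (zero_le_one.trans (hn.one_le_vS hv))
  have hp : ∀ p : ℝ, 0 ≤ uS u ^ p := fun p =>
    Real.rpow_nonneg (zero_le_one.trans (hn.one_le_uS hu)) p
  rw [mul_assoc]
  rcases le_total V (vS v) with hV | hV
  · obtain ⟨h1, h2, h3⟩ := hfar u hu v hv hV hδv
    rw [mul_assoc] at h1
    have hle := le_max_left C₁ C₂
    exact ⟨h1.trans (mul_le_mul_of_nonneg_right hle (mul_nonneg hv0 (hp _))),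
      h2.trans (mul_le_mul_of_nonneg_right hle (hp _)),
      h3.trans (mul_le_mul_of_nonneg_right hle (hp _))⟩
  · obtain ⟨h1, h2, h3⟩ := hnear u hu v hv hV hrv
    have hle := le_max_right C₁ C₂
    exact ⟨h1.trans (mul_le_mul_of_nonneg_right hle (mul_nonneg hv0 (hp _))),
      h2.trans (mul_le_mul_of_nonneg_right hle (hp _)),
      h3.trans (mul_le_mul_of_nonneg_right hle (hp _))⟩
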